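/- Write $h(A,v,y)$, for $A=\begin{pmatrix}a_1&a_2\\a_3&a_4\end{pmatrix}\in\mathfrak{gl}(2,\mathbb R)$, $v\in\mathbb R$, $y=(y_1,y_2)\in\mathbb R^2$, for the matrix $$h(A,v,y)=\begin{pmatrix} \mathrm{tr}A&0&0&\sqrt2v&0&-y_1&-y_2\\ 0&a_1&a_2&0&y_1&0&v\\ 0&a_3&a_4&0&y_2&-v&0\\ 0&0&0&0&\sqrt2v&0&0\\ 0&0&0&0&-\mathrm{tr}A&0&0\\ 0&0&0&0&0&-a_1&-a_3\\ 0&0&0&0&0&-a_2&-a_4\end{pmatrix},$$ and $\mathfrak{gl}(2,\mathbb R)\ltimes\mathfrak m(1,2)=\{h(A,v,y)\}$. Let $\mathrm G_2^*\subset \mathrm{GL}(7,\mathbb R)$ be the stabiliser of $\omega=\sqrt2(b^{167}+b^{235})-b^4\wedge(b^{15}-b^{26}-b^{37})$, where $b^1,\dots,b^7$ is the dual basis of $\mathbb R^7$ and $b^{ij}=b^i\wedge b^j$, $b^{ijk}=b^i\wedge b^j\wedge b^k$. Let $(M,g)$ be a smooth pseudo-Riemannian $7$-manifold of signature $(4,3)$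 (four minus signs). For an open set $U\subset M$ and $p\in U$, say that the holonomy of $(U,g)$ at $p$ is contained in $\mathrm G_2^*$ and of Type III 1a if there is a basis of $T_pM$ in which $g_p=2(b^1b^5+b^2b^6+b^3b^7)-(b^4)^2$, the holonomy group of the Levi-Civita connection of $(U,g)$ at $p$ is contained in $\mathrm G_2^*$, and the holonomy algebra is contained in $\mathfrak{gl}(2,\mathbb R)\ltimes\mathfrak m(1,2)$. (The algebra may be smaller.) Say that coordinates $x_1,\dots,x_7$ on an open set are normal for $g$ if there $g=2(b^1\cdot b^5+b^2\cdot b^6+b^3\cdot b^7)-(b^4)^2$ with \begin{align*} b^1&=dx_1+r_5\,dx_5+r_6\,dx_6+r_7\,dx_7,& b^2&=dx_2+s_6\,dx_6+s_7\,dx_7,& b^3&=dx_3+t_6\,dx_6+t_7\,dx_7,\\ b^5&=e^{u}dx_5,& b^i&=dx_i\quad(i=4,6,7), \end{align*} where $u,F_4,F_5,F_6,F_7$ are smooth functions of $(x_5,x_6,x_7)$, $s_6,t_6,t_7$ are smooth functions of $(x_2,x_3,x_5,x_6,x_7)$, \begin{align*} r_5&=\tfrac{x_4}{\sqrt2}\left[(e^uF_6)_{x_7}-(e^uF_7)_{x_6}-(F_4)_{x_5}\right]+F_5,\\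 r_6&=x_1u_{x_6}+F_6,\qquad r_7=x_1u_{x_7}+F_7,\qquad s_7=t_6+F_4, \end{align*} $F_5,F_6,F_7$ are otherwise arbitrary, and $u,s_6,t_6,t_7,F_4$ satisfy \begin{align*} u_{x_6}&=(s_6)_{x_2}+(t_6)_{x_3},\\ u_{x_7}&=(t_7)_{x_3}+(t_6)_{x_2},\\ (s_7)_{x_6}+t_7(s_6)_{x_3}+s_7(s_6)_{x_2}&=(s_6)_{x_7}+t_6(s_7)_{x_3}+s_6(s_7)_{x_2},\\ (t_7)_{x_6}+t_7(t_6)_{x_3}+s_7(t_6)_{x_2}&=(t_6)_{x_7}+t_6(t_7)_{x_3}+s_6(t_7)_{x_2}. \end{align*} Then the following hold. (a) For every $p\in M$: there is a simply connected open neighbourhood $U$ of $p$ such that the holonomy of $(U,g)$ at $p$ is contained in $\mathrm G_2^*$ and of Type III 1a if and only if there are normal coordinates for $g$ around $p$. More precisely: if $M$ is simply connected and the holonomy of $(M,g)$ at some point is contained in $\mathrm G_2^*$ and of Type III 1a, then every point of $M$ has normal coordinates for $g$ around it; and if $g$ has normal coordinates on an open set $U$, then for every $p\in U$ the holonomy of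 $(U,g)$ at $p$ is contained in $\mathrm G_2^*$ and of Type III 1a. (b) On $\mathbb R^7$ the functions $u=\frac43x_6+\frac{4x_7}{1+e^{x_5}}$, $s_6=\frac13L$, $t_6=\frac{L}{1+e^{x_5}}$, $t_7=\frac{3L}{(1+e^{x_5})^2}$ with $L=x_2+x_3(1+e^{x_5})$, together with $F_6=x_6x_7$ and $F_4=F_5=F_7=0$, satisfy the above system, and the metric they define has, at every point and with respect to a suitable basis as above, holonomy group in $\mathrm G_2^*$ and holonomy algebra equal to $\mathfrak{gl}(2,\mathbb R)\ltimes\mathfrak m(1,2)$. -/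

import Mathlib

open Set Bundle
open scoped Manifold ContDiff

noncomputable section

/-- The coordinate space `ℝ⁷`. Indices run over `Fin 7`, so the coordinate called `x₁, …, x₇` in
mathematical notation is `x 0, …, x 6`; the same shift applies to frames, coframes and matrices. -/
abbrev E7 : Type := Fin 7 → ℝ

/-! ### Matrix algebra: `ℝ^{4,3}`, `G₂*` and `𝔤𝔩(2,ℝ) ⋉ 𝔪(1,2)` -/

/-- The scalar product `2(b¹b⁵ + b²b⁶ + b³b⁷) - (b⁴)²` on `ℝ⁷`, of signature `(4,3)`
(four negative and three positive directions). -/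
def form43 (v w : E7) : ℝ :=
  (v 0 * w 4 + v 4 * w 0) + (v 1 * w 5 + v 5 * w 1) + (v 2 * w 6 + v 6 * w 2) - v 3 * w 3

/-- The elementary 3-form `bⁱ ∧ bʲ ∧ bᵏ` evaluated on three vectors. -/
def wedge3 (i j k : Fin 7) (v w z : E7) : ℝ :=
  Matrix.det !![v i, v j, v k; w i, w j, w k; z i, z j, z k]

/-- The generic 3-form `√2 (b¹⁶⁷ + b²³⁵) - b⁴ ∧ (b¹⁵ - b²⁶ - b³⁷)`. -/
def omegaG2 (v w z : E7) : ℝ :=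
  √2 * (wedge3 0 5 6 v w z + wedge3 1 2 4 v w z)
    - (wedge3 3 0 4 v w z - wedge3 3 1 5 v w z - wedge3 3 2 6 v w z)

/-- The group `G₂*`, as the stabiliser of `omegaG2` in `GL(7, ℝ)`. -/
def G2Star : Set (Matrix (Fin 7) (Fin 7) ℝ) :=
  {T | IsUnit T ∧ ∀ v w z : E7,
    omegaG2 (T.mulVec v) (T.mulVec w) (T.mulVec z) = omegaG2 v w z}

/-- The matrix `h(A, v, y)`. -/
def hMatrix (A : Matrix (Fin 2) (Fin 2) ℝ) (v : ℝ) (y : Fin 2 → ℝ) :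
    Matrix (Fin 7) (Fin 7) ℝ :=
  !![A.trace, 0, 0, √2 * v, 0, -y 0, -y 1;
     0, A 0 0, A 0 1, 0, y 0, 0, v;
     0, A 1 0, A 1 1, 0, y 1, -v, 0;
     0, 0, 0, 0, √2 * v, 0, 0;
     0, 0, 0, 0, -A.trace, 0, 0;
     0, 0, 0, 0, 0, -A 0 0, -A 1 0;
     0, 0, 0, 0, 0, -A 0 1, -A 1 1]

/-- The Lie algebra `𝔤𝔩(2,ℝ) ⋉ 𝔪(1,2) = {h(A, v, y)}` (Type III 1a). -/
def hIII1a : Set (Matrix (Fin 7) (Fin 7) ℝ) :=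
  {T | ∃ (A : Matrix (Fin 2) (Fin 2) ℝ) (v : ℝ) (y : Fin 2 → ℝ), T = hMatrix A v y}

/-! ### Metrics of signature `(4,3)`, parallel transport and holonomy -/

/-- The tangent space at a point of a 7-manifold. -/
abbrev T7 {M : Type*} [TopologicalSpace M] [ChartedSpace E7 M] (p : M) : Type :=
  TangentSpace 𝓘(ℝ, E7) p

/-- A tangent vector at `p` as a vector of `ℝ⁷` (the tangent space is a copy of `ℝ⁷` through the
preferred chart at `p`); used only to differentiate curves in a fixed tangent space. -/
def T7.toE7 {M : Type*} [TopologicalSpace M] [ChartedSpace E7 M] {p : M} (w : T7 p) : E7 := w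

/-- A smooth pseudo-Riemannian metric of signature `(4,3)`. -/
structure Metric43 (M : Type*) [TopologicalSpace M] [ChartedSpace E7 M]
    [IsManifold 𝓘(ℝ, E7) ∞ M] where
  /-- The scalar product on each tangent space. -/
  inner (p : M) : T7 p →L[ℝ] T7 p →L[ℝ] ℝ
  symm (p : M) (v w : T7 p) : inner p v w = inner p w v
  signature (p : M) : ∃ b : Module.Basis (Fin 7) ℝ (T7 p), ∀ i j,
    inner p (b i) (b j) = if i = j then (if i < 4 then -1 else 1) else 0
  contMDiff : ContMDiff 𝓘(ℝ, E7) (𝓘(ℝ, E7).prod 𝓘(ℝ, E7 →L[ℝ] E7 →L[ℝ] ℝ)) ∞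
    (fun p ↦ TotalSpace.mk' (E7 →L[ℝ] E7 →L[ℝ] ℝ) p (inner p))

section Holonomy

variable {M : Type*} [TopologicalSpace M] [ChartedSpace E7 M] [IsManifold 𝓘(ℝ, E7) ∞ M]

/-- The coordinates of a tangent vector `w` at `q` with respect to the chart `e`. -/
def chartVec (e : OpenPartialHomeomorph M E7) (q : M) (w : T7 q) : E7 :=
  mfderiv 𝓘(ℝ, E7) 𝓘(ℝ, E7) e q w

/-- The metric in the chart `e`: the pullback of `g` to `e.target` under `e.symm`. -/
def Metric43.inChart (g : Metric43 M) (e : OpenPartialHomeomorph M E7) (x v w : E7) : ℝ :=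
  g.inner (e.symm x) (mfderiv 𝓘(ℝ, E7) 𝓘(ℝ, E7) e.symm x v)
    (mfderiv 𝓘(ℝ, E7) 𝓘(ℝ, E7) e.symm x w)

/-- The Christoffel symbol of the first kind `Γ(v, w; z) = ½ (∂_v g(w,z) + ∂_w g(v,z) - ∂_z g(v,w))`
of the Levi-Civita connection of `g` in the chart `e`. -/
def Metric43.christoffel (g : Metric43 M) (e : OpenPartialHomeomorph M E7) (x v w z : E7) : ℝ :=
  (1 / 2) * (fderiv ℝ (fun x' ↦ g.inChart e x' w z) x v
    + fderiv ℝ (fun x' ↦ g.inChart e x' v z) x w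
    - fderiv ℝ (fun x' ↦ g.inChart e x' v w) x z)

/-- The vector field `Y` along the curve `γ : [0,1] → M` is parallel for the Levi-Civita connection:
in every chart, `g(Y' + Γ(γ', Y), z) = 0` for all `z`. -/
def Metric43.IsParallelAlong (g : Metric43 M) (γ : ℝ → M) (Y : ∀ t : ℝ, T7 (γ t)) : Prop :=
  ∀ t ∈ Icc (0 : ℝ) 1, ∀ e ∈ IsManifold.maximalAtlas 𝓘(ℝ, E7) ∞ M, γ t ∈ e.source →
    ∃ c' y' : E7,
      HasDerivWithinAt (fun s ↦ e (γ s)) c' (Icc 0 1) t ∧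
      HasDerivWithinAt (fun s ↦ chartVec e (γ s) (Y s)) y' (Icc 0 1) t ∧
      ∀ z : E7, g.inChart e (e (γ t)) y' z
        + g.christoffel e (e (γ t)) c' (chartVec e (γ t) (Y t)) z = 0

/-- `g.IsTransport U p q A`: the linear map `A : T_p M → T_q M` is the parallel transport along a
piecewise smooth curve in `U` from `p` to `q`. Such a curve is built by appending smooth arcs
`γ : [0,1] → U`; the transport `B` along an arc maps the initial value of every parallel field
to its final value. -/
inductive Metric43.IsTransport (g : Metric43 M) (U : Set M) (p : M) :
    (q : M) → (T7 p →ₗ[ℝ] T7 q) → Prop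
  | refl : p ∈ U → IsTransport g U p p LinearMap.id
  | append (γ : ℝ → M) (A : T7 p →ₗ[ℝ] T7 (γ 0)) (B : T7 (γ 0) →ₗ[ℝ] T7 (γ 1)) :
      IsTransport g U p (γ 0) A →
      ContMDiffOn 𝓘(ℝ, ℝ) 𝓘(ℝ, E7) ∞ γ (Icc 0 1) →
      (∀ t ∈ Icc (0 : ℝ) 1, γ t ∈ U) →
      (∀ v : T7 (γ 0), ∃ Y : ∀ t : ℝ, T7 (γ t),
        g.IsParallelAlong γ Y ∧ Y 0 = v ∧ Y 1 = B v) →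
      IsTransport g U p (γ 1) (B ∘ₗ A)

/-- The holonomy group at `p` of the open submanifold `(U, g)`: all parallel transports along
piecewise smooth loops at `p` in `U`. -/
def Metric43.holGroup (g : Metric43 M) (U : Set M) (p : M) : Set (T7 p →ₗ[ℝ] T7 p) :=
  {A | g.IsTransport U p p A}

/-- The holonomy algebra at `p` of the open submanifold `(U, g)`, i.e. the Lie algebra of the
holonomy group: the velocities at the identity of the `C¹` curves in the holonomy group. -/
def Metric43.holAlgebra (g : Metric43 M) (U : Set M) (p : M) : Set (T7 p →ₗ[ℝ] T7 p) :=
  {A | ∃ c : ℝ → (T7 p →ₗ[ℝ] T7 p), (∀ t, c t ∈ g.holGroup U p) ∧ c 0 = LinearMap.id ∧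
    ∀ v : T7 p, ContDiff ℝ 1 (fun t ↦ T7.toE7 (c t v)) ∧
      HasDerivAt (fun t ↦ T7.toE7 (c t v)) (T7.toE7 (A v)) 0}

/-- `b` is a basis of `T_p M` in which `g` takes the form `2(b¹b⁵ + b²b⁶ + b³b⁷) - (b⁴)²`. -/
def Metric43.IsAdapted (g : Metric43 M) (p : M) (b : Module.Basis (Fin 7) ℝ (T7 p)) : Prop :=
  ∀ i j, g.inner p (b i) (b j) = form43 (Pi.single i 1) (Pi.single j 1)

/-- With respect to some adapted basis of `T_p M`, the holonomy group of `(U, g)` is contained in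
`G₂*` and its holonomy algebra is contained in `𝔤𝔩(2,ℝ) ⋉ 𝔪(1,2)`. -/
def Metric43.HolIsIII1a (g : Metric43 M) (U : Set M) (p : M) : Prop :=
  ∃ b : Module.Basis (Fin 7) ℝ (T7 p), g.IsAdapted p b ∧
    (∀ A ∈ g.holGroup U p, LinearMap.toMatrix b b A ∈ G2Star) ∧
    (∀ A ∈ g.holAlgebra U p, LinearMap.toMatrix b b A ∈ hIII1a)

/-- With respect to some adapted basis of `T_p M`, the holonomy group of `(U, g)` is contained in
`G₂*` and its holonomy algebra is all of `𝔤𝔩(2,ℝ) ⋉ 𝔪(1,2)`. -/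
def Metric43.HolIsFullIII1a (g : Metric43 M) (U : Set M) (p : M) : Prop :=
  ∃ b : Module.Basis (Fin 7) ℝ (T7 p), g.IsAdapted p b ∧
    (∀ A ∈ g.holGroup U p, LinearMap.toMatrix b b A ∈ G2Star) ∧
    LinearMap.toMatrix b b '' g.holAlgebra U p = hIII1a

end Holonomy

/-! ### The normal form -/

/-- The partial derivative `∂f/∂xᵢ`. -/
def pd (i : Fin 7) (f : E7 → ℝ) (x : E7) : ℝ := fderiv ℝ f x (Pi.single i 1)

/-- The functions that enter the normal form. -/
structure NormalData where
  u : E7 → ℝ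
  s6 : E7 → ℝ
  t6 : E7 → ℝ
  t7 : E7 → ℝ
  F4 : E7 → ℝ
  F5 : E7 → ℝ
  F6 : E7 → ℝ
  F7 : E7 → ℝ

namespace NormalData

variable (D : NormalData)

/-- `r₅ = (x₄/√2) [(eᵘ F₆)_{x₇} - (eᵘ F₇)_{x₆} - (F₄)_{x₅}] + F₅`. -/
def r5 (x : E7) : ℝ :=
  x 3 / √2 * (pd 6 (fun x' ↦ Real.exp (D.u x') * D.F6 x') x
    - pd 5 (fun x' ↦ Real.exp (D.u x') * D.F7 x') x - pd 4 D.F4 x) + D.F5 x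

/-- `r₆ = x₁ u_{x₆} + F₆`. -/
def r6 (x : E7) : ℝ := x 0 * pd 5 D.u x + D.F6 x

/-- `r₇ = x₁ u_{x₇} + F₇`. -/
def r7 (x : E7) : ℝ := x 0 * pd 6 D.u x + D.F7 x

/-- `s₇ = t₆ + F₄`. -/
def s7 (x : E7) : ℝ := D.t6 x + D.F4 x

/-- The coframe `b¹, …, b⁷` at `x`, evaluated on the vector `v`; thus `v i` is `dxᵢ(v)`. -/
def coframe (x v : E7) : E7 :=
  ![v 0 + D.r5 x * v 4 + D.r6 x * v 5 + D.r7 x * v 6,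
    v 1 + D.s6 x * v 5 + D.s7 x * v 6,
    v 2 + D.t6 x * v 5 + D.t7 x * v 6,
    v 3,
    Real.exp (D.u x) * v 4,
    v 5,
    v 6]

/-- The metric `2(b¹b⁵ + b²b⁶ + b³b⁷) - (b⁴)²`. -/
def metric (x v w : E7) : ℝ := form43 (D.coframe x v) (D.coframe x w)

/-- The functions are smooth on `V`, depend only on the coordinates they are allowed to depend on,
and satisfy the system of differential equations on `V`. -/
structure IsAdmissible (V : Set E7) : Prop where
  smooth_u : ContDiffOn ℝ ∞ D.u V
  smooth_s6 : ContDiffOn ℝ ∞ D.s6 V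
  smooth_t6 : ContDiffOn ℝ ∞ D.t6 V
  smooth_t7 : ContDiffOn ℝ ∞ D.t7 V
  smooth_F4 : ContDiffOn ℝ ∞ D.F4 V
  smooth_F5 : ContDiffOn ℝ ∞ D.F5 V
  smooth_F6 : ContDiffOn ℝ ∞ D.F6 V
  smooth_F7 : ContDiffOn ℝ ∞ D.F7 V
  dep_u : DependsOn D.u {4, 5, 6}
  dep_s6 : DependsOn D.s6 {1, 2, 4, 5, 6}
  dep_t6 : DependsOn D.t6 {1, 2, 4, 5, 6}
  dep_t7 : DependsOn D.t7 {1, 2, 4, 5, 6}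
  dep_F4 : DependsOn D.F4 {4, 5, 6}
  dep_F5 : DependsOn D.F5 {4, 5, 6}
  dep_F6 : DependsOn D.F6 {4, 5, 6}
  dep_F7 : DependsOn D.F7 {4, 5, 6}
  eq1 : ∀ x ∈ V, pd 5 D.u x = pd 1 D.s6 x + pd 2 D.t6 x
  eq2 : ∀ x ∈ V, pd 6 D.u x = pd 2 D.t7 x + pd 1 D.t6 x
  eq3 : ∀ x ∈ V, pd 5 D.s7 x + D.t7 x * pd 2 D.s6 x + D.s7 x * pd 1 D.s6 x
    = pd 6 D.s6 x + D.t6 x * pd 2 D.s7 x + D.s6 x * pd 1 D.s7 x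
  eq4 : ∀ x ∈ V, pd 5 D.t7 x + D.t7 x * pd 2 D.t6 x + D.s7 x * pd 1 D.t6 x
    = pd 6 D.t6 x + D.t6 x * pd 2 D.t7 x + D.s6 x * pd 1 D.t7 x

/-- The functions of the example. -/
def example1a : NormalData where
  u x := 4 / 3 * x 5 + 4 * x 6 / (1 + Real.exp (x 4))
  s6 x := 1 / 3 * (x 1 + x 2 * (1 + Real.exp (x 4)))
  t6 x := (x 1 + x 2 * (1 + Real.exp (x 4))) / (1 + Real.exp (x 4))
  t7 x := 3 * (x 1 + x 2 * (1 + Real.exp (x 4))) / (1 + Real.exp (x 4)) ^ 2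
  F4 _ := 0
  F5 _ := 0
  F6 x := x 5 * x 6
  F7 _ := 0

end NormalData

/-- In the coordinates given by the chart `e`, the metric `g` has the normal form. -/
def Metric43.IsNormalIn {M : Type*} [TopologicalSpace M] [ChartedSpace E7 M]
    [IsManifold 𝓘(ℝ, E7) ∞ M] (g : Metric43 M) (e : OpenPartialHomeomorph M E7) : Prop :=
  e ∈ IsManifold.maximalAtlas 𝓘(ℝ, E7) ∞ M ∧
    ∃ D : NormalData, D.IsAdmissible e.target ∧
      ∀ x ∈ e.target, ∀ v w : E7, g.inChart e x v w = D.metric x v w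

end

/-! The theorem rests on one algebraic fact: the endomorphisms `h(A, v, y)` are exactly those that
annihilate `omegaG2` as derivations and map the null plane spanned by the second and third basis
vectors into itself (`isIII1a_of_omegaDer`, `IsIII1a.omegaDer_eq_zero`, `IsIII1a.map_nullPlane`).
Type III 1a therefore means a parallel G₂*-structure together with a parallel null plane. In an
adapted coframe `B` it says that the Levi-Civita form `Θ`, which is determined by skewness and the
torsion equation `dB + Θ ∧ B = 0`, takes values in this algebra (`IsIII1aCoframe`).

From holonomy to coordinates: extend the adapted basis at `p` to a coframe that is parallel along
the rays of a chart. Its form `Θ` takes values in the holonomy algebra, because small loops (out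
along a ray, across in a frame that is radial about a nearby point, and back) have holonomies with
velocity `Θ x w` (`exists_radial_frames_frameHol`). The torsion equation is then read row by row.
The last three rows make `ker b⁵` and `ker (b⁶, b⁷)` involutive, and the fourth makes `b⁴` closed on
the leaves of `ker b⁵`. Frobenius' theorem and changes of frame by `GL(2,ℝ)` and `v` give `b⁴ =
dx₄`, `b⁵ = f dx₅`, `b⁶ = dx₆`, `b⁷ = dx₇` (`IsIII1aCoframe.exists_rectified`). Now `A` and `v`
vanish on `ker (b⁵, b⁶, b⁷)`, so `b¹, b², b³` have primitives along its leaves, which are the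
remaining coordinates (`IsIII1aCoframe.exists_coordinates`). A change of frame by `y` removes `dx₅`
from `b²` and `b³`. What is left of the torsion equation is `ShapeSystem`, and its solutions are the
normal form data (`exists_normalData_of_shapeSystem`).

Frobenius' theorem is proved by solving the equation along rays and showing that the defect in the
other directions obeys a linear equation with zero initial value. Smooth dependence on the
parameters comes from the inverse function theorem in the Banach space `C([0,1], Y)`.

From coordinates to holonomy: `NormalData.conn` is an explicit form with values in the algebra that
satisfies the torsion equation. Parallel transport in the coordinate domain thus preserves `omegaG2`
and the null plane. This puts the holonomy group in G₂*, and differentiating the two invariances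
puts the holonomy algebra in `𝔤𝔩(2,ℝ) ⋉ 𝔪(1,2)`.

For the example, curvature operators lie in the holonomy algebra
(`IsLCCoframe.curvature_mem_frameHol`), which is closed under brackets, and three curvature
operators at the origin generate everything. Parallel transport carries the result to all points
(`exists_frameRel`). -/

open Filter Metric
open scoped Topology

/-! ### Composition operators on spaces of continuous maps -/

section Composition

set_option synthInstance.maxHeartbeats 200000

universe u

variable {K : Type*} [TopologicalSpace K] [CompactSpace K]

/-- A bounded bilinear map applied pointwise to continuous maps. -/
noncomputable def ContinuousMap.bilinApply (K : Type*) [TopologicalSpace K] [CompactSpace K]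
    {G E F : Type*} [NormedAddCommGroup G] [NormedSpace ℝ G] [NormedAddCommGroup E]
    [NormedSpace ℝ E] [NormedAddCommGroup F] [NormedSpace ℝ F] (b : G →L[ℝ] E →L[ℝ] F) :
    C(K, G) →L[ℝ] C(K, E) →L[ℝ] C(K, F) :=
  LinearMap.mkContinuous₂
    (LinearMap.mk₂ ℝ (fun (A : C(K, G)) (h : C(K, E)) ↦
        (⟨fun t ↦ b (A t) (h t), (b.continuous.comp A.continuous).clm_apply h.continuous⟩ :
          C(K, F)))
      (fun _ _ _ ↦ by ext; simp) (fun _ _ _ ↦ by ext; simp)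
      (fun _ _ _ ↦ by ext; simp) (fun _ _ _ ↦ by ext; simp)) ‖b‖
    (fun A h ↦ by
      rw [ContinuousMap.norm_le _ (by positivity)]
      intro t
      refine (b.le_opNorm₂ (A t) (h t)).trans ?_
      have := A.norm_coe_le_norm t
      have := h.norm_coe_le_norm t
      gcongr)

theorem ContinuousMap.bilinApply_apply {G E F : Type*} [NormedAddCommGroup G] [NormedSpace ℝ G]
    [NormedAddCommGroup E] [NormedSpace ℝ E]
    [NormedAddCommGroup F] [NormedSpace ℝ F] (b : G →L[ℝ] E →L[ℝ] F)
    (A : C(K, G)) (h : C(K, E)) (t : K) :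
    ContinuousMap.bilinApply K b A h t = b (A t) (h t) := rfl

/-- The derivative of composition with `f` at `η`, where `A = f' ∘ η`. -/
noncomputable def ContinuousMap.clmApply {E F : Type*} [NormedAddCommGroup E] [NormedSpace ℝ E]
    [NormedAddCommGroup F] [NormedSpace ℝ F] (A : C(K, E →L[ℝ] F)) : C(K, E) →L[ℝ] C(K, F) :=
  ContinuousMap.bilinApply K (ContinuousLinearMap.id ℝ (E →L[ℝ] F)) A

/-- The mean value inequality bounds the remainder at `t` by the oscillation of `fderiv ℝ f` on a
ball around `η t`. Compactness of the range of `η` makes the radius independent of `t`, as the sup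
norm requires. -/
theorem hasFDerivAt_continuousMap_comp {E F : Type*} [NormedAddCommGroup E] [NormedSpace ℝ E]
    [NormedAddCommGroup F] [NormedSpace ℝ F] {f : E → F} (hf : ContDiff ℝ 1 f) (η : C(K, E)) :
    HasFDerivAt (fun η : C(K, E) ↦ (⟨f, hf.continuous⟩ : C(E, F)).comp η)
      (ContinuousMap.clmApply
        ((⟨fderiv ℝ f, hf.continuous_fderiv one_ne_zero⟩ : C(E, E →L[ℝ] F)).comp η)) η := by
  rw [hasFDerivAt_iff_isLittleO_nhds_zero, Asymptotics.isLittleO_iff]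
  intro ε hε
  have hU := (isCompact_range η.continuous).uniformContinuousAt_of_continuousAt (fderiv ℝ f)
    (fun a _ ↦ (hf.continuous_fderiv one_ne_zero).continuousAt) (Metric.dist_mem_uniformity hε)
  obtain ⟨δ, hδ, hδU⟩ := Metric.mem_uniformity_dist.1 hU
  filter_upwards [Metric.ball_mem_nhds (0 : C(K, E)) hδ] with h hh
  rw [ContinuousMap.norm_le _ (by positivity)]
  intro t
  have hht : ‖h t‖ < δ := (h.norm_coe_le_norm t).trans_lt (by simpa using hh)
  have key := (convex_ball (η t) δ).norm_image_sub_le_of_norm_hasFDerivWithin_le'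
    (f := f) (f' := fderiv ℝ f) (φ := fderiv ℝ f (η t)) (C := ε) (x := η t) (y := η t + h t)
    (fun z _ ↦ (hf.differentiable one_ne_zero z).hasFDerivAt.hasFDerivWithinAt)
    (fun z hz ↦ by
      have : dist (η t) z < δ := by rw [dist_comm]; exact hz
      have := hδU this (mem_range_self t)
      simp only [mem_ofPred_eq] at this
      rw [← dist_eq_norm, dist_comm]; exact this.le)
    (mem_ball_self hδ) (by simpa using hht)
  simp only [add_sub_cancel_left] at key
  exact key.trans (mul_le_mul_of_nonneg_left (h.norm_coe_le_norm t) hε.le)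

/-- Induction on the order, for all targets `F` at once: the derivative is composition with `fderiv
ℝ f`, whose target is `E →L[ℝ] F`, followed by a bounded linear map. This change of target is why
both spaces share a universe. -/
theorem contDiff_continuousMap_comp_nat {E : Type u} [NormedAddCommGroup E] [NormedSpace ℝ E]
    (n : ℕ) : ∀ {F : Type u} [NormedAddCommGroup F] [NormedSpace ℝ F] {f : E → F}
      (hf : ContDiff ℝ ∞ f),
      ContDiff ℝ n (fun η : C(K, E) ↦ (⟨f, hf.continuous⟩ : C(E, F)).comp η) := by
  induction n with
  | zero =>
    intro F _ _ f hf
    exact contDiff_zero.2 (ContinuousMap.continuous_postcomp _)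
  | succ n ih =>
    intro F _ _ f hf
    have hf1 : ContDiff ℝ 1 f := hf.of_le (by exact_mod_cast le_top)
    have hd := fun η : C(K, E) ↦ hasFDerivAt_continuousMap_comp hf1 η
    push_cast
    rw [contDiff_succ_iff_fderiv]
    refine ⟨fun η ↦ (hd η).differentiableAt, by simp, ?_⟩
    have hf' : ContDiff ℝ ∞ (fderiv ℝ f) := hf.fderiv_right (by simp)
    have : fderiv ℝ (fun η : C(K, E) ↦ (⟨f, hf.continuous⟩ : C(E, F)).comp η)
        = fun η ↦ ContinuousMap.clmApply
          ((⟨fderiv ℝ f, hf'.continuous⟩ : C(E, E →L[ℝ] F)).comp η) :=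
      funext fun η ↦ (hd η).fderiv
    rw [this]
    exact (ContinuousMap.bilinApply K (ContinuousLinearMap.id ℝ (E →L[ℝ] F))).contDiff.comp (ih hf')

/-- Composition with a smooth map is a smooth operator on continuous maps. -/
theorem contDiff_continuousMap_comp {E F : Type u} [NormedAddCommGroup E] [NormedSpace ℝ E]
    [NormedAddCommGroup F] [NormedSpace ℝ F] {f : E → F} (hf : ContDiff ℝ ∞ f) :
    ContDiff ℝ ∞ (fun η : C(K, E) ↦ (⟨f, hf.continuous⟩ : C(E, F)).comp η) :=
  contDiff_infty.2 fun n ↦ contDiff_continuousMap_comp_nat n hf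

end Composition

/-! ### Local diffeomorphisms -/

/-- The inverse function theorem controls the inverse at one point. Restricting to the open set
where the derivative stays invertible makes the inverse smooth on the whole target. -/
theorem exists_openPartialHomeomorph_of_hasFDerivAt {E F : Type*} [NormedAddCommGroup E]
    [NormedSpace ℝ E] [CompleteSpace E] [NormedAddCommGroup F] [NormedSpace ℝ F]
    {f : E → F} {U : Set E} {a : E} (hU : IsOpen U) (ha : a ∈ U)
    (hf : ContDiffOn ℝ ∞ f U) (f' : E ≃L[ℝ] F) (hf' : HasFDerivAt f (f' : E →L[ℝ] F) a) :
    ∃ e : OpenPartialHomeomorph E F, a ∈ e.source ∧ e.source ⊆ U ∧ (e : E → F) = f ∧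
      ContDiffOn ℝ ∞ e.symm e.target ∧
      ∀ x ∈ e.source, ∃ L : E ≃L[ℝ] F, HasFDerivAt f (L : E →L[ℝ] F) x := by
  have hfa : ContDiffAt ℝ ∞ f a := hf.contDiffAt (hU.mem_nhds ha)
  let e₀ := hfa.toOpenPartialHomeomorph f hf' (by simp)
  have hcont : ContinuousOn (fderiv ℝ f) U := hf.continuousOn_fderiv_of_isOpen hU (by simp)
  have hO : IsOpen (U ∩ fderiv ℝ f ⁻¹' range ((↑) : (E ≃L[ℝ] F) → E →L[ℝ] F)) :=
    hcont.isOpen_inter_preimage hU ContinuousLinearEquiv.isOpen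
  let e := e₀.restrOpen _ hO
  have hae₀ : a ∈ e₀.source := hfa.mem_toOpenPartialHomeomorph_source hf' (by simp)
  have hequiv : ∀ x ∈ e.source, ∃ L : E ≃L[ℝ] F, HasFDerivAt f (L : E →L[ℝ] F) x := by
    rintro x ⟨-, hxU, L, hL⟩
    refine ⟨L, ?_⟩
    rw [hL]
    exact ((hf.contDiffAt (hU.mem_nhds hxU)).differentiableAt (by simp)).hasFDerivAt
  refine ⟨e, ⟨hae₀, ha, f', hf'.fderiv.symm⟩, fun x hx ↦ hx.2.1, rfl, ?_, hequiv⟩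
  intro y hy
  obtain ⟨L, hL⟩ := hequiv _ (e.map_target hy)
  exact (e.contDiffAt_symm hy hL
    (hf.contDiffAt (hU.mem_nhds (e.map_target hy).2.1))).contDiffWithinAt

/-! ### Cutting off -/

/-- Multiplication by a bump function makes local equations global, so that composition operators on
spaces of continuous maps apply to them. -/
theorem exists_contDiff_eventuallyEq {E F : Type*} [NormedAddCommGroup E] [NormedSpace ℝ E]
    [HasContDiffBump E] [NormedAddCommGroup F] [NormedSpace ℝ F] {f : E → F} {U : Set E} {a : E}
    (hU : IsOpen U) (ha : a ∈ U) (hf : ContDiffOn ℝ ∞ f U) :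
    ∃ f' : E → F, ContDiff ℝ ∞ f' ∧ f' =ᶠ[𝓝 a] f := by
  obtain ⟨r, hr, hrU⟩ := Metric.isOpen_iff.1 hU a ha
  let χ : ContDiffBump a := ⟨r / 4, r / 2, by positivity, by linarith⟩
  refine ⟨fun x ↦ χ x • f x, contDiff_iff_contDiffAt.2 fun x ↦ ?_, ?_⟩
  · by_cases hx : x ∈ ball a r
    · exact χ.contDiff.contDiffAt.smul (hf.contDiffAt (hU.mem_nhds (hrU hx)))
    · have : ∀ᶠ y in 𝓝 x, y ∉ closedBall a (r / 2) :=
        (isClosed_closedBall.isOpen_compl).mem_nhds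
          (fun h ↦ hx (closedBall_subset_ball (by linarith) h))
      refine (contDiffAt_const (c := (0 : F))).congr_of_eventuallyEq ?_
      filter_upwards [this] with y hy
      rw [χ.zero_of_le_dist (by simpa [χ] using (not_le.1 (mt mem_closedBall.2 hy)).le), zero_smul]
  · filter_upwards [χ.eventuallyEq_one] with x hx
    simp [hx]

/-! ### Ordinary differential equations along rays -/

section Rays

open scoped unitInterval

variable {Y : Type*} [NormedAddCommGroup Y] [NormedSpace ℝ Y]

/-- The primitive vanishing at `0`, as an operator on `C([0,1], Y)`. -/
noncomputable def primitiveCLM (Y : Type*) [NormedAddCommGroup Y] [NormedSpace ℝ Y] :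
    C(I, Y) →L[ℝ] C(I, Y) :=
  LinearMap.mkContinuous
    { toFun := fun η ↦ ⟨fun t ↦ ∫ s in (0 : ℝ)..t, IccExtend zero_le_one η s,
        (intervalIntegral.continuous_primitive
          (fun a b ↦ (η.continuous.Icc_extend' (h := zero_le_one)).intervalIntegrable a b) 0).comp
          continuous_subtype_val⟩
      map_add' := fun η θ ↦ by
        ext t
        simp only [ContinuousMap.coe_mk, ContinuousMap.add_apply]
        rw [← intervalIntegral.integral_add
          (η.continuous.Icc_extend'.intervalIntegrable _ _)
          (θ.continuous.Icc_extend'.intervalIntegrable _ _)]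
        rfl
      map_smul' := fun c η ↦ by
        ext t
        simp only [ContinuousMap.coe_mk, ContinuousMap.smul_apply, RingHom.id_apply]
        rw [← intervalIntegral.integral_smul]
        rfl } 1
    (fun η ↦ by
      rw [ContinuousMap.norm_le _ (by positivity)]
      intro t
      have h := intervalIntegral.norm_integral_le_of_norm_le_const
        (f := IccExtend zero_le_one η) (a := 0) (b := (t : ℝ)) (C := ‖η‖)
        (fun s _ ↦ η.norm_coe_le_norm _)
      have ht : |(t : ℝ) - 0| ≤ 1 := by
        rw [sub_zero, abs_of_nonneg t.2.1]; exact t.2.2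
      rw [one_mul]
      exact h.trans (mul_le_of_le_one_right (norm_nonneg _) ht))

theorem primitiveCLM_apply (η : C(I, Y)) (t : I) :
    primitiveCLM Y η t = ∫ s in (0 : ℝ)..t, IccExtend zero_le_one η s := rfl

/-- The segment `t ↦ t • x`. -/
noncomputable def rayCLM (X : Type*) [NormedAddCommGroup X] [NormedSpace ℝ X] :
    X →L[ℝ] C(I, X) :=
  LinearMap.mkContinuous
    { toFun := fun x ↦ ⟨fun t ↦ (t : ℝ) • x, by fun_prop⟩
      map_add' := fun x y ↦ by ext; simp
      map_smul' := fun c x ↦ by ext t; exact smul_comm _ _ _ } 1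
    (fun x ↦ by
      rw [ContinuousMap.norm_le _ (by positivity)]
      intro t
      simp only [LinearMap.coe_mk, AddHom.coe_mk, ContinuousMap.coe_mk, one_mul]
      rw [norm_smul, Real.norm_of_nonneg t.2.1]
      exact mul_le_of_le_one_left (norm_nonneg _) t.2.2)

/-- Constant maps. -/
noncomputable def constCLM (X : Type*) [NormedAddCommGroup X] [NormedSpace ℝ X] :
    X →L[ℝ] C(I, X) :=
  LinearMap.mkContinuous
    { toFun := fun x ↦ ContinuousMap.const I x
      map_add' := fun x y ↦ by ext; simp
      map_smul' := fun c x ↦ by ext t; simp } 1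
    (fun x ↦ by
      rw [ContinuousMap.norm_le _ (by positivity)]
      intro t
      simp)

theorem rayCLM_apply {X : Type*} [NormedAddCommGroup X] [NormedSpace ℝ X] (x : X) (t : I) :
    rayCLM X x t = (t : ℝ) • x := rfl

theorem constCLM_apply {X : Type*} [NormedAddCommGroup X] [NormedSpace ℝ X] (x : X) (t : I) :
    constCLM X x t = x := rfl

/-- Only the endpoint `1` is needed: by rescaling, the value at time `s` of the solution along one
ray is the value at time `1` along a shorter ray. -/
theorem hasDerivWithinAt_of_eq_primitive [CompleteSpace Y] {η θ : C(I, Y)} {y : Y}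
    (h : η = constCLM Y y + primitiveCLM Y θ) :
    HasDerivWithinAt (IccExtend zero_le_one η) (θ 1) (Icc 0 1) 1 := by
  have h1 : HasDerivAt (fun t ↦ y + ∫ s in (0 : ℝ)..t, IccExtend zero_le_one θ s)
      (θ 1) 1 := by
    have := intervalIntegral.integral_hasDerivAt_right
      (f := IccExtend zero_le_one θ) (a := 0) (b := 1)
      (θ.continuous.Icc_extend'.intervalIntegrable _ _)
      (θ.continuous.Icc_extend'.stronglyMeasurableAtFilter _ _)
      θ.continuous.Icc_extend'.continuousAt
    have h' := this.const_add y
    rwa [IccExtend_of_mem zero_le_one θ (show (1:ℝ) ∈ Icc (0:ℝ) 1 by simp)] at h'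
  refine h1.hasDerivWithinAt.congr_of_mem (fun t ht ↦ ?_) (by simp)
  rw [IccExtend_of_mem zero_le_one η ht, h]
  rfl

/-- The map `t ↦ s t` of the unit interval, for `s ∈ [0,1]`. -/
def scaleI (s : I) : C(I, I) := ⟨fun t ↦ s * t, by fun_prop⟩

/-- This is the substitution `r ↦ s r`. It shows that a solution along the ray through `x`, slowed
down by `s`, solves the equation along the ray through `s x`. -/
theorem primitiveCLM_comp_scaleI (θ : C(I, Y)) (s : I) :
    (primitiveCLM Y θ).comp (scaleI s) = primitiveCLM Y ((s : ℝ) • θ.comp (scaleI s)) := by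
  ext t
  simp only [ContinuousMap.comp_apply, primitiveCLM_apply]
  have h1 : ∀ r ∈ uIcc (0 : ℝ) t, IccExtend zero_le_one ((s : ℝ) • θ.comp (scaleI s)) r
      = (s : ℝ) • IccExtend zero_le_one θ (s * r) := by
    intro r hr
    rw [uIcc_of_le t.2.1] at hr
    have hr' : r ∈ Icc (0 : ℝ) 1 := ⟨hr.1, hr.2.trans t.2.2⟩
    have hsr : (s : ℝ) * r ∈ Icc (0 : ℝ) 1 := (s * ⟨r, hr'⟩ : I).2
    rw [IccExtend_of_mem _ _ hr', IccExtend_of_mem _ _ hsr]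
    rfl
  rw [intervalIntegral.integral_congr h1, intervalIntegral.integral_smul,
    intervalIntegral.smul_integral_comp_mul_left]
  simp [scaleI]

end Rays

/-! ### Smooth dependence on parameters and the Frobenius theorem. -/

section RaySolution

open scoped unitInterval

universe u

variable {X Y : Type u} [NormedAddCommGroup X] [NormedSpace ℝ X]
  [NormedAddCommGroup Y] [NormedSpace ℝ Y]

set_option synthInstance.maxHeartbeats 200000

/-- The right-hand side `t ↦ f(t x, η(t)) x` of the ordinary differential equation along the ray
through `x`. -/
noncomputable def rayField (f : C(X × Y, X →L[ℝ] Y)) (x : X) (η : C(I, Y)) : C(I, Y) :=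
  ⟨fun t ↦ f ((t : ℝ) • x, η t) x, by fun_prop⟩

/-- The field factors as a bounded linear map `(x, η) ↦ (t ↦ (t x, η t))`, composition with `f`, and
bilinear evaluation on the constant curve `x`. -/
theorem contDiff_rayField {f : X × Y → X →L[ℝ] Y} (hf : ContDiff ℝ ∞ f) :
    ContDiff ℝ ∞ (fun z : X × C(I, Y) ↦ rayField ⟨f, hf.continuous⟩ z.1 z.2) := by
  let ι : X × C(I, Y) →L[ℝ] C(I, X × Y) :=
    (ContinuousLinearMap.compLeftContinuous ℝ I (ContinuousLinearMap.inl ℝ X Y)) ∘L rayCLM X ∘L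
        ContinuousLinearMap.fst ℝ X C(I, Y)
      + (ContinuousLinearMap.compLeftContinuous ℝ I (ContinuousLinearMap.inr ℝ X Y)) ∘L
        ContinuousLinearMap.snd ℝ X C(I, Y)
  have h1 := (contDiff_continuousMap_comp (K := I) hf).comp ι.contDiff
  have h2 : ContDiff ℝ ∞ (fun z : X × C(I, Y) ↦ constCLM X z.1) :=
    (constCLM X).contDiff.comp contDiff_fst
  have h3 := ((ContinuousMap.bilinApply I (ContinuousLinearMap.id ℝ (X →L[ℝ] Y))).contDiff.comp
    h1).clm_apply h2
  convert! h3 using 2 with z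
  ext t
  simp [rayField, ContinuousMap.bilinApply_apply, ι, constCLM_apply, rayCLM_apply]

/-- At `x = 0` the field vanishes for every `η`, so its derivative has no `η`-component. The
linearised integral equation is then a shear, which is invertible without any smallness condition.
-/
theorem hasFDerivAt_rayField_zero {f : X × Y → X →L[ℝ] Y} (hf : ContDiff ℝ ∞ f) (y : Y) :
    ∃ D : X →L[ℝ] C(I, Y),
      HasFDerivAt (fun z : X × C(I, Y) ↦ rayField ⟨f, hf.continuous⟩ z.1 z.2)
        (D ∘L ContinuousLinearMap.fst ℝ X C(I, Y)) (0, constCLM Y y) := by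
  have hd := ((contDiff_rayField hf).differentiable (by simp) (0, constCLM Y y)).hasFDerivAt
  set Φ := fderiv ℝ (fun z : X × C(I, Y) ↦ rayField ⟨f, hf.continuous⟩ z.1 z.2)
    (0, constCLM Y y) with hΦ
  have h0 : Φ ∘L ContinuousLinearMap.inr ℝ X C(I, Y) = 0 := by
    have h1 : HasFDerivAt (fun η : C(I, Y) ↦ rayField ⟨f, hf.continuous⟩ 0 η)
        (Φ ∘L ContinuousLinearMap.inr ℝ X C(I, Y)) (constCLM Y y) :=
      HasFDerivAt.comp (constCLM Y y)
        (g := fun z : X × C(I, Y) ↦ rayField ⟨f, hf.continuous⟩ z.1 z.2) hd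
        (hasFDerivAt_prodMk_right (0 : X) (constCLM Y y))
    have h2 : (fun η : C(I, Y) ↦ rayField ⟨f, hf.continuous⟩ (0 : X) η) = fun _ ↦ 0 := by
      funext η; ext t; simp [rayField]
    rw [h2] at h1
    exact h1.unique (hasFDerivAt_const _ _)
  refine ⟨Φ ∘L ContinuousLinearMap.inl ℝ X C(I, Y), ?_⟩
  have hD : (Φ ∘L ContinuousLinearMap.inl ℝ X C(I, Y)) ∘L ContinuousLinearMap.fst ℝ X C(I, Y)
      = Φ := by
    refine ContinuousLinearMap.ext fun z ↦ ?_
    have := DFunLike.congr_fun h0 z.2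
    simp only [ContinuousLinearMap.comp_apply, ContinuousLinearMap.inr_apply,
      zero_apply] at this
    have hz : z = (z.1, 0) + (0, z.2) := by simp
    conv_rhs => rw [hz, map_add, this, add_zero]
    rfl
  rw [hD]
  exact hd

/-- The shear `(p, η) ↦ (p, η - c p)` as a linear equivalence. -/
def shearEquiv {P C : Type*} [NormedAddCommGroup P] [NormedSpace ℝ P]
    [NormedAddCommGroup C] [NormedSpace ℝ C] (c : P →L[ℝ] C) : (P × C) ≃L[ℝ] (P × C) :=
  ContinuousLinearEquiv.equivOfInverse
    ((ContinuousLinearMap.fst ℝ P C).prod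
      (ContinuousLinearMap.snd ℝ P C - c ∘L ContinuousLinearMap.fst ℝ P C))
    ((ContinuousLinearMap.fst ℝ P C).prod
      (ContinuousLinearMap.snd ℝ P C + c ∘L ContinuousLinearMap.fst ℝ P C))
    (fun z ↦ by simp) (fun z ↦ by simp)

/-- The equation along the ray through `x` with initial value `y` has a solution that depends
smoothly on `x` and `y`. -/
theorem exists_radial_solution_of_contDiff [CompleteSpace X] [CompleteSpace Y]
    {f : X × Y → X →L[ℝ] Y} (hf : ContDiff ℝ ∞ f) (y₀ : Y) :
    ∃ r > 0, ∃ α : X × Y → Y, ContDiffOn ℝ ∞ α (ball (0, y₀) r) ∧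
      (∀ z ∈ ball ((0 : X), y₀) r, z.1 = 0 → α z = z.2) ∧
      ∀ z ∈ ball ((0 : X), y₀) r, fderiv ℝ α z (z.1, 0) = f (z.1, α z) z.1 := by
  let F : X → C(I, Y) → C(I, Y) := rayField ⟨f, hf.continuous⟩
  have hF : ContDiff ℝ ∞ (fun z : X × C(I, Y) ↦ F z.1 z.2) := contDiff_rayField hf
  obtain ⟨D, hD⟩ := hasFDerivAt_rayField_zero hf y₀
  -- The second component of `Ψ` vanishes exactly on solutions of `η = y + ∫ F(x, η)`. The inverse
  -- of `Ψ`, restricted to second component `0`, gives them as a smooth function of `(x, y)`.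
  let Ψ : (X × Y) × C(I, Y) → (X × Y) × C(I, Y) := fun w ↦
    (w.1, w.2 - (constCLM Y w.1.2 + primitiveCLM Y (F w.1.1 w.2)))
  let a : (X × Y) × C(I, Y) := ((0, y₀), constCLM Y y₀)
  have hproj : ContDiff ℝ ∞ (fun w : (X × Y) × C(I, Y) ↦ (w.1.1, w.2)) := by fun_prop
  have hΨ : ContDiff ℝ ∞ Ψ := by
    refine contDiff_fst.prodMk (contDiff_snd.sub (((constCLM Y).contDiff.comp ?_).add
      ((primitiveCLM Y).contDiff.comp (hF.comp hproj))))
    fun_prop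
  let c : X × Y →L[ℝ] C(I, Y) := constCLM Y ∘L ContinuousLinearMap.snd ℝ X Y
    + primitiveCLM Y ∘L D ∘L ContinuousLinearMap.fst ℝ X Y
  have hΨ' : HasFDerivAt Ψ (shearEquiv c : (X × Y) × C(I, Y) →L[ℝ] (X × Y) × C(I, Y)) a := by
    have h1 : HasFDerivAt (fun w : (X × Y) × C(I, Y) ↦ F w.1.1 w.2)
        ((D ∘L ContinuousLinearMap.fst ℝ X C(I, Y)) ∘L
          ((ContinuousLinearMap.fst ℝ X Y ∘L ContinuousLinearMap.fst ℝ (X × Y) C(I, Y)).prod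
            (ContinuousLinearMap.snd ℝ (X × Y) C(I, Y)))) a :=
      HasFDerivAt.comp a (g := fun z : X × C(I, Y) ↦ F z.1 z.2) hD
        ((ContinuousLinearMap.fst ℝ X Y ∘L ContinuousLinearMap.fst ℝ (X × Y) C(I, Y)).prod
            (ContinuousLinearMap.snd ℝ (X × Y) C(I, Y))).hasFDerivAt
    have h2 := hasFDerivAt_fst (𝕜 := ℝ) (p := a) |>.prodMk ((hasFDerivAt_snd (𝕜 := ℝ) (p := a)).sub
      ((constCLM Y ∘L ContinuousLinearMap.snd ℝ X Y ∘L
        ContinuousLinearMap.fst ℝ (X × Y) C(I, Y)).hasFDerivAt.add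
        ((primitiveCLM Y).hasFDerivAt.comp a h1)))
    exact h2
  obtain ⟨e, hae, -, hecoe, hesymm, -⟩ :=
    exists_openPartialHomeomorph_of_hasFDerivAt isOpen_univ (mem_univ a) hΨ.contDiffOn _ hΨ'
  have hΨa : Ψ a = ((0, y₀), 0) := by
    refine Prod.ext rfl ?_
    have : F 0 (constCLM Y y₀) = 0 := by ext t; simp [F, rayField]
    change constCLM Y y₀ - (constCLM Y y₀ + primitiveCLM Y (F 0 (constCLM Y y₀))) = 0
    rw [this]; simp
  obtain ⟨ρ, hρ, hρe⟩ := Metric.isOpen_iff.1 e.open_source a hae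
  -- the solution curves
  let sol : X × Y → (X × Y) × C(I, Y) := fun p ↦ e.symm (p, 0)
  have hat : ((0, y₀), (0 : C(I, Y))) ∈ e.target := by
    rw [← hΨa, ← hecoe]; exact e.map_source hae
  have hOt : IsOpen ((fun p : X × Y ↦ (p, (0 : C(I, Y)))) ⁻¹' e.target) :=
    e.open_target.preimage (by fun_prop)
  have hs : ContDiffOn ℝ ∞ sol ((fun p : X × Y ↦ (p, (0 : C(I, Y)))) ⁻¹' e.target) :=
    hesymm.comp (by fun_prop) (fun p hp ↦ hp)
  have hs0 : sol (0, y₀) = a := by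
    change e.symm ((0, y₀), 0) = a
    rw [← hΨa, ← hecoe, e.left_inv hae]
  have hO2 : IsOpen ((fun p : X × Y ↦ (p, (0 : C(I, Y)))) ⁻¹' e.target ∩ sol ⁻¹' ball a ρ) :=
    hs.continuousOn.isOpen_inter_preimage hOt isOpen_ball
  obtain ⟨r, hr, hrO⟩ := Metric.isOpen_iff.1 hO2 (0, y₀)
    ⟨hat, by rw [mem_preimage, hs0]; exact mem_ball_self hρ⟩
  have hs1 : ∀ p ∈ ball ((0 : X), y₀) r, (sol p).1 = p ∧
      (sol p).2 = constCLM Y p.2 + primitiveCLM Y (F p.1 (sol p).2) := by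
    intro p hp
    have h := e.right_inv (hrO hp).1
    rw [hecoe] at h
    have h1 : (sol p).1 = p := congrArg Prod.fst h
    have h2 : (sol p).2 - (constCLM Y (sol p).1.2 + primitiveCLM Y (F (sol p).1.1 (sol p).2)) = 0 :=
      congrArg Prod.snd h
    rw [h1] at h2
    exact ⟨h1, sub_eq_zero.1 h2⟩
  have hball : ∀ p ∈ ball ((0 : X), y₀) r, ∀ s : I, ((s : ℝ) • p.1, p.2) ∈ ball ((0 : X), y₀) r := by
    intro p hp s
    rw [← ball_prod_same] at hp ⊢
    refine ⟨?_, hp.2⟩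
    have := hp.1
    simp only [mem_ball, dist_zero_right] at this ⊢
    rw [norm_smul, Real.norm_of_nonneg s.2.1]
    exact (mul_le_of_le_one_left (norm_nonneg _) s.2.2).trans_lt this
  -- The rescaled curve solves the equation for `s x` and is no farther from the constant curve in
  -- the sup norm. Hence it lies where `Ψ` is injective and must be the solution chosen there.
  have hscale : ∀ p ∈ ball ((0 : X), y₀) r, ∀ s : I,
      (sol ((s : ℝ) • p.1, p.2)).2 = (sol p).2.comp (scaleI s) := by
    intro p hp s
    have hq := hball p hp s
    have hmem : (((s : ℝ) • p.1, p.2), (sol p).2.comp (scaleI s)) ∈ e.source := by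
      apply hρe
      rw [← ball_prod_same]
      have h1 := (hrO hp).2
      have h2 := (hrO hq).2
      rw [mem_preimage, ← ball_prod_same] at h1 h2
      refine ⟨by simpa only [(hs1 _ hq).1] using h2.1, ?_⟩
      have h3 := h1.2
      rw [mem_ball, ContinuousMap.dist_lt_iff hρ] at h3 ⊢
      exact fun t ↦ h3 (scaleI s t)
    have hΨs : Ψ (((s : ℝ) • p.1, p.2), (sol p).2.comp (scaleI s)) = (((s : ℝ) • p.1, p.2), 0) := by
      refine Prod.ext rfl ?_
      change (sol p).2.comp (scaleI s) - (constCLM Y p.2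
        + primitiveCLM Y (F ((s : ℝ) • p.1) ((sol p).2.comp (scaleI s)))) = 0
      have h4 : F ((s : ℝ) • p.1) ((sol p).2.comp (scaleI s))
          = (s : ℝ) • (F p.1 (sol p).2).comp (scaleI s) := by
        ext t
        simp only [F, rayField, scaleI, ContinuousMap.coe_mk, ContinuousMap.comp_apply,
          ContinuousMap.smul_apply, map_smul, smul_smul, Icc.coe_mul]
        rw [mul_comm (t : ℝ)]
      rw [h4, ← primitiveCLM_comp_scaleI, sub_eq_zero]
      conv_lhs => rw [(hs1 p hp).2]
      rfl
    have := congrArg e.symm hΨs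
    rw [← hecoe, e.left_inv hmem] at this
    exact (congrArg Prod.snd this).symm
  let ev : C(I, Y) →L[ℝ] Y := ContinuousMap.evalCLM ℝ (1 : I)
  have hα : ContDiffOn ℝ ∞ (fun p ↦ (sol p).2 1) (ball (0, y₀) r) :=
    ev.contDiff.comp_contDiffOn (contDiff_snd.comp_contDiffOn (hs.mono fun p hp ↦ (hrO hp).1))
  -- By `hscale`, the endpoint value at `(t x, y)` is the value at time `t` of the solution for `(x,
  -- y)`. Differentiating at `t = 1` gives the radial derivative of the endpoint map.
  refine ⟨r, hr, fun p ↦ (sol p).2 1, hα, ?_, ?_⟩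
  · intro z hz hz0
    have := DFunLike.congr_fun (hs1 z hz).2 1
    have hF0 : F z.1 (sol z).2 = 0 := by ext t; simp [F, rayField, hz0]
    rw [hF0] at this
    simpa [constCLM_apply] using this
  · intro z hz
    have h1 := hasDerivWithinAt_of_eq_primitive (hs1 z hz).2
    have h2 : HasDerivWithinAt (fun t : ℝ ↦ (sol (t • z.1, z.2)).2 1) (F z.1 (sol z).2 1)
        (Icc 0 1) 1 := by
      refine h1.congr_of_mem (fun t ht ↦ ?_) (by simp)
      rw [IccExtend_of_mem _ _ ht, hscale z hz ⟨t, ht⟩]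
      simp [scaleI]
    have h3 : HasFDerivAt (fun p ↦ (sol p).2 1) (fderiv ℝ (fun p ↦ (sol p).2 1) z)
        ((fun t : ℝ ↦ (t • z.1, z.2)) 1) := by
      simp only [one_smul]
      exact ((hα.contDiffAt (isOpen_ball.mem_nhds hz)).differentiableAt (by simp)).hasFDerivAt
    have h4 : HasDerivAt (fun t : ℝ ↦ (t • z.1, z.2)) (z.1, 0) 1 := by
      have := ((hasDerivAt_id (1 : ℝ)).smul_const z.1).prodMk (hasDerivAt_const (1 : ℝ) z.2)
      simpa using this
    have h5 := (h3.comp_hasDerivAt (1 : ℝ) h4).hasDerivWithinAt (s := Icc 0 1)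
    have h6 := (uniqueDiffOn_Icc (zero_lt_one' ℝ) 1 (by simp)).eq_deriv _ h5 h2
    rw [h6]
    simp [F, rayField]

/-- Local version of `exists_radial_solution_of_contDiff`. -/
theorem exists_radial_solution {X Y : Type u} [NormedAddCommGroup X] [NormedSpace ℝ X]
    [FiniteDimensional ℝ X] [NormedAddCommGroup Y] [NormedSpace ℝ Y] [FiniteDimensional ℝ Y]
    {f : X × Y → X →L[ℝ] Y} {Ω : Set (X × Y)} (hΩ : IsOpen Ω) {y₀ : Y} (h₀ : (0, y₀) ∈ Ω)
    (hf : ContDiffOn ℝ ∞ f Ω) :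
    ∃ r > 0, ∃ α : X × Y → Y, ContDiffOn ℝ ∞ α (ball (0, y₀) r) ∧
      (∀ z ∈ ball ((0 : X), y₀) r, z.1 = 0 → α z = z.2) ∧
      ∀ z ∈ ball ((0 : X), y₀) r, (z.1, α z) ∈ Ω ∧
        fderiv ℝ α z (z.1, 0) = f (z.1, α z) z.1 := by
  have := FiniteDimensional.complete ℝ X
  have := FiniteDimensional.complete ℝ Y
  -- The equation is solved for the cut-off field. The ball is then shrunk so that the solution
  -- stays where the cut-off field equals `f`.
  obtain ⟨f', hf', hff'⟩ := exists_contDiff_eventuallyEq hΩ h₀ hf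
  obtain ⟨r, hr, α, hα, hα0, hαr⟩ := exists_radial_solution_of_contDiff hf' y₀
  have hO : IsOpen (ball ((0 : X), y₀) r ∩ (fun z ↦ (z.1, α z)) ⁻¹'
      interior ({z | f' z = f z} ∩ Ω)) :=
    (continuousOn_fst.prodMk hα.continuousOn).isOpen_inter_preimage isOpen_ball isOpen_interior
  have h00 : α (0, y₀) = y₀ := hα0 _ (mem_ball_self hr) rfl
  obtain ⟨r', hr', hrO⟩ := Metric.isOpen_iff.1 hO (0, y₀) ⟨mem_ball_self hr, by
    rw [mem_preimage, h00, mem_interior_iff_mem_nhds]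
    exact inter_mem hff' (hΩ.mem_nhds h₀)⟩
  refine ⟨r', hr', α, hα.mono fun z hz ↦ (hrO hz).1, fun z hz ↦ hα0 z (hrO hz).1, fun z hz ↦ ?_⟩
  have h1 : (z.1, α z) ∈ {z | f' z = f z} ∩ Ω := interior_subset (hrO hz).2
  exact ⟨h1.2, (hαr z (hrO hz).1).trans (by rw [show f' _ = f _ from h1.1])⟩

/-- **Frobenius theorem** for the total differential equation `D_x α(x, y) = f(x, α(x, y))`. -/
theorem exists_total_differential_solution {X Y : Type u} [NormedAddCommGroup X] [NormedSpace ℝ X]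
    [FiniteDimensional ℝ X] [NormedAddCommGroup Y] [NormedSpace ℝ Y] [FiniteDimensional ℝ Y]
    {f : X × Y → X →L[ℝ] Y} {Ω : Set (X × Y)} (hΩ : IsOpen Ω) {y₀ : Y} (h₀ : (0, y₀) ∈ Ω)
    (hf : ContDiffOn ℝ ∞ f Ω)
    (hint : ∀ z ∈ Ω, ∀ ξ ζ : X, fderiv ℝ f z (ξ, f z ξ) ζ = fderiv ℝ f z (ζ, f z ζ) ξ) :
    ∃ r > 0, ∃ α : X × Y → Y, ContDiffOn ℝ ∞ α (ball (0, y₀) r) ∧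
      (∀ z ∈ ball ((0 : X), y₀) r, z.1 = 0 → α z = z.2) ∧
      ∀ z ∈ ball ((0 : X), y₀) r, (z.1, α z) ∈ Ω ∧
        ∀ ξ, fderiv ℝ α z (ξ, 0) = f (z.1, α z) ξ := by
  obtain ⟨r, hr, α, hα, hα0, hαr⟩ := exists_radial_solution hΩ h₀ hf
  refine ⟨r, hr, α, hα, hα0, fun z hz ↦ ⟨(hαr z hz).1, fun ξ ↦ ?_⟩⟩
  have hαat : ∀ w ∈ ball ((0 : X), y₀) r, ContDiffAt ℝ ∞ α w := fun w hw ↦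
    hα.contDiffAt (isOpen_ball.mem_nhds hw)
  have hfat : ∀ w ∈ ball ((0 : X), y₀) r, HasFDerivAt f (fderiv ℝ f (w.1, α w)) (w.1, α w) :=
    fun w hw ↦ ((hf.contDiffAt (hΩ.mem_nhds (hαr w hw).1)).differentiableAt
      (by simp)).hasFDerivAt
  -- the defect and its radial derivative
  let m : X × Y → Y := fun w ↦ fderiv ℝ α w (ξ, 0) - f (w.1, α w) ξ
  have hD1 : ∀ w ∈ ball ((0 : X), y₀) r, HasFDerivAt α (fderiv ℝ α w) w := fun w hw ↦
    ((hαat w hw).differentiableAt (by simp)).hasFDerivAt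
  have hD2 : ∀ w ∈ ball ((0 : X), y₀) r,
      HasFDerivAt (fderiv ℝ α) (fderiv ℝ (fderiv ℝ α) w) w := fun w hw ↦
    (((hαat w hw).fderiv_right (m := ∞) (by simp)).differentiableAt (by simp)).hasFDerivAt
  have hcompd : ∀ w ∈ ball ((0 : X), y₀) r, HasFDerivAt (fun w ↦ f (w.1, α w))
      (fderiv ℝ f (w.1, α w) ∘L (ContinuousLinearMap.fst ℝ X Y).prod (fderiv ℝ α w)) w :=
    fun w hw ↦ HasFDerivAt.comp w (g := f) (hfat w hw) (hasFDerivAt_fst.prodMk (hD1 w hw))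
  have hm : ∀ w ∈ ball ((0 : X), y₀) r, HasFDerivAt m
      ((fderiv ℝ (fderiv ℝ α) w).flip (ξ, 0) -
        (fderiv ℝ f (w.1, α w) ∘L
          (ContinuousLinearMap.fst ℝ X Y).prod (fderiv ℝ α w)).flip ξ) w := by
    intro w hw
    have h1 := (hD2 w hw).clm_apply (hasFDerivAt_const ((ξ, 0) : X × Y) w)
    have h2 := (hcompd w hw).clm_apply (hasFDerivAt_const ξ w)
    have h3 := h1.sub h2
    simp only [ContinuousLinearMap.comp_zero, zero_add] at h3
    exact h3
  -- The radial equation is differentiated in the direction `ξ`. Symmetry of the second derivative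
  -- of `α` and the integrability condition cancel everything but a linear expression in the defect
  -- `m`; the term `- m w` comes from differentiating the radial vector itself.
  have hmrad : ∀ w ∈ ball ((0 : X), y₀) r, fderiv ℝ m w (w.1, 0)
      = - m w + fderiv ℝ f (w.1, α w) (0, m w) w.1 := by
    intro w hw
    have hEq : (fun w : X × Y ↦ fderiv ℝ α w (w.1, 0)) =ᶠ[𝓝 w] fun w ↦ f (w.1, α w) w.1 := by
      filter_upwards [isOpen_ball.mem_nhds hw] with w' hw' using (hαr w' hw').2
    have hl := (hD2 w hw).clm_apply
      (((ContinuousLinearMap.inl ℝ X Y) ∘L (ContinuousLinearMap.fst ℝ X Y)).hasFDerivAt (x := w))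
    have hrr := (hcompd w hw).clm_apply ((ContinuousLinearMap.fst ℝ X Y).hasFDerivAt (x := w))
    have hu := (hl.congr_of_eventuallyEq hEq.symm).unique hrr
    have hu' := DFunLike.congr_fun hu (ξ, 0)
    simp only [ContinuousLinearMap.comp_apply, add_apply,
      ContinuousLinearMap.inl_apply, ContinuousLinearMap.coe_fst', ContinuousLinearMap.flip_apply,
      ContinuousLinearMap.prod_apply] at hu'
    have hsymm : fderiv ℝ (fderiv ℝ α) w (w.1, 0) (ξ, 0)
        = fderiv ℝ (fderiv ℝ α) w (ξ, 0) (w.1, 0) :=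
      ((hαat w hw).isSymmSndFDerivAt (by simpa using ENat.LEInfty.out)).eq _ _
    rw [(hm w hw).fderiv]
    simp only [sub_apply, ContinuousLinearMap.flip_apply,
      ContinuousLinearMap.comp_apply, ContinuousLinearMap.prod_apply,
      ContinuousLinearMap.coe_fst']
    rw [hsymm, (hαr w hw).2]
    have hi := hint _ (hαr w hw).1 w.1 ξ
    have hmw : fderiv ℝ α w (ξ, 0) = m w + f (w.1, α w) ξ := by simp [m]
    rw [hmw] at hu'
    have hsplit : (ξ, m w + f (w.1, α w) ξ) = ((ξ, f (w.1, α w) ξ) + (0, m w) : X × Y) := by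
      simp [add_comm]
    rw [hsplit, map_add, add_apply] at hu'
    rw [hi]
    rw [← sub_eq_zero] at hu' ⊢
    refine Eq.trans ?_ hu'
    abel
  -- Gronwall
  have hray : ∀ t ∈ Icc (0 : ℝ) 1, (t • z.1, z.2) ∈ ball ((0 : X), y₀) r := by
    intro t ht
    rw [← ball_prod_same] at hz ⊢
    refine ⟨?_, hz.2⟩
    have := hz.1
    simp only [mem_ball, dist_zero_right] at this ⊢
    rw [norm_smul, Real.norm_of_nonneg ht.1]
    exact (mul_le_of_le_one_left (norm_nonneg _) ht.2).trans_lt this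
  -- Along the ray `t m' = -m + t A m`. The factor `t` absorbs the singular term, so that `k' = A k`
  -- with `k 0 = 0`.
  let k : ℝ → Y := fun t ↦ t • m (t • z.1, z.2)
  let A : ℝ → Y →L[ℝ] Y := fun t ↦
    (fderiv ℝ f (t • z.1, α (t • z.1, z.2)) ∘L ContinuousLinearMap.inr ℝ X Y).flip z.1
  have hk : ∀ t ∈ Icc (0 : ℝ) 1, HasDerivAt k (A t (k t)) t := by
    intro t ht
    have hw := hray t ht
    have h4 : HasDerivAt (fun t : ℝ ↦ (t • z.1, z.2)) (z.1, 0) t := by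
      simpa using ((hasDerivAt_id t).smul_const z.1).prodMk (hasDerivAt_const t z.2)
    have h5 := (hasDerivAt_id t).smul
      ((hm _ hw).differentiableAt.hasFDerivAt.comp_hasDerivAt t h4)
    convert! h5 using 1
    have h6 := hmrad _ hw
    have h7 : ((t • z.1, (0 : Y)) : X × Y) = t • (z.1, 0) := by simp
    dsimp only at h6
    rw [h7, map_smul] at h6
    simp only [id, one_smul]
    rw [h6]
    have h8 : ((0 : X), k t) = t • ((0 : X), m (t • z.1, z.2)) := by simp [k]
    simp only [A, ContinuousLinearMap.flip_apply, ContinuousLinearMap.comp_apply,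
      ContinuousLinearMap.inr_apply, h8, map_smul, smul_apply]
    simp
  have hcont : ContinuousOn A (Icc 0 1) := by
    have hc1 : ContinuousOn (fun t : ℝ ↦ (t • z.1, z.2)) (Icc 0 1) := by fun_prop
    have hc2 : ContinuousOn (fun t : ℝ ↦ (t • z.1, α (t • z.1, z.2))) (Icc 0 1) :=
      (by fun_prop : ContinuousOn (fun t : ℝ ↦ t • z.1) (Icc 0 1)).prodMk
        (hα.continuousOn.comp hc1 hray)
    have hc3 := (hf.continuousOn_fderiv_of_isOpen hΩ (by simp)).comp hc2
      (fun t ht ↦ (hαr _ (hray t ht)).1)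
    exact ((ContinuousLinearMap.flipₗᵢ ℝ Y X Y).continuous.comp_continuousOn
      (hc3.clm_comp continuousOn_const)).clm_apply continuousOn_const
  obtain ⟨C, hC⟩ := isCompact_Icc.exists_bound_of_continuousOn hcont
  have hk0 : k 1 = 0 := eq_zero_of_abs_deriv_le_mul_abs_self_of_eq_zero_right
    (f' := fun t ↦ A t (k t)) (K := C)
    (fun t ht ↦ (hk t ht).continuousAt.continuousWithinAt)
    (fun t ht ↦ (hk t ⟨ht.1, ht.2.le⟩).hasDerivWithinAt) (by simp [k])
    (fun t ht ↦ ((A t).le_opNorm _).trans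
      (mul_le_mul_of_nonneg_right (hC t ⟨ht.1, ht.2.le⟩) (norm_nonneg _))) 1 (by simp)
  have : m z = 0 := by simpa [k] using hk0
  exact sub_eq_zero.1 this

end RaySolution

/-! ### First integrals and relative primitives -/

section FirstIntegrals

universe u

/-- The differential system used to straighten the distribution `ker β`: in the splitting
`E = X ⊕ F` given by `ι` and `σ`, the leaves are graphs with slope `- (β σ)⁻¹ β ι`. -/
noncomputable def graphSlope {E F X : Type*} [NormedAddCommGroup E] [NormedSpace ℝ E]
    [NormedAddCommGroup F] [NormedSpace ℝ F] [NormedAddCommGroup X] [NormedSpace ℝ X]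
    (ι : X →L[ℝ] E) (σ : F →L[ℝ] E) (b : E →L[ℝ] F) : X →L[ℝ] F :=
  - ((b ∘L σ).inverse ∘L b ∘L ι)

theorem graphSlope_spec {E F X : Type*} [NormedAddCommGroup E] [NormedSpace ℝ E]
    [NormedAddCommGroup F] [NormedSpace ℝ F] [NormedAddCommGroup X] [NormedSpace ℝ X]
    (ι : X →L[ℝ] E) (σ : F →L[ℝ] E) (b : E →L[ℝ] F) (hb : (b ∘L σ).IsInvertible) (ξ : X) (υ : F) :
    b (ι ξ + σ υ) = 0 ↔ υ = graphSlope ι σ b ξ := by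
  obtain ⟨S, hS⟩ := hb
  have hS' : ∀ w, b (σ w) = S w := fun w ↦ (DFunLike.congr_fun hS w).symm
  simp only [graphSlope, ← hS, ContinuousLinearMap.inverse_equiv, neg_apply,
    ContinuousLinearMap.comp_apply, map_add, hS', ContinuousLinearEquiv.coe_coe]
  rw [← map_neg, ContinuousLinearEquiv.eq_symm_apply, add_comm, add_eq_zero_iff_eq_neg]

variable {E F G : Type u} [NormedAddCommGroup E] [NormedSpace ℝ E] [FiniteDimensional ℝ E]
  [NormedAddCommGroup F] [NormedSpace ℝ F] [FiniteDimensional ℝ F]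
  [NormedAddCommGroup G] [NormedSpace ℝ G] [FiniteDimensional ℝ G]

set_option maxHeartbeats 1000000 in
/-- If `ker β` is involutive and `η` is closed along its leaves, then there are locally a submersion
`φ` constant along the leaves and a primitive `ψ` of `η` along the leaves. -/
theorem exists_firstIntegral_primitive {β : E → E →L[ℝ] F} {η : E → E →L[ℝ] G} {V : Set E}
    {p : E} (hV : IsOpen V) (hp : p ∈ V) (hβ : ContDiffOn ℝ ∞ β V) (hη : ContDiffOn ℝ ∞ η V)
    (hsurj : Function.Surjective (β p))
    (hinv : ∀ q ∈ V, ∀ v w, β q v = 0 → β q w = 0 → fderiv ℝ β q v w = fderiv ℝ β q w v)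
    (hcl : ∀ q ∈ V, ∀ v w, β q v = 0 → β q w = 0 → fderiv ℝ η q v w = fderiv ℝ η q w v) :
    ∃ V' ⊆ V, IsOpen V' ∧ p ∈ V' ∧ ∃ (φ : E → F) (ψ : E → G), ContDiffOn ℝ ∞ φ V' ∧
      ContDiffOn ℝ ∞ ψ V' ∧ Function.Surjective (fderiv ℝ φ p) ∧
      ∀ q ∈ V', ∀ v, β q v = 0 → fderiv ℝ φ q v = 0 ∧ fderiv ℝ ψ q v = η q v := by
  have := FiniteDimensional.complete ℝ E
  have := FiniteDimensional.complete ℝ F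
  obtain ⟨σ₀, hσ₀⟩ := (β p : E →ₗ[ℝ] F).exists_rightInverse_of_surjective
    (LinearMap.range_eq_top.2 hsurj)
  let σ : F →L[ℝ] E := LinearMap.toContinuousLinearMap σ₀
  have hσ : ∀ y, β p (σ y) = y := fun y ↦ DFunLike.congr_fun hσ₀ y
  let X := LinearMap.ker (β p : E →ₗ[ℝ] F)
  let ι : X →L[ℝ] E := X.subtypeL
  have hι : ∀ ξ : X, β p (ι ξ) = 0 := fun ξ ↦ ξ.2
  have := FiniteDimensional.complete ℝ X
  -- the splitting of `E`
  let T : (X × F) ≃L[ℝ] E := ContinuousLinearEquiv.equivOfInverse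
    (ι ∘L ContinuousLinearMap.fst ℝ X F + σ ∘L ContinuousLinearMap.snd ℝ X F)
    (((ContinuousLinearMap.id ℝ E - σ ∘L β p).codRestrict X (fun v ↦ by
      simp only [X, LinearMap.mem_ker, ContinuousLinearMap.coe_coe, sub_apply,
        ContinuousLinearMap.comp_apply, map_sub, hσ, ContinuousLinearMap.id_apply, sub_self])).prod
      (β p))
    (fun z ↦ by
      refine Prod.ext (Subtype.ext ?_) ?_
      · simp [hσ, ι]
      · simp [hσ, hι])
    (fun v ↦ by simp [ι])
  have hT : ∀ z, T z = ι z.1 + σ z.2 := fun z ↦ rfl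
  let q : X × (F × G) → E := fun z ↦ p + T (z.1, z.2.1)
  let q' : X × (F × G) →L[ℝ] E := (T : X × F →L[ℝ] E) ∘L (ContinuousLinearMap.fst ℝ X (F × G)).prod
    (ContinuousLinearMap.fst ℝ F G ∘L ContinuousLinearMap.snd ℝ X (F × G))
  have hqd : ∀ z, HasFDerivAt q q' z := fun z ↦ q'.hasFDerivAt.const_add p
  have hq' : ∀ ξ υ, q' (ξ, υ) = ι ξ + σ υ.1 := fun ξ υ ↦ rfl
  have hqc : ContDiff ℝ ∞ q := contDiff_const.add q'.contDiff
  let V₀ : Set E := V ∩ (fun x ↦ β x ∘L σ) ⁻¹' range ((↑) : (F ≃L[ℝ] F) → F →L[ℝ] F)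
  have hV₀ : IsOpen V₀ := (hβ.continuousOn.clm_comp continuousOn_const).isOpen_inter_preimage hV
    ContinuousLinearEquiv.isOpen
  -- The leaves are graphs over `X` with slope `f1`. The second component of `f` integrates `η`
  -- along them, so a single application of Frobenius yields both the leaves and the primitive.
  let f1 : X × (F × G) → X →L[ℝ] F := fun z ↦ graphSlope ι σ (β (q z))
  let f : X × (F × G) → X →L[ℝ] F × G := fun z ↦ (f1 z).prod (η (q z) ∘L (ι + σ ∘L f1 z))
  let Ω := q ⁻¹' V₀
  have hΩ : IsOpen Ω := hV₀.preimage hqc.continuous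
  have hβq : ContDiffOn ℝ ∞ (fun z ↦ β (q z)) Ω := hβ.comp hqc.contDiffOn fun z hz ↦ hz.1
  have hηq : ContDiffOn ℝ ∞ (fun z ↦ η (q z)) Ω := hη.comp hqc.contDiffOn fun z hz ↦ hz.1
  have hf1 : ContDiffOn ℝ ∞ f1 Ω := by
    have h1 : ContDiffOn ℝ ∞ (fun z ↦ (β (q z) ∘L σ).inverse) Ω := by
      intro z hz
      obtain ⟨S, hS⟩ := hz.2
      have h2 : ContDiffAt ℝ ∞ ContinuousLinearMap.inverse (β (q z) ∘L σ) := by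
        rw [← show _ = β (q z) ∘L σ from hS]
        exact contDiffAt_map_inverse S
      exact h2.comp_contDiffWithinAt z ((hβq z hz).clm_comp contDiffWithinAt_const)
    exact (h1.clm_comp (hβq.clm_comp contDiffOn_const)).neg
  have hW : ContDiffOn ℝ ∞ (fun z ↦ ι + σ ∘L f1 z) Ω :=
    contDiffOn_const.add (contDiffOn_const.clm_comp hf1)
  have hf2 : ContDiffOn ℝ ∞ (fun z ↦ η (q z) ∘L (ι + σ ∘L f1 z)) Ω := hηq.clm_comp hW
  have hf : ContDiffOn ℝ ∞ f Ω := by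
    have hfe : f = fun z ↦ ContinuousLinearMap.inl ℝ F G ∘L f1 z
        + ContinuousLinearMap.inr ℝ F G ∘L (η (q z) ∘L (ι + σ ∘L f1 z)) := by
      funext z
      refine ContinuousLinearMap.ext fun ξ ↦ ?_
      refine Prod.ext ?_ ?_ <;> simp [f]
    rw [hfe]
    exact (contDiffOn_const.clm_comp hf1).add (contDiffOn_const.clm_comp hf2)
  have hker : ∀ z ∈ Ω, ∀ ξ, β (q z) (ι ξ + σ (f1 z ξ)) = 0 := fun z hz ξ ↦
    (graphSlope_spec ι σ _ hz.2 ξ _).2 rfl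
  have hat : ∀ {H : Type u} [NormedAddCommGroup H] [NormedSpace ℝ H] {k : X × (F × G) → H},
      ContDiffOn ℝ ∞ k Ω → ∀ z ∈ Ω, HasFDerivAt k (fderiv ℝ k z) z := fun hk z hz ↦
    ((hk.contDiffAt (hΩ.mem_nhds hz)).differentiableAt (by simp)).hasFDerivAt
  have hβd : ∀ z ∈ Ω, HasFDerivAt (fun z ↦ β (q z)) (fderiv ℝ β (q z) ∘L q') z := fun z hz ↦
    HasFDerivAt.comp z (((hβ.contDiffAt (hV.mem_nhds hz.1)).differentiableAt
      (by simp)).hasFDerivAt) (hqd z)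
  have hηd : ∀ z ∈ Ω, HasFDerivAt (fun z ↦ η (q z)) (fderiv ℝ η (q z) ∘L q') z := fun z hz ↦
    HasFDerivAt.comp z (((hη.contDiffAt (hV.mem_nhds hz.1)).differentiableAt
      (by simp)).hasFDerivAt) (hqd z)
  have hWd : ∀ z ∈ Ω, ∀ ξ, HasFDerivAt (fun z ↦ ι ξ + σ (f1 z ξ))
      (σ ∘L (fderiv ℝ f1 z).flip ξ) z := by
    intro z hz ξ
    have h1 := (hat hf1 z hz).clm_apply (hasFDerivAt_const ξ z)
    simp only [ContinuousLinearMap.comp_zero, zero_add] at h1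
    exact (σ.hasFDerivAt.comp z h1).const_add (ι ξ)
  -- Differentiating `β (ι ζ + σ (f1 ζ)) = 0` along the lifted direction of `ξ` expresses `dβ`
  -- through `df1`. Involutivity becomes symmetry of the derivative of `f1` once `β ∘ σ` is
  -- inverted.
  have hint1 : ∀ z ∈ Ω, ∀ ξ ζ : X,
      fderiv ℝ f1 z (ξ, f z ξ) ζ = fderiv ℝ f1 z (ζ, f z ζ) ξ := by
    intro z hz
    have key : ∀ ξ ζ : X, fderiv ℝ β (q z) (ι ξ + σ (f1 z ξ)) (ι ζ + σ (f1 z ζ))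
        = - β (q z) (σ (fderiv ℝ f1 z (ξ, f z ξ) ζ)) := by
      intro ξ ζ
      have h1 := (hβd z hz).clm_apply (hWd z hz ζ)
      have h2 : (fun z ↦ β (q z) (ι ζ + σ (f1 z ζ))) =ᶠ[𝓝 z] fun _ ↦ 0 := by
        filter_upwards [hΩ.mem_nhds hz] with w hw using hker w hw ζ
      have h3 := (h1.congr_of_eventuallyEq h2.symm).unique (hasFDerivAt_const 0 z)
      have h4 := DFunLike.congr_fun h3 (ξ, f z ξ)
      simp only [add_apply, ContinuousLinearMap.comp_apply, ContinuousLinearMap.flip_apply,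
        zero_apply, hq'] at h4
      rw [add_comm] at h4
      exact eq_neg_of_add_eq_zero_left h4
    intro ξ ζ
    have h1 := hinv (q z) hz.1 _ _ (hker z hz ξ) (hker z hz ζ)
    rw [key, key, neg_inj] at h1
    obtain ⟨S, hS⟩ := hz.2
    have hS' : ∀ w, β (q z) (σ w) = S w := fun w ↦ (DFunLike.congr_fun hS w).symm
    rw [hS', hS'] at h1
    exact S.injective h1
  have hint : ∀ z ∈ Ω, ∀ ξ ζ : X, fderiv ℝ f z (ξ, f z ξ) ζ = fderiv ℝ f z (ζ, f z ζ) ξ := by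
    intro z hz
    have hfd : ∀ w ζ, fderiv ℝ f z w ζ = (fderiv ℝ f1 z w ζ,
        fderiv ℝ η (q z) (q' w) (ι ζ + σ (f1 z ζ)) + η (q z) (σ (fderiv ℝ f1 z w ζ))) := by
      intro w ζ
      have h1 := (hat hf z hz).clm_apply (hasFDerivAt_const ζ z)
      have h2 := ((hat hf1 z hz).clm_apply (hasFDerivAt_const ζ z)).prodMk
        ((hηd z hz).clm_apply (hWd z hz ζ))
      have h3 := DFunLike.congr_fun (h1.unique h2) w
      simp only [ContinuousLinearMap.comp_zero, zero_add, ContinuousLinearMap.flip_apply,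
        ContinuousLinearMap.prod_apply, add_apply, ContinuousLinearMap.comp_apply] at h3
      rw [h3, add_comm]
    intro ξ ζ
    rw [hfd, hfd, hint1 z hz ξ ζ, hq', hq']
    have := hcl (q z) hz.1 _ _ (hker z hz ξ) (hker z hz ζ)
    change (_, fderiv ℝ η (q z) (ι ξ + σ (f1 z ξ)) _ + _)
      = (_, fderiv ℝ η (q z) (ι ζ + σ (f1 z ζ)) _ + _)
    rw [this]
  have hq0 : q (0, 0) = p := by simp [q]
  have h00 : ((0 : X), (0 : F × G)) ∈ Ω := by
    refine ⟨by rw [hq0]; exact hp, ContinuousLinearEquiv.refl ℝ F, ?_⟩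
    ext1 y
    simp [hq0, hσ]
  obtain ⟨r, hr, α, hα, hα0, hαf⟩ := exists_total_differential_solution hΩ h00 hf hint
  -- the straightening map
  let j : X × F →L[ℝ] X × (F × G) := (ContinuousLinearMap.fst ℝ X F).prod
    (ContinuousLinearMap.inl ℝ F G ∘L ContinuousLinearMap.snd ℝ X F)
  have hj : ∀ z, j z = (z.1, (z.2, 0)) := fun z ↦ rfl
  let O := j ⁻¹' ball ((0 : X), (0 : F × G)) r
  have hO : IsOpen O := isOpen_ball.preimage j.continuous
  let a : X × F → F × G := fun z ↦ α (j z)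
  have ha : ContDiffOn ℝ ∞ a O := hα.comp j.contDiff.contDiffOn fun z hz ↦ hz
  have had : ∀ z ∈ O, HasFDerivAt a (fderiv ℝ a z) z := fun z hz ↦
    ((ha.contDiffAt (hO.mem_nhds hz)).differentiableAt (by simp)).hasFDerivAt
  have hax : ∀ z ∈ O, ∀ ξ, fderiv ℝ a z (ξ, 0) = f (z.1, a z) ξ := by
    intro z hz ξ
    have h1 : HasFDerivAt a (fderiv ℝ α (j z) ∘L j) z := HasFDerivAt.comp z
      (((hα.contDiffAt (isOpen_ball.mem_nhds hz)).differentiableAt (by simp)).hasFDerivAt)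
      j.hasFDerivAt
    rw [h1.fderiv]
    exact (hαf (j z) hz).2 ξ
  let Ψ : X × F → E := fun z ↦ q (z.1, a z)
  have hΨ : ContDiffOn ℝ ∞ Ψ O := hqc.comp_contDiffOn (contDiff_fst.contDiffOn.prodMk ha)
  have hΨd : ∀ z ∈ O, HasFDerivAt Ψ
      (q' ∘L (ContinuousLinearMap.fst ℝ X F).prod (fderiv ℝ a z)) z := fun z hz ↦
    HasFDerivAt.comp z (hqd _) (hasFDerivAt_fst.prodMk (had z hz))
  have h0O : (0 : X × F) ∈ O := by
    rw [mem_preimage, map_zero]; exact mem_ball_self hr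
  have ha0 : a 0 = 0 := hα0 (j 0) h0O rfl
  have hΨ0 : Ψ 0 = p := by
    change q (0, a 0) = p
    rw [ha0, hq0]
  have hf10 : f1 (0, 0) = 0 := by
    ext1 ξ
    exact ((graphSlope_spec ι σ _ h00.2 ξ 0).1 (by simp [hq0, hι])).symm
  have hΨ0d : HasFDerivAt Ψ (T : X × F →L[ℝ] E) 0 := by
    have h1 := hΨd 0 h0O
    convert! h1 using 1
    refine ContinuousLinearMap.ext fun z ↦ ?_
    have h2 : fderiv ℝ a 0 (0, z.2) = (z.2, 0) := by
      have h3 : HasFDerivAt (fun y : F ↦ a (0, y)) (fderiv ℝ a 0 ∘L ContinuousLinearMap.inr ℝ X F)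
          0 := HasFDerivAt.comp (0 : F) (g := a) (had 0 h0O) (hasFDerivAt_prodMk_right (0 : X) (0 : F))
      have h4 : (fun y : F ↦ a (0, y)) =ᶠ[𝓝 0] fun y ↦ ContinuousLinearMap.inl ℝ F G y := by
        have : ∀ᶠ y : F in 𝓝 0, ((0 : X), y) ∈ O :=
          (Continuous.prodMk_right (0 : X)).continuousAt.preimage_mem_nhds (hO.mem_nhds h0O)
        filter_upwards [this] with y hy using hα0 (j (0, y)) hy rfl
      exact DFunLike.congr_fun (h3.unique
        ((ContinuousLinearMap.inl ℝ F G).hasFDerivAt.congr_of_eventuallyEq h4)) z.2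
    have h5 : fderiv ℝ a 0 z = (z.2, (f (0, 0) z.1).2) := by
      have : z = (z.1, 0) + (0, z.2) := by simp
      conv_lhs => rw [this, map_add, h2, hax 0 h0O, ha0]
      simp [f, hf10]
    simp [h5, hq', hT]
  obtain ⟨e, h0e, heO, hecoe, hesymm, hed⟩ :=
    exists_openPartialHomeomorph_of_hasFDerivAt hO h0O hΨ T hΨ0d
  have hinvd : ∀ x ∈ e.target, HasFDerivAt e.symm (fderiv ℝ e.symm x) x := fun x hx ↦
    ((hesymm.contDiffAt (e.open_target.mem_nhds hx)).differentiableAt (by simp)).hasFDerivAt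
  have hchain : ∀ z ∈ e.source, ∀ w, fderiv ℝ e.symm (Ψ z) (fderiv ℝ Ψ z w) = w := by
    intro z hz w
    have hzt : Ψ z ∈ e.target := by rw [← hecoe]; exact e.map_source hz
    have h1 := HasFDerivAt.comp z (hinvd _ hzt) (hΨd z (heO hz)).differentiableAt.hasFDerivAt
    have h2 : (e.symm ∘ Ψ) =ᶠ[𝓝 z] id := by
      filter_upwards [e.open_source.mem_nhds hz] with w hw
      change e.symm (Ψ w) = w
      rw [← hecoe, e.left_inv hw]
    exact DFunLike.congr_fun ((h1.congr_of_eventuallyEq h2.symm).unique (hasFDerivAt_id z)) w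
  have hpt : p ∈ e.target := by rw [← hΨ0, ← hecoe]; exact e.map_source h0e
  have hφd : ∀ x ∈ e.target, HasFDerivAt (fun x ↦ (e.symm x).2)
      (ContinuousLinearMap.snd ℝ X F ∘L fderiv ℝ e.symm x) x := fun x hx ↦
    hasFDerivAt_snd.comp x (hinvd x hx)
  have hψd : ∀ x ∈ e.target, HasFDerivAt (fun x ↦ (a (e.symm x)).2)
      (ContinuousLinearMap.snd ℝ F G ∘L fderiv ℝ a (e.symm x) ∘L fderiv ℝ e.symm x) x :=
    fun x hx ↦ hasFDerivAt_snd.comp x ((had _ (heO (e.map_target hx))).comp x (hinvd x hx))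
  -- In the straightened coordinates, `φ` is the label of the leaf and `ψ` the integral of `η`
  -- accumulated on it from the slice where the `X`-component vanishes.
  refine ⟨e.target, ?_, e.open_target, hpt, fun x ↦ (e.symm x).2, fun x ↦ (a (e.symm x)).2,
    contDiff_snd.comp_contDiffOn hesymm, contDiff_snd.comp_contDiffOn
      (ha.comp hesymm fun x hx ↦ heO (e.map_target hx)), ?_, ?_⟩
  · intro x hx
    have := (hαf (j (e.symm x)) (heO (e.map_target hx))).1.1
    have h2 : Ψ (e.symm x) = x := by rw [← hecoe, e.right_inv hx]
    rw [← h2]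
    exact this
  · intro y
    refine ⟨σ y, ?_⟩
    rw [(hφd p hpt).fderiv]
    have h1 := hchain 0 h0e (0, y)
    rw [hΨ0d.fderiv, hΨ0] at h1
    have h2 : (T : X × F →L[ℝ] E) (0, y) = σ y := by
      rw [ContinuousLinearEquiv.coe_coe, hT]; simp
    rw [h2] at h1
    simp [h1]
  · intro x hx v hv
    set z := e.symm x with hz
    have hzs : z ∈ e.source := e.map_target hx
    have hΨz : Ψ z = x := by rw [hz, ← hecoe, e.right_inv hx]
    have hzΩ : (z.1, a z) ∈ Ω := (hαf (j z) (heO hzs)).1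
    have hqz : q (z.1, a z) = x := hΨz
    obtain ⟨⟨ξ, υ⟩, hv'⟩ := T.surjective v
    rw [hT] at hv'
    have hυ : υ = f1 (z.1, a z) ξ :=
      (graphSlope_spec ι σ _ hzΩ.2 ξ υ).1 (by rw [hqz, hv', hv])
    have h1 : fderiv ℝ Ψ z (ξ, 0) = v := by
      rw [(hΨd z (heO hzs)).fderiv]
      simp only [ContinuousLinearMap.comp_apply, ContinuousLinearMap.prod_apply,
        ContinuousLinearMap.coe_fst', hq', hax z (heO hzs)]
      rw [← hv', hυ]
      rfl
    have h2 : fderiv ℝ e.symm x v = (ξ, 0) := by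
      rw [← hΨz, ← h1]; exact hchain z hzs (ξ, 0)
    refine ⟨by rw [(hφd x hx).fderiv]; simp [h2], ?_⟩
    rw [(hψd x hx).fderiv]
    simp only [ContinuousLinearMap.comp_apply, h2, ← hz, hax z (heO hzs)]
    change η (q (z.1, a z)) (ι ξ + σ (f1 (z.1, a z) ξ)) = η x v
    rw [hqz, ← hυ, hv']

end FirstIntegrals

/-! ### Linear algebra of `𝔤𝔩(2,ℝ) ⋉ 𝔪(1,2)` -/

/-- `form43` as a bounded bilinear form. -/
noncomputable def form43L : E7 →L[ℝ] E7 →L[ℝ] ℝ :=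
  LinearMap.mkContinuous₂ (LinearMap.mk₂ ℝ form43
    (fun _ _ _ ↦ by simp [form43]; ring) (fun _ _ _ ↦ by simp [form43]; ring)
    -- The constant `7` counts the products in `form43`, each bounded by `‖v‖ * ‖w‖`.
    (fun _ _ _ ↦ by simp [form43]; ring) (fun _ _ _ ↦ by simp [form43]; ring)) 7 (fun v w ↦ by
      have hv := fun i ↦ norm_le_pi_norm v i
      have hw := fun i ↦ norm_le_pi_norm w i
      have h : ∀ i j, |v i * w j| ≤ ‖v‖ * ‖w‖ := fun i j ↦ by
        rw [abs_mul]; exact mul_le_mul (hv i) (hw j) (abs_nonneg _) (norm_nonneg _)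
      rw [LinearMap.mk₂_apply, Real.norm_eq_abs, form43, abs_le]
      have := fun i j ↦ (abs_le.1 (h i j)).1
      have := fun i j ↦ (abs_le.1 (h i j)).2
      constructor <;>
      linarith [(abs_le.1 (h 0 4)).1, (abs_le.1 (h 0 4)).2, (abs_le.1 (h 4 0)).1,
        (abs_le.1 (h 4 0)).2, (abs_le.1 (h 1 5)).1, (abs_le.1 (h 1 5)).2, (abs_le.1 (h 5 1)).1,
        (abs_le.1 (h 5 1)).2, (abs_le.1 (h 2 6)).1, (abs_le.1 (h 2 6)).2, (abs_le.1 (h 6 2)).1,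
        (abs_le.1 (h 6 2)).2, (abs_le.1 (h 3 3)).1, (abs_le.1 (h 3 3)).2])

@[simp] theorem form43L_apply (v w : E7) : form43L v w = form43 v w := rfl

theorem form43_comm (v w : E7) : form43 v w = form43 w v := by
  simp only [form43]; ring

theorem form43_add_left (a b c : E7) : form43 (a + b) c = form43 a c + form43 b c :=
  DFunLike.congr_fun (form43L.map_add a b) c

theorem form43_sub_left (a b c : E7) : form43 (a - b) c = form43 a c - form43 b c :=
  DFunLike.congr_fun (form43L.map_sub a b) c

theorem form43_zero_left (a : E7) : form43 0 a = 0 := by simp [form43]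

theorem eq_zero_of_form43_eq_zero {a : E7} (h : ∀ b, form43 a b = 0) : a = 0 := by
  have h' := fun i ↦ h (Pi.single i 1)
  have h0 := h' 0
  have h1 := h' 1
  have h2 := h' 2
  have h3 := h' 3
  have h4 := h' 4
  have h5 := h' 5
  have h6 := h' 6
  simp [form43] at h0 h1 h2 h3 h4 h5 h6
  ext i
  fin_cases i <;> simpa

theorem omegaG2_eq (v w z : E7) : omegaG2 v w z =
    √2 * ((v 0 * (w 5 * z 6 - w 6 * z 5) - v 5 * (w 0 * z 6 - w 6 * z 0)
        + v 6 * (w 0 * z 5 - w 5 * z 0))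
      + (v 1 * (w 2 * z 4 - w 4 * z 2) - v 2 * (w 1 * z 4 - w 4 * z 1)
        + v 4 * (w 1 * z 2 - w 2 * z 1)))
    - ((v 3 * (w 0 * z 4 - w 4 * z 0) - v 0 * (w 3 * z 4 - w 4 * z 3)
        + v 4 * (w 3 * z 0 - w 0 * z 3))
      - (v 3 * (w 1 * z 5 - w 5 * z 1) - v 1 * (w 3 * z 5 - w 5 * z 3)
        + v 5 * (w 3 * z 1 - w 1 * z 3))
      - (v 3 * (w 2 * z 6 - w 6 * z 2) - v 2 * (w 3 * z 6 - w 6 * z 3)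
        + v 6 * (w 3 * z 2 - w 2 * z 3))) := by
  simp only [omegaG2, wedge3, Matrix.det_fin_three, Matrix.of_apply, Matrix.cons_val', Matrix.cons_val_zero,
    Matrix.cons_val_one, Matrix.cons_val, Matrix.cons_val_fin_one]
  ring

/-- The derivation of `omegaG2` induced by `T`. -/
noncomputable def omegaDer (T : E7 → E7) (v w z : E7) : ℝ :=
  omegaG2 (T v) w z + omegaG2 v (T w) z + omegaG2 v w (T z)

/-- The plane spanned by the second and third basis vectors. -/
def nullPlane : Submodule ℝ E7 where
  carrier := {w | w 0 = 0 ∧ w 3 = 0 ∧ w 4 = 0 ∧ w 5 = 0 ∧ w 6 = 0}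
  add_mem' := by
    rintro a b ⟨h0, h3, h4, h5, h6⟩ ⟨k0, k3, k4, k5, k6⟩
    simp [*]
  zero_mem' := by simp
  smul_mem' := by
    rintro c a ⟨h0, h3, h4, h5, h6⟩
    simp [*]

theorem mem_nullPlane {w : E7} :
    w ∈ nullPlane ↔ w 0 = 0 ∧ w 3 = 0 ∧ w 4 = 0 ∧ w 5 = 0 ∧ w 6 = 0 := Iff.rfl

/-- The action of `hMatrix` on vectors. -/
noncomputable def hVec (a₁ a₂ a₃ a₄ v y₁ y₂ : ℝ) (w : E7) : E7 :=
  ![(a₁ + a₄) * w 0 + √2 * v * w 3 - y₁ * w 5 - y₂ * w 6,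
    a₁ * w 1 + a₂ * w 2 + y₁ * w 4 + v * w 6,
    a₃ * w 1 + a₄ * w 2 + y₂ * w 4 - v * w 5,
    √2 * v * w 4,
    -(a₁ + a₄) * w 4,
    -a₁ * w 5 - a₃ * w 6,
    -a₂ * w 5 - a₄ * w 6]

/-- The endomorphisms in `𝔤𝔩(2,ℝ) ⋉ 𝔪(1,2)`. -/
def IsIII1a (T : E7 → E7) : Prop :=
  ∃ a₁ a₂ a₃ a₄ v y₁ y₂ : ℝ, ∀ w, T w = hVec a₁ a₂ a₃ a₄ v y₁ y₂ w

theorem hMatrix_mulVec (A : Matrix (Fin 2) (Fin 2) ℝ) (v : ℝ) (y : Fin 2 → ℝ) (w : E7) :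
    (hMatrix A v y).mulVec w = hVec (A 0 0) (A 0 1) (A 1 0) (A 1 1) v (y 0) (y 1) w := by
  ext i
  fin_cases i <;>
    simp [hMatrix, hVec, Matrix.mulVec, dotProduct, Fin.sum_univ_succ, Matrix.trace] <;> ring

theorem mem_hIII1a_iff {T : Matrix (Fin 7) (Fin 7) ℝ} : T ∈ hIII1a ↔ IsIII1a T.mulVec := by
  constructor
  · rintro ⟨A, v, y, rfl⟩
    exact ⟨_, _, _, _, _, _, _, hMatrix_mulVec A v y⟩
  · rintro ⟨a₁, a₂, a₃, a₄, v, y₁, y₂, h⟩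
    refine ⟨!![a₁, a₂; a₃, a₄], v, ![y₁, y₂], ?_⟩
    apply Matrix.mulVec_injective
    funext w
    rw [h, hMatrix_mulVec]
    simp

theorem IsIII1a.form43_skew {T : E7 → E7} (hT : IsIII1a T) (a b : E7) :
    form43 (T a) b + form43 a (T b) = 0 := by
  obtain ⟨a₁, a₂, a₃, a₄, v, y₁, y₂, h⟩ := hT
  rw [h, h]
  simp [form43, hVec]
  ring

theorem IsIII1a.omegaDer_eq_zero {T : E7 → E7} (hT : IsIII1a T) (a b c : E7) :
    omegaDer T a b c = 0 := by
  obtain ⟨a₁, a₂, a₃, a₄, v, y₁, y₂, h⟩ := hT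
  have hs : √2 * √2 = 2 := Real.mul_self_sqrt (by norm_num)
  simp only [omegaDer, omegaG2_eq, h]
  simp only [hVec, Matrix.cons_val]
  generalize √2 = s at hs
  linear_combination (v * (a 3 * b 5 * c 6 - a 3 * b 6 * c 5 - a 5 * b 3 * c 6 + a 5 * b 6 * c 3
    - a 6 * b 5 * c 3 + a 6 * b 3 * c 5)) * hs

theorem IsIII1a.map_nullPlane {T : E7 → E7} (hT : IsIII1a T) {w : E7} (hw : w ∈ nullPlane) :
    T w ∈ nullPlane := by
  obtain ⟨a₁, a₂, a₃, a₄, v, y₁, y₂, h⟩ := hT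
  obtain ⟨h0, h3, h4, h5, h6⟩ := hw
  rw [h, mem_nullPlane]
  simp [hVec, *]

theorem linearMap_apply_eq_sum (T : E7 →ₗ[ℝ] E7) (w : E7) (i : Fin 7) :
    T w i = w 0 * T (Pi.single 0 1) i + w 1 * T (Pi.single 1 1) i + w 2 * T (Pi.single 2 1) i
      + w 3 * T (Pi.single 3 1) i + w 4 * T (Pi.single 4 1) i + w 5 * T (Pi.single 5 1) i
      + w 6 * T (Pi.single 6 1) i := by
  have h : w = w 0 • Pi.single 0 1 + w 1 • Pi.single 1 1 + w 2 • Pi.single 2 1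
      + w 3 • Pi.single 3 1 + w 4 • Pi.single 4 1 + w 5 • Pi.single 5 1
      + w 6 • Pi.single 6 1 := by
    ext j; fin_cases j <;> simp
  conv_lhs => rw [h]
  simp only [map_add, map_smul, Pi.add_apply, Pi.smul_apply, smul_eq_mul]

/-- Evaluating the derivation on triples of basis vectors gives linear equations for the entries of
`T`, and the condition on the null plane supplies the missing zeros. Membership can thus be tested
on invariant tensors, for changes of frame as well as for curves in the holonomy group; skewness for
`form43` comes out as a consequence. -/
theorem isIII1a_of_omegaDer {T : E7 →ₗ[ℝ] E7} (hω : ∀ a b c, omegaDer T a b c = 0)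
    (hP : ∀ w ∈ nullPlane, T w ∈ nullPlane) : IsIII1a T := by
  have hs : √2 * √2 = 2 := Real.mul_self_sqrt (by norm_num)
  have hs0 : √2 ≠ 0 := by positivity
  have hp1 := hP (Pi.single 1 1) (by simp [mem_nullPlane])
  have hp2 := hP (Pi.single 2 1) (by simp [mem_nullPlane])
  simp only [mem_nullPlane] at hp1 hp2
  obtain ⟨z01, z31, z41, z51, z61⟩ := hp1
  obtain ⟨z02, z32, z42, z52, z62⟩ := hp2
  have q012 := hω (Pi.single 0 1) (Pi.single 1 1) (Pi.single 2 1)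
  have q013 := hω (Pi.single 0 1) (Pi.single 1 1) (Pi.single 3 1)
  have q014 := hω (Pi.single 0 1) (Pi.single 1 1) (Pi.single 4 1)
  have q015 := hω (Pi.single 0 1) (Pi.single 1 1) (Pi.single 5 1)
  have q023 := hω (Pi.single 0 1) (Pi.single 2 1) (Pi.single 3 1)
  have q024 := hω (Pi.single 0 1) (Pi.single 2 1) (Pi.single 4 1)
  have q034 := hω (Pi.single 0 1) (Pi.single 3 1) (Pi.single 4 1)
  have q035 := hω (Pi.single 0 1) (Pi.single 3 1) (Pi.single 5 1)
  have q036 := hω (Pi.single 0 1) (Pi.single 3 1) (Pi.single 6 1)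
  have q045 := hω (Pi.single 0 1) (Pi.single 4 1) (Pi.single 5 1)
  have q046 := hω (Pi.single 0 1) (Pi.single 4 1) (Pi.single 6 1)
  have q056 := hω (Pi.single 0 1) (Pi.single 5 1) (Pi.single 6 1)
  have q123 := hω (Pi.single 1 1) (Pi.single 2 1) (Pi.single 3 1)
  have q124 := hω (Pi.single 1 1) (Pi.single 2 1) (Pi.single 4 1)
  have q125 := hω (Pi.single 1 1) (Pi.single 2 1) (Pi.single 5 1)
  have q126 := hω (Pi.single 1 1) (Pi.single 2 1) (Pi.single 6 1)
  have q134 := hω (Pi.single 1 1) (Pi.single 3 1) (Pi.single 4 1)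
  have q135 := hω (Pi.single 1 1) (Pi.single 3 1) (Pi.single 5 1)
  have q136 := hω (Pi.single 1 1) (Pi.single 3 1) (Pi.single 6 1)
  have q145 := hω (Pi.single 1 1) (Pi.single 4 1) (Pi.single 5 1)
  have q146 := hω (Pi.single 1 1) (Pi.single 4 1) (Pi.single 6 1)
  have q156 := hω (Pi.single 1 1) (Pi.single 5 1) (Pi.single 6 1)
  have q234 := hω (Pi.single 2 1) (Pi.single 3 1) (Pi.single 4 1)
  have q235 := hω (Pi.single 2 1) (Pi.single 3 1) (Pi.single 5 1)
  have q236 := hω (Pi.single 2 1) (Pi.single 3 1) (Pi.single 6 1)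
  have q245 := hω (Pi.single 2 1) (Pi.single 4 1) (Pi.single 5 1)
  have q246 := hω (Pi.single 2 1) (Pi.single 4 1) (Pi.single 6 1)
  have q256 := hω (Pi.single 2 1) (Pi.single 5 1) (Pi.single 6 1)
  have q345 := hω (Pi.single 3 1) (Pi.single 4 1) (Pi.single 5 1)
  have q346 := hω (Pi.single 3 1) (Pi.single 4 1) (Pi.single 6 1)
  have q356 := hω (Pi.single 3 1) (Pi.single 5 1) (Pi.single 6 1)
  have q456 := hω (Pi.single 4 1) (Pi.single 5 1) (Pi.single 6 1)
  simp [omegaDer, omegaG2_eq, z01, z31, z41, z51, z61, z02, z32, z42, z52, z62] at q012 q013 q014 q015 q023 q024 q034 q035 q036 q045 q046 q056 q123 q124 q125 q126 q134 q135 q136 q145 q146 q156 q234 q235 q236 q245 q246 q256 q345 q346 q356 q456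
  have e36 : T (Pi.single 3 1) 6 = 0 := by
    have : √2 * T (Pi.single 3 1) 6 = 0 := by linarith
    exact (mul_eq_zero.1 this).resolve_left hs0
  have e35 : T (Pi.single 3 1) 5 = 0 := by
    have : √2 * T (Pi.single 3 1) 5 = 0 := by linarith
    exact (mul_eq_zero.1 this).resolve_left hs0
  have e46 : T (Pi.single 4 1) 6 = 0 := by
    have : √2 * T (Pi.single 4 1) 6 = 0 := by linarith
    exact (mul_eq_zero.1 this).resolve_left hs0
  have e45 : T (Pi.single 4 1) 5 = 0 := by
    have : √2 * T (Pi.single 4 1) 5 = 0 := by linarith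
    exact (mul_eq_zero.1 this).resolve_left hs0
  have e32 : T (Pi.single 3 1) 2 = 0 := by
    have : √2 * T (Pi.single 3 1) 2 = 0 := by linarith
    exact (mul_eq_zero.1 this).resolve_left hs0
  have e31 : T (Pi.single 3 1) 1 = 0 := by
    have : √2 * T (Pi.single 3 1) 1 = 0 := by linarith
    exact (mul_eq_zero.1 this).resolve_left hs0
  have f056 : T (Pi.single 0 1) 0 + T (Pi.single 5 1) 5 + T (Pi.single 6 1) 6 = 0 := by
    rw [← mul_add, ← mul_add] at q056
    exact (mul_eq_zero.1 q056).resolve_left hs0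
  have f124 : T (Pi.single 1 1) 1 + T (Pi.single 2 1) 2 + T (Pi.single 4 1) 4 = 0 := by
    rw [← mul_add, ← mul_add] at q124
    exact (mul_eq_zero.1 q124).resolve_left hs0
  have e33 : T (Pi.single 3 1) 3 = 0 := by linarith
  have e52 : T (Pi.single 5 1) 2 = - T (Pi.single 6 1) 1 := by
    have : √2 * (T (Pi.single 5 1) 2 + T (Pi.single 6 1) 1) = 0 := by linarith
    linarith [(mul_eq_zero.1 this).resolve_left hs0]
  have e30 : T (Pi.single 3 1) 0 = √2 * T (Pi.single 6 1) 1 := by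
    have : √2 * (T (Pi.single 3 1) 0 - √2 * T (Pi.single 6 1) 1) = 0 := by
      linear_combination q356 - e52 - T (Pi.single 6 1) 1 * hs
    linarith [(mul_eq_zero.1 this).resolve_left hs0]
  refine ⟨T (Pi.single 1 1) 1, T (Pi.single 2 1) 1, T (Pi.single 1 1) 2, T (Pi.single 2 1) 2,
    T (Pi.single 6 1) 1, T (Pi.single 4 1) 1, T (Pi.single 4 1) 2, fun w ↦ ?_⟩
  ext i
  rw [linearMap_apply_eq_sum]
  fin_cases i
  · simp [hVec, *]
    linear_combination w 0 * (q034 - f124 - e33) + w 5 * q345 + w 6 * q346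
  · simp [hVec, *]
    ring
  · simp [hVec, *]
    ring
  · simp [hVec, *]
    linear_combination - w 4 * q246
  · simp [hVec, *]
    linear_combination w 4 * f124
  · simp [hVec, *]
    linear_combination -w 5 * (q135 + e33) - w 6 * q136
  · simp [hVec, *]
    linear_combination -w 5 * q235 - w 6 * (q236 + e33)

/-! ### Derivatives of the invariant tensors -/

theorem wedge3_eq (i j k : Fin 7) (v w z : E7) : wedge3 i j k v w z =
    v i * (w j * z k - w k * z j) - v j * (w i * z k - w k * z i)
      + v k * (w i * z j - w j * z i) := by
  simp only [wedge3, Matrix.det_fin_three, Matrix.of_apply, Matrix.cons_val', Matrix.cons_val_zero,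
    Matrix.cons_val_one, Matrix.cons_val, Matrix.cons_val_fin_one]
  ring

theorem HasDerivWithinAt.wedge3 {a b c : ℝ → E7} {a' b' c' : E7} {s : Set ℝ} {t : ℝ}
    (ha : HasDerivWithinAt a a' s t) (hb : HasDerivWithinAt b b' s t)
    (hc : HasDerivWithinAt c c' s t) (i j k : Fin 7) :
    HasDerivWithinAt (fun t ↦ _root_.wedge3 i j k (a t) (b t) (c t))
      (_root_.wedge3 i j k a' (b t) (c t) + _root_.wedge3 i j k (a t) b' (c t)
        + _root_.wedge3 i j k (a t) (b t) c') s t := by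
  have ha := hasDerivWithinAt_pi.1 ha
  have hb := hasDerivWithinAt_pi.1 hb
  have hc := hasDerivWithinAt_pi.1 hc
  simp only [wedge3_eq]
  refine ((((ha i).mul (((hb j).mul (hc k)).sub ((hb k).mul (hc j)))).sub
    ((ha j).mul (((hb i).mul (hc k)).sub ((hb k).mul (hc i))))).add
    ((ha k).mul (((hb i).mul (hc j)).sub ((hb j).mul (hc i))))).congr_deriv ?_
  simp only [Pi.sub_apply, Pi.mul_apply]
  ring

theorem HasDerivWithinAt.omegaG2 {a b c : ℝ → E7} {a' b' c' : E7} {s : Set ℝ} {t : ℝ}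
    (ha : HasDerivWithinAt a a' s t) (hb : HasDerivWithinAt b b' s t)
    (hc : HasDerivWithinAt c c' s t) :
    HasDerivWithinAt (fun t ↦ _root_.omegaG2 (a t) (b t) (c t))
      (_root_.omegaG2 a' (b t) (c t) + _root_.omegaG2 (a t) b' (c t)
        + _root_.omegaG2 (a t) (b t) c') s t := by
  have hw := fun i j k ↦ ha.wedge3 hb hc i j k
  refine ((((hw 0 5 6).add (hw 1 2 4)).const_mul √2).sub
    (((hw 3 0 4).sub (hw 3 1 5)).sub (hw 3 2 6))).congr_deriv ?_
  simp only [_root_.omegaG2]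
  ring

theorem omegaG2_sub_left (a a' b c : E7) :
    omegaG2 (a - a') b c = omegaG2 a b c - omegaG2 a' b c := by
  simp only [omegaG2_eq, Pi.sub_apply]; ring

theorem omegaG2_sub_mid (a b b' c : E7) :
    omegaG2 a (b - b') c = omegaG2 a b c - omegaG2 a b' c := by
  simp only [omegaG2_eq, Pi.sub_apply]; ring

theorem omegaG2_sub_right (a b c c' : E7) :
    omegaG2 a b (c - c') = omegaG2 a b c - omegaG2 a b c' := by
  simp only [omegaG2_eq, Pi.sub_apply]; ring

/-- Differentiation of the invariance of `omegaG2` along the line `x + t • v`. It controls the term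
`dh ∘ h⁻¹` in a change of coframe. -/
theorem omegaDer_eq_zero_of_hasFDerivAt {h : E7 → E7 →L[ℝ] E7} {h' : E7 →L[ℝ] E7 →L[ℝ] E7} {x : E7}
    (hh : HasFDerivAt h h' x) {V : Set E7} (hV : V ∈ 𝓝 x)
    (hω : ∀ y ∈ V, ∀ a b c, omegaG2 (h y a) (h y b) (h y c) = omegaG2 a b c) (v a b c : E7) :
    omegaG2 (h' v a) (h x b) (h x c) + omegaG2 (h x a) (h' v b) (h x c)
      + omegaG2 (h x a) (h x b) (h' v c) = 0 := by
  have hl : HasDerivAt (fun t : ℝ ↦ x + t • v) v 0 := by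
    simpa using ((hasDerivAt_id (0 : ℝ)).smul_const v).const_add x
  have hx : x + (0 : ℝ) • v = x := by simp
  have hd : ∀ a, HasDerivWithinAt (fun t : ℝ ↦ h (x + t • v) a) (h' v a) univ 0 := by
    intro a
    have h1 : HasDerivAt (fun t : ℝ ↦ h (x + t • v)) (h' v) 0 :=
      HasFDerivAt.comp_hasDerivAt (0 : ℝ) (by rw [hx]; exact hh) hl
    have h2 := h1.clm_apply (hasDerivAt_const (0 : ℝ) a)
    simp only [map_zero, add_zero] at h2
    exact h2.hasDerivWithinAt
  have h3 := (hd a).omegaG2 (hd b) (hd c)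
  rw [hasDerivWithinAt_univ] at h3
  have h4 : (fun t : ℝ ↦ omegaG2 (h (x + t • v) a) (h (x + t • v) b) (h (x + t • v) c))
      =ᶠ[𝓝 0] fun _ ↦ omegaG2 a b c := by
    have : ∀ᶠ t : ℝ in 𝓝 0, x + t • v ∈ V :=
      hl.continuousAt.preimage_mem_nhds (by rw [hx]; exact hV)
    filter_upwards [this] with t ht using hω _ ht a b c
  have h5 := (h3.congr_of_eventuallyEq h4.symm).unique (hasDerivAt_const _ _)
  simpa [hx] using h5

/-- Difference quotients lie in `P`, which is closed because the space is finite-dimensional. -/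
theorem fderiv_apply_mem_submodule {h : E7 → E7} {h' : E7 →L[ℝ] E7} {x : E7}
    (hh : HasFDerivAt h h' x) {V : Set E7} (hV : V ∈ 𝓝 x) (P : Submodule ℝ E7)
    (hP : ∀ y ∈ V, h y ∈ P) (v : E7) : h' v ∈ P := by
  have hl : HasDerivAt (fun t : ℝ ↦ x + t • v) v 0 := by
    simpa using ((hasDerivAt_id (0 : ℝ)).smul_const v).const_add x
  have hx : x + (0 : ℝ) • v = x := by simp
  have h1 : HasDerivAt (fun t : ℝ ↦ h (x + t • v)) (h' v) 0 :=
    HasFDerivAt.comp_hasDerivAt (0 : ℝ) (by rw [hx]; exact hh) hl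
  have hev : ∀ᶠ t : ℝ in 𝓝[≠] 0, x + t • v ∈ V :=
    nhdsWithin_le_nhds (hl.continuousAt.preimage_mem_nhds (by rw [hx]; exact hV))
  have hcl : IsClosed (P : Set E7) := P.closed_of_finiteDimensional
  refine hcl.mem_of_tendsto (hasDerivAt_iff_tendsto_slope.1 h1) ?_
  filter_upwards [hev] with t ht
  rw [slope_def_module]
  exact P.smul_mem _ (P.sub_mem (hP _ ht) (by simpa using hP x (mem_of_mem_nhds hV)))

/-! ### Coframes with their Levi-Civita connection -/

/-- `B` is a smooth coframe on `V` in which the metric `G` is `form43`, and `Θ` is the connection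
form of the Levi-Civita connection of `G` in this coframe. -/
structure IsLCCoframe (G : E7 → E7 → E7 → ℝ) (V : Set E7) (B : E7 → E7 →L[ℝ] E7)
    (Θ : E7 → E7 →L[ℝ] E7 →L[ℝ] E7) : Prop where
  isOpen : IsOpen V
  smooth : ContDiffOn ℝ ∞ B V
  smooth_conn : ContDiffOn ℝ ∞ Θ V
  invertible : ∀ x ∈ V, (B x).IsInvertible
  metric : ∀ x ∈ V, ∀ v w, G x v w = form43 (B x v) (B x w)
  skew : ∀ x ∈ V, ∀ v a b, form43 (Θ x v a) b + form43 a (Θ x v b) = 0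
  torsion : ∀ x ∈ V, ∀ v w, fderiv ℝ B x v w + Θ x v (B x w)
    = fderiv ℝ B x w v + Θ x w (B x v)

namespace IsLCCoframe

variable {G : E7 → E7 → E7 → ℝ} {V : Set E7} {B : E7 → E7 →L[ℝ] E7}
  {Θ : E7 → E7 →L[ℝ] E7 →L[ℝ] E7}

theorem hasFDerivAt (h : IsLCCoframe G V B Θ) {x : E7} (hx : x ∈ V) :
    HasFDerivAt B (fderiv ℝ B x) x :=
  ((h.smooth.contDiffAt (h.isOpen.mem_nhds hx)).differentiableAt (by simp)).hasFDerivAt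

theorem mono (h : IsLCCoframe G V B Θ) {W : Set E7} (hW : IsOpen W) (hWV : W ⊆ V) :
    IsLCCoframe G W B Θ where
  isOpen := hW
  smooth := h.smooth.mono hWV
  smooth_conn := h.smooth_conn.mono hWV
  invertible x hx := h.invertible x (hWV hx)
  metric x hx := h.metric x (hWV hx)
  skew x hx := h.skew x (hWV hx)
  torsion x hx := h.torsion x (hWV hx)

theorem fderiv_metric (h : IsLCCoframe G V B Θ) {x : E7} (hx : x ∈ V) (v w z : E7) :
    fderiv ℝ (fun x' ↦ G x' w z) x v
      = form43 (fderiv ℝ B x v w) (B x z) + form43 (B x w) (fderiv ℝ B x v z) := by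
  have hB := h.hasFDerivAt hx
  have h1 : ∀ w, HasFDerivAt (fun x' ↦ B x' w) ((fderiv ℝ B x).flip w) x := by
    intro w
    have := hB.clm_apply (hasFDerivAt_const w x)
    simpa using this
  have h2 := (form43L.hasFDerivAt.comp x (h1 w)).clm_apply (h1 z)
  have h3 : (fun x' ↦ G x' w z) =ᶠ[𝓝 x] fun x' ↦ form43L (B x' w) (B x' z) := by
    filter_upwards [h.isOpen.mem_nhds hx] with y hy using h.metric y hy w z
  rw [(h2.congr_of_eventuallyEq h3).fderiv]
  simp [add_comm]

/-- The Koszul formula. -/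
theorem koszul (h : IsLCCoframe G V B Θ) {x : E7} (hx : x ∈ V) (v w z : E7) :
    (1 / 2) * (fderiv ℝ (fun x' ↦ G x' w z) x v + fderiv ℝ (fun x' ↦ G x' v z) x w
      - fderiv ℝ (fun x' ↦ G x' v w) x z)
    = form43 (fderiv ℝ B x v w + Θ x v (B x w)) (B x z) := by
  rw [h.fderiv_metric hx, h.fderiv_metric hx, h.fderiv_metric hx]
  -- As in the classical derivation, three torsion identities and three skewness identities,
  -- permuted over `v`, `w`, `z`, combine linearly.
  have t1 := congrArg (fun a ↦ form43 a (B x z)) (h.torsion x hx v w)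
  have t2 := congrArg (fun a ↦ form43 a (B x w)) (h.torsion x hx v z)
  have t3 := congrArg (fun a ↦ form43 a (B x v)) (h.torsion x hx w z)
  have s1 := h.skew x hx v (B x w) (B x z)
  have s2 := h.skew x hx w (B x v) (B x z)
  have s3 := h.skew x hx z (B x v) (B x w)
  simp only [form43_add_left] at t1 t2 t3 ⊢
  have c := form43_comm
  rw [c (B x w) (Θ x v (B x z))] at s1
  rw [c (B x v) (Θ x w (B x z))] at s2
  rw [c (B x v) (Θ x z (B x w))] at s3
  rw [c (B x w) (fderiv ℝ B x v z), c (B x v) (fderiv ℝ B x w z), c (B x v) (fderiv ℝ B x z w)]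
  linarith

/-- Pull-back of a coframe and its connection by a local diffeomorphism. -/
theorem pullback (h : IsLCCoframe G V B Θ) {κ : E7 → E7} {W : Set E7} (hW : IsOpen W)
    (hκ : ContDiffOn ℝ ∞ κ W) (hmaps : MapsTo κ W V)
    (hinv : ∀ x ∈ W, (fderiv ℝ κ x).IsInvertible) {G' : E7 → E7 → E7 → ℝ}
    (hG : ∀ x ∈ W, ∀ v w, G' x v w = G (κ x) (fderiv ℝ κ x v) (fderiv ℝ κ x w)) :
    IsLCCoframe G' W (fun x ↦ B (κ x) ∘L fderiv ℝ κ x) (fun x ↦ Θ (κ x) ∘L fderiv ℝ κ x) := by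
  have hκ' : ContDiffOn ℝ ∞ (fderiv ℝ κ) W := hκ.fderiv_of_isOpen hW (by simp)
  refine ⟨hW, (h.smooth.comp hκ hmaps).clm_comp hκ', (h.smooth_conn.comp hκ hmaps).clm_comp hκ',
    fun x hx ↦ (h.invertible _ (hmaps hx)).comp (hinv x hx), fun x hx v w ↦ ?_,
    fun x hx v a b ↦ h.skew _ (hmaps hx) _ a b, fun x hx v w ↦ ?_⟩
  · rw [hG x hx, h.metric _ (hmaps hx)]; rfl
  · have hκx := hκ.contDiffAt (hW.mem_nhds hx)
    have h1 : HasFDerivAt (fun x ↦ B (κ x)) (fderiv ℝ B (κ x) ∘L fderiv ℝ κ x) x :=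
      (h.hasFDerivAt (hmaps hx)).comp x (hκx.differentiableAt (by simp)).hasFDerivAt
    have h2 : HasFDerivAt (fderiv ℝ κ) (fderiv ℝ (fderiv ℝ κ) x) x :=
      ((hκ'.contDiffAt (hW.mem_nhds hx)).differentiableAt (by simp)).hasFDerivAt
    have h3 := (h1.clm_comp h2).fderiv
    -- The second derivative of `κ` is symmetric and so drops out of the torsion equation.
    have hs : fderiv ℝ (fderiv ℝ κ) x v w = fderiv ℝ (fderiv ℝ κ) x w v :=
      (hκx.isSymmSndFDerivAt (by simpa using ENat.LEInfty.out)).eq _ _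
    rw [h3]
    have ht := h.torsion _ (hmaps hx) (fderiv ℝ κ x v) (fderiv ℝ κ x w)
    simp only [add_apply, ContinuousLinearMap.comp_apply, ContinuousLinearMap.compL_apply,
      ContinuousLinearMap.flip_apply, hs]
    rw [add_assoc, add_assoc, ht]

end IsLCCoframe

/-- A coframe whose Levi-Civita connection form takes values in `𝔤𝔩(2,ℝ) ⋉ 𝔪(1,2)`. -/
structure IsIII1aCoframe (G : E7 → E7 → E7 → ℝ) (V : Set E7) (B : E7 → E7 →L[ℝ] E7)
    (Θ : E7 → E7 →L[ℝ] E7 →L[ℝ] E7) : Prop extends IsLCCoframe G V B Θ where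
  isIII1a : ∀ x ∈ V, ∀ v, IsIII1a (Θ x v)

/-- A change of coframe by a function with values in the group preserving `form43`, `omegaG2` and
`nullPlane`. -/
theorem IsIII1aCoframe.gauge {G : E7 → E7 → E7 → ℝ} {V : Set E7} {B : E7 → E7 →L[ℝ] E7}
    {Θ : E7 → E7 →L[ℝ] E7 →L[ℝ] E7} (hB : IsIII1aCoframe G V B Θ) {h : E7 → E7 →L[ℝ] E7}
    (hh : ContDiffOn ℝ ∞ h V) (hinv : ∀ x ∈ V, (h x).IsInvertible)
    (hform : ∀ x ∈ V, ∀ a b, form43 (h x a) (h x b) = form43 a b)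
    (hω : ∀ x ∈ V, ∀ a b c, omegaG2 (h x a) (h x b) (h x c) = omegaG2 a b c)
    (hP : ∀ x ∈ V, ∀ a, h x a ∈ nullPlane ↔ a ∈ nullPlane) :
    ∃ Θ', IsIII1aCoframe G V (fun x ↦ h x ∘L B x) Θ' := by
  have hd : ∀ x ∈ V, HasFDerivAt h (fderiv ℝ h x) x := fun x hx ↦
    ((hh.contDiffAt (hB.isOpen.mem_nhds hx)).differentiableAt (by simp)).hasFDerivAt
  -- The transformation law `Θ' = h Θ h⁻¹ - dh h⁻¹`, dictated by the torsion equation for `h B`.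
  let Θ' : E7 → E7 →L[ℝ] E7 →L[ℝ] E7 := fun x ↦
    ((ContinuousLinearMap.compL ℝ E7 E7 E7).flip (h x).inverse) ∘L
      ((ContinuousLinearMap.compL ℝ E7 E7 E7 (h x)) ∘L Θ x - fderiv ℝ h x)
  have hΘ' : ∀ x ∈ V, ∀ v a, Θ' x v (h x a) = h x (Θ x v a) - fderiv ℝ h x v a := by
    intro x hx v a
    obtain ⟨S, hS⟩ := hinv x hx
    simp [Θ', ← hS]
  have hsurj : ∀ x ∈ V, ∀ a, ∃ b, h x b = a := by
    intro x hx a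
    obtain ⟨S, hS⟩ := hinv x hx
    exact ⟨S.symm a, by simp [← hS]⟩
  -- Both terms of `Θ'` annihilate `omegaG2` and preserve the null plane, so `isIII1a_of_omegaDer`
  -- applies without computing `dh h⁻¹`.
  have hIII : ∀ x ∈ V, ∀ v, IsIII1a (Θ' x v) := by
    intro x hx v
    refine isIII1a_of_omegaDer (T := (Θ' x v : E7 →ₗ[ℝ] E7)) (fun a b c ↦ ?_) (fun w hw ↦ ?_)
    · obtain ⟨a, rfl⟩ := hsurj x hx a
      obtain ⟨b, rfl⟩ := hsurj x hx b
      obtain ⟨c, rfl⟩ := hsurj x hx c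
      have h1 := omegaDer_eq_zero_of_hasFDerivAt (hd x hx) (hB.isOpen.mem_nhds hx) hω v a b c
      have h2 := (hB.isIII1a x hx v).omegaDer_eq_zero a b c
      rw [omegaDer, ← hω x hx, ← hω x hx a, ← hω x hx a b] at h2
      simp only [omegaDer, ContinuousLinearMap.coe_coe, hΘ' x hx]
      rw [omegaG2_sub_left, omegaG2_sub_mid, omegaG2_sub_right]
      linarith
    · obtain ⟨w, rfl⟩ := hsurj x hx w
      have hw' := (hP x hx w).1 hw
      rw [ContinuousLinearMap.coe_coe, hΘ' x hx]
      refine nullPlane.sub_mem ((hP x hx _).2 ((hB.isIII1a x hx v).map_nullPlane hw')) ?_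
      have h1 : HasFDerivAt (fun y ↦ h y w) ((fderiv ℝ h x).flip w) x := by
        simpa using (hd x hx).clm_apply (hasFDerivAt_const w x)
      exact fderiv_apply_mem_submodule h1 (hB.isOpen.mem_nhds hx) nullPlane
        (fun y hy ↦ (hP y hy w).2 hw') v
  have hhinv : ContDiffOn ℝ ∞ (fun x ↦ (h x).inverse) V := by
    intro x hx
    obtain ⟨S, hS⟩ := hinv x hx
    have h2 : ContDiffAt ℝ ∞ ContinuousLinearMap.inverse (h x) := by
      rw [← hS]; exact contDiffAt_map_inverse S
    exact h2.comp_contDiffWithinAt x (hh x hx)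
  refine ⟨Θ', ⟨hB.isOpen, hh.clm_comp hB.smooth, ?_, fun x hx ↦
    (hinv x hx).comp (hB.invertible x hx), fun x hx v w ↦ ?_,
    fun x hx v a b ↦ (hIII x hx v).form43_skew a b, fun x hx v w ↦ ?_⟩, hIII⟩
  · exact ((ContinuousLinearMap.contDiff _).comp_contDiffOn hhinv).clm_comp
      ((((ContinuousLinearMap.contDiff _).comp_contDiffOn hh).clm_comp hB.smooth_conn).sub
        (hh.fderiv_of_isOpen hB.isOpen (by simp)))
  · rw [hB.metric x hx]; exact (hform x hx _ _).symm
  · have h1 := ((hd x hx).clm_comp (hB.hasFDerivAt hx)).fderiv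
    rw [h1]
    have ht := congrArg (h x) (hB.torsion x hx v w)
    simp only [add_apply, ContinuousLinearMap.comp_apply, ContinuousLinearMap.compL_apply,
      ContinuousLinearMap.flip_apply, hΘ' x hx, map_add] at ht ⊢
    rw [← sub_eq_zero] at ht ⊢
    refine Eq.trans ?_ ht
    abel

/-! ### Partial derivatives -/

theorem pd_congr {f g : E7 → ℝ} {x : E7} (h : f =ᶠ[𝓝 x] g) (i : Fin 7) : pd i f x = pd i g x := by
  rw [pd, pd, h.fderiv_eq]

theorem pd_congr_of_isOpen {f g : E7 → ℝ} {V : Set E7} (hV : IsOpen V) (h : ∀ x ∈ V, f x = g x)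
    {x : E7} (hx : x ∈ V) (i : Fin 7) : pd i f x = pd i g x :=
  pd_congr (by filter_upwards [hV.mem_nhds hx] with y hy using h y hy) i

@[simp] theorem pd_const (i : Fin 7) (c : ℝ) (x : E7) : pd i (fun _ ↦ c) x = 0 := by
  simp [pd]

theorem pd_coord (i j : Fin 7) (x : E7) :
    pd i (fun x ↦ x j) x = (Pi.single i (1 : ℝ) : E7) j := by
  have : HasFDerivAt (fun x : E7 ↦ x j) (ContinuousLinearMap.proj (R := ℝ) (φ := fun _ : Fin 7 ↦ ℝ) j) x :=
    (ContinuousLinearMap.proj (R := ℝ) (φ := fun _ : Fin 7 ↦ ℝ) j).hasFDerivAt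
  rw [pd, this.fderiv]; rfl

theorem pd_add {f g : E7 → ℝ} {x : E7} (i : Fin 7) (hf : DifferentiableAt ℝ f x)
    (hg : DifferentiableAt ℝ g x) : pd i (fun x ↦ f x + g x) x = pd i f x + pd i g x := by
  simp only [pd]
  rw [fderiv_fun_add hf hg]; rfl

theorem pd_sub {f g : E7 → ℝ} {x : E7} (i : Fin 7) (hf : DifferentiableAt ℝ f x)
    (hg : DifferentiableAt ℝ g x) : pd i (fun x ↦ f x - g x) x = pd i f x - pd i g x := by
  simp only [pd]
  rw [fderiv_fun_sub hf hg]; rfl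

theorem pd_mul {f g : E7 → ℝ} {x : E7} (i : Fin 7) (hf : DifferentiableAt ℝ f x)
    (hg : DifferentiableAt ℝ g x) :
    pd i (fun x ↦ f x * g x) x = pd i f x * g x + f x * pd i g x := by
  simp only [pd]
  rw [fderiv_fun_mul hf hg]
  simp; ring

theorem pd_exp {f : E7 → ℝ} {x : E7} (i : Fin 7) (hf : DifferentiableAt ℝ f x) :
    pd i (fun x ↦ Real.exp (f x)) x = Real.exp (f x) * pd i f x := by
  simp only [pd]
  rw [fderiv_exp hf]; rfl

theorem pd_log {f : E7 → ℝ} {x : E7} (i : Fin 7) (hf : DifferentiableAt ℝ f x) (h0 : f x ≠ 0) :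
    pd i (fun x ↦ Real.log (f x)) x = (f x)⁻¹ * pd i f x := by
  simp only [pd]
  rw [fderiv.log hf h0]; rfl

theorem fderiv_eq_sum_pd (f : E7 → ℝ) (x v : E7) :
    fderiv ℝ f x v = v 0 * pd 0 f x + v 1 * pd 1 f x + v 2 * pd 2 f x + v 3 * pd 3 f x
      + v 4 * pd 4 f x + v 5 * pd 5 f x + v 6 * pd 6 f x := by
  have h : v = v 0 • Pi.single 0 1 + v 1 • Pi.single 1 1 + v 2 • Pi.single 2 1
      + v 3 • Pi.single 3 1 + v 4 • Pi.single 4 1 + v 5 • Pi.single 5 1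
      + v 6 • Pi.single 6 1 := by
    ext j; fin_cases j <;> simp
  conv_lhs => rw [h]
  simp only [map_add, map_smul, smul_eq_mul, pd]

theorem ContDiffOn.pd {f : E7 → ℝ} {V : Set E7} (hf : ContDiffOn ℝ ∞ f V) (hV : IsOpen V)
    (i : Fin 7) : ContDiffOn ℝ ∞ (_root_.pd i f) V :=
  (hf.fderiv_of_isOpen hV (by simp)).clm_apply contDiffOn_const

theorem pd_comm {f : E7 → ℝ} {V : Set E7} (hV : IsOpen V) (hf : ContDiffOn ℝ ∞ f V) {x : E7}
    (hx : x ∈ V) (i j : Fin 7) : pd i (pd j f) x = pd j (pd i f) x := by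
  have hfx := hf.contDiffAt (hV.mem_nhds hx)
  have h2 : HasFDerivAt (fderiv ℝ f) (fderiv ℝ (fderiv ℝ f) x) x :=
    (((hf.fderiv_of_isOpen hV (by simp : (∞ : WithTop ℕ∞) + 1 ≤ ∞)).contDiffAt
      (hV.mem_nhds hx)).differentiableAt (by simp)).hasFDerivAt
  have h3 : ∀ i j, pd i (pd j f) x
      = fderiv ℝ (fderiv ℝ f) x (Pi.single i 1) (Pi.single j 1) := by
    intro i j
    have := h2.clm_apply (hasFDerivAt_const (Pi.single j (1 : ℝ) : E7) x)
    change fderiv ℝ (fun x ↦ fderiv ℝ f x (Pi.single j 1)) x (Pi.single i 1) = _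
    rw [this.fderiv]
    simp
  rw [h3, h3]
  exact (hfx.isSymmSndFDerivAt (by simpa using ENat.LEInfty.out)).eq _ _

/-! ### The differential equations of the normal form -/

/-- A coframe of the shape of the normal form. -/
def shapeVec (f r₄ r₅ r₆ s₅ s₆ t₅ t₆ : ℝ) (v : E7) : E7 :=
  ![v 0 + r₄ * v 4 + r₅ * v 5 + r₆ * v 6, v 1 + s₅ * v 5 + s₆ * v 6, v 2 + t₅ * v 5 + t₆ * v 6,
    v 3, f * v 4, v 5, v 6]

/-- The first-order system that expresses that a coframe of the shape `shapeVec` has Levi-Civita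
connection in `𝔤𝔩(2,ℝ) ⋉ 𝔪(1,2)`. -/
structure ShapeSystem (f r₄ r₅ r₆ s₅ s₆ t₅ t₆ : E7 → ℝ) (x : E7) : Prop where
  f_indep : pd 0 f x = 0 ∧ pd 1 f x = 0 ∧ pd 2 f x = 0 ∧ pd 3 f x = 0
  s₅_indep : pd 0 s₅ x = 0 ∧ pd 3 s₅ x = 0
  s₆_indep : pd 0 s₆ x = 0 ∧ pd 3 s₆ x = 0
  t₅_indep : pd 0 t₅ x = 0 ∧ pd 3 t₅ x = 0
  t₆_indep : pd 0 t₆ x = 0 ∧ pd 3 t₆ x = 0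
  r₄_indep : pd 0 r₄ x = 0 ∧ pd 1 r₄ x = 0 ∧ pd 2 r₄ x = 0
  r₅_indep : pd 1 r₅ x = 0 ∧ pd 2 r₅ x = 0 ∧ pd 3 r₅ x = 0
  r₆_indep : pd 1 r₆ x = 0 ∧ pd 2 r₆ x = 0 ∧ pd 3 r₆ x = 0
  f₅ : pd 5 f x = (pd 1 s₅ x + pd 2 t₅ x) * f x
  f₆ : pd 6 f x = (pd 1 s₆ x + pd 2 t₆ x) * f x
  st₁ : pd 1 s₆ x = pd 1 t₅ x
  st₂ : pd 2 s₆ x = pd 2 t₅ x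
  r₅₀ : pd 0 r₅ x * f x = pd 5 f x
  r₆₀ : pd 0 r₆ x * f x = pd 6 f x
  eq₁ : pd 5 s₆ x + t₆ x * pd 2 s₅ x + s₆ x * pd 1 s₅ x
    = pd 6 s₅ x + t₅ x * pd 2 s₆ x + s₅ x * pd 1 s₆ x
  eq₂ : pd 5 t₆ x + t₆ x * pd 2 t₅ x + s₆ x * pd 1 t₅ x
    = pd 6 t₅ x + t₅ x * pd 2 t₆ x + s₅ x * pd 1 t₆ x
  eq₀ : f x * (pd 5 r₆ x - pd 6 r₅ x) + pd 5 f x * r₆ x - pd 6 f x * r₅ x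
    + (pd 4 s₆ x - pd 4 t₅ x) + √2 * pd 3 r₄ x = 0

/-- The torsion equation is evaluated on pairs of coordinate vectors. Some components determine the
entries of the connection form; eliminating these from the others leaves the system. Subscripts
count from zero here, so that `r₄`, `s₅`, `t₆` correspond to `r5`, `s6`, `t7` of `NormalData`. -/
theorem shapeSystem_of_coframe {G : E7 → E7 → E7 → ℝ} {W : Set E7} {B : E7 → E7 →L[ℝ] E7}
    {Θ : E7 → E7 →L[ℝ] E7 →L[ℝ] E7} (h : IsIII1aCoframe G W B Θ)
    {f r₄ r₅ r₆ s₅ s₆ t₅ t₆ : E7 → ℝ}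
    (hB : ∀ x ∈ W, ∀ v, B x v
      = shapeVec (f x) (r₄ x) (r₅ x) (r₆ x) (s₅ x) (s₆ x) (t₅ x) (t₆ x) v)
    (hf : ∀ x ∈ W, 0 < f x) {x : E7} (hx : x ∈ W) :
    ShapeSystem f r₄ r₅ r₆ s₅ s₆ t₅ t₆ x := by
  choose a1 a2 a3 a4 v y1 y2 hΘ using fun i : Fin 7 ↦ h.isIII1a x hx (Pi.single i 1)
  have hs : √2 * √2 = 2 := Real.mul_self_sqrt (by norm_num)
  have hs0 : √2 ≠ 0 := by positivity
  have hf0 : f x ≠ 0 := (hf x hx).ne'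
  have hd : ∀ i j k, fderiv ℝ B x (Pi.single i 1) (Pi.single j 1) k
      = pd i (fun x ↦ shapeVec (f x) (r₄ x) (r₅ x) (r₆ x) (s₅ x) (s₆ x) (t₅ x) (t₆ x)
        (Pi.single j 1) k) x := by
    intro i j k
    have h1 := (h.hasFDerivAt hx).clm_apply (hasFDerivAt_const (Pi.single j (1 : ℝ) : E7) x)
    have h2 := hasFDerivAt_pi'.1 h1 k
    rw [← pd_congr_of_isOpen (f := fun x ↦ B x (Pi.single j 1) k) h.isOpen
      (fun y hy ↦ by rw [hB y hy]) hx, pd, h2.fderiv]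
    simp
  have T : ∀ i j k,
      pd i (fun x ↦ shapeVec (f x) (r₄ x) (r₅ x) (r₆ x) (s₅ x) (s₆ x) (t₅ x) (t₆ x)
        (Pi.single j 1) k) x
      + hVec (a1 i) (a2 i) (a3 i) (a4 i) (v i) (y1 i) (y2 i)
        (shapeVec (f x) (r₄ x) (r₅ x) (r₆ x) (s₅ x) (s₆ x) (t₅ x) (t₆ x) (Pi.single j 1)) k
      = pd j (fun x ↦ shapeVec (f x) (r₄ x) (r₅ x) (r₆ x) (s₅ x) (s₆ x) (t₅ x) (t₆ x)
        (Pi.single i 1) k) x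
      + hVec (a1 j) (a2 j) (a3 j) (a4 j) (v j) (y1 j) (y2 j)
        (shapeVec (f x) (r₄ x) (r₅ x) (r₆ x) (s₅ x) (s₆ x) (t₅ x) (t₆ x) (Pi.single i 1)) k := by
    intro i j k
    have := congrFun (h.torsion x hx (Pi.single i 1) (Pi.single j 1)) k
    simpa only [Pi.add_apply, hd, hΘ, hB x hx] using this
  -- rows 6 and 7
  have A1 : ∀ i : Fin 5, a1 i.castSucc.castSucc = 0 := by
    intro i; have := T i.castSucc.castSucc 5 5; fin_cases i <;> simpa [shapeVec, hVec] using this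
  have A3 : ∀ i : Fin 5, a3 i.castSucc.castSucc = 0 := by
    intro i; have := T i.castSucc.castSucc 6 5; fin_cases i <;> simpa [shapeVec, hVec] using this
  have A2 : ∀ i : Fin 5, a2 i.castSucc.castSucc = 0 := by
    intro i; have := T i.castSucc.castSucc 5 6; fin_cases i <;> simpa [shapeVec, hVec] using this
  have A4 : ∀ i : Fin 5, a4 i.castSucc.castSucc = 0 := by
    intro i; have := T i.castSucc.castSucc 6 6; fin_cases i <;> simpa [shapeVec, hVec] using this
  have a10 : a1 0 = 0 := A1 0
  have a11 : a1 1 = 0 := A1 1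
  have a12 : a1 2 = 0 := A1 2
  have a13 : a1 3 = 0 := A1 3
  have a14 : a1 4 = 0 := A1 4
  have a20 : a2 0 = 0 := A2 0
  have a21 : a2 1 = 0 := A2 1
  have a22 : a2 2 = 0 := A2 2
  have a23 : a2 3 = 0 := A2 3
  have a24 : a2 4 = 0 := A2 4
  have a30 : a3 0 = 0 := A3 0
  have a31 : a3 1 = 0 := A3 1
  have a32 : a3 2 = 0 := A3 2
  have a33 : a3 3 = 0 := A3 3
  have a34 : a3 4 = 0 := A3 4
  have a40 : a4 0 = 0 := A4 0
  have a41 : a4 1 = 0 := A4 1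
  have a42 : a4 2 = 0 := A4 2
  have a43 : a4 3 = 0 := A4 3
  have a44 : a4 4 = 0 := A4 4
  have c5 := T 5 6 5
  have c6 := T 5 6 6
  -- row 4
  have v0 := T 0 4 3
  have v1 := T 1 4 3
  have v2 := T 2 4 3
  have v3 := T 3 4 3
  have v5 := T 5 4 3
  have v6 := T 6 4 3
  simp [shapeVec, hVec, hf0] at c5 c6 v0 v1 v2 v3 v5 v6
  -- row 5
  have f0 := T 0 4 4
  have f1 := T 1 4 4
  have f2 := T 2 4 4
  have f3 := T 3 4 4
  have f5 := T 5 4 4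
  have f6 := T 6 4 4
  -- rows 2 and 3
  have y10 := T 0 4 1
  have y11 := T 1 4 1
  have y12 := T 2 4 1
  have y13 := T 3 4 1
  have y20 := T 0 4 2
  have y21 := T 1 4 2
  have y22 := T 2 4 2
  have y23 := T 3 4 2
  simp [shapeVec, hVec, hf0, a10, a11, a12, a13, a14, a20, a21, a22, a23, a24, a30, a31, a32, a33,
    a34, a40, a41, a42, a43, a44] at f0 f1 f2 f3 f5 f6 y10 y11 y12 y13 y20 y21 y22 y23
  have s50 := T 0 5 1
  have s51 := T 1 5 1
  have s52 := T 2 5 1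
  have s53 := T 3 5 1
  have s60 := T 0 6 1
  have s61 := T 1 6 1
  have s62 := T 2 6 1
  have s63 := T 3 6 1
  have t50 := T 0 5 2
  have t51 := T 1 5 2
  have t52 := T 2 5 2
  have t53 := T 3 5 2
  have t60 := T 0 6 2
  have t61 := T 1 6 2
  have t62 := T 2 6 2
  have t63 := T 3 6 2
  have e145 := T 4 5 1
  have e146 := T 4 6 1
  have e156 := T 5 6 1
  have e245 := T 4 5 2
  have e246 := T 4 6 2
  have e256 := T 5 6 2
  simp [shapeVec, hVec, a10, a11, a12, a13, a14, a20, a21, a22, a23, a24, a30, a31, a32, a33,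
    a34, a40, a41, a42, a43, a44, v0, v1, v2, v3, v5, v6, y10, y11, y12, y13, y20, y21, y22, y23]
    at s50 s51 s52 s53 s60 s61 s62 s63 t50 t51 t52 t53 t60 t61 t62 t63 e145 e146 e156 e245 e246 e256
  -- row 1
  have r40 := T 0 4 0
  have r41 := T 1 4 0
  have r42 := T 2 4 0
  have r43 := T 3 4 0
  have r50 := T 0 5 0
  have r51 := T 1 5 0
  have r52 := T 2 5 0
  have r53 := T 3 5 0
  have r60 := T 0 6 0
  have r61 := T 1 6 0
  have r62 := T 2 6 0
  have r63 := T 3 6 0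
  have e056 := T 5 6 0
  simp [shapeVec, hVec, a10, a11, a12, a13, a14, a20, a21, a22, a23, a24, a30, a31, a32, a33,
    a34, a40, a41, a42, a43, a44, v0, v1, v2, v3, v5, v6, y10, y11, y12, y13, y20, y21, y22, y23]
    at r40 r41 r42 r43 r50 r51 r52 r53 r60 r61 r62 r63 e056
  refine ⟨⟨f0, f1, f2, f3⟩, ⟨s50, s53⟩, ⟨s60, s63⟩, ⟨t50, t53⟩, ⟨t60, t63⟩, ⟨r40, r41, r42⟩,
    ⟨r51, r52, r53⟩, ⟨r61, r62, r63⟩, ?_, ?_, ?_, ?_, ?_, ?_, ?_, ?_, ?_⟩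
  · linear_combination f5 - f x * s51 - f x * t52
  · linear_combination f6 - f x * s61 - f x * t62
  · linear_combination s61 - t51 - c5
  · linear_combination s62 - t52 - c6
  · linear_combination f x * r50 - f5
  · linear_combination f x * r60 - f6
  · linear_combination e156 + t₆ x * s52 + s₆ x * s51 - t₅ x * s62 - s₅ x * s61
  · linear_combination e256 + t₆ x * t52 + s₆ x * t51 - t₅ x * t62 - s₅ x * t61
  -- The first row on the last two coordinate vectors contains `y1 6` and `y2 5`. By `e146` and
  -- `e245` they are expressed through `v 4`, and `r43` identifies `√2 * v 4` with `pd 3 r₄ x`; this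
  -- ties `r₄` to the bracket.
  · linear_combination f x * e056 + r₆ x * f5 - r₅ x * f6 + e146 - e245 + √2 * r43 + v 4 * hs

/-- Replace the coordinates outside `S` by those of `c`. -/
def freeze (S : Finset (Fin 7)) (c x : E7) : E7 := fun i ↦ if i ∈ S then x i else c i

theorem freeze_mem_ball {S : Finset (Fin 7)} {c x : E7} {r : ℝ} (hx : x ∈ ball c r) :
    freeze S c x ∈ ball c r := by
  have hr : 0 < r := dist_nonneg.trans_lt hx
  rw [mem_ball, dist_pi_lt_iff hr] at hx ⊢
  intro i
  by_cases hi : i ∈ S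
  · simpa [freeze, hi] using hx i
  · simpa [freeze, hi] using hr

theorem dependsOn_comp_freeze (g : E7 → ℝ) (S : Finset (Fin 7)) (c : E7) :
    DependsOn (fun x ↦ g (freeze S c x)) (S : Set (Fin 7)) := by
  intro x y hxy
  have : freeze S c x = freeze S c y := by
    ext i
    by_cases hi : i ∈ S
    · simp [freeze, hi, hxy i (by simpa using hi)]
    · simp [freeze, hi]
  simp only [this]

/-- The points `freeze S c x` and `x` are joined by a segment along which only coordinates outside
`S` vary, and balls of the sup norm are boxes, so the segment stays inside. Composing with `freeze`
then gives the independence on all of `ℝ⁷` that `NormalData.IsAdmissible` asks for. -/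
theorem eq_comp_freeze {g : E7 → ℝ} {c : E7} {r : ℝ} (hg : ContDiffOn ℝ ∞ g (ball c r))
    {S : Finset (Fin 7)} (h : ∀ x ∈ ball c r, ∀ i ∉ S, pd i g x = 0) {x : E7}
    (hx : x ∈ ball c r) : g (freeze S c x) = g x := by
  let w : E7 := x - freeze S c x
  have hw : ∀ i ∈ S, w i = 0 := fun i hi ↦ by simp [w, freeze, hi]
  have hseg : ∀ t ∈ Icc (0 : ℝ) 1, freeze S c x + t • w ∈ ball c r := fun t ht ↦
    (convex_ball c r).add_smul_sub_mem (freeze_mem_ball hx) hx ht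
  have hz : ∀ y ∈ ball c r, fderiv ℝ g y w = 0 := by
    intro y hy
    rw [fderiv_eq_sum_pd]
    have : ∀ i, w i * pd i g y = 0 := by
      intro i
      by_cases hi : i ∈ S
      · rw [hw i hi, zero_mul]
      · rw [h y hy i hi, mul_zero]
    simp only [this]; norm_num
  have hd : ∀ t ∈ Icc (0 : ℝ) 1, HasDerivAt (fun t : ℝ ↦ g (freeze S c x + t • w)) 0 t := by
    intro t ht
    have h1 : HasDerivAt (fun t : ℝ ↦ freeze S c x + t • w) w t := by
      simpa using ((hasDerivAt_id t).smul_const w).const_add (freeze S c x)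
    have h2 := ((hg.contDiffAt (isOpen_ball.mem_nhds (hseg t ht))).differentiableAt
      (by simp)).hasFDerivAt.comp_hasDerivAt t h1
    rwa [hz _ (hseg t ht)] at h2
  have := constant_of_has_deriv_right_zero
    (fun t ht ↦ (hd t ht).continuousAt.continuousWithinAt)
    (fun t ht ↦ (hd t ⟨ht.1, ht.2.le⟩).hasDerivWithinAt) 1 (by simp)
  simpa [w] using this.symm

/-- A function that is smooth on a box and has vanishing partial derivatives outside `S` agrees on
the box with a function that depends only on the coordinates in `S`. -/
theorem exists_dependsOn {g : E7 → ℝ} {c : E7} {r : ℝ} (hg : ContDiffOn ℝ ∞ g (ball c r))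
    (S : Finset (Fin 7)) (h : ∀ x ∈ ball c r, ∀ i ∉ S, pd i g x = 0) :
    ∃ g' : E7 → ℝ, DependsOn g' (S : Set (Fin 7)) ∧ ContDiffOn ℝ ∞ g' (ball c r) ∧
      ∀ x ∈ ball c r, g' x = g x :=
  ⟨fun x ↦ g (freeze S c x), dependsOn_comp_freeze g S c,
    hg.congr fun _ hx ↦ eq_comp_freeze hg h hx, fun _ hx ↦ eq_comp_freeze hg h hx⟩

theorem pd_eq_zero_of_dependsOn {g : E7 → ℝ} {S : Set (Fin 7)} (hg : DependsOn g S) {i : Fin 7}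
    (hi : i ∉ S) {x : E7} (hd : DifferentiableAt ℝ g x) : pd i g x = 0 := by
  have h1 : HasDerivAt (fun t : ℝ ↦ x + t • (Pi.single i 1 : E7)) (Pi.single i 1) 0 := by
    simpa using ((hasDerivAt_id (0 : ℝ)).smul_const (Pi.single i 1 : E7)).const_add x
  have h2 : HasDerivAt (fun t : ℝ ↦ g (x + t • (Pi.single i 1 : E7))) (pd i g x) 0 :=
    HasFDerivAt.comp_hasDerivAt (0 : ℝ) (by simpa using hd.hasFDerivAt) h1
  have h3 : (fun t : ℝ ↦ g (x + t • (Pi.single i 1 : E7))) = fun _ ↦ g x := by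
    funext t
    refine hg fun j hj ↦ ?_
    have : j ≠ i := fun h ↦ hi (h ▸ hj)
    simp [this]
  rw [h3] at h2
  exact h2.unique (hasDerivAt_const _ _)

/-- If `x` and `y` agree on `S`, translation by `y - x` leaves `g` unchanged, so the derivatives at
both points agree whether or not `g` is differentiable. -/
theorem DependsOn.pd {g : E7 → ℝ} {S : Set (Fin 7)} (hg : DependsOn g S) (i : Fin 7) :
    DependsOn (_root_.pd i g) S := by
  intro x y hxy
  have h1 : (fun z ↦ g (z + (y - x))) = g := by
    funext z
    exact hg fun j hj ↦ by simp [hxy j hj]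
  have h2 : fderiv ℝ g x = fderiv ℝ g (x + (y - x)) := by
    conv_lhs => rw [← h1]
    exact fderiv_comp_add_right (y - x)
  rw [_root_.pd, _root_.pd, h2, add_sub_cancel]

theorem DependsOn.comp₂ {g k : E7 → ℝ} {S : Set (Fin 7)} (hg : DependsOn g S) (hk : DependsOn k S)
    (op : ℝ → ℝ → ℝ) : DependsOn (fun x ↦ op (g x) (k x)) S := fun x y hxy ↦ by
  change op (g x) (k x) = op (g y) (k y)
  rw [hg hxy, hk hxy]

set_option maxHeartbeats 1000000 in
/-- Solutions of `ShapeSystem` on a box come from normal form data. -/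
theorem exists_normalData_of_shapeSystem {c : E7} {r : ℝ} {f r₄ r₅ r₆ s₅ s₆ t₅ t₆ : E7 → ℝ}
    (hf : ContDiffOn ℝ ∞ f (ball c r)) (hr₄ : ContDiffOn ℝ ∞ r₄ (ball c r))
    (hr₅ : ContDiffOn ℝ ∞ r₅ (ball c r)) (hr₆ : ContDiffOn ℝ ∞ r₆ (ball c r))
    (hs₅ : ContDiffOn ℝ ∞ s₅ (ball c r)) (hs₆ : ContDiffOn ℝ ∞ s₆ (ball c r))
    (ht₅ : ContDiffOn ℝ ∞ t₅ (ball c r)) (ht₆ : ContDiffOn ℝ ∞ t₆ (ball c r))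
    (hf0 : ∀ x ∈ ball c r, 0 < f x)
    (h : ∀ x ∈ ball c r, ShapeSystem f r₄ r₅ r₆ s₅ s₆ t₅ t₆ x) :
    ∃ D : NormalData, D.IsAdmissible (ball c r) ∧ ∀ x ∈ ball c r, ∀ v, D.coframe x v
      = shapeVec (f x) (r₄ x) (r₅ x) (r₆ x) (s₅ x) (s₆ x) (t₅ x) (t₆ x) v := by
  have hW : IsOpen (ball c r) := isOpen_ball
  have dif : ∀ {g : E7 → ℝ}, ContDiffOn ℝ ∞ g (ball c r) → ∀ x ∈ ball c r,
      DifferentiableAt ℝ g x := fun hg x hx ↦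
    (hg.contDiffAt (hW.mem_nhds hx)).differentiableAt (by simp)
  have hcoord : ∀ j : Fin 7, ContDiffOn ℝ ∞ (fun x : E7 ↦ x j) (ball c r) := fun j ↦
    (contDiff_apply ℝ ℝ j).contDiffOn
  have hlogpd : ∀ x ∈ ball c r, ∀ i, pd i (fun x ↦ Real.log (f x)) x = (f x)⁻¹ * pd i f x :=
    fun x hx i ↦ pd_log i (dif hf x hx) (hf0 x hx).ne'
  obtain ⟨u, hu_dep, hu, hu_eq⟩ := exists_dependsOn (g := fun x ↦ Real.log (f x))
    (hf.log fun x hx ↦ (hf0 x hx).ne') {4, 5, 6} (by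
      intro x hx i hi
      rw [hlogpd x hx]
      obtain ⟨h0, h1, h2, h3⟩ := (h x hx).f_indep
      fin_cases i <;> simp_all)
  obtain ⟨S6, hS6_dep, hS6, hS6_eq⟩ := exists_dependsOn hs₅ {1, 2, 4, 5, 6} (by
      intro x hx i hi
      obtain ⟨h0, h1⟩ := (h x hx).s₅_indep
      fin_cases i <;> simp_all)
  obtain ⟨T6, hT6_dep, hT6, hT6_eq⟩ := exists_dependsOn ht₅ {1, 2, 4, 5, 6} (by
      intro x hx i hi
      obtain ⟨h0, h1⟩ := (h x hx).t₅_indep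
      fin_cases i <;> simp_all)
  obtain ⟨T7, hT7_dep, hT7, hT7_eq⟩ := exists_dependsOn ht₆ {1, 2, 4, 5, 6} (by
      intro x hx i hi
      obtain ⟨h0, h1⟩ := (h x hx).t₆_indep
      fin_cases i <;> simp_all)
  obtain ⟨F4, hF4_dep, hF4, hF4_eq⟩ := exists_dependsOn (hs₆.sub ht₅) {4, 5, 6} (by
      intro x hx i hi
      have e := pd_sub i (dif hs₆ x hx) (dif ht₅ x hx)
      change pd i (fun x ↦ s₆ x - t₅ x) x = 0
      rw [e]
      obtain ⟨h0, h1⟩ := (h x hx).s₆_indep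
      obtain ⟨h2, h3⟩ := (h x hx).t₅_indep
      have h4 := (h x hx).st₁
      have h5 := (h x hx).st₂
      fin_cases i <;> simp_all)
  simp only [Finset.coe_insert, Finset.coe_singleton] at hu_dep hS6_dep hT6_dep hT7_dep hF4_dep
  have hupd : ∀ x ∈ ball c r, ∀ i, pd i u x = (f x)⁻¹ * pd i f x := fun x hx i ↦
    (pd_congr_of_isOpen hW hu_eq hx i).trans (hlogpd x hx i)
  have hu' := fun i ↦ hu.pd hW i
  have hpdr : ∀ {k : E7 → ℝ}, ContDiffOn ℝ ∞ k (ball c r) → ∀ j x, x ∈ ball c r → ∀ i,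
      pd i (fun x ↦ k x - x 0 * pd j u x) x
        = pd i k x - ((Pi.single i (1 : ℝ) : E7) 0 * pd j u x + x 0 * pd i (pd j u) x) := by
    intro k hk j x hx i
    rw [pd_sub i (dif hk x hx) (dif ((hcoord 0).mul (hu' j)) x hx),
      pd_mul i (dif (hcoord 0) x hx) (dif (hu' j) x hx), pd_coord]
  -- Since `f = eᵘ`, the equation `r₅₀` says that `r₅` has derivative `pd 5 u` in the first
  -- coordinate. Subtracting the linear term leaves a function of the last three coordinates; `F7`
  -- is obtained in the same way.
  obtain ⟨F6, hF6_dep, hF6, hF6_eq⟩ := exists_dependsOn (g := fun x ↦ r₅ x - x 0 * pd 5 u x)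
    (hr₅.sub ((hcoord 0).mul (hu' 5))) {4, 5, 6} (by
      intro x hx i hi
      have hz : pd i (pd 5 u) x = 0 :=
        pd_eq_zero_of_dependsOn (hu_dep.pd 5) (by simpa using hi) (dif (hu' 5) x hx)
      rw [hpdr hr₅ 5 x hx i, hz, hupd x hx 5, ← (h x hx).r₅₀]
      obtain ⟨h1, h2, h3⟩ := (h x hx).r₅_indep
      have := (hf0 x hx).ne'
      fin_cases i
      · simp; rw [mul_comm (pd 0 r₅ x), inv_mul_cancel_left₀ this, sub_self]
      all_goals simp_all)
  obtain ⟨F7, hF7_dep, hF7, hF7_eq⟩ := exists_dependsOn (g := fun x ↦ r₆ x - x 0 * pd 6 u x)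
    (hr₆.sub ((hcoord 0).mul (hu' 6))) {4, 5, 6} (by
      intro x hx i hi
      have hz : pd i (pd 6 u) x = 0 :=
        pd_eq_zero_of_dependsOn (hu_dep.pd 6) (by simpa using hi) (dif (hu' 6) x hx)
      rw [hpdr hr₆ 6 x hx i, hz, hupd x hx 6, ← (h x hx).r₆₀]
      obtain ⟨h1, h2, h3⟩ := (h x hx).r₆_indep
      have := (hf0 x hx).ne'
      fin_cases i
      · simp; rw [mul_comm (pd 0 r₆ x), inv_mul_cancel_left₀ this, sub_self]
      all_goals simp_all)
  simp only [Finset.coe_insert, Finset.coe_singleton] at hF6_dep hF7_dep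
  have hexp : ∀ x ∈ ball c r, Real.exp (u x) = f x := fun x hx ↦ by
    rw [hu_eq x hx, Real.exp_log (hf0 x hx)]
  -- `K` is the bracket in the formula for `r₅` of the normal form. By `eq₀` it equals `√2 * pd 3
  -- r₄`, so `r₄ - x₄ K / √2` no longer depends on `x₄` and serves as `F5`.
  let K : E7 → ℝ := fun x ↦ pd 6 (fun x' ↦ Real.exp (u x') * F6 x') x
    - pd 5 (fun x' ↦ Real.exp (u x') * F7 x') x - pd 4 F4 x
  have hK_dep : DependsOn K {4, 5, 6} :=
    (((hu_dep.comp₂ hF6_dep fun a b ↦ Real.exp a * b).pd 6).comp₂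
      ((hu_dep.comp₂ hF7_dep fun a b ↦ Real.exp a * b).pd 5) fun a b ↦ a - b).comp₂
      (hF4_dep.pd 4) fun a b ↦ a - b
  have hK : ContDiffOn ℝ ∞ K (ball c r) :=
    (((hu.exp.mul hF6).pd hW 6).sub ((hu.exp.mul hF7).pd hW 5)).sub (hF4.pd hW 4)
  have hK_eq : ∀ x ∈ ball c r, K x = √2 * pd 3 r₄ x := by
    intro x hx
    have e1 : ∀ {F : E7 → ℝ}, ContDiffOn ℝ ∞ F (ball c r) → ∀ i,
        pd i (fun x' ↦ Real.exp (u x') * F x') x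
          = Real.exp (u x) * pd i u x * F x + Real.exp (u x) * pd i F x := by
      intro F hF i
      rw [pd_mul i (dif hu.exp x hx) (dif hF x hx), pd_exp i (dif hu x hx)]
    have e2 : pd 6 F6 x = pd 6 r₅ x - x 0 * pd 6 (pd 5 u) x := by
      rw [pd_congr_of_isOpen hW hF6_eq hx, hpdr hr₅ 5 x hx]; simp
    have e3 : pd 5 F7 x = pd 5 r₆ x - x 0 * pd 5 (pd 6 u) x := by
      rw [pd_congr_of_isOpen hW hF7_eq hx, hpdr hr₆ 6 x hx]; simp
    have e4 : pd 4 F4 x = pd 4 s₆ x - pd 4 t₅ x := by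
      rw [pd_congr_of_isOpen hW hF4_eq hx]
      exact pd_sub 4 (dif hs₆ x hx) (dif ht₅ x hx)
    have e5 := pd_comm hW hu hx 5 6
    have e6 := hupd x hx
    have hfx := (hf0 x hx).ne'
    have e7 : ∀ i, f x * pd i u x = pd i f x := fun i ↦ by rw [e6]; field_simp
    simp only [K]
    rw [e1 hF6, e1 hF7, e2, e3, e4, hF6_eq x hx, hF7_eq x hx, hexp x hx, e5]
    have := (h x hx).eq₀
    linear_combination (r₅ x - x 0 * pd 5 u x) * e7 6 - (r₆ x - x 0 * pd 6 u x) * e7 5 - this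
      - x 0 * pd 6 u x * e7 5 + x 0 * pd 5 u x * e7 6
  have hs : √2 * √2 = 2 := Real.mul_self_sqrt (by norm_num)
  have hs0 : √2 ≠ 0 := by positivity
  obtain ⟨F5, hF5_dep, hF5, hF5_eq⟩ := exists_dependsOn (g := fun x ↦ r₄ x - x 3 * (K x / √2))
    (hr₄.sub ((hcoord 3).mul (hK.div_const _))) {4, 5, 6} (by
      intro x hx i hi
      have hz : pd i (fun x ↦ K x / √2) x = 0 :=
        pd_eq_zero_of_dependsOn (hK_dep.comp₂ hK_dep fun a _ ↦ a / √2) (by simpa using hi)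
          (dif (hK.div_const _) x hx)
      rw [pd_sub i (dif hr₄ x hx) (dif ((hcoord 3).mul (hK.div_const _)) x hx),
        pd_mul i (dif (hcoord 3) x hx) (dif (hK.div_const _) x hx), pd_coord, hz, hK_eq x hx]
      obtain ⟨h1, h2, h3⟩ := (h x hx).r₄_indep
      fin_cases i
      · simp_all
      · simp_all
      · simp_all
      · simp [hs0]
      all_goals simp_all)
  simp only [Finset.coe_insert, Finset.coe_singleton] at hF5_dep
  let D : NormalData := ⟨u, S6, T6, T7, F4, F5, F6, F7⟩
  have hs7 : ∀ x ∈ ball c r, D.s7 x = s₆ x := fun x hx ↦ by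
    simp [NormalData.s7, D, hT6_eq x hx, hF4_eq x hx]
  refine ⟨D, ⟨hu, hS6, hT6, hT7, hF4, hF5, hF6, hF7, hu_dep, hS6_dep, hT6_dep, hT7_dep, hF4_dep,
    hF5_dep, hF6_dep, hF7_dep, fun x hx ↦ ?_, fun x hx ↦ ?_, fun x hx ↦ ?_, fun x hx ↦ ?_⟩,
    fun x hx v ↦ ?_⟩
  · change pd 5 u x = pd 1 S6 x + pd 2 T6 x
    rw [hupd x hx, (h x hx).f₅, pd_congr_of_isOpen hW hS6_eq hx, pd_congr_of_isOpen hW hT6_eq hx]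
    have := (hf0 x hx).ne'
    field_simp
  · change pd 6 u x = pd 2 T7 x + pd 1 T6 x
    rw [hupd x hx, (h x hx).f₆, pd_congr_of_isOpen hW hT7_eq hx, pd_congr_of_isOpen hW hT6_eq hx,
      (h x hx).st₁]
    have := (hf0 x hx).ne'
    field_simp
    ring
  · change pd 5 D.s7 x + T7 x * pd 2 S6 x + D.s7 x * pd 1 S6 x
      = pd 6 S6 x + T6 x * pd 2 D.s7 x + S6 x * pd 1 D.s7 x
    simp only [pd_congr_of_isOpen hW hs7 hx, pd_congr_of_isOpen hW hS6_eq hx, hs7 x hx,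
      hT7_eq x hx, hT6_eq x hx, hS6_eq x hx]
    exact (h x hx).eq₁
  · change pd 5 T7 x + T7 x * pd 2 T6 x + D.s7 x * pd 1 T6 x
      = pd 6 T6 x + T6 x * pd 2 T7 x + S6 x * pd 1 T7 x
    simp only [pd_congr_of_isOpen hW hT7_eq hx, pd_congr_of_isOpen hW hT6_eq hx, hs7 x hx,
      hT7_eq x hx, hT6_eq x hx, hS6_eq x hx]
    exact (h x hx).eq₂
  · have e5 : D.r5 x = r₄ x := by
      change x 3 / √2 * K x + F5 x = r₄ x
      rw [hF5_eq x hx]; ring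
    have e6 : D.r6 x = r₅ x := by
      change x 0 * pd 5 u x + F6 x = r₅ x
      rw [hF6_eq x hx]; ring
    have e7 : D.r7 x = r₆ x := by
      change x 0 * pd 6 u x + F7 x = r₆ x
      rw [hF7_eq x hx]; ring
    simp only [NormalData.coframe, shapeVec, e5, e6, e7, hs7 x hx]
    simp only [D, hexp x hx, hS6_eq x hx, hT6_eq x hx, hT7_eq x hx]

/-! ### Changes of coframe -/

/-- `h` preserves `form43`, `omegaG2` and `nullPlane`. -/
structure PreservesIII1a (h : E7 → E7) : Prop where
  form : ∀ a b, form43 (h a) (h b) = form43 a b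
  omega : ∀ a b c, omegaG2 (h a) (h b) (h c) = omegaG2 a b c
  plane : ∀ a, h a ∈ nullPlane ↔ a ∈ nullPlane

theorem PreservesIII1a.comp {h k : E7 → E7} (hh : PreservesIII1a h) (hk : PreservesIII1a k) :
    PreservesIII1a (h ∘ k) where
  form a b := (hh.form _ _).trans (hk.form a b)
  omega a b c := (hh.omega _ _ _).trans (hk.omega a b c)
  plane a := (hh.plane _).trans (hk.plane a)

theorem isInvertible_of_form43 {h : E7 →L[ℝ] E7}
    (hh : ∀ a b, form43 (h a) (h b) = form43 a b) : h.IsInvertible := by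
  have hinj : Function.Injective (h : E7 →ₗ[ℝ] E7) := by
    rw [← LinearMap.ker_eq_bot, LinearMap.ker_eq_bot']
    intro a ha
    refine eq_zero_of_form43_eq_zero fun b ↦ ?_
    rw [← hh, show h a = 0 from ha, form43_zero_left]
  exact ⟨(LinearEquiv.ofInjectiveEndo _ hinj).toContinuousLinearEquiv, by ext; rfl⟩

/-- The action of `GL(2,ℝ)` on `ℝ⁷`; here `q` is the inverse of the determinant. -/
noncomputable def gaugeGL (p₁ p₂ p₃ p₄ q : ℝ) (a : E7) : E7 :=
  ![q * a 0, q * (p₄ * a 1 - p₃ * a 2), q * (p₁ * a 2 - p₂ * a 1), a 3,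
    (p₁ * p₄ - p₂ * p₃) * a 4, p₁ * a 5 + p₂ * a 6, p₃ * a 5 + p₄ * a 6]

/-- The one-parameter group generated by `h(0, 1, 0)`. -/
noncomputable def gaugeV (v : ℝ) (a : E7) : E7 :=
  ![a 0 + √2 * v * a 3 + v ^ 2 * a 4, a 1 + v * a 6, a 2 - v * a 5, a 3 + √2 * v * a 4, a 4, a 5,
    a 6]

/-- The abelian group generated by the `h(0, 0, y)`. -/
noncomputable def gaugeY (y₁ y₂ : ℝ) (a : E7) : E7 :=
  ![a 0 - y₁ * a 5 - y₂ * a 6, a 1 + y₁ * a 4, a 2 + y₂ * a 4, a 3, a 4, a 5, a 6]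

theorem preservesIII1a_gaugeGL {p₁ p₂ p₃ p₄ q : ℝ} (h : q * (p₁ * p₄ - p₂ * p₃) = 1) :
    PreservesIII1a (gaugeGL p₁ p₂ p₃ p₄ q) where
  form a b := by
    simp only [form43, gaugeGL, Matrix.cons_val]
    linear_combination (a 0 * b 4 + a 4 * b 0 + a 1 * b 5 + a 5 * b 1 + a 2 * b 6 + a 6 * b 2) * h
  omega a b c := by
    simp only [omegaG2_eq, gaugeGL, Matrix.cons_val]
    have h2 : q * q * ((p₁ * p₄ - p₂ * p₃) * (p₁ * p₄ - p₂ * p₃)) = 1 := by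
      linear_combination (q * (p₁ * p₄ - p₂ * p₃) + 1) * h
    linear_combination √2 * ((a 0 * (b 5 * c 6 - b 6 * c 5) - a 5 * (b 0 * c 6 - b 6 * c 0)
        + a 6 * (b 0 * c 5 - b 5 * c 0))) * h
      + √2 * (a 1 * (b 2 * c 4 - b 4 * c 2) - a 2 * (b 1 * c 4 - b 4 * c 1)
        + a 4 * (b 1 * c 2 - b 2 * c 1)) * h2
     - ((a 3 * (b 0 * c 4 - b 4 * c 0) - a 0 * (b 3 * c 4 - b 4 * c 3)
        + a 4 * (b 3 * c 0 - b 0 * c 3))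
      - (a 3 * (b 1 * c 5 - b 5 * c 1) - a 1 * (b 3 * c 5 - b 5 * c 3)
        + a 5 * (b 3 * c 1 - b 1 * c 3))
      - (a 3 * (b 2 * c 6 - b 6 * c 2) - a 2 * (b 3 * c 6 - b 6 * c 3)
        + a 6 * (b 3 * c 2 - b 2 * c 3))) * h
  plane a := by
    have hd : p₁ * p₄ - p₂ * p₃ ≠ 0 := right_ne_zero_of_mul_eq_one h
    have hq : q ≠ 0 := left_ne_zero_of_mul_eq_one h
    simp only [mem_nullPlane, gaugeGL, Matrix.cons_val, mul_eq_zero, hd, hq, false_or]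
    refine ⟨fun ⟨h0, h3, h4, h5, h6⟩ ↦ ⟨h0, h3, h4, ?_, ?_⟩, fun ⟨h0, h3, h4, h5, h6⟩ ↦
      ⟨h0, h3, h4, by simp [h5, h6], by simp [h5, h6]⟩⟩
    · linear_combination q * p₄ * h5 - q * p₂ * h6 - a 5 * h
    · linear_combination q * p₁ * h6 - q * p₃ * h5 - a 6 * h

theorem preservesIII1a_gaugeV (v : ℝ) : PreservesIII1a (gaugeV v) where
  form a b := by
    have hs : √2 * √2 = 2 := Real.mul_self_sqrt (by norm_num)
    simp only [form43, gaugeV, Matrix.cons_val]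
    linear_combination (-v ^ 2 * a 4 * b 4) * hs
  omega a b c := by
    have hs : √2 * √2 = 2 := Real.mul_self_sqrt (by norm_num)
    simp only [omegaG2_eq, gaugeV, Matrix.cons_val]
    ring_nf
    simp only [show √2 ^ 2 = 2 by rw [sq, hs]]
    ring
  plane a := by
    simp only [mem_nullPlane, gaugeV, Matrix.cons_val]
    constructor
    · rintro ⟨h0, h3, h4, h5, h6⟩
      have h3' : a 3 = 0 := by simpa [h4] using h3
      exact ⟨by simpa [h3', h4] using h0, h3', h4, h5, h6⟩
    · rintro ⟨h0, h3, h4, h5, h6⟩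
      simp [*]

theorem preservesIII1a_gaugeY (y₁ y₂ : ℝ) : PreservesIII1a (gaugeY y₁ y₂) where
  form a b := by simp only [form43, gaugeY, Matrix.cons_val]; ring
  omega a b c := by simp only [omegaG2_eq, gaugeY, Matrix.cons_val]; ring
  plane a := by
    simp only [mem_nullPlane, gaugeY, Matrix.cons_val]
    constructor
    · rintro ⟨h0, h3, h4, h5, h6⟩
      exact ⟨by simpa [h5, h6] using h0, h3, h4, h5, h6⟩
    · rintro ⟨h0, h3, h4, h5, h6⟩
      simp [*]

theorem contDiffOn_clm_of_apply {h : E7 → E7 →L[ℝ] E7} {V : Set E7}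
    (hh : ∀ a i, ContDiffOn ℝ ∞ (fun x ↦ h x a i) V) : ContDiffOn ℝ ∞ h V :=
  contDiffOn_clm_apply.2 fun a ↦ contDiffOn_pi.2 (hh a)

theorem IsIII1aCoframe.gauge' {G : E7 → E7 → E7 → ℝ} {V : Set E7} {B : E7 → E7 →L[ℝ] E7}
    {Θ : E7 → E7 →L[ℝ] E7 →L[ℝ] E7} (hB : IsIII1aCoframe G V B Θ) (h : E7 → E7 →ₗ[ℝ] E7)
    (hh : ∀ a i, ContDiffOn ℝ ∞ (fun x ↦ h x a i) V)
    (hP : ∀ x ∈ V, PreservesIII1a (h x)) :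
    ∃ B' Θ', IsIII1aCoframe G V B' Θ' ∧ ∀ x v, B' x v = h x (B x v) := by
  let k : E7 → E7 →L[ℝ] E7 := fun x ↦ LinearMap.toContinuousLinearMap (h x)
  obtain ⟨Θ', h'⟩ := hB.gauge (h := k) (contDiffOn_clm_of_apply hh)
    (fun x hx ↦ isInvertible_of_form43 (hP x hx).form) (fun x hx ↦ (hP x hx).form)
    (fun x hx ↦ (hP x hx).omega) (fun x hx ↦ (hP x hx).plane)
  exact ⟨_, Θ', h', fun x v ↦ rfl⟩

/-- The linear map underlying `gaugeGL`. -/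
noncomputable def gaugeGLₗ (p₁ p₂ p₃ p₄ q : ℝ) : E7 →ₗ[ℝ] E7 where
  toFun := gaugeGL p₁ p₂ p₃ p₄ q
  map_add' a b := by ext i; fin_cases i <;> simp [gaugeGL] <;> ring
  map_smul' c a := by ext i; fin_cases i <;> simp [gaugeGL] <;> ring

/-- The linear map underlying `gaugeV`. -/
noncomputable def gaugeVₗ (v : ℝ) : E7 →ₗ[ℝ] E7 where
  toFun := gaugeV v
  map_add' a b := by ext i; fin_cases i <;> simp [gaugeV] <;> ring
  map_smul' c a := by ext i; fin_cases i <;> simp [gaugeV] <;> ring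

/-- The linear map underlying `gaugeY`. -/
noncomputable def gaugeYₗ (y₁ y₂ : ℝ) : E7 →ₗ[ℝ] E7 where
  toFun := gaugeY y₁ y₂
  map_add' a b := by ext i; fin_cases i <;> simp [gaugeY] <;> ring
  map_smul' c a := by ext i; fin_cases i <;> simp [gaugeY] <;> ring

/-! ### Adapted coordinates -/

theorem forall_fin_seven {P : Fin 7 → Prop} (h0 : P 0) (h1 : P 1) (h2 : P 2) (h3 : P 3) (h4 : P 4)
    (h5 : P 5) (h6 : P 6) : ∀ i, P i := by
  intro i
  fin_cases i <;> assumption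

theorem fderiv_clm_comp_apply {F : Type*} [NormedAddCommGroup F] [NormedSpace ℝ F]
    {B : E7 → E7 →L[ℝ] E7} {x : E7} (hB : DifferentiableAt ℝ B x) (ρ : E7 →L[ℝ] F) (v w : E7) :
    fderiv ℝ (fun x ↦ ρ ∘L B x) x v w = ρ (fderiv ℝ B x v w) := by
  have h := ((ContinuousLinearMap.compL ℝ E7 E7 F ρ).hasFDerivAt (x := B x)).comp x hB.hasFDerivAt
  have h2 : HasFDerivAt (fun x ↦ ρ ∘L B x) _ x := h
  rw [h2.fderiv]
  rfl

namespace IsLCCoframe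

variable {G : E7 → E7 → E7 → ℝ} {V : Set E7} {B : E7 → E7 →L[ℝ] E7}
  {Θ : E7 → E7 →L[ℝ] E7 →L[ℝ] E7}

theorem contDiffOn_inverse (h : IsLCCoframe G V B Θ) :
    ContDiffOn ℝ ∞ (fun x ↦ (B x).inverse) V := by
  intro x hx
  obtain ⟨S, hS⟩ := h.invertible x hx
  have h2 : ContDiffAt ℝ ∞ ContinuousLinearMap.inverse (B x) := by
    rw [← hS]; exact contDiffAt_map_inverse S
  exact h2.comp_contDiffWithinAt x (h.smooth x hx)

theorem apply_inverse (h : IsLCCoframe G V B Θ) {x : E7} (hx : x ∈ V) (a : E7) :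
    B x ((B x).inverse a) = a := by
  obtain ⟨S, hS⟩ := h.invertible x hx
  simp [← hS]

theorem eq_zero (h : IsLCCoframe G V B Θ) {x v : E7} (hx : x ∈ V) (hv : B x v = 0) : v = 0 := by
  obtain ⟨S, hS⟩ := h.invertible x hx
  simpa [← hS] using hv

end IsLCCoframe

theorem IsIII1aCoframe.exists_apply {G : E7 → E7 → E7 → ℝ} {V : Set E7} {B : E7 → E7 →L[ℝ] E7}
    {Θ : E7 → E7 →L[ℝ] E7 →L[ℝ] E7} (h : IsIII1aCoframe G V B Θ) {x : E7} (hx : x ∈ V) :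
    ∃ a₁ a₂ a₃ a₄ a y₁ y₂ : E7 → ℝ, ∀ v w i,
      fderiv ℝ B x v w i + hVec (a₁ v) (a₂ v) (a₃ v) (a₄ v) (a v) (y₁ v) (y₂ v) (B x w) i
        = fderiv ℝ B x w v i
          + hVec (a₁ w) (a₂ w) (a₃ w) (a₄ w) (a w) (y₁ w) (y₂ w) (B x v) i := by
  choose a₁ a₂ a₃ a₄ a y₁ y₂ H using h.isIII1a x hx
  refine ⟨a₁, a₂, a₃, a₄, a, y₁, y₂, fun v w i ↦ ?_⟩
  have := congrFun (h.torsion x hx v w) i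
  simpa only [Pi.add_apply, H] using this

set_option maxHeartbeats 1000000 in
/-- Coordinates `X₃, X₄, X₅, X₆` adapted to a coframe with connection in `𝔤𝔩(2,ℝ) ⋉ 𝔪(1,2)`. -/
theorem IsIII1aCoframe.exists_rectified {G : E7 → E7 → E7 → ℝ} {V : Set E7}
    {B : E7 → E7 →L[ℝ] E7} {Θ : E7 → E7 →L[ℝ] E7 →L[ℝ] E7} (h : IsIII1aCoframe G V B Θ)
    {p : E7} (hp : p ∈ V) :
    ∃ V' ⊆ V, p ∈ V' ∧ ∃ B' Θ', IsIII1aCoframe G V' B' Θ' ∧ ∃ X₃ X₄ X₅ X₆ f : E7 → ℝ,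
      ContDiffOn ℝ ∞ X₃ V' ∧ ContDiffOn ℝ ∞ X₄ V' ∧ ContDiffOn ℝ ∞ X₅ V' ∧
      ContDiffOn ℝ ∞ X₆ V' ∧ ContDiffOn ℝ ∞ f V' ∧ ∀ x ∈ V', 0 < f x ∧ ∀ v,
        B' x v 3 = fderiv ℝ X₃ x v ∧ B' x v 4 = f x * fderiv ℝ X₄ x v ∧
        B' x v 5 = fderiv ℝ X₅ x v ∧ B' x v 6 = fderiv ℝ X₆ x v := by
  have hs : √2 * √2 = 2 := Real.mul_self_sqrt (by norm_num)
  have hs0 : √2 ≠ 0 := by positivity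
  have hd : ∀ x ∈ V, DifferentiableAt ℝ B x := fun x hx ↦ (h.hasFDerivAt hx).differentiableAt
  let P : Fin 7 → E7 →L[ℝ] ℝ := fun i ↦ ContinuousLinearMap.proj i
  have hsm : ∀ {F : Type} [NormedAddCommGroup F] [NormedSpace ℝ F] (ρ : E7 →L[ℝ] F),
      ContDiffOn ℝ ∞ (fun x ↦ ρ ∘L B x) V := fun ρ ↦ contDiffOn_const.clm_comp h.smooth
  have hsurj : Function.Surjective (B p) := fun a ↦ ⟨_, h.apply_inverse hp a⟩
  -- Row 4 of the torsion equation (counting from zero) involves component 4 only, so its kernel is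
  -- involutive; row 3 makes component 3 closed on the leaves. `X₄` labels the leaves and `X₃` is
  -- the primitive.
  obtain ⟨V₁, hV₁V, hV₁, hp₁, X₄, X₃, hX₄, hX₃, hX₄s, hX₁⟩ :=
    exists_firstIntegral_primitive (β := fun x ↦ P 4 ∘L B x) (η := fun x ↦ P 3 ∘L B x)
      h.isOpen hp (hsm _) (hsm _)
      (fun t ↦ by
        obtain ⟨v, hv⟩ := hsurj (Pi.single 4 t)
        exact ⟨v, by simp [P, hv]⟩)
      (fun x hx v w hv hw ↦ by
        simp only [fderiv_clm_comp_apply (hd x hx)]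
        simp only [P, ContinuousLinearMap.comp_apply, ContinuousLinearMap.proj_apply] at hv hw ⊢
        obtain ⟨a₁, a₂, a₃, a₄, a, y₁, y₂, H⟩ := h.exists_apply hx
        simpa [hVec, hv, hw] using H v w 4)
      (fun x hx v w hv hw ↦ by
        simp only [fderiv_clm_comp_apply (hd x hx)]
        simp only [P, ContinuousLinearMap.comp_apply, ContinuousLinearMap.proj_apply] at hv hw ⊢
        obtain ⟨a₁, a₂, a₃, a₄, a, y₁, y₂, H⟩ := h.exists_apply hx
        simpa [hVec, hv, hw] using H v w 3)
  -- The last two rows involve only components 5 and 6, so their common kernel is involutive. Only a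
  -- first integral is wanted here, hence `η = 0`.
  obtain ⟨V₂, hV₂V, hV₂, hp₂, Y, ψ, hY, -, hYs, hY₂⟩ :=
    exists_firstIntegral_primitive (β := fun x ↦ ((P 5).prod (P 6)) ∘L B x)
      (η := fun _ ↦ (0 : E7 →L[ℝ] ℝ))
      h.isOpen hp (hsm _) contDiffOn_const
      (fun t ↦ by
        obtain ⟨v, hv⟩ := hsurj (Pi.single 5 t.1 + Pi.single 6 t.2)
        exact ⟨v, by simp [P, hv]⟩)
      (fun x hx v w hv hw ↦ by
        simp only [fderiv_clm_comp_apply (hd x hx)]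
        simp only [P, ContinuousLinearMap.comp_apply, ContinuousLinearMap.prod_apply,
          ContinuousLinearMap.proj_apply, Prod.mk_eq_zero] at hv hw ⊢
        obtain ⟨a₁, a₂, a₃, a₄, a, y₁, y₂, H⟩ := h.exists_apply hx
        refine Prod.ext ?_ ?_
        · simpa [hVec, hv, hw] using H v w 5
        · simpa [hVec, hv, hw] using H v w 6)
      (fun x hx v w hv hw ↦ by simp)
  simp only [P, ContinuousLinearMap.comp_apply, ContinuousLinearMap.proj_apply,
    ContinuousLinearMap.prod_apply, Prod.mk_eq_zero] at hX₁ hY₂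
  let ε : Fin 7 → E7 → E7 := fun j x ↦ (B x).inverse (Pi.single j 1)
  have hε : ∀ j, ContDiffOn ℝ ∞ (ε j) V := fun j ↦
    h.contDiffOn_inverse.clm_apply contDiffOn_const
  have hBε : ∀ j, ∀ x ∈ V, B x (ε j x) = Pi.single j 1 := fun j x hx ↦ h.apply_inverse hx _
  let c : E7 → ℝ := fun x ↦ fderiv ℝ X₄ x (ε 4 x)
  let m : E7 → ℝ := fun x ↦ fderiv ℝ X₃ x (ε 4 x)
  have hX₄' : ∀ x ∈ V₁, ∀ v, fderiv ℝ X₄ x v = c x * B x v 4 := by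
    intro x hx v
    have := (hX₁ x hx (v - B x v 4 • ε 4 x) (by simp [hBε _ x (hV₁V hx)])).1
    rw [map_sub, map_smul, sub_eq_zero] at this
    rw [this, smul_eq_mul, mul_comm]
  have hX₃' : ∀ x ∈ V₁, ∀ v, fderiv ℝ X₃ x v = B x v 3 + m x * B x v 4 := by
    intro x hx v
    have := (hX₁ x hx (v - B x v 4 • ε 4 x) (by simp [hBε _ x (hV₁V hx)])).2
    simp only [map_sub, map_smul, smul_eq_mul, Pi.sub_apply, Pi.smul_apply,
      hBε _ x (hV₁V hx)] at this
    simp only [ne_eq, Fin.reduceEq, not_false_eq_true, Pi.single_eq_of_ne, mul_zero,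
      sub_zero] at this
    simp only [m]
    linarith
  have hY' : ∀ x ∈ V₂, ∀ v, fderiv ℝ Y x v
      = B x v 5 • fderiv ℝ Y x (ε 5 x) + B x v 6 • fderiv ℝ Y x (ε 6 x) := by
    intro x hx v
    have := (hY₂ x hx (v - (B x v 5 • ε 5 x + B x v 6 • ε 6 x))
      (by simp [hBε _ x (hV₂V hx)])).1
    rw [map_sub, sub_eq_zero] at this
    rw [this]; simp
  let X₅ : E7 → ℝ := fun x ↦ (Y x).1
  let X₆ : E7 → ℝ := fun x ↦ (Y x).2
  let p₁ : E7 → ℝ := fun x ↦ (fderiv ℝ Y x (ε 5 x)).1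
  let p₂ : E7 → ℝ := fun x ↦ (fderiv ℝ Y x (ε 6 x)).1
  let p₃ : E7 → ℝ := fun x ↦ (fderiv ℝ Y x (ε 5 x)).2
  let p₄ : E7 → ℝ := fun x ↦ (fderiv ℝ Y x (ε 6 x)).2
  let d : E7 → ℝ := fun x ↦ p₁ x * p₄ x - p₂ x * p₃ x
  have hYd : ∀ x ∈ V₂, HasFDerivAt Y (fderiv ℝ Y x) x := fun x hx ↦
    ((hY.contDiffAt (hV₂.mem_nhds hx)).differentiableAt (by simp)).hasFDerivAt
  have hX₅' : ∀ x ∈ V₂, ∀ v, fderiv ℝ X₅ x v = p₁ x * B x v 5 + p₂ x * B x v 6 := by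
    intro x hx v
    have h1 : HasFDerivAt X₅ _ x := (hYd x hx).fst
    rw [h1.fderiv]
    have := congrArg Prod.fst (hY' x hx v)
    simp only [Prod.fst_add, Prod.smul_fst, smul_eq_mul] at this
    simp only [ContinuousLinearMap.comp_apply, ContinuousLinearMap.coe_fst', p₁, p₂]
    linarith
  have hX₆' : ∀ x ∈ V₂, ∀ v, fderiv ℝ X₆ x v = p₃ x * B x v 5 + p₄ x * B x v 6 := by
    intro x hx v
    have h1 : HasFDerivAt X₆ _ x := (hYd x hx).snd
    rw [h1.fderiv]
    have := congrArg Prod.snd (hY' x hx v)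
    simp only [Prod.snd_add, Prod.smul_snd, smul_eq_mul] at this
    simp only [ContinuousLinearMap.comp_apply, ContinuousLinearMap.coe_snd', p₃, p₄]
    linarith
  have hc0 : c p ≠ 0 := by
    obtain ⟨v, hv⟩ := hX₄s 1
    rw [hX₄' p hp₁] at hv
    exact left_ne_zero_of_mul_eq_one hv
  have hd0 : d p ≠ 0 := by
    obtain ⟨v, hv⟩ := hYs (1, 0)
    obtain ⟨w, hw⟩ := hYs (0, 1)
    rw [hY' p hp₂] at hv hw
    have h1 := congrArg Prod.fst hv
    have h2 := congrArg Prod.snd hv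
    have h3 := congrArg Prod.fst hw
    have h4 := congrArg Prod.snd hw
    simp only [Prod.fst_add, Prod.smul_fst, Prod.snd_add, Prod.smul_snd, smul_eq_mul] at h1 h2 h3 h4
    change _ * p₁ p + _ * p₂ p = 1 at h1
    change _ * p₃ p + _ * p₄ p = 0 at h2
    change _ * p₁ p + _ * p₂ p = 0 at h3
    change _ * p₃ p + _ * p₄ p = 1 at h4
    have : d p * (B p v 5 * B p w 6 - B p v 6 * B p w 5) = 1 := by
      simp only [d]
      linear_combination (B p w 5 * p₃ p + B p w 6 * p₄ p) * h1 + h4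
        - (B p w 5 * p₁ p + B p w 6 * p₂ p) * h2
    exact left_ne_zero_of_mul_eq_one this
  have hV₁₂ : IsOpen (V₁ ∩ V₂) := hV₁.inter hV₂
  have hfd : ∀ {F : Type} [NormedAddCommGroup F] [NormedSpace ℝ F] {X : E7 → F} {W : Set E7},
      IsOpen W → ContDiffOn ℝ ∞ X W → W ⊆ V → ∀ j,
      ContDiffOn ℝ ∞ (fun x ↦ fderiv ℝ X x (ε j x)) W := fun hW hX hWV j ↦
    (hX.fderiv_of_isOpen hW (by simp)).clm_apply ((hε j).mono hWV)
  have hcs : ContDiffOn ℝ ∞ c (V₁ ∩ V₂) := (hfd hV₁ hX₄ hV₁V 4).mono inter_subset_left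
  have hms : ContDiffOn ℝ ∞ m (V₁ ∩ V₂) := (hfd hV₁ hX₃ hV₁V 4).mono inter_subset_left
  have hp₁s : ContDiffOn ℝ ∞ p₁ (V₁ ∩ V₂) := (hfd hV₂ hY hV₂V 5).fst.mono inter_subset_right
  have hp₂s : ContDiffOn ℝ ∞ p₂ (V₁ ∩ V₂) := (hfd hV₂ hY hV₂V 6).fst.mono inter_subset_right
  have hp₃s : ContDiffOn ℝ ∞ p₃ (V₁ ∩ V₂) := (hfd hV₂ hY hV₂V 5).snd.mono inter_subset_right
  have hp₄s : ContDiffOn ℝ ∞ p₄ (V₁ ∩ V₂) := (hfd hV₂ hY hV₂V 6).snd.mono inter_subset_right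
  have hds : ContDiffOn ℝ ∞ d (V₁ ∩ V₂) := (hp₁s.mul hp₄s).sub (hp₂s.mul hp₃s)
  -- Here `d * c` keeps the sign it has at `p`. After the change of frame, component 4 becomes `(d /
  -- c) dX₄`; rescaling `X₄` by the constant `d p / c p` then makes the factor `f` positive.
  let V' : Set E7 := (V₁ ∩ V₂) ∩ (fun x ↦ (d x * c x) * (d p * c p)) ⁻¹' Ioi 0
  have hV' : IsOpen V' := ((hds.mul hcs).mul contDiffOn_const).continuousOn.isOpen_inter_preimage
    hV₁₂ isOpen_Ioi
  have hsub : V' ⊆ V₁ ∩ V₂ := inter_subset_left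
  have hne : ∀ x ∈ V', d x ≠ 0 ∧ c x ≠ 0 := by
    rintro x ⟨-, hx⟩
    have h1 : d x * c x ≠ 0 := left_ne_zero_of_mul (ne_of_gt hx)
    exact ⟨left_ne_zero_of_mul h1, right_ne_zero_of_mul h1⟩
  have hV'V : V' ⊆ V := fun x hx ↦ hV₁V (hsub hx).1
  have hB' : IsIII1aCoframe G V' B Θ :=
    ⟨h.toIsLCCoframe.mono hV' hV'V, fun x hx ↦ h.isIII1a x (hV'V hx)⟩
  -- `gaugeVₗ (m / √2)` adds `m` times component 4 to component 3 and so turns it into `dX₃`. The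
  -- `GL(2,ℝ)` factor turns components 5 and 6 into `dX₅` and `dX₆`.
  obtain ⟨B', Θ', hB'', hB''eq⟩ := hB'.gauge'
    (fun x ↦ gaugeGLₗ (p₁ x) (p₂ x) (p₃ x) (p₄ x) (d x)⁻¹ ∘ₗ gaugeVₗ (m x / √2))
    (by
      have hq : ContDiffOn ℝ ∞ (fun x ↦ (d x)⁻¹) V' := (hds.mono hsub).inv fun x hx ↦ (hne x hx).1
      have q1 := hp₁s.mono hsub
      have q2 := hp₂s.mono hsub
      have q3 := hp₃s.mono hsub
      have q4 := hp₄s.mono hsub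
      have q5 : ContDiffOn ℝ ∞ (fun x ↦ m x / √2) V' := (hms.mono hsub).div_const _
      intro a
      simp only [LinearMap.comp_apply, gaugeGLₗ, gaugeVₗ, LinearMap.coe_mk, AddHom.coe_mk]
      refine forall_fin_seven ?_ ?_ ?_ ?_ ?_ ?_ ?_ <;>
        simp only [gaugeGL, gaugeV, Matrix.cons_val] <;> fun_prop)
    (fun x hx ↦ (preservesIII1a_gaugeGL (inv_mul_cancel₀ (hne x hx).1)).comp
      (preservesIII1a_gaugeV _))
  refine ⟨V', hV'V, ⟨⟨hp₁, hp₂⟩, ?_⟩, B', Θ', hB'', X₃, fun x ↦ (d p / c p) * X₄ x, X₅, X₆,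
    fun x ↦ d x * c p / (d p * c x), hX₃.mono fun x hx ↦ (hsub hx).1,
    contDiffOn_const.mul (hX₄.mono fun x hx ↦ (hsub hx).1), hY.fst.mono fun x hx ↦ (hsub hx).2,
    hY.snd.mono fun x hx ↦ (hsub hx).2, ((hds.mono hsub).mul contDiffOn_const).div
      (contDiffOn_const.mul (hcs.mono hsub)) fun x hx ↦ mul_ne_zero hd0 (hne x hx).2,
    fun x hx ↦ ⟨?_, fun v ↦ ?_⟩⟩
  · exact mul_self_pos.2 (mul_ne_zero hd0 hc0)
  · have h1 : 0 < (d x * c x) * (d p * c p) := hx.2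
    have h2 : d x * c p / (d p * c x) = ((d x * c x) * (d p * c p)) / (d p * c x) ^ 2 := by
      have := (hne x hx).2
      field_simp
    change 0 < d x * c p / (d p * c x)
    rw [h2]
    exact div_pos h1 (sq_pos_of_ne_zero (mul_ne_zero hd0 (hne x hx).2))
  · have hX₄d : DifferentiableAt ℝ X₄ x :=
      (hX₄.contDiffAt (hV₁.mem_nhds (hsub hx).1)).differentiableAt (by simp)
    have e4 : fderiv ℝ (fun x ↦ (d p / c p) * X₄ x) x v = d p / c p * (c x * B x v 4) := by
      rw [fderiv_const_mul hX₄d, smul_apply, hX₄' x (hsub hx).1, smul_eq_mul]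
    rw [hB''eq, e4, hX₃' x (hsub hx).1, hX₅' x (hsub hx).2, hX₆' x (hsub hx).2]
    have := (hne x hx).2
    refine ⟨?_, ?_, rfl, rfl⟩
    · change B x v 3 + √2 * (m x / √2) * B x v 4 = _
      field_simp
    · change d x * B x v 4 = _
      field_simp

set_option maxHeartbeats 1000000 in
/-- All coordinates adapted to a coframe with connection in `𝔤𝔩(2,ℝ) ⋉ 𝔪(1,2)`. -/
theorem IsIII1aCoframe.exists_coordinates {G : E7 → E7 → E7 → ℝ} {V : Set E7}
    {B : E7 → E7 →L[ℝ] E7} {Θ : E7 → E7 →L[ℝ] E7 →L[ℝ] E7} (h : IsIII1aCoframe G V B Θ)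
    {X₃ X₄ X₅ X₆ f : E7 → ℝ} (hX₃ : ContDiffOn ℝ ∞ X₃ V) (hX₄ : ContDiffOn ℝ ∞ X₄ V)
    (hX₅ : ContDiffOn ℝ ∞ X₅ V) (hX₆ : ContDiffOn ℝ ∞ X₆ V)
    (hX : ∀ x ∈ V, 0 < f x ∧ ∀ v,
        B x v 3 = fderiv ℝ X₃ x v ∧ B x v 4 = f x * fderiv ℝ X₄ x v ∧
        B x v 5 = fderiv ℝ X₅ x v ∧ B x v 6 = fderiv ℝ X₆ x v) {p : E7} (hp : p ∈ V) :
    ∃ V' ⊆ V, IsOpen V' ∧ p ∈ V' ∧ ∃ X : E7 → E7, ContDiffOn ℝ ∞ X V' ∧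
      ∀ x ∈ V', (∀ v, B x v 3 = fderiv ℝ X x v 3 ∧ B x v 4 = f x * fderiv ℝ X x v 4 ∧
        B x v 5 = fderiv ℝ X x v 5 ∧ B x v 6 = fderiv ℝ X x v 6) ∧
        ∀ v, B x v 4 = 0 → B x v 5 = 0 → B x v 6 = 0 → B x v 0 = fderiv ℝ X x v 0 ∧
          B x v 1 = fderiv ℝ X x v 1 ∧ B x v 2 = fderiv ℝ X x v 2 := by
  have hs0 : √2 ≠ 0 := by positivity
  have hd : ∀ x ∈ V, DifferentiableAt ℝ B x := fun x hx ↦ (h.hasFDerivAt hx).differentiableAt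
  have hsm : ∀ {F : Type} [NormedAddCommGroup F] [NormedSpace ℝ F] (ρ : E7 →L[ℝ] F),
      ContDiffOn ℝ ∞ (fun x ↦ ρ ∘L B x) V := fun ρ ↦ contDiffOn_const.clm_comp h.smooth
  have hsurj : ∀ x ∈ V, Function.Surjective (B x) := fun x hx a ↦ ⟨_, h.apply_inverse hx a⟩
  -- A component of the coframe that is the differential of a function is closed, by symmetry of
  -- second derivatives.
  have hclosed : ∀ {Y : E7 → ℝ} {i : Fin 7}, ContDiffOn ℝ ∞ Y V →
      (∀ x ∈ V, ∀ v, B x v i = fderiv ℝ Y x v) → ∀ x ∈ V, ∀ v w,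
      fderiv ℝ B x v w i = fderiv ℝ B x w v i := by
    intro Y i hY hBY x hx v w
    have h1 : ∀ v w, fderiv ℝ B x v w i = fderiv ℝ (fderiv ℝ Y) x v w := by
      intro v w
      change (ContinuousLinearMap.proj i : E7 →L[ℝ] ℝ) (fderiv ℝ B x v w) = _
      rw [← fderiv_clm_comp_apply (hd x hx)]
      congr 2
      refine Filter.EventuallyEq.fderiv_eq ?_
      filter_upwards [h.isOpen.mem_nhds hx] with y hy
      ext v
      exact hBY y hy v
    rw [h1, h1]
    exact ((hY.contDiffAt (h.isOpen.mem_nhds hx)).isSymmSndFDerivAt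
      (by simpa using ENat.LEInfty.out)).eq _ _
  have c3 := hclosed hX₃ fun x hx v ↦ ((hX x hx).2 v).1
  have c5 := hclosed hX₅ fun x hx v ↦ ((hX x hx).2 v).2.2.1
  have c6 := hclosed hX₆ fun x hx v ↦ ((hX x hx).2 v).2.2.2
  -- Components 3, 5 and 6 are closed. Pairing a vector of the common kernel of components 4, 5, 6
  -- with preimages of the corresponding basis vectors shows that the `A`- and `v`-parts of `Θ`
  -- vanish on that kernel. What remains is the `y`-part, which pairs trivially with the kernel.
  have key : ∀ x ∈ V, ∀ v w, B x v 4 = 0 → B x v 5 = 0 → B x v 6 = 0 → B x w 4 = 0 →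
      B x w 5 = 0 → B x w 6 = 0 → (fderiv ℝ B x v w 0 = fderiv ℝ B x w v 0 ∧
        fderiv ℝ B x v w 1 = fderiv ℝ B x w v 1 ∧ fderiv ℝ B x v w 2 = fderiv ℝ B x w v 2) ∧
      fderiv ℝ B x v w 4 = fderiv ℝ B x w v 4 := by
    intro x hx v w hv4 hv5 hv6 hw4 hw5 hw6
    obtain ⟨a₁, a₂, a₃, a₄, a, y₁, y₂, H⟩ := h.exists_apply hx
    have hz : ∀ v, B x v 4 = 0 → B x v 5 = 0 → B x v 6 = 0 →
        a₁ v = 0 ∧ a₂ v = 0 ∧ a₃ v = 0 ∧ a₄ v = 0 ∧ a v = 0 := by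
      intro v hv4 hv5 hv6
      obtain ⟨z4, hz4⟩ := hsurj x hx (Pi.single 4 1)
      obtain ⟨z5, hz5⟩ := hsurj x hx (Pi.single 5 1)
      obtain ⟨z6, hz6⟩ := hsurj x hx (Pi.single 6 1)
      have e4 := H v z4 3
      have e5 := H v z5 5
      have e5' := H v z6 5
      have e6 := H v z5 6
      have e6' := H v z6 6
      rw [c3 x hx] at e4
      rw [c5 x hx] at e5 e5'
      rw [c6 x hx] at e6 e6'
      simp only [hVec, Matrix.cons_val, hz4, hz5, hz6, hv4, hv5, hv6, add_right_inj] at e4 e5 e5' e6 e6'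
      simp [hs0] at e4 e5 e5' e6 e6'
      exact ⟨e5, e6, e5', e6', e4⟩
    obtain ⟨q1, q2, q3, q4, q5⟩ := hz v hv4 hv5 hv6
    obtain ⟨k1, k2, k3, k4, k5⟩ := hz w hw4 hw5 hw6
    refine ⟨⟨?_, ?_, ?_⟩, ?_⟩
    · simpa [hVec, hv4, hv5, hv6, hw4, hw5, hw6, q1, q2, q3, q4, q5, k1, k2, k3, k4, k5] using H v w 0
    · simpa [hVec, hv4, hv5, hv6, hw4, hw5, hw6, q1, q2, q3, q4, q5, k1, k2, k3, k4, k5] using H v w 1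
    · simpa [hVec, hv4, hv5, hv6, hw4, hw5, hw6, q1, q2, q3, q4, q5, k1, k2, k3, k4, k5] using H v w 2
    · simpa [hVec, hv4, hv5, hv6, hw4, hw5, hw6, q1, q2, q3, q4, q5, k1, k2, k3, k4, k5] using H v w 4
  let P : Fin 7 → E7 →L[ℝ] ℝ := fun i ↦ ContinuousLinearMap.proj i
  -- On the leaves of the common kernel of components 4, 5, 6, the components 0, 1, 2 are closed.
  -- Their primitives `ψ` are the three missing coordinates.
  obtain ⟨V', hV'V, hV', hpV', φ, ψ, -, hψ, -, hφψ⟩ :=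
    exists_firstIntegral_primitive (β := fun x ↦ ((P 4).prod ((P 5).prod (P 6))) ∘L B x)
      (η := fun x ↦ ((P 0).prod ((P 1).prod (P 2))) ∘L B x)
      h.isOpen hp (hsm _) (hsm _)
      (fun t ↦ by
        obtain ⟨v, hv⟩ := hsurj p hp (Pi.single 4 t.1 + Pi.single 5 t.2.1 + Pi.single 6 t.2.2)
        exact ⟨v, by simp [P, hv]⟩)
      (fun x hx v w hv hw ↦ by
        simp only [fderiv_clm_comp_apply (hd x hx)]
        simp only [P, ContinuousLinearMap.comp_apply, ContinuousLinearMap.prod_apply,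
          ContinuousLinearMap.proj_apply, Prod.mk_eq_zero] at hv hw ⊢
        have := key x hx v w hv.1 hv.2.1 hv.2.2 hw.1 hw.2.1 hw.2.2
        exact Prod.ext this.2 (Prod.ext (c5 x hx v w) (c6 x hx v w)))
      (fun x hx v w hv hw ↦ by
        simp only [fderiv_clm_comp_apply (hd x hx)]
        simp only [P, ContinuousLinearMap.comp_apply, ContinuousLinearMap.prod_apply,
          ContinuousLinearMap.proj_apply, Prod.mk_eq_zero] at hv hw ⊢
        have := key x hx v w hv.1 hv.2.1 hv.2.2 hw.1 hw.2.1 hw.2.2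
        exact Prod.ext this.1.1 (Prod.ext this.1.2.1 this.1.2.2))
  simp only [P, ContinuousLinearMap.comp_apply, ContinuousLinearMap.proj_apply,
    ContinuousLinearMap.prod_apply, Prod.mk_eq_zero] at hφψ
  let X : E7 → E7 := fun x ↦ ![(ψ x).1, (ψ x).2.1, (ψ x).2.2, X₃ x, X₄ x, X₅ x, X₆ x]
  have hXs : ContDiffOn ℝ ∞ X V' := by
    refine contDiffOn_pi.2 (forall_fin_seven ?_ ?_ ?_ ?_ ?_ ?_ ?_) <;>
      simp only [X, Matrix.cons_val]
    exacts [hψ.fst, hψ.snd.fst, hψ.snd.snd, hX₃.mono hV'V, hX₄.mono hV'V, hX₅.mono hV'V,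
      hX₆.mono hV'V]
  refine ⟨V', hV'V, hV', hpV', X, hXs, fun x hx ↦ ?_⟩
  have hXd : HasFDerivAt X (fderiv ℝ X x) x :=
    ((hXs.contDiffAt (hV'.mem_nhds hx)).differentiableAt (by simp)).hasFDerivAt
  have hXi : ∀ i v, fderiv ℝ X x v i = fderiv ℝ (fun y ↦ X y i) x v := fun i v ↦ by
    rw [(hasFDerivAt_pi'.1 hXd i).fderiv]; rfl
  have hψd : HasFDerivAt ψ (fderiv ℝ ψ x) x :=
    ((hψ.contDiffAt (hV'.mem_nhds hx)).differentiableAt (by simp)).hasFDerivAt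
  constructor
  · intro v
    simp only [hXi]
    exact (hX x (hV'V hx)).2 v
  · intro v h4 h5 h6
    have e := (hφψ x hx v ⟨h4, h5, h6⟩).2
    simp only [hXi]
    have e0 : HasFDerivAt (fun y ↦ X y 0) _ x := hψd.fst
    have e1 : HasFDerivAt (fun y ↦ X y 1) _ x := hψd.snd.fst
    have e2 : HasFDerivAt (fun y ↦ X y 2) _ x := hψd.snd.snd
    rw [e0.fderiv, e1.fderiv, e2.fderiv]
    simp [e]

-- In these coordinates the coframe differs from `shapeVec` only by multiples of the fifth
-- coordinate differential in components 1 and 2. A frame change by `y` removes them, and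
-- `shapeSystem_of_coframe` applies.
set_option maxHeartbeats 1000000 in
theorem IsIII1aCoframe.exists_normalData {G : E7 → E7 → E7 → ℝ} {c : E7} {r : ℝ}
    {B : E7 → E7 →L[ℝ] E7} {Θ : E7 → E7 →L[ℝ] E7 →L[ℝ] E7} (h : IsIII1aCoframe G (ball c r) B Θ)
    {f : E7 → ℝ} (hf : ContDiffOn ℝ ∞ f (ball c r)) (hf0 : ∀ x ∈ ball c r, 0 < f x)
    (hcomp : ∀ x ∈ ball c r, ∀ v,
      (B x v 3 = v 3 ∧ B x v 4 = f x * v 4 ∧ B x v 5 = v 5 ∧ B x v 6 = v 6) ∧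
      (v 4 = 0 → v 5 = 0 → v 6 = 0 → B x v 0 = v 0 ∧ B x v 1 = v 1 ∧ B x v 2 = v 2)) :
    ∃ D : NormalData, D.IsAdmissible (ball c r) ∧ ∀ x ∈ ball c r, ∀ v w,
      G x v w = D.metric x v w := by
  have hBs : ∀ j i, ContDiffOn ℝ ∞ (fun x ↦ B x (Pi.single j 1) i) (ball c r) := fun j ↦
    contDiffOn_pi.1 (h.smooth.clm_apply contDiffOn_const)
  have hq : ∀ i, ContDiffOn ℝ ∞ (fun x ↦ -B x (Pi.single 4 1) i / f x) (ball c r) := fun i ↦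
    (hBs 4 i).neg.div hf fun x hx ↦ (hf0 x hx).ne'
  -- `gaugeY` adds `y` times component 4 to components 1 and 2, and component 4 of the fifth
  -- coordinate vector is `f x`; hence the quotients by `f x`.
  obtain ⟨B', Θ', hB', hB'eq⟩ := h.gauge'
    (fun x ↦ gaugeYₗ (-B x (Pi.single 4 1) 1 / f x) (-B x (Pi.single 4 1) 2 / f x))
    (by
      have q1 := hq 1
      have q2 := hq 2
      intro a
      simp only [gaugeYₗ, LinearMap.coe_mk, AddHom.coe_mk]
      refine forall_fin_seven ?_ ?_ ?_ ?_ ?_ ?_ ?_ <;>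
        simp only [gaugeY, Matrix.cons_val] <;> fun_prop)
    (fun x hx ↦ preservesIII1a_gaugeY _ _)
  have hB's : ∀ j i, ContDiffOn ℝ ∞ (fun x ↦ B' x (Pi.single j 1) i) (ball c r) := fun j ↦
    contDiffOn_pi.1 (hB'.smooth.clm_apply contDiffOn_const)
  have hdec : ∀ x ∈ ball c r, ∀ v, B x v 0 = v 0 + v 4 * B x (Pi.single 4 1) 0
        + v 5 * B x (Pi.single 5 1) 0 + v 6 * B x (Pi.single 6 1) 0 ∧
      B x v 1 = v 1 + v 4 * B x (Pi.single 4 1) 1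
        + v 5 * B x (Pi.single 5 1) 1 + v 6 * B x (Pi.single 6 1) 1 ∧
      B x v 2 = v 2 + v 4 * B x (Pi.single 4 1) 2
        + v 5 * B x (Pi.single 5 1) 2 + v 6 * B x (Pi.single 6 1) 2 := by
    intro x hx v
    have := (hcomp x hx (v - (v 4 • Pi.single 4 1 + v 5 • Pi.single 5 1 + v 6 • Pi.single 6 1))).2
      (by simp) (by simp) (by simp)
    simp only [map_sub, map_add, map_smul, Pi.sub_apply, Pi.add_apply, Pi.smul_apply,
      smul_eq_mul] at this
    simp at this
    obtain ⟨k0, k1, k2⟩ := this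
    refine ⟨?_, ?_, ?_⟩
    · linear_combination k0
    · linear_combination k1
    · linear_combination k2
  have hshape : ∀ x ∈ ball c r, ∀ v, B' x v = shapeVec (f x) (B' x (Pi.single 4 1) 0)
      (B' x (Pi.single 5 1) 0) (B' x (Pi.single 6 1) 0) (B' x (Pi.single 5 1) 1)
      (B' x (Pi.single 6 1) 1) (B' x (Pi.single 5 1) 2) (B' x (Pi.single 6 1) 2) v := by
    intro x hx v
    have hc := fun v ↦ (hcomp x hx v).1
    have hfx := (hf0 x hx).ne'
    obtain ⟨d0, d1, d2⟩ := hdec x hx v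
    have g : ∀ y₁ y₂ a, gaugeYₗ y₁ y₂ a = gaugeY y₁ y₂ a := fun _ _ _ ↦ rfl
    simp only [hB'eq, g]
    refine funext (forall_fin_seven ?_ ?_ ?_ ?_ ?_ ?_ ?_) <;>
      simp only [gaugeY, shapeVec, Matrix.cons_val, (hc _).1, (hc _).2.1, (hc _).2.2.1,
        (hc _).2.2.2, d0, d1, d2]
    · simp
      ring
    · simp
      field_simp
      ring
    · simp
      field_simp
      ring
  obtain ⟨D, hD, hDc⟩ := exists_normalData_of_shapeSystem hf (hB's 4 0) (hB's 5 0) (hB's 6 0)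
    (hB's 5 1) (hB's 6 1) (hB's 5 2) (hB's 6 2) hf0
    fun x hx ↦ shapeSystem_of_coframe hB' hshape hf0 hx
  refine ⟨D, hD, fun x hx v w ↦ ?_⟩
  rw [hB'.metric x hx, NormalData.metric, hDc x hx, hDc x hx, ← hshape x hx, ← hshape x hx]

set_option maxHeartbeats 1000000 in
/-- A metric with an adapted coframe whose connection form takes values in
`𝔤𝔩(2,ℝ) ⋉ 𝔪(1,2)` has the normal form in suitable coordinates. -/
theorem IsIII1aCoframe.exists_normal {G : E7 → E7 → E7 → ℝ} {V : Set E7}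
    {B : E7 → E7 →L[ℝ] E7} {Θ : E7 → E7 →L[ℝ] E7 →L[ℝ] E7} (h : IsIII1aCoframe G V B Θ)
    {p : E7} (hp : p ∈ V) :
    ∃ e : OpenPartialHomeomorph E7 E7, p ∈ e.source ∧ e.source ⊆ V ∧
      ContDiffOn ℝ ∞ e e.source ∧ ContDiffOn ℝ ∞ e.symm e.target ∧
      ∃ D : NormalData, D.IsAdmissible e.target ∧ ∀ x ∈ e.target, ∀ v w,
        G (e.symm x) (fderiv ℝ e.symm x v) (fderiv ℝ e.symm x w) = D.metric x v w := by
  obtain ⟨V₁, hV₁V, hp₁, B₀, Θ₀, hB₀, X₃, X₄, X₅, X₆, f, h3, h4, h5, h6, hf, hX₁⟩ :=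
    h.exists_rectified hp
  obtain ⟨V₂, hV₂V₁, hV₂, hp₂, X, hX, hBX⟩ := hB₀.exists_coordinates h3 h4 h5 h6 hX₁ hp₁
  -- If `dX` kills `v`, the last four components of `B₀ p v` vanish. This makes the relation for the
  -- first three available, and they vanish too.
  have hinj : Function.Injective (fderiv ℝ X p : E7 →ₗ[ℝ] E7) := by
    rw [← LinearMap.ker_eq_bot, LinearMap.ker_eq_bot']
    intro v hv
    have hv : fderiv ℝ X p v = 0 := hv
    obtain ⟨k1, k2⟩ := hBX p hp₂
    obtain ⟨q3, q4, q5, q6⟩ := k1 v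
    simp only [hv, Pi.zero_apply, mul_zero] at q3 q4 q5 q6
    obtain ⟨q0, q1, q2⟩ := k2 v q4 q5 q6
    simp only [hv, Pi.zero_apply] at q0 q1 q2
    exact hB₀.eq_zero hp₁ (funext (forall_fin_seven q0 q1 q2 q3 q4 q5 q6))
  have hXp : HasFDerivAt X (fderiv ℝ X p) p :=
    ((hX.contDiffAt (hV₂.mem_nhds hp₂)).differentiableAt (by simp)).hasFDerivAt
  obtain ⟨e₀, he₀p, he₀V, he₀X, he₀s, he₀d⟩ := exists_openPartialHomeomorph_of_hasFDerivAt hV₂ hp₂ hX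
    (LinearEquiv.ofInjectiveEndo _ hinj).toContinuousLinearEquiv
    (hXp.congr_fderiv (by ext; rfl))
  obtain ⟨r, hr, hrt⟩ := Metric.isOpen_iff.1 e₀.open_target _ (e₀.map_source he₀p)
  rw [he₀X] at hrt
  -- The coordinate domain is cut down to a box, because the reduction of the coefficients to fewer
  -- variables needs one.
  let W := ball (X p) r
  let e₁ := e₀.symm.restrOpen W isOpen_ball
  have he₁ : e₁.source = W := by
    change e₀.target ∩ W = W
    exact inter_eq_right.2 hrt
  have he₁t : e₁.target ⊆ e₀.source := by
    intro x hx
    rw [← e₁.right_inv hx]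
    have : e₁.symm x ∈ e₀.target := by
      have := e₁.symm.map_source hx
      rw [show e₁.symm.target = W from he₁] at this
      exact hrt this
    exact e₀.symm.map_source this
  have hpe : p ∈ e₁.target := by
    have h1 : X p ∈ e₁.source := he₁ ▸ mem_ball_self hr
    have h2 := e₁.map_source h1
    have h3 : e₁ (X p) = p := by
      change e₀.symm (X p) = p
      rw [← he₀X]
      exact e₀.left_inv he₀p
    rwa [h3] at h2
  let κ : E7 → E7 := e₀.symm
  have hκs : ContDiffOn ℝ ∞ κ W := he₀s.mono hrt
  have hκX : ∀ x ∈ W, κ x ∈ V₂ ∧ (fderiv ℝ κ x).IsInvertible ∧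
      ∀ v, fderiv ℝ X (κ x) (fderiv ℝ κ x v) = v := by
    intro x hx
    have h1 : κ x ∈ e₀.source := e₀.map_target (hrt hx)
    obtain ⟨L, hL⟩ := he₀d _ h1
    have h2 : HasFDerivAt κ (L.symm : E7 →L[ℝ] E7) x :=
      e₀.hasFDerivAt_symm (hrt hx) (by rw [he₀X]; exact hL)
    rw [h2.fderiv, hL.fderiv]
    exact ⟨he₀V h1, ⟨L.symm, rfl⟩, fun v ↦ by simp⟩
  have hB₂ := hB₀.toIsLCCoframe.mono hV₂ hV₂V₁
  have hB₁ : IsIII1aCoframe (fun x v w ↦ G (κ x) (fderiv ℝ κ x v) (fderiv ℝ κ x w)) W _ _ :=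
    ⟨hB₂.pullback isOpen_ball hκs (fun x hx ↦ (hκX x hx).1) (fun x hx ↦ (hκX x hx).2.1)
      fun x hx v w ↦ rfl, fun x hx v ↦ hB₀.isIII1a _ (hV₂V₁ (hκX x hx).1) _⟩
  have hcomp : ∀ x ∈ W, ∀ v,
      ((B₀ (κ x) ∘L fderiv ℝ κ x) v 3 = v 3 ∧ (B₀ (κ x) ∘L fderiv ℝ κ x) v 4 = f (κ x) * v 4 ∧
        (B₀ (κ x) ∘L fderiv ℝ κ x) v 5 = v 5 ∧ (B₀ (κ x) ∘L fderiv ℝ κ x) v 6 = v 6) ∧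
      (v 4 = 0 → v 5 = 0 → v 6 = 0 → (B₀ (κ x) ∘L fderiv ℝ κ x) v 0 = v 0 ∧
        (B₀ (κ x) ∘L fderiv ℝ κ x) v 1 = v 1 ∧ (B₀ (κ x) ∘L fderiv ℝ κ x) v 2 = v 2) := by
    intro x hx v
    obtain ⟨hκ₂, -, hκi⟩ := hκX x hx
    obtain ⟨k1, k2⟩ := hBX _ hκ₂
    have k1 := k1 (fderiv ℝ κ x v)
    have k2 := k2 (fderiv ℝ κ x v)
    rw [hκi] at k1 k2
    refine ⟨k1, fun h4 h5 h6 ↦ k2 ?_ ?_ ?_⟩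
    · rw [k1.2.1, h4, mul_zero]
    · rw [k1.2.2.1, h5]
    · rw [k1.2.2.2, h6]
  have hfW : ∀ x ∈ W, 0 < f (κ x) := fun x hx ↦ (hX₁ _ (hV₂V₁ (hκX x hx).1)).1
  have hfs : ContDiffOn ℝ ∞ (fun x ↦ f (κ x)) W := hf.comp hκs fun x hx ↦ hV₂V₁ (hκX x hx).1
  obtain ⟨D, hD, hDm⟩ := hB₁.exists_normalData hfs hfW hcomp
  have het : e₁.symm.target = W := he₁
  refine ⟨e₁.symm, hpe, fun x hx ↦ hV₁V (hV₂V₁ (he₀V (he₁t hx))), ?_, ?_, D, ?_, ?_⟩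
  · change ContDiffOn ℝ ∞ e₀ e₁.target
    rw [he₀X]
    exact hX.mono fun x hx ↦ he₀V (he₁t hx)
  · rw [het]; exact hκs
  · rw [het]; exact hD
  · rw [het]; exact hDm

/-! ### The Levi-Civita connection of the normal form -/

/-- The endomorphism-valued one-form with the given components in `𝔤𝔩(2,ℝ) ⋉ 𝔪(1,2)`. -/
noncomputable def hForm (a₁ a₂ a₃ a₄ a y₁ y₂ : E7 →L[ℝ] ℝ) : E7 →L[ℝ] E7 →L[ℝ] E7 :=
  LinearMap.toContinuousLinearMap
    ((LinearMap.toContinuousLinearMap : (E7 →ₗ[ℝ] E7) ≃ₗ[ℝ] E7 →L[ℝ] E7).toLinearMap ∘ₗ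
      LinearMap.mk₂ ℝ (fun v w ↦ hVec (a₁ v) (a₂ v) (a₃ v) (a₄ v) (a v) (y₁ v) (y₂ v) w)
        (fun _ _ _ ↦ by ext i; fin_cases i <;> simp [hVec] <;> ring)
        (fun _ _ _ ↦ by ext i; fin_cases i <;> simp [hVec] <;> ring)
        (fun _ _ _ ↦ by ext i; fin_cases i <;> simp [hVec] <;> ring)
        (fun _ _ _ ↦ by ext i; fin_cases i <;> simp [hVec] <;> ring))

theorem hForm_apply (a₁ a₂ a₃ a₄ a y₁ y₂ : E7 →L[ℝ] ℝ) (v w : E7) :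
    hForm a₁ a₂ a₃ a₄ a y₁ y₂ v w
      = hVec (a₁ v) (a₂ v) (a₃ v) (a₄ v) (a v) (y₁ v) (y₂ v) w := rfl

/-- The one-form `c₄ dx₄ + c₅ dx₅ + c₆ dx₆`. -/
noncomputable def oneForm (c₄ c₅ c₆ : ℝ) : E7 →L[ℝ] ℝ :=
  c₄ • ContinuousLinearMap.proj 4 + c₅ • ContinuousLinearMap.proj 5
    + c₆ • ContinuousLinearMap.proj 6

theorem oneForm_apply (c₄ c₅ c₆ : ℝ) (v : E7) :
    oneForm c₄ c₅ c₆ v = c₄ * v 4 + c₅ * v 5 + c₆ * v 6 := by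
  simp [oneForm]

namespace NormalData

variable (D : NormalData)

/-- The coframe as a field of linear maps. -/
noncomputable def coframeL (x : E7) : E7 →L[ℝ] E7 :=
  LinearMap.toContinuousLinearMap
    { toFun := D.coframe x
      map_add' := fun a b ↦ by ext i; fin_cases i <;> simp [coframe] <;> ring
      map_smul' := fun c a ↦ by ext i; fin_cases i <;> simp [coframe] <;> ring }

theorem coframeL_apply (x v : E7) : D.coframeL x v = D.coframe x v := rfl

/-- The bracket in the formula for `r₅`. -/
noncomputable def bracket (x : E7) : ℝ :=
  pd 6 (fun x' ↦ Real.exp (D.u x') * D.F6 x') x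
    - pd 5 (fun x' ↦ Real.exp (D.u x') * D.F7 x') x - pd 4 D.F4 x

/-- The Levi-Civita connection form of the normal form. -/
noncomputable def conn (x : E7) : E7 →L[ℝ] E7 →L[ℝ] E7 :=
  hForm (oneForm 0 (pd 1 D.s6 x) (pd 1 D.s7 x)) (oneForm 0 (pd 2 D.s6 x) (pd 2 D.s7 x))
    (oneForm 0 (pd 1 D.t6 x) (pd 1 D.t7 x)) (oneForm 0 (pd 2 D.t6 x) (pd 2 D.t7 x))
    (oneForm (D.bracket x / 2) 0 0)
    (oneForm (pd 4 D.r6 x - pd 5 D.r5 x - pd 5 D.u x * D.r5 x)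
      (Real.exp (-D.u x) * pd 4 D.s6 x)
      (Real.exp (-D.u x) * pd 4 D.s7 x + Real.exp (-D.u x) * D.bracket x / 2))
    (oneForm (pd 4 D.r7 x - pd 6 D.r5 x - pd 6 D.u x * D.r5 x)
      (Real.exp (-D.u x) * pd 4 D.t6 x - Real.exp (-D.u x) * D.bracket x / 2)
      (Real.exp (-D.u x) * pd 4 D.t7 x))

variable {D} {V : Set E7}

theorem IsAdmissible.dep_bracket (h : D.IsAdmissible V) : DependsOn D.bracket {4, 5, 6} :=
  (((h.dep_u.comp₂ h.dep_F6 fun a b ↦ Real.exp a * b).pd 6).comp₂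
    ((h.dep_u.comp₂ h.dep_F7 fun a b ↦ Real.exp a * b).pd 5) fun a b ↦ a - b).comp₂
    (h.dep_F4.pd 4) fun a b ↦ a - b

theorem IsAdmissible.smooth_bracket (h : D.IsAdmissible V) (hV : IsOpen V) :
    ContDiffOn ℝ ∞ D.bracket V :=
  (((h.smooth_u.exp.mul h.smooth_F6).pd hV 6).sub
    ((h.smooth_u.exp.mul h.smooth_F7).pd hV 5)).sub (h.smooth_F4.pd hV 4)

theorem IsAdmissible.smooth_r5 (h : D.IsAdmissible V) (hV : IsOpen V) :
    ContDiffOn ℝ ∞ D.r5 V :=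
  (((contDiff_apply ℝ ℝ (3 : Fin 7)).contDiffOn.div_const _).mul (h.smooth_bracket hV)).add
    h.smooth_F5

theorem IsAdmissible.smooth_r6 (h : D.IsAdmissible V) (hV : IsOpen V) :
    ContDiffOn ℝ ∞ D.r6 V :=
  ((contDiff_apply ℝ ℝ (0 : Fin 7)).contDiffOn.mul (h.smooth_u.pd hV 5)).add h.smooth_F6

theorem IsAdmissible.smooth_r7 (h : D.IsAdmissible V) (hV : IsOpen V) :
    ContDiffOn ℝ ∞ D.r7 V :=
  ((contDiff_apply ℝ ℝ (0 : Fin 7)).contDiffOn.mul (h.smooth_u.pd hV 6)).add h.smooth_F7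

theorem IsAdmissible.smooth_s7 (h : D.IsAdmissible V) : ContDiffOn ℝ ∞ D.s7 V :=
  h.smooth_t6.add h.smooth_F4

theorem IsAdmissible.contDiffOn_coframeL (h : D.IsAdmissible V) (hV : IsOpen V) :
    ContDiffOn ℝ ∞ D.coframeL V := by
  have h1 := h.smooth_r5 hV
  have h2 := h.smooth_r6 hV
  have h3 := h.smooth_r7 hV
  have h4 := h.smooth_s6
  have h5 := h.smooth_s7
  have h6 := h.smooth_t6
  have h7 := h.smooth_t7
  have h8 := h.smooth_u.exp
  refine contDiffOn_clm_of_apply fun a ↦ forall_fin_seven ?_ ?_ ?_ ?_ ?_ ?_ ?_ <;>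
    simp only [coframeL_apply, coframe, Matrix.cons_val] <;> fun_prop

theorem IsAdmissible.contDiffOn_conn (h : D.IsAdmissible V) (hV : IsOpen V) :
    ContDiffOn ℝ ∞ D.conn V := by
  have k0 := h.smooth_r5 hV
  have k1 := fun i ↦ (h.smooth_r5 hV).pd hV i
  have k2 := (h.smooth_r6 hV).pd hV 4
  have k3 := (h.smooth_r7 hV).pd hV 4
  have k4 := fun i ↦ h.smooth_s6.pd hV i
  have k5 := fun i ↦ h.smooth_s7.pd hV i
  have k6 := fun i ↦ h.smooth_t6.pd hV i
  have k7 := fun i ↦ h.smooth_t7.pd hV i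
  have k8 := h.smooth_u.neg.exp
  have k9 := h.smooth_bracket hV
  have k10 := fun i ↦ h.smooth_u.pd hV i
  refine contDiffOn_clm_apply.2 fun v ↦ contDiffOn_clm_of_apply fun a ↦
    forall_fin_seven ?_ ?_ ?_ ?_ ?_ ?_ ?_ <;>
    simp only [conn, hForm_apply, oneForm_apply, hVec, Matrix.cons_val] <;> fun_prop

theorem coframeL_isInvertible (x : E7) : (D.coframeL x).IsInvertible := by
  have hinj : Function.Injective (D.coframeL x : E7 →ₗ[ℝ] E7) := by
    rw [← LinearMap.ker_eq_bot, LinearMap.ker_eq_bot']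
    intro v hv
    have hv' : ∀ i, D.coframe x v i = 0 := fun i ↦ congrFun hv i
    have h3 := hv' 3
    have h4 := hv' 4
    have h5 := hv' 5
    have h6 := hv' 6
    simp only [coframe, Matrix.cons_val, mul_eq_zero, (Real.exp_pos _).ne', false_or] at h3 h4 h5 h6
    have h0 := hv' 0
    have h1 := hv' 1
    have h2 := hv' 2
    simp only [coframe, Matrix.cons_val, h4, h5, h6, mul_zero, add_zero] at h0 h1 h2
    exact funext (forall_fin_seven h0 h1 h2 h3 h4 h5 h6)
  exact ⟨(LinearEquiv.ofInjectiveEndo _ hinj).toContinuousLinearEquiv, by ext; rfl⟩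

-- The rows of the torsion equation match the system: row 1 (counting from zero) is `eq3`, row 2 is
-- `eq4`, row 4 follows from `eq1` and `eq2`, and row 0 uses `eq1`, `eq2` and the definition of the
-- bracket in `r5`. The other rows are identities.
set_option maxHeartbeats 1000000 in
theorem IsAdmissible.torsion (h : D.IsAdmissible V) (hV : IsOpen V) {x : E7} (hx : x ∈ V)
    (v w : E7) : fderiv ℝ D.coframeL x v w + D.conn x v (D.coframeL x w)
      = fderiv ℝ D.coframeL x w v + D.conn x w (D.coframeL x v) := by
  have dif : ∀ {g : E7 → ℝ}, ContDiffOn ℝ ∞ g V → DifferentiableAt ℝ g x := fun hg ↦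
    (hg.contDiffAt (hV.mem_nhds hx)).differentiableAt (by simp)
  have hB : HasFDerivAt D.coframeL (fderiv ℝ D.coframeL x) x :=
    (((h.contDiffOn_coframeL hV).contDiffAt (hV.mem_nhds hx)).differentiableAt
      (by simp)).hasFDerivAt
  have hd : ∀ v w i, fderiv ℝ D.coframeL x v w i = fderiv ℝ (fun x ↦ D.coframe x w i) x v := by
    intro v w i
    have h1 := hasFDerivAt_pi'.1 (hB.clm_apply (hasFDerivAt_const w x)) i
    have h2 : HasFDerivAt (fun x ↦ D.coframe x w i) _ x := h1
    rw [h2.fderiv]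
    simp
  have hs : √2 * √2 = 2 := Real.mul_self_sqrt (by norm_num)
  have hs0 : √2 ≠ 0 := by positivity
  have hE : Real.exp (D.u x) * Real.exp (-D.u x) = 1 := by
    rw [← Real.exp_add, add_neg_cancel, Real.exp_zero]
  have sm5 := h.smooth_r5 hV
  have sm6 := h.smooth_r6 hV
  have sm7 := h.smooth_r7 hV
  -- derivatives of the coefficients
  have z : ∀ {g : E7 → ℝ}, ContDiffOn ℝ ∞ g V → DependsOn g {4, 5, 6} →
      pd 0 g x = 0 ∧ pd 1 g x = 0 ∧ pd 2 g x = 0 ∧ pd 3 g x = 0 := fun hg hdep ↦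
    ⟨pd_eq_zero_of_dependsOn hdep (by simp) (dif hg), pd_eq_zero_of_dependsOn hdep (by simp) (dif hg),
      pd_eq_zero_of_dependsOn hdep (by simp) (dif hg),
      pd_eq_zero_of_dependsOn hdep (by simp) (dif hg)⟩
  have z' : ∀ {g : E7 → ℝ}, ContDiffOn ℝ ∞ g V → DependsOn g {1, 2, 4, 5, 6} →
      pd 0 g x = 0 ∧ pd 3 g x = 0 := fun hg hdep ↦
    ⟨pd_eq_zero_of_dependsOn hdep (by simp) (dif hg), pd_eq_zero_of_dependsOn hdep (by simp) (dif hg)⟩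
  obtain ⟨u0, u1, u2, u3⟩ := z h.smooth_u h.dep_u
  obtain ⟨s0, s3⟩ := z' h.smooth_s6 h.dep_s6
  obtain ⟨t0, t3⟩ := z' h.smooth_t6 h.dep_t6
  obtain ⟨T0, T3⟩ := z' h.smooth_t7 h.dep_t7
  obtain ⟨f0, f1, f2, f3⟩ := z h.smooth_F4 h.dep_F4
  have s7 : ∀ i, pd i D.s7 x = pd i D.t6 x + pd i D.F4 x := fun i ↦
    pd_add i (dif h.smooth_t6) (dif h.smooth_F4)
  have hc : ∀ j : Fin 7, DifferentiableAt ℝ (fun x : E7 ↦ x j) x := fun j ↦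
    (contDiff_apply ℝ ℝ j).contDiffAt.differentiableAt (n := 1) (by simp)
  have r5 : ∀ i, pd i D.r5 x = (Pi.single i (1 : ℝ) : E7) 3 * (D.bracket x / √2)
      + x 3 * pd i (fun x ↦ D.bracket x / √2) x + pd i D.F5 x := by
    intro i
    have e : D.r5 = fun x ↦ x 3 * (D.bracket x / √2) + D.F5 x := by
      funext x; simp only [NormalData.r5, bracket]; ring
    have hb : DifferentiableAt ℝ (fun x ↦ D.bracket x / √2) x :=
      dif ((h.smooth_bracket hV).div_const _)
    rw [e, pd_add i ((hc 3).fun_mul hb) (dif h.smooth_F5), pd_mul i (hc 3) hb, pd_coord]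
  have hbd : DependsOn (fun x ↦ D.bracket x / √2) {4, 5, 6} :=
    h.dep_bracket.comp₂ h.dep_bracket fun a _ ↦ a / √2
  obtain ⟨b0, b1, b2, b3⟩ := z ((h.smooth_bracket hV).div_const _) hbd
  obtain ⟨g0, g1, g2, g3⟩ := z h.smooth_F5 h.dep_F5
  have r50 : pd 0 D.r5 x = 0 := by simp [r5, b0, g0]
  have r51 : pd 1 D.r5 x = 0 := by simp [r5, b1, g1]
  have r52 : pd 2 D.r5 x = 0 := by simp [r5, b2, g2]
  have r53 : pd 3 D.r5 x = √2 * (D.bracket x / 2) := by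
    simp only [r5, b3, g3, Pi.single_eq_same, one_mul, mul_zero, add_zero]
    rw [div_eq_iff hs0]
    linear_combination (-D.bracket x / 2) * hs
  clear r5
  have r6 : ∀ i, pd i D.r6 x = (Pi.single i (1 : ℝ) : E7) 0 * pd 5 D.u x
      + x 0 * pd i (pd 5 D.u) x + pd i D.F6 x := by
    intro i
    have hu := dif (h.smooth_u.pd hV 5)
    have e : D.r6 = fun x ↦ x 0 * pd 5 D.u x + D.F6 x := rfl
    rw [e, pd_add i ((hc 0).fun_mul hu) (dif h.smooth_F6), pd_mul i (hc 0) hu, pd_coord]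
  have r7 : ∀ i, pd i D.r7 x = (Pi.single i (1 : ℝ) : E7) 0 * pd 6 D.u x
      + x 0 * pd i (pd 6 D.u) x + pd i D.F7 x := by
    intro i
    have hu := dif (h.smooth_u.pd hV 6)
    have e : D.r7 = fun x ↦ x 0 * pd 6 D.u x + D.F7 x := rfl
    rw [e, pd_add i ((hc 0).fun_mul hu) (dif h.smooth_F7), pd_mul i (hc 0) hu, pd_coord]
  obtain ⟨p0, p1, p2, p3⟩ := z (h.smooth_u.pd hV 5) (h.dep_u.pd 5)
  obtain ⟨q0, q1, q2, q3⟩ := z (h.smooth_u.pd hV 6) (h.dep_u.pd 6)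
  obtain ⟨k0, k1, k2, k3⟩ := z h.smooth_F6 h.dep_F6
  obtain ⟨l0, l1, l2, l3⟩ := z h.smooth_F7 h.dep_F7
  have r60 : pd 0 D.r6 x = pd 5 D.u x := by simp [r6, p0, k0]
  have r61 : pd 1 D.r6 x = 0 := by simp [r6, p1, k1]
  have r62 : pd 2 D.r6 x = 0 := by simp [r6, p2, k2]
  have r63 : pd 3 D.r6 x = 0 := by simp [r6, p3, k3]
  have r66 : pd 6 D.r6 x = x 0 * pd 6 (pd 5 D.u) x + pd 6 D.F6 x := by simp [r6]
  have r70 : pd 0 D.r7 x = pd 6 D.u x := by simp [r7, q0, l0]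
  have r71 : pd 1 D.r7 x = 0 := by simp [r7, q1, l1]
  have r72 : pd 2 D.r7 x = 0 := by simp [r7, q2, l2]
  have r73 : pd 3 D.r7 x = 0 := by simp [r7, q3, l3]
  have r75 : pd 5 D.r7 x = x 0 * pd 6 (pd 5 D.u) x + pd 5 D.F7 x := by
    simp [r7, pd_comm hV h.smooth_u hx 5 6]
  clear r6 r7
  have hK : D.bracket x = Real.exp (D.u x) * (pd 6 D.u x * D.F6 x + pd 6 D.F6 x
      - pd 5 D.u x * D.F7 x - pd 5 D.F7 x) - pd 4 D.F4 x := by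
    have e1 : ∀ {F : E7 → ℝ}, ContDiffOn ℝ ∞ F V → ∀ i,
        pd i (fun x' ↦ Real.exp (D.u x') * F x') x
          = Real.exp (D.u x) * pd i D.u x * F x + Real.exp (D.u x) * pd i F x := by
      intro F hF i
      rw [pd_mul i (dif h.smooth_u.exp) (dif hF), pd_exp i (dif h.smooth_u)]
    rw [bracket, e1 h.smooth_F6, e1 h.smooth_F7]
    ring
  have e1 := h.eq1 x hx
  have e2 := h.eq2 x hx
  have e3 := h.eq3 x hx
  have e4 := h.eq4 x hx
  rw [s7, s7, s7, f1, f2, add_zero, add_zero] at e3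
  have D5 := (dif sm5).hasFDerivAt
  have D6 := (dif sm6).hasFDerivAt
  have D7 := (dif sm7).hasFDerivAt
  have Ds6 := (dif h.smooth_s6).hasFDerivAt
  have Ds7 := (dif h.smooth_s7).hasFDerivAt
  have Dt6 := (dif h.smooth_t6).hasFDerivAt
  have Dt7 := (dif h.smooth_t7).hasFDerivAt
  have Du := (dif h.smooth_u).hasFDerivAt.exp
  refine funext (forall_fin_seven ?_ ?_ ?_ ?_ ?_ ?_ ?_)
  · have c : ∀ w, HasFDerivAt (fun x ↦ D.coframe x w 0) _ x := fun w ↦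
      ((((hasFDerivAt_const (w 0) x).add (D5.mul_const (w 4))).add (D6.mul_const (w 5))).add
        (D7.mul_const (w 6)))
    simp only [Pi.add_apply, hd, (c _).fderiv]
    simp only [conn, hForm_apply, oneForm_apply, hVec, coframeL_apply,
      coframe, Matrix.cons_val, add_apply, smul_apply, zero_apply, smul_eq_mul, fderiv_eq_sum_pd,
      r50, r51, r52, r53, r60, r61, r62, r63, r66, r70, r71, r72, r73, r75, s7, f1, f2]
    simp only [NormalData.r6, NormalData.r7]
    linear_combination (-(v 5 * (w 0 + D.r5 x * w 4 + (x 0 * pd 5 D.u x + D.F6 x) * w 5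
          + (x 0 * pd 6 D.u x + D.F7 x) * w 6)
        - w 5 * (v 0 + D.r5 x * v 4 + (x 0 * pd 5 D.u x + D.F6 x) * v 5
          + (x 0 * pd 6 D.u x + D.F7 x) * v 6))) * e1
      + (-(v 6 * (w 0 + D.r5 x * w 4 + (x 0 * pd 5 D.u x + D.F6 x) * w 5
          + (x 0 * pd 6 D.u x + D.F7 x) * w 6)
        - w 6 * (v 0 + D.r5 x * v 4 + (x 0 * pd 5 D.u x + D.F6 x) * v 5
          + (x 0 * pd 6 D.u x + D.F7 x) * v 6))) * e2
      + (v 5 * w 6 - v 6 * w 5) * Real.exp (-D.u x) * hK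
      + (v 5 * w 6 - v 6 * w 5) * (pd 6 D.u x * D.F6 x + pd 6 D.F6 x
      - pd 5 D.u x * D.F7 x - pd 5 D.F7 x) * hE
  · have c : ∀ w, HasFDerivAt (fun x ↦ D.coframe x w 1) _ x := fun w ↦
      ((hasFDerivAt_const (w 1) x).add (Ds6.mul_const (w 5))).add (Ds7.mul_const (w 6))
    simp only [Pi.add_apply, hd, (c _).fderiv]
    simp only [conn, hForm_apply, oneForm_apply, hVec, coframeL_apply,
      coframe, Matrix.cons_val, add_apply, smul_apply, zero_apply, smul_eq_mul, fderiv_eq_sum_pd,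
      s7, f0, f1, f2, f3, s0, s3, t0, t3]
    linear_combination (v 5 * w 6 - v 6 * w 5) * e3
      + (pd 4 D.s6 x * (v 5 * w 4 - v 4 * w 5)
        + (pd 4 D.t6 x + pd 4 D.F4 x + D.bracket x / 2) * (v 6 * w 4 - v 4 * w 6)) * hE
  · have c : ∀ w, HasFDerivAt (fun x ↦ D.coframe x w 2) _ x := fun w ↦
      ((hasFDerivAt_const (w 2) x).add (Dt6.mul_const (w 5))).add (Dt7.mul_const (w 6))
    simp only [Pi.add_apply, hd, (c _).fderiv]
    simp only [conn, hForm_apply, oneForm_apply, hVec, coframeL_apply,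
      coframe, Matrix.cons_val, add_apply, smul_apply, zero_apply, smul_eq_mul, fderiv_eq_sum_pd,
      t0, t3, T0, T3]
    linear_combination (v 5 * w 6 - v 6 * w 5) * e4
      + ((pd 4 D.t6 x - D.bracket x / 2) * (v 5 * w 4 - v 4 * w 5)
        + pd 4 D.t7 x * (v 6 * w 4 - v 4 * w 6)) * hE
  · have c : ∀ w, HasFDerivAt (fun x ↦ D.coframe x w 3) (0 : E7 →L[ℝ] ℝ) x := fun w ↦
      hasFDerivAt_const (w 3) x
    simp only [Pi.add_apply, hd, (c _).fderiv]
    simp only [conn, hForm_apply, oneForm_apply, hVec, coframeL_apply,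
      coframe, Matrix.cons_val, zero_apply]
    ring
  · have c : ∀ w, HasFDerivAt (fun x ↦ D.coframe x w 4)
      (w 4 • (Real.exp (D.u x) • fderiv ℝ D.u x)) x := fun w ↦ Du.mul_const (w 4)
    simp only [Pi.add_apply, hd, (c _).fderiv]
    simp only [conn, hForm_apply, oneForm_apply, hVec, coframeL_apply,
      coframe, Matrix.cons_val, smul_apply, smul_eq_mul, fderiv_eq_sum_pd, u0, u1, u2, u3, s7,
      f1, f2]
    linear_combination Real.exp (D.u x) * (v 5 * w 4 - v 4 * w 5) * e1
      + Real.exp (D.u x) * (v 6 * w 4 - v 4 * w 6) * e2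
  · have c : ∀ w, HasFDerivAt (fun x ↦ D.coframe x w 5) (0 : E7 →L[ℝ] ℝ) x := fun w ↦
      hasFDerivAt_const (w 5) x
    simp only [Pi.add_apply, hd, (c _).fderiv]
    simp only [conn, hForm_apply, oneForm_apply, hVec, coframeL_apply,
      coframe, Matrix.cons_val, zero_apply, s7, f1]
    ring
  · have c : ∀ w, HasFDerivAt (fun x ↦ D.coframe x w 6) (0 : E7 →L[ℝ] ℝ) x := fun w ↦
      hasFDerivAt_const (w 6) x
    simp only [Pi.add_apply, hd, (c _).fderiv]
    simp only [conn, hForm_apply, oneForm_apply, hVec, coframeL_apply,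
      coframe, Matrix.cons_val, zero_apply, s7, f2]
    ring

/-- The normal form has connection form in `𝔤𝔩(2,ℝ) ⋉ 𝔪(1,2)`. -/
theorem IsAdmissible.isIII1aCoframe (h : D.IsAdmissible V) (hV : IsOpen V) :
    IsIII1aCoframe D.metric V D.coframeL D.conn := by
  have h1 : ∀ x, ∀ v, IsIII1a (D.conn x v) := fun x v ↦ ⟨_, _, _, _, _, _, _, fun w ↦ rfl⟩
  exact ⟨⟨hV, h.contDiffOn_coframeL hV, h.contDiffOn_conn hV, fun x _ ↦ coframeL_isInvertible x,
    fun x _ v w ↦ rfl, fun x _ v a b ↦ (h1 x v).form43_skew a b, fun x hx v w ↦ h.torsion hV hx v w⟩,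
    fun x _ v ↦ h1 x v⟩

end NormalData

/-! ### The metric in charts -/

section Charts

set_option linter.unusedSectionVars false

variable {M : Type*} [TopologicalSpace M] [ChartedSpace E7 M] [IsManifold 𝓘(ℝ, E7) ∞ M]
  {e e' : OpenPartialHomeomorph M E7}

theorem mdifferentiable_of_mem_maximalAtlas (he : e ∈ IsManifold.maximalAtlas 𝓘(ℝ, E7) ∞ M) :
    e.MDifferentiable 𝓘(ℝ, E7) 𝓘(ℝ, E7) :=
  ⟨(contMDiffOn_of_mem_maximalAtlas he).mdifferentiableOn (by simp),
    (contMDiffOn_symm_of_mem_maximalAtlas he).mdifferentiableOn (by simp)⟩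

theorem chartVec_mfderiv_symm (he : e ∈ IsManifold.maximalAtlas 𝓘(ℝ, E7) ∞ M) {x : E7}
    (hx : x ∈ e.target) (v : E7) :
    chartVec e (e.symm x) (mfderiv 𝓘(ℝ, E7) 𝓘(ℝ, E7) e.symm x v) = v :=
  DFunLike.congr_fun ((mdifferentiable_of_mem_maximalAtlas he).comp_symm_deriv hx) v

/-- Smoothness of `g` is stated for a section of a bundle of bilinear forms. Feeding that section
the smooth fields obtained by pushing constant vectors forward under `e.symm` turns it into
smoothness of coefficients. -/
theorem contDiffOn_inChart (g : Metric43 M) (he : e ∈ IsManifold.maximalAtlas 𝓘(ℝ, E7) ∞ M)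
    (v w : E7) : ContDiffOn ℝ ∞ (fun x ↦ g.inChart e x v w) e.target := by
  have hs := contMDiffOn_symm_of_mem_maximalAtlas he
  have ht : ∀ v : E7, ContMDiffOn 𝓘(ℝ, E7) (𝓘(ℝ, E7).prod 𝓘(ℝ, E7)) ∞
      (fun x : E7 ↦ TotalSpace.mk' E7 (E := (TangentSpace 𝓘(ℝ, E7) : M → Type _)) (e.symm x)
        (mfderiv 𝓘(ℝ, E7) 𝓘(ℝ, E7) e.symm x v)) e.target := by
    intro v
    have h1 := hs.contMDiffOn_tangentMapWithin (m := ∞) (by simp) e.open_target.uniqueMDiffOn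
    have h2 : ContMDiff 𝓘(ℝ, E7) (𝓘(ℝ, E7).prod 𝓘(ℝ, E7)) ∞
        (fun x : E7 ↦ TotalSpace.mk' E7 (E := (TangentSpace 𝓘(ℝ, E7) : E7 → Type _)) x v) :=
      (contMDiff_vectorSpace_iff_contDiff (V := fun _ ↦ v)).2 contDiff_const
    have h3 := h1.comp h2.contMDiffOn (s := e.target) (fun x hx ↦ hx)
    refine h3.congr fun x hx ↦ ?_
    simp only [Function.comp_apply, tangentMapWithin, mfderivWithin_of_isOpen e.open_target hx]
  have h4 : ContMDiffOn 𝓘(ℝ, E7) (𝓘(ℝ, E7).prod 𝓘(ℝ, ℝ)) ∞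
      (fun x ↦ TotalSpace.mk' ℝ (E := Bundle.Trivial M ℝ) (e.symm x) (g.inChart e x v w))
      e.target := by
    apply ContMDiffOn.clm_bundle_apply₂ (F₁ := E7) (F₂ := E7)
    · exact g.contMDiff.comp_contMDiffOn hs
    · exact ht v
    · exact ht w
  intro x hx
  have h5 := h4 x hx
  simp only [contMDiffWithinAt_totalSpace] at h5
  exact h5.2.contDiffWithinAt

/-- The metric in a chart, as a field of bilinear forms. -/
noncomputable def Metric43.inChartL (g : Metric43 M) (e : OpenPartialHomeomorph M E7) (x : E7) :
    E7 →L[ℝ] E7 →L[ℝ] ℝ :=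
  let A : E7 →L[ℝ] E7 := mfderiv 𝓘(ℝ, E7) 𝓘(ℝ, E7) e.symm x
  let G : E7 →L[ℝ] E7 →L[ℝ] ℝ := g.inner (e.symm x)
  G.bilinearComp A A

theorem Metric43.inChartL_apply (g : Metric43 M) (e : OpenPartialHomeomorph M E7) (x v w : E7) :
    g.inChartL e x v w = g.inChart e x v w := rfl

theorem contDiffOn_inChartL (g : Metric43 M) (he : e ∈ IsManifold.maximalAtlas 𝓘(ℝ, E7) ∞ M) :
    ContDiffOn ℝ ∞ (g.inChartL e) e.target :=
  contDiffOn_clm_apply.2 fun v ↦ contDiffOn_clm_apply.2 fun w ↦ contDiffOn_inChart g he v w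

theorem inChart_symm (g : Metric43 M) (x v w : E7) : g.inChart e x v w = g.inChart e x w v :=
  g.symm _ _ _

theorem inner_eq_inChart (g : Metric43 M) (he : e ∈ IsManifold.maximalAtlas 𝓘(ℝ, E7) ∞ M) {p : M}
    (hp : p ∈ e.source) (v w : T7 p) :
    g.inner p v w = g.inChart e (e p) (chartVec e p v) (chartVec e p w) := by
  have h := (mdifferentiable_of_mem_maximalAtlas he).symm_comp_deriv hp
  have h1 : ∀ v, mfderiv 𝓘(ℝ, E7) 𝓘(ℝ, E7) e.symm (e p) (chartVec e p v) = v := fun v ↦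
    DFunLike.congr_fun h v
  unfold Metric43.inChart
  rw [h1, h1, e.left_inv hp]

theorem contDiffOn_transition (he : e ∈ IsManifold.maximalAtlas 𝓘(ℝ, E7) ∞ M)
    (he' : e' ∈ IsManifold.maximalAtlas 𝓘(ℝ, E7) ∞ M) :
    ContDiffOn ℝ ∞ (fun x ↦ e' (e.symm x)) (e.target ∩ e.symm ⁻¹' e'.source) := by
  have h := (contMDiffOn_of_mem_maximalAtlas he').comp
    ((contMDiffOn_symm_of_mem_maximalAtlas he).mono (inter_subset_left (t := e.symm ⁻¹' e'.source)))
    (fun x hx ↦ hx.2)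
  exact h.contDiffOn

theorem isOpen_transition_source (e e' : OpenPartialHomeomorph M E7) :
    IsOpen (e.target ∩ e.symm ⁻¹' e'.source) :=
  e.symm.continuousOn.isOpen_inter_preimage e.open_target e'.open_source

/-- The chart components of a vector in two charts. -/
theorem chartVec_transition (he : e ∈ IsManifold.maximalAtlas 𝓘(ℝ, E7) ∞ M)
    (he' : e' ∈ IsManifold.maximalAtlas 𝓘(ℝ, E7) ∞ M) {p : M} (hp : p ∈ e.source)
    (hp' : p ∈ e'.source) (v : T7 p) :
    chartVec e' p v = fderiv ℝ (fun x ↦ e' (e.symm x)) (e p) (chartVec e p v) := by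
  have d := mdifferentiable_of_mem_maximalAtlas he
  have d' := mdifferentiable_of_mem_maximalAtlas he'
  have hmem : e p ∈ e.target ∩ e.symm ⁻¹' e'.source := ⟨e.map_source hp, by
    simpa [e.left_inv hp] using hp'⟩
  have h1 : DifferentiableAt ℝ (fun x ↦ e' (e.symm x)) (e p) :=
    ((contDiffOn_transition he he').contDiffAt
      ((isOpen_transition_source e e').mem_nhds hmem)).differentiableAt (by simp)
  have h2 : mfderiv 𝓘(ℝ, E7) 𝓘(ℝ, E7) ((fun x ↦ e' (e.symm x)) ∘ e) p
      = (mfderiv 𝓘(ℝ, E7) 𝓘(ℝ, E7) (fun x ↦ e' (e.symm x)) (e p)).comp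
        (mfderiv 𝓘(ℝ, E7) 𝓘(ℝ, E7) e p) :=
    mfderiv_comp p h1.mdifferentiableAt (d.mdifferentiableAt hp)
  have h3 : mfderiv 𝓘(ℝ, E7) 𝓘(ℝ, E7) ((fun x ↦ e' (e.symm x)) ∘ e) p
      = mfderiv 𝓘(ℝ, E7) 𝓘(ℝ, E7) e' p := by
    apply Filter.EventuallyEq.mfderiv_eq
    filter_upwards [e.open_source.mem_nhds hp] with q hq
    simp [e.left_inv hq]
  rw [h3, mfderiv_eq_fderiv] at h2
  exact DFunLike.congr_fun h2 v

theorem inChart_transition (g : Metric43 M) (he : e ∈ IsManifold.maximalAtlas 𝓘(ℝ, E7) ∞ M)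
    (he' : e' ∈ IsManifold.maximalAtlas 𝓘(ℝ, E7) ∞ M) {x : E7}
    (hx : x ∈ e.target ∩ e.symm ⁻¹' e'.source) (v w : E7) :
    g.inChart e x v w = g.inChart e' (e' (e.symm x))
      (fderiv ℝ (fun x ↦ e' (e.symm x)) x v) (fderiv ℝ (fun x ↦ e' (e.symm x)) x w) := by
  have hp : e.symm x ∈ e.source := e.map_target hx.1
  have h := inner_eq_inChart g he' hx.2 (mfderiv 𝓘(ℝ, E7) 𝓘(ℝ, E7) e.symm x v)
    (mfderiv 𝓘(ℝ, E7) 𝓘(ℝ, E7) e.symm x w)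
  rw [chartVec_transition he he' hp hx.2, chartVec_transition he he' hp hx.2,
    chartVec_mfderiv_symm he hx.1, chartVec_mfderiv_symm he hx.1, e.right_inv hx.1] at h
  exact h

theorem isInvertible_transition (he : e ∈ IsManifold.maximalAtlas 𝓘(ℝ, E7) ∞ M)
    (he' : e' ∈ IsManifold.maximalAtlas 𝓘(ℝ, E7) ∞ M) {x : E7}
    (hx : x ∈ e.target ∩ e.symm ⁻¹' e'.source) :
    (fderiv ℝ (fun x ↦ e' (e.symm x)) x).IsInvertible := by
  have hp : e.symm x ∈ e.source := e.map_target hx.1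
  have hinj : Function.Injective
      (fderiv ℝ (fun x ↦ e' (e.symm x)) x : E7 →ₗ[ℝ] E7) := by
    rw [← LinearMap.ker_eq_bot, LinearMap.ker_eq_bot']
    intro v hv
    have h1 := chartVec_transition he he' hp hx.2 (mfderiv 𝓘(ℝ, E7) 𝓘(ℝ, E7) e.symm x v)
    rw [chartVec_mfderiv_symm he hx.1, e.right_inv hx.1,
      show fderiv ℝ (fun x ↦ e' (e.symm x)) x v = 0 from hv] at h1
    have h2 := (mdifferentiable_of_mem_maximalAtlas he').mfderiv_injective hx.2
      (h1.trans (map_zero (mfderiv 𝓘(ℝ, E7) 𝓘(ℝ, E7) e' (e.symm x))).symm)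
    have h3 := chartVec_mfderiv_symm he hx.1 v
    rw [h2] at h3
    rw [← h3]
    exact map_zero (mfderiv 𝓘(ℝ, E7) 𝓘(ℝ, E7) e (e.symm x))
  exact ⟨(LinearEquiv.ofInjectiveEndo _ hinj).toContinuousLinearEquiv, by ext; rfl⟩

end Charts

/-! ### Radial coframes -/

section Radial

set_option maxSynthPendingDepth 3

variable {E : Type*} [NormedAddCommGroup E] [NormedSpace ℝ E]

/-- The Christoffel symbols of the first kind. -/
noncomputable def christoffelL (DG : E →L[ℝ] E →L[ℝ] E →L[ℝ] ℝ) :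
    E →L[ℝ] E →L[ℝ] E →L[ℝ] ℝ :=
  (1 / 2 : ℝ) • (DG + DG.flip
    - ((ContinuousLinearMap.flipₗᵢ ℝ E E ℝ).toContinuousLinearEquiv :
        (E →L[ℝ] E →L[ℝ] ℝ) →L[ℝ] E →L[ℝ] E →L[ℝ] ℝ) ∘L DG.flip)

theorem christoffelL_apply (DG : E →L[ℝ] E →L[ℝ] E →L[ℝ] ℝ) (v w z : E) :
    christoffelL DG v w z = 1 / 2 * (DG v w z + DG w v z - DG z v w) := rfl

theorem contDiff_christoffelL : ContDiff ℝ ∞ (christoffelL (E := E)) := by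
  let f := ContinuousLinearMap.flipₗᵢ ℝ E E (E →L[ℝ] ℝ)
  let k : (E →L[ℝ] E →L[ℝ] ℝ) →L[ℝ] E →L[ℝ] E →L[ℝ] ℝ :=
    (ContinuousLinearMap.flipₗᵢ ℝ E E ℝ).toContinuousLinearEquiv
  have h : ContDiff ℝ ∞ (fun DG : E →L[ℝ] E →L[ℝ] E →L[ℝ] ℝ ↦
      (1 / 2 : ℝ) • (DG + f DG - k ∘L f DG)) :=
    ((contDiff_id.add f.contDiff).sub (contDiff_const.clm_comp f.contDiff)).const_smul (1 / 2 : ℝ)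
  exact h

variable [FiniteDimensional ℝ E]

theorem isInvertible_of_ker {F : Type*} [NormedAddCommGroup F] [NormedSpace ℝ F]
    [FiniteDimensional ℝ F] (hF : Module.finrank ℝ E = Module.finrank ℝ F) {A : E →L[ℝ] F}
    (hA : ∀ v, A v = 0 → v = 0) : A.IsInvertible := by
  have hinj : Function.Injective (A : E →ₗ[ℝ] F) := by
    rw [← LinearMap.ker_eq_bot, LinearMap.ker_eq_bot']
    exact hA
  exact ⟨(LinearEquiv.ofInjectiveOfFinrankEq _ hinj hF).toContinuousLinearEquiv,
    by ext; rfl⟩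

theorem contDiffOn_inverse_of_isInvertible {X E F : Type*} [NormedAddCommGroup X] [NormedSpace ℝ X]
    [NormedAddCommGroup E] [NormedSpace ℝ E] [NormedAddCommGroup F] [NormedSpace ℝ F]
    [CompleteSpace E] {A : X → E →L[ℝ] F} {V : Set X} (hA : ContDiffOn ℝ ∞ A V)
    (hinv : ∀ x ∈ V, (A x).IsInvertible) : ContDiffOn ℝ ∞ (fun x ↦ (A x).inverse) V := by
  intro x hx
  obtain ⟨S, hS⟩ := hinv x hx
  have h2 : ContDiffAt ℝ ∞ ContinuousLinearMap.inverse (A x) := by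
    rw [← hS]; exact contDiffAt_map_inverse S
  exact h2.comp_contDiffWithinAt x (hA x hx)

/-- A smooth nondegenerate metric has Christoffel symbols of the second kind. -/
theorem exists_christoffel {G : E → E →L[ℝ] E →L[ℝ] ℝ} {V : Set E} (hV : IsOpen V)
    (hG : ContDiffOn ℝ ∞ G V) (hsymm : ∀ x ∈ V, ∀ v w, G x v w = G x w v)
    (hnd : ∀ x ∈ V, ∀ v, G x v = 0 → v = 0) :
    ∃ Γ : E → E →L[ℝ] E →L[ℝ] E, ContDiffOn ℝ ∞ Γ V ∧ (∀ x ∈ V, ∀ v w, Γ x v w = Γ x w v) ∧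
      ∀ x ∈ V, ∀ v w z, fderiv ℝ G x v w z = G x (Γ x v w) z + G x w (Γ x v z) := by
  have := FiniteDimensional.complete ℝ E
  have hGinv : ∀ x ∈ V, (G x).IsInvertible := fun x hx ↦ isInvertible_of_ker
    (by rw [LinearEquiv.finrank_eq (LinearMap.toContinuousLinearMap : (E →ₗ[ℝ] ℝ) ≃ₗ[ℝ] _).symm,
      Module.finrank_linearMap, Module.finrank_self, mul_one]) (hnd x hx)
  have hDG : ContDiffOn ℝ ∞ (fderiv ℝ G) V := hG.fderiv_of_isOpen hV (by simp)
  have hGd : ∀ x ∈ V, HasFDerivAt G (fderiv ℝ G x) x := fun x hx ↦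
    ((hG.contDiffAt (hV.mem_nhds hx)).differentiableAt (by simp)).hasFDerivAt
  have hDGs : ∀ x ∈ V, ∀ v w z, fderiv ℝ G x v w z = fderiv ℝ G x v z w := by
    intro x hx v w z
    have h1 : ∀ w z, HasFDerivAt (fun y ↦ G y w z) ((fderiv ℝ G x).flip w |>.flip z) x := by
      intro w z
      have := ((hGd x hx).clm_apply (hasFDerivAt_const w x)).clm_apply (hasFDerivAt_const z x)
      refine this.congr_fderiv ?_
      ext v; simp
    have h2 := (h1 w z).congr_of_eventuallyEq (f₁ := fun y ↦ G y z w) (by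
      filter_upwards [hV.mem_nhds hx] with y hy using hsymm y hy z w)
    exact DFunLike.congr_fun (h2.unique (h1 z w)) v
  let Γ : E → E →L[ℝ] E →L[ℝ] E := fun x ↦
    (ContinuousLinearMap.compL ℝ E (E →L[ℝ] ℝ) E (G x).inverse) ∘L christoffelL (fderiv ℝ G x)
  have hΓs : ContDiffOn ℝ ∞ Γ V :=
    (((ContinuousLinearMap.compL ℝ E (E →L[ℝ] ℝ) E).contDiff.comp_contDiffOn
      (contDiffOn_inverse_of_isInvertible hG hGinv))).clm_comp
      (contDiff_christoffelL.comp_contDiffOn hDG)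
  have hΓ : ∀ x ∈ V, ∀ v w z, G x (Γ x v w) z
      = 1 / 2 * (fderiv ℝ G x v w z + fderiv ℝ G x w v z - fderiv ℝ G x z v w) := by
    intro x hx v w z
    obtain ⟨S, hS⟩ := hGinv x hx
    rw [← christoffelL_apply]
    simp [Γ, ← hS]
  refine ⟨Γ, hΓs, fun x hx v w ↦ ?_, fun x hx v w z ↦ ?_⟩
  · rw [← sub_eq_zero]
    refine hnd x hx _ ?_
    ext z
    rw [map_sub, sub_apply, hΓ x hx, hΓ x hx, hDGs x hx z v w, zero_apply]
    ring
  · rw [hsymm x hx w, hΓ x hx, hΓ x hx, hDGs x hx v w z, hDGs x hx z v w, hDGs x hx w v z]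
    ring

/-- Every frame at a point extends to a smooth frame that is parallel along the rays through the
point. -/
theorem exists_radial_frame {Γ : E → E →L[ℝ] E →L[ℝ] E} {V : Set E} (hV : IsOpen V)
    (hΓ : ContDiffOn ℝ ∞ Γ V) {x₀ : E} (hx₀ : x₀ ∈ V) (F₀ : E →L[ℝ] E) :
    ∃ r > 0, ball x₀ r ⊆ V ∧ ∃ F : E → E →L[ℝ] E, ContDiffOn ℝ ∞ F (ball x₀ r) ∧ F x₀ = F₀ ∧
      ∀ z ∈ ball 0 r, ∀ t ∈ Icc (0 : ℝ) 1,
        fderiv ℝ F (x₀ + t • z) z + Γ (x₀ + t • z) z ∘L F (x₀ + t • z) = 0 := by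
  -- The unknown is the whole frame, and the equation `dF = -Γ F` is imposed along rays only, so no
  -- integrability condition arises.
  obtain ⟨r₁, hr₁, α, hα, hα0, hαr⟩ := exists_radial_solution
    (Ω := {q : E × (E →L[ℝ] E) | x₀ + q.1 ∈ V}) (y₀ := F₀)
    (f := fun q ↦ -((ContinuousLinearMap.compL ℝ E E E).flip q.2 ∘L Γ (x₀ + q.1)))
    (hV.preimage (by fun_prop)) (by simpa using hx₀)
    ((((ContinuousLinearMap.compL ℝ E E E).flip.contDiff.comp contDiff_snd).contDiffOn.clm_comp
      (hΓ.comp (contDiff_const.add contDiff_fst).contDiffOn fun q hq ↦ hq)).neg)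
  obtain ⟨r₂, hr₂, hr₂V⟩ := Metric.isOpen_iff.1 hV x₀ hx₀
  let r := min r₁ r₂
  have hr : 0 < r := lt_min hr₁ hr₂
  let F : E → E →L[ℝ] E := fun x ↦ α (x - x₀, F₀)
  have hmem : ∀ x ∈ ball x₀ r, (x - x₀, F₀) ∈ ball ((0 : E), F₀) r₁ := by
    intro x hx
    rw [mem_ball, Prod.dist_eq, dist_self, max_eq_left dist_nonneg, dist_zero_right, ← dist_eq_norm]
    exact lt_of_lt_of_le hx (min_le_left _ _)
  have hrV : ball x₀ r ⊆ V := (ball_subset_ball (min_le_right _ _)).trans hr₂V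
  have hF : ContDiffOn ℝ ∞ F (ball x₀ r) :=
    hα.comp (by fun_prop : ContDiff ℝ ∞ fun x : E ↦ (x - x₀, F₀)).contDiffOn hmem
  have hFr : ∀ x ∈ ball x₀ r, fderiv ℝ F x (x - x₀) = -(Γ x (x - x₀) ∘L F x) := by
    intro x hx
    have h1 : HasFDerivAt α (fderiv ℝ α (x - x₀, F₀)) (x - x₀, F₀) :=
      ((hα.contDiffAt (isOpen_ball.mem_nhds (hmem x hx))).differentiableAt (by simp)).hasFDerivAt
    have h2 : HasFDerivAt (fun x : E ↦ (x - x₀, F₀)) (ContinuousLinearMap.inl ℝ E (E →L[ℝ] E)) x :=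
      ((hasFDerivAt_id x).sub_const x₀).prodMk (hasFDerivAt_const F₀ x)
    have h3 : HasFDerivAt F _ x := h1.comp x h2
    rw [h3.fderiv]
    have h4 := (hαr _ (hmem x hx)).2
    simpa [F] using h4
  refine ⟨r, hr, hrV, F, hF, ?_, fun z hz t ht ↦ ?_⟩
  · have := hα0 (x₀ - x₀, F₀) (hmem x₀ (mem_ball_self hr)) (by simp)
    exact this
  have hseg : ∀ t ∈ Icc (0 : ℝ) 1, x₀ + t • z ∈ ball x₀ r := by
    intro t ht
    rw [mem_ball_zero_iff] at hz
    rw [mem_ball, dist_self_add_left, norm_smul, Real.norm_of_nonneg ht.1]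
    exact lt_of_le_of_lt (mul_le_of_le_one_left (norm_nonneg _) ht.2) hz
  let N : ℝ → E →L[ℝ] E := fun t ↦ fderiv ℝ F (x₀ + t • z) z + Γ (x₀ + t • z) z ∘L F (x₀ + t • z)
  have hpos : ∀ t ∈ Ioc (0 : ℝ) 1, N t = 0 := by
    intro t ht
    have h1 := hFr _ (hseg t ⟨ht.1.le, ht.2⟩)
    rw [add_sub_cancel_left, map_smul, map_smul] at h1
    have h2 : t • N t = 0 := by
      simp only [N, smul_add]
      rw [h1, ContinuousLinearMap.smul_comp, neg_add_cancel]
    exact (smul_eq_zero.1 h2).resolve_left ht.1.ne'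
  -- The radial equation at `x₀ + t • z` concerns the vector `t • z`. Dividing by `t` settles `t >
  -- 0`, and continuity settles `t = 0`.
  rcases eq_or_lt_of_le ht.1 with h0 | h0
  · subst h0
    have hcont : ContinuousWithinAt N (Ioc 0 1) 0 := by
      have hc : ContinuousOn N (Icc 0 1) := by
        have hline : ContinuousOn (fun t : ℝ ↦ x₀ + t • z) (Icc 0 1) := by fun_prop
        have hdF := (hF.continuousOn_fderiv_of_isOpen isOpen_ball (by simp)).comp hline hseg
        have hΓc := (hΓ.continuousOn.mono hrV).comp hline hseg
        have hFc := hF.continuousOn.comp hline hseg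
        exact (hdF.clm_apply continuousOn_const).add
          ((hΓc.clm_apply continuousOn_const).clm_comp hFc)
      exact (hc 0 (by simp)).mono Ioc_subset_Icc_self
    have hmemc : (0 : ℝ) ∈ closure (Ioc (0 : ℝ) 1) := by
      rw [closure_Ioc (by norm_num)]; simp
    have := hcont.mem_closure hmemc (t := {0}) (fun t ht ↦ hpos t ht)
    simpa [N] using this
  · exact hpos t ⟨h0, ht.2⟩

/-- Every adapted frame at a point extends to a smooth adapted frame that is parallel along the
rays through the point. -/
theorem exists_radial_coframe {G : E7 → E7 →L[ℝ] E7 →L[ℝ] ℝ} {V : Set E7} (hV : IsOpen V)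
    (hG : ContDiffOn ℝ ∞ G V) (hsymm : ∀ x ∈ V, ∀ v w, G x v w = G x w v)
    (hnd : ∀ x ∈ V, ∀ v, G x v = 0 → v = 0) {x₀ : E7} (hx₀ : x₀ ∈ V) {b₀ : E7 →L[ℝ] E7}
    (hb₀ : ∀ v w, G x₀ v w = form43 (b₀ v) (b₀ w)) :
    ∃ r > 0, ball x₀ r ⊆ V ∧ ∃ B Θ, IsLCCoframe (fun x v w ↦ G x v w) (ball x₀ r) B Θ ∧
      B x₀ = b₀ ∧ Θ x₀ = 0 ∧ ∀ z ∈ ball 0 r, ∀ t ∈ Icc (0 : ℝ) 1, Θ (x₀ + t • z) z = 0 := by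
  obtain ⟨S₀, hS₀⟩ : b₀.IsInvertible := isInvertible_of_ker rfl fun v hv ↦
    hnd _ hx₀ v (by ext1 w; rw [hb₀, hv, form43_zero_left]; rfl)
  obtain ⟨Γ, hΓs, hΓsymm, hcompat⟩ := exists_christoffel hV hG hsymm hnd
  obtain ⟨r, hr, hrV, F, hF, hF₀, hFr⟩ := exists_radial_frame hV hΓs hx₀ (S₀.symm : E7 →L[ℝ] E7)
  have hGd : ∀ x ∈ V, HasFDerivAt G (fderiv ℝ G x) x := fun x hx ↦
    ((hG.contDiffAt (hV.mem_nhds hx)).differentiableAt (by simp)).hasFDerivAt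
  have hFd : ∀ x ∈ ball x₀ r, HasFDerivAt F (fderiv ℝ F x) x := fun x hx ↦
    ((hF.contDiffAt (isOpen_ball.mem_nhds hx)).differentiableAt (by simp)).hasFDerivAt
  let N : E7 → E7 →L[ℝ] E7 →L[ℝ] E7 := fun x ↦
    fderiv ℝ F x + (ContinuousLinearMap.compL ℝ E7 E7 E7).flip (F x) ∘L Γ x
  have hN : ∀ x v a, N x v a = fderiv ℝ F x v a + Γ x v (F x a) := fun _ _ _ ↦ rfl
  have hNs : ContDiffOn ℝ ∞ N (ball x₀ r) :=
    (hF.fderiv_of_isOpen isOpen_ball (by simp)).add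
      (((ContinuousLinearMap.compL ℝ E7 E7 E7).flip.contDiff.comp_contDiffOn hF).clm_comp
        (hΓs.mono hrV))
  have hNr : ∀ z ∈ ball 0 r, ∀ t ∈ Icc (0 : ℝ) 1, N (x₀ + t • z) z = 0 := hFr
  -- At the centre every direction is radial after rescaling, so the covariant derivative `N` of the
  -- frame vanishes there altogether.
  have hN₀ : N x₀ = 0 := by
    ext1 z
    obtain ⟨c, hc, hcz⟩ : ∃ c : ℝ, 0 < c ∧ c • z ∈ ball (0 : E7) r := by
      refine ⟨r / (‖z‖ + 1), by positivity, ?_⟩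
      rw [mem_ball_zero_iff, norm_smul, Real.norm_of_nonneg (by positivity), div_mul_eq_mul_div,
        div_lt_iff₀ (by positivity)]
      nlinarith [norm_nonneg z]
    have := hNr _ hcz 0 (by simp)
    rw [zero_smul, add_zero, map_smul] at this
    exact (smul_eq_zero.1 this).resolve_left hc.ne'
  have hGF : ∀ a b, ∀ x ∈ ball x₀ r, HasFDerivAt (fun y ↦ G y (F y a) (F y b))
      (((fderiv ℝ G x).flip (F x a)).flip (F x b)
        + (G x).flip (F x b) ∘L (fderiv ℝ F x).flip a + G x (F x a) ∘L (fderiv ℝ F x).flip b) x := by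
    intro a b x hx
    have ha := (hFd x hx).clm_apply (hasFDerivAt_const a x)
    have hb := (hFd x hx).clm_apply (hasFDerivAt_const b x)
    refine (((hGd x (hrV hx)).clm_apply ha).clm_apply hb).congr_fderiv ?_
    ext1 v
    simp
    ring
  -- Compatibility of `Γ` with `G` makes scalar products of the frame vectors constant along each
  -- ray, so the frame stays adapted.
  have hconst : ∀ a b, ∀ x ∈ ball x₀ r, G x (F x a) (F x b) = form43 a b := by
    intro a b x hx
    obtain ⟨z, rfl⟩ : ∃ z, x = x₀ + z := ⟨x - x₀, by simp⟩
    have hz : z ∈ ball (0 : E7) r := by simpa [mem_ball, dist_eq_norm] using hx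
    have hseg : ∀ t ∈ Icc (0 : ℝ) 1, x₀ + t • z ∈ ball x₀ r := by
      intro t ht
      rw [mem_ball_zero_iff] at hz
      rw [mem_ball, dist_self_add_left, norm_smul, Real.norm_of_nonneg ht.1]
      exact lt_of_le_of_lt (mul_le_of_le_one_left (norm_nonneg _) ht.2) hz
    have hline : ∀ t : ℝ, HasDerivAt (fun t : ℝ ↦ x₀ + t • z) z t := fun t ↦ by
      simpa using ((hasDerivAt_id t).smul_const z).const_add x₀
    have hder : ∀ t ∈ Icc (0 : ℝ) 1, HasDerivAt
        (fun t : ℝ ↦ G (x₀ + t • z) (F (x₀ + t • z) a) (F (x₀ + t • z) b)) 0 t := by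
      intro t ht
      have h1 := (hGF a b _ (hseg t ht)).comp_hasDerivAt t (hline t)
      refine h1.congr_deriv ?_
      have h2 := fun c ↦ DFunLike.congr_fun (hNr z hz t ht) c
      simp only [hN] at h2
      have h3 : ∀ c, fderiv ℝ F (x₀ + t • z) z c
          = -Γ (x₀ + t • z) z (F (x₀ + t • z) c) := fun c ↦ eq_neg_of_add_eq_zero_left (h2 c)
      simp only [add_apply, ContinuousLinearMap.comp_apply, ContinuousLinearMap.flip_apply, h3,
        hcompat _ (hrV (hseg t ht)), map_neg]
      ring
    have := constant_of_has_deriv_right_zero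
      (fun t ht ↦ (hder t ht).continuousAt.continuousWithinAt)
      (fun t ht ↦ (hder t ⟨ht.1, ht.2.le⟩).hasDerivWithinAt) 1 (by simp)
    rw [zero_smul, add_zero, one_smul, hF₀, hb₀, ← hS₀] at this
    simpa using this
  have hFinv : ∀ x ∈ ball x₀ r, (F x).IsInvertible := fun x hx ↦ isInvertible_of_ker rfl
    fun v hv ↦ eq_zero_of_form43_eq_zero fun b ↦ by
      rw [← hconst v b x hx, hv, map_zero]; rfl
  have hFB : ∀ x ∈ ball x₀ r, (∀ a, F x ((F x).inverse a) = a) ∧ ∀ a, (F x).inverse (F x a) = a := by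
    intro x hx
    obtain ⟨S, hS⟩ := hFinv x hx
    simp [← hS]
  let B : E7 → E7 →L[ℝ] E7 := fun x ↦ (F x).inverse
  have hBs : ContDiffOn ℝ ∞ B (ball x₀ r) := contDiffOn_inverse_of_isInvertible hF hFinv
  let Θ : E7 → E7 →L[ℝ] E7 →L[ℝ] E7 := fun x ↦ ContinuousLinearMap.compL ℝ E7 E7 E7 (B x) ∘L N x
  have hΘ : ∀ x v a, Θ x v a = B x (N x v a) := fun _ _ _ ↦ rfl
  have hBd : ∀ x ∈ ball x₀ r, ∀ v a, fderiv ℝ B x v (F x a) = -B x (fderiv ℝ F x v a) := by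
    intro x hx v a
    have h1 : HasFDerivAt B (fderiv ℝ B x) x :=
      ((hBs.contDiffAt (isOpen_ball.mem_nhds hx)).differentiableAt (by simp)).hasFDerivAt
    have h2 := h1.clm_apply ((hFd x hx).clm_apply (hasFDerivAt_const a x))
    have h3 := h2.congr_of_eventuallyEq (f₁ := fun _ ↦ a) (by
      filter_upwards [isOpen_ball.mem_nhds hx] with y hy using ((hFB y hy).2 a).symm)
    have h4 := DFunLike.congr_fun (h3.unique (hasFDerivAt_const a x)) v
    simp at h4
    rw [add_comm] at h4
    exact eq_neg_of_add_eq_zero_left h4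
  have hm : ∀ x ∈ ball x₀ r, ∀ v w, G x v w = form43 (B x v) (B x w) := fun x hx v w ↦ by
    rw [← hconst _ _ x hx, (hFB x hx).1, (hFB x hx).1]
  refine ⟨r, hr, hrV, B, Θ, ⟨isOpen_ball, hBs, ?_, fun x hx ↦ ?_, hm, fun x hx v a b ↦ ?_,
    fun x hx v w ↦ ?_⟩, ?_, ?_, fun z hz t ht ↦ ?_⟩
  · exact ((ContinuousLinearMap.compL ℝ E7 E7 E7).contDiff.comp_contDiffOn hBs).clm_comp hNs
  · obtain ⟨S, hS⟩ := hFinv x hx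
    exact ⟨S.symm, by simp [B, ← hS]⟩
  · have h1 := (hGF a b x hx).congr_of_eventuallyEq (f₁ := fun _ ↦ form43 a b) (by
      filter_upwards [isOpen_ball.mem_nhds hx] with y hy using (hconst a b y hy).symm)
    have h2 := DFunLike.congr_fun (h1.unique (hasFDerivAt_const _ x)) v
    simp only [add_apply, ContinuousLinearMap.comp_apply, ContinuousLinearMap.flip_apply,
      hcompat x (hrV hx), zero_apply] at h2
    have h3 : form43 (Θ x v a) b = G x (N x v a) (F x b) := by
      rw [hm x hx, hΘ]; simp only [B]; rw [(hFB x hx).2]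
    have h4 : form43 a (Θ x v b) = G x (F x a) (N x v b) := by
      rw [hm x hx, hΘ]; simp only [B]; rw [(hFB x hx).2]
    rw [h3, h4, hN, hN, map_add, map_add, add_apply]
    linarith
  · have h1 : ∀ v w, fderiv ℝ B x v w + Θ x v (B x w) = B x (Γ x v w) := by
      intro v w
      have h2 := hBd x hx v (B x w)
      rw [show F x (B x w) = w from (hFB x hx).1 w] at h2
      rw [h2, hΘ, hN, show F x (B x w) = w from (hFB x hx).1 w, map_add, neg_add_cancel_left]
    rw [h1, h1, hΓsymm x (hrV hx)]
  · simp [B, hF₀, hS₀]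
  · ext1 v
    simp [Θ, hN₀]
  · ext1 a
    rw [hΘ, hNr z hz t ht]; simp

end Radial

/-! ### Parallel fields in coframes -/

namespace IsLCCoframe

variable {G : E7 → E7 → E7 → ℝ} {V : Set E7} {B B' : E7 → E7 →L[ℝ] E7}
  {Θ Θ' : E7 → E7 →L[ℝ] E7 →L[ℝ] E7}

theorem inverse_apply (h : IsLCCoframe G V B Θ) {x : E7} (hx : x ∈ V) (a : E7) :
    (B x).inverse (B x a) = a := by
  obtain ⟨S, hS⟩ := h.invertible x hx
  simp [← hS]

/-- The equation for parallel fields in terms of the components with respect to a coframe. -/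
theorem parallel_iff (h : IsLCCoframe G V B Θ) {x : E7} (hx : x ∈ V) (c' y y' : E7) :
    (∀ z, G x y' z + (1 / 2) * (fderiv ℝ (fun x' ↦ G x' y z) x c'
      + fderiv ℝ (fun x' ↦ G x' c' z) x y - fderiv ℝ (fun x' ↦ G x' c' y) x z) = 0) ↔
    fderiv ℝ B x c' y + B x y' + Θ x c' (B x y) = 0 := by
  have key : ∀ z, G x y' z + (1 / 2) * (fderiv ℝ (fun x' ↦ G x' y z) x c'
      + fderiv ℝ (fun x' ↦ G x' c' z) x y - fderiv ℝ (fun x' ↦ G x' c' y) x z)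
      = form43 (fderiv ℝ B x c' y + B x y' + Θ x c' (B x y)) (B x z) := by
    intro z
    rw [h.koszul hx, h.metric x hx, ← form43_add_left]
    congr 1
    abel
  simp only [key]
  constructor
  · intro H
    refine eq_zero_of_form43_eq_zero fun b ↦ ?_
    have := H ((B x).inverse b)
    rwa [h.apply_inverse hx] at this
  · intro H z
    rw [H, form43_zero_left]

theorem hasDerivWithinAt_apply (h : IsLCCoframe G V B Θ) {c y : ℝ → E7} {c' y' : E7} {s : Set ℝ}
    {t : ℝ} (hc : HasDerivWithinAt c c' s t) (hy : HasDerivWithinAt y y' s t) (ht : c t ∈ V) :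
    HasDerivWithinAt (fun τ ↦ B (c τ) (y τ)) (fderiv ℝ B (c t) c' (y t) + B (c t) y') s t :=
  ((h.hasFDerivAt ht).comp_hasDerivWithinAt t hc).clm_apply hy

/-- The change of coframe between two coframes of the same metric. -/
theorem transition (h : IsLCCoframe G V B Θ) (h' : IsLCCoframe G V B' Θ') :
    ContDiffOn ℝ ∞ (fun x ↦ B' x ∘L (B x).inverse) V ∧
    (∀ x ∈ V, ∀ v, (B' x ∘L (B x).inverse) (B x v) = B' x v) ∧
    (∀ x ∈ V, ∀ a b, form43 ((B' x ∘L (B x).inverse) a) ((B' x ∘L (B x).inverse) b)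
      = form43 a b) ∧
    ∀ x ∈ V, ∀ v a, fderiv ℝ (fun x ↦ B' x ∘L (B x).inverse) x v a
      = (B' x ∘L (B x).inverse) (Θ x v a) - Θ' x v ((B' x ∘L (B x).inverse) a) := by
  have hs : ContDiffOn ℝ ∞ (fun x ↦ B' x ∘L (B x).inverse) V :=
    h'.smooth.clm_comp h.contDiffOn_inverse
  have hSB : ∀ x ∈ V, ∀ v, (B' x ∘L (B x).inverse) (B x v) = B' x v := fun x hx v ↦ by
    rw [ContinuousLinearMap.comp_apply, h.inverse_apply hx]
  have hform : ∀ x ∈ V, ∀ a b, form43 ((B' x ∘L (B x).inverse) a) ((B' x ∘L (B x).inverse) b)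
      = form43 a b := by
    intro x hx a b
    rw [ContinuousLinearMap.comp_apply, ContinuousLinearMap.comp_apply, ← h'.metric x hx,
      h.metric x hx, h.apply_inverse hx, h.apply_inverse hx]
  refine ⟨hs, hSB, hform, fun x hx v a ↦ ?_⟩
  obtain ⟨w, rfl⟩ : ∃ w, B x w = a := ⟨_, h.apply_inverse hx a⟩
  have hS : HasFDerivAt (fun x ↦ B' x ∘L (B x).inverse) _ x :=
    ((hs.contDiffAt (h.isOpen.mem_nhds hx)).differentiableAt (by simp)).hasFDerivAt
  have h1 := hS.clm_apply ((h.hasFDerivAt hx).clm_apply (hasFDerivAt_const w x))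
  have h2 := ((h'.hasFDerivAt hx).clm_apply (hasFDerivAt_const w x)).congr_of_eventuallyEq
    (f₁ := fun x ↦ (B' x ∘L (B x).inverse) (B x w)) (by
      filter_upwards [h.isOpen.mem_nhds hx] with y hy using hSB y hy w)
  have h3 := DFunLike.congr_fun (h1.unique h2) v
  simp only [add_apply, ContinuousLinearMap.comp_apply, ContinuousLinearMap.flip_apply,
    zero_apply, map_zero, zero_add] at h3
  rw [← sub_eq_zero]
  refine eq_zero_of_form43_eq_zero fun b ↦ ?_
  obtain ⟨z, rfl⟩ : ∃ z, B' x z = b := ⟨_, h'.apply_inverse hx b⟩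
  -- The left side of the Koszul formula involves only the metric. Comparing its right sides in the
  -- two coframes gives the transformation law of the connection forms.
  have k1 := h.koszul hx v w z
  rw [h'.koszul hx v w z, ← hform x hx (fderiv ℝ B x v w + Θ x v (B x w)), hSB x hx, ← h3,
    ← sub_eq_zero, ← form43_sub_left] at k1
  rw [← k1]
  congr 1
  rw [map_add, ContinuousLinearMap.comp_apply, ContinuousLinearMap.comp_apply,
    ContinuousLinearMap.comp_apply, h.inverse_apply hx]
  abel

end IsLCCoframe

section Frames

set_option linter.unusedSectionVars false

variable {M : Type*} [TopologicalSpace M] [ChartedSpace E7 M] [IsManifold 𝓘(ℝ, E7) ∞ M]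
  {g : Metric43 M} {e e' : OpenPartialHomeomorph M E7} {V : Set E7} {B : E7 → E7 →L[ℝ] E7}
  {Θ : E7 → E7 →L[ℝ] E7 →L[ℝ] E7}

/-- The components of tangent vectors with respect to a coframe in a chart. -/
noncomputable def frameAt (e : OpenPartialHomeomorph M E7) (B : E7 → E7 →L[ℝ] E7) (p : M) :
    T7 p →ₗ[ℝ] E7 :=
  let A : T7 p →L[ℝ] E7 := mfderiv 𝓘(ℝ, E7) 𝓘(ℝ, E7) e p
  (B (e p) : E7 →ₗ[ℝ] E7) ∘ₗ (A : T7 p →ₗ[ℝ] E7)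

theorem frameAt_apply (p : M) (v : T7 p) : frameAt e B p v = B (e p) (chartVec e p v) := rfl

theorem frameAt_mfderiv_symm (he : e ∈ IsManifold.maximalAtlas 𝓘(ℝ, E7) ∞ M) {x : E7}
    (hx : x ∈ e.target) (v : E7) :
    frameAt e B (e.symm x) (mfderiv 𝓘(ℝ, E7) 𝓘(ℝ, E7) e.symm x v) = B x v := by
  rw [frameAt_apply, chartVec_mfderiv_symm he hx, e.right_inv hx]

theorem inner_eq_form43 (he : e ∈ IsManifold.maximalAtlas 𝓘(ℝ, E7) ∞ M)
    (h : IsLCCoframe (g.inChart e) V B Θ) {p : M} (hp : p ∈ e.source) (hpV : e p ∈ V)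
    (v w : T7 p) : g.inner p v w = form43 (frameAt e B p v) (frameAt e B p w) := by
  rw [inner_eq_inChart g he hp, h.metric _ hpV]; rfl

theorem frameAt_bijective (he : e ∈ IsManifold.maximalAtlas 𝓘(ℝ, E7) ∞ M)
    (h : IsLCCoframe (g.inChart e) V B Θ) {p : M} (hp : p ∈ e.source) (hpV : e p ∈ V) :
    Function.Bijective (frameAt e B p) := by
  obtain ⟨S, hS⟩ := h.invertible _ hpV
  have h1 := (mdifferentiable_of_mem_maximalAtlas he).mfderiv_bijective hp
  have h2 : Function.Bijective (B (e p)) := by rw [← hS]; exact S.bijective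
  exact h2.comp h1

/-- `frameAt` as an isomorphism. -/
noncomputable def frameEquiv (he : e ∈ IsManifold.maximalAtlas 𝓘(ℝ, E7) ∞ M)
    (h : IsLCCoframe (g.inChart e) V B Θ) {p : M} (hp : p ∈ e.source) (hpV : e p ∈ V) :
    T7 p ≃ₗ[ℝ] E7 :=
  LinearEquiv.ofBijective (frameAt e B p) (frameAt_bijective he h hp hpV)

theorem frameEquiv_apply (he : e ∈ IsManifold.maximalAtlas 𝓘(ℝ, E7) ∞ M)
    (h : IsLCCoframe (g.inChart e) V B Θ) {p : M} (hp : p ∈ e.source) (hpV : e p ∈ V) (v : T7 p) :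
    frameEquiv he h hp hpV v = frameAt e B p v := rfl

/-- The components of a parallel field satisfy a linear differential equation. -/
theorem Metric43.IsParallelAlong.frameAt_deriv {γ : ℝ → M} {Y : ∀ t, T7 (γ t)}
    (hY : g.IsParallelAlong γ Y) (he : e ∈ IsManifold.maximalAtlas 𝓘(ℝ, E7) ∞ M)
    (h : IsLCCoframe (g.inChart e) V B Θ) {t : ℝ} (ht : t ∈ Icc (0 : ℝ) 1) (hγ : γ t ∈ e.source)
    (hγV : e (γ t) ∈ V) :
    ∃ c', HasDerivWithinAt (fun s ↦ e (γ s)) c' (Icc 0 1) t ∧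
      HasDerivWithinAt (fun s ↦ frameAt e B (γ s) (Y s))
        (-Θ (e (γ t)) c' (frameAt e B (γ t) (Y t))) (Icc 0 1) t := by
  obtain ⟨c', y', hc, hy, hz⟩ := hY t ht e he hγ
  refine ⟨c', hc, (h.hasDerivWithinAt_apply hc hy hγV).congr_deriv ?_⟩
  exact eq_neg_of_add_eq_zero_left ((h.parallel_iff hγV _ _ _).1 hz)

theorem transition_comp_transition (he : e ∈ IsManifold.maximalAtlas 𝓘(ℝ, E7) ∞ M)
    (he' : e' ∈ IsManifold.maximalAtlas 𝓘(ℝ, E7) ∞ M) {x : E7}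
    (hx : x ∈ e.target ∩ e.symm ⁻¹' e'.source) (v : E7) :
    fderiv ℝ (fun x ↦ e (e'.symm x)) (e' (e.symm x)) (fderiv ℝ (fun x ↦ e' (e.symm x)) x v)
      = v := by
  have hp : e.symm x ∈ e.source := e.map_target hx.1
  have h1 := chartVec_transition he he' hp hx.2 (mfderiv 𝓘(ℝ, E7) 𝓘(ℝ, E7) e.symm x v)
  have h2 := chartVec_transition he' he hx.2 hp (mfderiv 𝓘(ℝ, E7) 𝓘(ℝ, E7) e.symm x v)
  rw [chartVec_mfderiv_symm he hx.1, e.right_inv hx.1] at h1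
  rw [chartVec_mfderiv_symm he hx.1, h1] at h2
  exact h2.symm

/-- A field with constant components along a curve on which the connection form vanishes is
parallel. -/
theorem isParallelAlong_of_frame (he : e ∈ IsManifold.maximalAtlas 𝓘(ℝ, E7) ∞ M)
    (h : IsLCCoframe (g.inChart e) V B Θ) (hVe : V ⊆ e.target) {c : ℝ → E7} (hc : ContDiff ℝ ∞ c)
    (hcV : ∀ t ∈ Icc (0 : ℝ) 1, c t ∈ V) (hΘ : ∀ t ∈ Icc (0 : ℝ) 1, Θ (c t) (deriv c t) = 0)
    (a : E7) : g.IsParallelAlong (fun t ↦ e.symm (c t))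
      (fun t ↦ mfderiv 𝓘(ℝ, E7) 𝓘(ℝ, E7) e.symm (c t) ((B (c t)).inverse a)) := by
  intro t ht e' he' hγ
  let κ : E7 → E7 := fun x ↦ e' (e.symm x)
  let κ' : E7 → E7 := fun x ↦ e (e'.symm x)
  have hκs := contDiffOn_transition he he'
  have hκs' := contDiffOn_transition he' he
  have hTo := isOpen_transition_source e e'
  have hTo' := isOpen_transition_source e' e
  have hcT : c t ∈ V ∩ (e.target ∩ e.symm ⁻¹' e'.source) := ⟨hcV t ht, hVe (hcV t ht), hγ⟩
  -- Parallelism has to be verified in every chart `e'`. The coframe and its connection form are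
  -- therefore pulled back to `e'`, where the field again has constant components.
  have hV'o : IsOpen ((e'.target ∩ e'.symm ⁻¹' e.source) ∩ κ' ⁻¹' V) :=
    hκs'.continuousOn.isOpen_inter_preimage hTo' h.isOpen
  have h' : IsLCCoframe (g.inChart e') _ _ _ := h.pullback hV'o (hκs'.mono inter_subset_left)
    (fun x hx ↦ hx.2) (fun x hx ↦ isInvertible_transition he' he hx.1)
    (fun x hx v w ↦ inChart_transition g he' he hx.1 v w)
  have hκ'κ : ∀ x ∈ e.target ∩ e.symm ⁻¹' e'.source, κ' (κ x) = x := fun x hx ↦ by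
    simp only [κ, κ']
    rw [e'.left_inv hx.2, e.right_inv hx.1]
  have hmem : ∀ x ∈ V ∩ (e.target ∩ e.symm ⁻¹' e'.source),
      κ x ∈ (e'.target ∩ e'.symm ⁻¹' e.source) ∩ κ' ⁻¹' V := fun x hx ↦
    ⟨⟨e'.map_source hx.2.2, by
      simp only [κ, mem_preimage]; rw [e'.left_inv hx.2.2]; exact e.map_target hx.2.1⟩, by
      rw [mem_preimage, hκ'κ x hx.2]; exact hx.1⟩
  have hnear : ∀ᶠ s in 𝓝 t, c s ∈ V ∩ (e.target ∩ e.symm ⁻¹' e'.source) :=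
    hc.continuous.continuousAt.eventually ((h.isOpen.inter hTo).mem_nhds hcT)
  have hcd : HasDerivAt c (deriv c t) t :=
    ((hc.contDiffAt (x := t)).differentiableAt (by simp)).hasDerivAt
  have hκd : HasFDerivAt κ (fderiv ℝ κ (c t)) (c t) :=
    ((hκs.contDiffAt (hTo.mem_nhds hcT.2)).differentiableAt (by simp)).hasFDerivAt
  have hck : HasDerivAt (fun s ↦ κ (c s)) (fderiv ℝ κ (c t) (deriv c t)) t :=
    hκd.comp_hasDerivAt t hcd
  -- the components of the field in the chart `e'`
  have hcomp : ∀ s, c s ∈ V ∩ (e.target ∩ e.symm ⁻¹' e'.source) →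
      chartVec e' (e.symm (c s)) (mfderiv 𝓘(ℝ, E7) 𝓘(ℝ, E7) e.symm (c s) ((B (c s)).inverse a))
        = fderiv ℝ κ (c s) ((B (c s)).inverse a) := by
    intro s hs
    rw [chartVec_transition he he' (e.map_target hs.2.1) hs.2.2, chartVec_mfderiv_symm he hs.2.1,
      e.right_inv hs.2.1]
  obtain ⟨y', hy'⟩ : ∃ y', HasDerivAt (fun s ↦ fderiv ℝ κ (c s) ((B (c s)).inverse a)) y' t := by
    have h1 : DifferentiableAt ℝ (fderiv ℝ κ) (c t) :=
      ((hκs.fderiv_of_isOpen hTo (m := ∞) (by simp)).contDiffAt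
        (hTo.mem_nhds hcT.2)).differentiableAt (by simp)
    have h2 : DifferentiableAt ℝ (fun x ↦ (B x).inverse) (c t) :=
      (h.contDiffOn_inverse.contDiffAt (h.isOpen.mem_nhds hcT.1)).differentiableAt (by simp)
    have h3 : DifferentiableAt ℝ (fun x ↦ fderiv ℝ κ x ((B x).inverse a)) (c t) :=
      h1.clm_apply (h2.clm_apply (differentiableAt_const a))
    exact ⟨_, h3.hasFDerivAt.comp_hasDerivAt t hcd⟩
  have hy : HasDerivAt (fun s ↦ chartVec e' (e.symm (c s))
      (mfderiv 𝓘(ℝ, E7) 𝓘(ℝ, E7) e.symm (c s) ((B (c s)).inverse a))) y' t :=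
    hy'.congr_of_eventuallyEq (by filter_upwards [hnear] with s hs using hcomp s hs)
  refine ⟨_, y', hck.hasDerivWithinAt, hy.hasDerivWithinAt, ?_⟩
  refine (h'.parallel_iff (hmem _ hcT) _ _ _).2 ?_
  have hconst := (h'.hasDerivWithinAt_apply (s := univ) hck.hasDerivWithinAt hy.hasDerivWithinAt
    (hmem _ hcT)).hasDerivAt univ_mem
  have hconst' : HasDerivAt (fun s ↦ (B (κ' (κ (c s))) ∘L fderiv ℝ κ' (κ (c s)))
      (chartVec e' (e.symm (c s))
        (mfderiv 𝓘(ℝ, E7) 𝓘(ℝ, E7) e.symm (c s) ((B (c s)).inverse a)))) 0 t := by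
    refine (hasDerivAt_const t a).congr_of_eventuallyEq ?_
    filter_upwards [hnear] with s hs
    rw [hcomp s hs, ContinuousLinearMap.comp_apply, transition_comp_transition he he' hs.2,
      hκ'κ _ hs.2, h.apply_inverse hs.1]
  rw [hconst.unique hconst', zero_add, ContinuousLinearMap.comp_apply]
  have hΘ0 : fderiv ℝ κ' (κ (c t)) (fderiv ℝ κ (c t) (deriv c t)) = deriv c t :=
    transition_comp_transition he he' hcT.2 _
  change Θ (κ' (κ (c t))) (fderiv ℝ κ' (κ (c t)) (fderiv ℝ κ (c t) (deriv c t))) _ = 0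
  rw [hΘ0, hκ'κ _ hcT.2, hΘ t ht, zero_apply]

/-- Parallel transport along a curve on which the connection form vanishes. -/
theorem isTransport_of_frame (he : e ∈ IsManifold.maximalAtlas 𝓘(ℝ, E7) ∞ M)
    (h : IsLCCoframe (g.inChart e) V B Θ) (hVe : V ⊆ e.target) {U : Set M}
    (hVU : ∀ x ∈ V, e.symm x ∈ U) {c : ℝ → E7} (hc : ContDiff ℝ ∞ c)
    (hcV : ∀ t ∈ Icc (0 : ℝ) 1, c t ∈ V) (hΘ : ∀ t ∈ Icc (0 : ℝ) 1, Θ (c t) (deriv c t) = 0)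
    {p q : M} (hp : e.symm (c 0) = p) (hq : e.symm (c 1) = q) {A : T7 p →ₗ[ℝ] T7 q}
    (hA : ∀ v, frameAt e B q (A v) = frameAt e B p v) : g.IsTransport U p q A := by
  subst hp hq
  have h0 : c 0 ∈ V := hcV 0 (by simp)
  have h1 : c 1 ∈ V := hcV 1 (by simp)
  have hinj : ∀ t ∈ Icc (0 : ℝ) 1, Function.Injective (frameAt e B (e.symm (c t))) := fun t ht ↦
    (frameAt_bijective he h (e.map_target (hVe (hcV t ht)))
      (by rw [e.right_inv (hVe (hcV t ht))]; exact hcV t ht)).1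
  have hfr : ∀ a, ∀ t ∈ Icc (0 : ℝ) 1, frameAt e B (e.symm (c t))
      (mfderiv 𝓘(ℝ, E7) 𝓘(ℝ, E7) e.symm (c t) ((B (c t)).inverse a)) = a := fun a t ht ↦ by
    rw [frameAt_mfderiv_symm he (hVe (hcV t ht)), h.apply_inverse (hcV t ht)]
  have := Metric43.IsTransport.append (g := g) (U := U) (p := e.symm (c 0)) (fun t ↦ e.symm (c t))
    LinearMap.id A (.refl (hVU _ h0))
    ((contMDiffOn_symm_of_mem_maximalAtlas he).comp hc.contMDiff.contMDiffOn
      fun t ht ↦ hVe (hcV t ht))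
    (fun t ht ↦ hVU _ (hcV t ht))
    (fun v ↦ ⟨_, isParallelAlong_of_frame he h hVe hc hcV hΘ (frameAt e B (e.symm (c 0)) v),
      hinj 0 (by simp) (hfr _ 0 (by simp)),
      hinj 1 (by simp) ((hfr _ 1 (by simp)).trans (hA v).symm)⟩)
  rwa [LinearMap.comp_id] at this

end Frames

/-! ### Frames related by parallel transport -/

section FrameRel

set_option linter.unusedSectionVars false

variable {M : Type*} [TopologicalSpace M] [ChartedSpace E7 M] [IsManifold 𝓘(ℝ, E7) ∞ M]
  {g : Metric43 M} {U : Set M} {p q r : M}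

theorem Metric43.IsTransport.comp {A : T7 p →ₗ[ℝ] T7 q} {C : T7 q →ₗ[ℝ] T7 r}
    (hA : g.IsTransport U p q A) (hC : g.IsTransport U q r C) :
    g.IsTransport U p r (C ∘ₗ A) := by
  induction hC with
  | refl _ => exact hA
  | append γ C₁ C₂ _ hγ hγU hpar ih =>
    rw [LinearMap.comp_assoc]
    exact .append γ _ _ ih hγ hγU hpar

/-- The frames `φ` at `p` and `ψ` at `q` are related by parallel transport in `U`, in both
directions. -/
def Metric43.FrameRel (g : Metric43 M) (U : Set M) (φ : T7 p ≃ₗ[ℝ] E7) (ψ : T7 q ≃ₗ[ℝ] E7) :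
    Prop :=
  g.IsTransport U p q (φ.trans ψ.symm) ∧ g.IsTransport U q p (ψ.trans φ.symm)

/-- The frame `φ` identifies `g` with `form43`. -/
def Metric43.IsIsoFrame (g : Metric43 M) (φ : T7 p ≃ₗ[ℝ] E7) : Prop :=
  ∀ v w, g.inner p v w = form43 (φ v) (φ w)

namespace Metric43.FrameRel

variable {φ : T7 p ≃ₗ[ℝ] E7} {ψ : T7 q ≃ₗ[ℝ] E7} {χ : T7 r ≃ₗ[ℝ] E7}

theorem refl (hp : p ∈ U) : g.FrameRel U φ φ := by
  have h : g.IsTransport U p p (φ.trans φ.symm : T7 p ≃ₗ[ℝ] T7 p) := by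
    rw [LinearEquiv.self_trans_symm]; exact .refl hp
  exact ⟨h, h⟩

theorem symm (h : g.FrameRel U φ ψ) : g.FrameRel U ψ φ := ⟨h.2, h.1⟩

theorem trans (h : g.FrameRel U φ ψ) (h' : g.FrameRel U ψ χ) : g.FrameRel U φ χ := by
  have h1 := h.1.comp h'.1
  have h2 := h'.2.comp h.2
  refine ⟨?_, ?_⟩
  · convert h1 using 1
    ext v; simp
  · convert h2 using 1
    ext v; simp

theorem trans_right (h : g.FrameRel U φ ψ) (S : E7 ≃ₗ[ℝ] E7) :
    g.FrameRel U (φ.trans S) (ψ.trans S) := by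
  refine ⟨?_, ?_⟩
  · convert h.1 using 1
    ext v; simp
  · convert h.2 using 1
    ext v; simp

/-- For fixed `φ`, this and `inv` make the automorphisms `S` a group: the holonomy group read in the
frame `φ`. The inverse is at hand because `FrameRel` records transports in both directions. -/
theorem mul {S S' : E7 ≃ₗ[ℝ] E7} (h : g.FrameRel U φ (φ.trans S))
    (h' : g.FrameRel U φ (φ.trans S')) : g.FrameRel U φ (φ.trans (S'.trans S)) :=
  h.trans (h'.trans_right S)

theorem inv {S : E7 ≃ₗ[ℝ] E7} (h : g.FrameRel U φ (φ.trans S)) :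
    g.FrameRel U φ (φ.trans S.symm) := by
  have := (h.trans_right S.symm).symm
  rwa [LinearEquiv.trans_assoc, LinearEquiv.self_trans_symm, LinearEquiv.trans_refl] at this

end Metric43.FrameRel

theorem Metric43.IsIsoFrame.trans {φ : T7 p ≃ₗ[ℝ] E7} (h : g.IsIsoFrame φ) {S : E7 ≃ₗ[ℝ] E7}
    (hS : ∀ a b, form43 (S a) (S b) = form43 a b) : g.IsIsoFrame (φ.trans S) := fun v w ↦ by
  rw [LinearEquiv.trans_apply, LinearEquiv.trans_apply, hS, h]

theorem Metric43.inner_nondegenerate (g : Metric43 M) (p : M) {v : T7 p}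
    (hv : ∀ w, g.inner p v w = 0) : v = 0 := by
  obtain ⟨b, hb⟩ := g.signature p
  refine b.repr.injective (Finsupp.ext fun i ↦ ?_)
  have h := hv (b i)
  rw [← b.sum_repr v, map_sum, sum_apply] at h
  simp only [map_smul, smul_apply, hb, smul_eq_mul, mul_ite, mul_zero, Finset.sum_ite_eq',
    Finset.mem_univ, if_true] at h
  rw [map_zero, Finsupp.zero_apply]
  split_ifs at h <;> linarith

theorem Metric43.isIsoFrame_of_basis {b : Module.Basis (Fin 7) ℝ (T7 p)} (hb : g.IsAdapted p b) :
    g.IsIsoFrame b.equivFun := by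
  intro v w
  conv_lhs => rw [← b.sum_equivFun v, ← b.sum_equivFun w]
  conv_rhs => rw [← form43L_apply, pi_eq_sum_univ' (b.equivFun v), pi_eq_sum_univ' (b.equivFun w)]
  simp only [map_sum, sum_apply, map_smul, smul_apply]
  refine Finset.sum_congr rfl fun i _ ↦ congrArg _ (Finset.sum_congr rfl fun j _ ↦ congrArg _ ?_)
  rw [hb, form43L_apply]

theorem Metric43.isAdapted_of_isIsoFrame {φ : T7 p ≃ₗ[ℝ] E7} (hφ : g.IsIsoFrame φ) :
    g.IsAdapted p (Module.Basis.ofEquivFun φ) := fun i j ↦ by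
  rw [hφ, Module.Basis.coe_ofEquivFun, LinearEquiv.apply_symm_apply, LinearEquiv.apply_symm_apply]

/-- In each of the three hyperbolic planes of `form43`, the sum and the difference of the null
vectors, divided by `√2`, form an orthonormal basis. -/
theorem exists_diagonalizing : ∃ K : E7 ≃ₗ[ℝ] E7, ∀ a c, form43 (K a) (K c)
    = -(a 0 * c 0) - a 1 * c 1 - a 2 * c 2 - a 3 * c 3 + a 4 * c 4 + a 5 * c 5 + a 6 * c 6 := by
  let K : E7 →ₗ[ℝ] E7 :=
    { toFun a := ![(a 4 + a 0) / √2, (a 5 + a 1) / √2, (a 6 + a 2) / √2, a 3,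
        (a 4 - a 0) / √2, (a 5 - a 1) / √2, (a 6 - a 2) / √2]
      map_add' a c := by
        ext i; revert i; refine forall_fin_seven ?_ ?_ ?_ ?_ ?_ ?_ ?_ <;> simp <;> ring
      map_smul' s a := by
        ext i; revert i; refine forall_fin_seven ?_ ?_ ?_ ?_ ?_ ?_ ?_ <;> simp <;> ring }
  have h2 : √2 ≠ 0 := by positivity
  have hK : ∀ a c, form43 (K a) (K c) = -(a 0 * c 0) - a 1 * c 1 - a 2 * c 2 - a 3 * c 3
      + a 4 * c 4 + a 5 * c 5 + a 6 * c 6 := by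
    intro a c
    simp [form43, K]
    field_simp
    rw [Real.sq_sqrt (by norm_num)]
    ring
  have hinj : Function.Injective K := by
    rw [← LinearMap.ker_eq_bot, LinearMap.ker_eq_bot']
    intro a ha
    have h := fun c ↦ hK a c
    simp only [ha, form43_zero_left] at h
    ext i
    have := h (Pi.single i 1)
    revert i
    refine forall_fin_seven ?_ ?_ ?_ ?_ ?_ ?_ ?_ <;> simp <;> intro this <;> simp [this]
  exact ⟨LinearEquiv.ofInjectiveEndo K hinj, hK⟩

theorem Metric43.exists_isIsoFrame (g : Metric43 M) (p : M) :
    ∃ φ : T7 p ≃ₗ[ℝ] E7, g.IsIsoFrame φ := by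
  obtain ⟨b, hb⟩ := g.signature p
  obtain ⟨K, hK⟩ := exists_diagonalizing
  refine ⟨b.equivFun.trans K, fun v w ↦ ?_⟩
  rw [LinearEquiv.trans_apply, LinearEquiv.trans_apply, hK]
  conv_lhs => rw [← b.sum_equivFun v, ← b.sum_equivFun w]
  simp only [map_sum, sum_apply, map_smul, smul_apply, hb, smul_eq_mul, mul_ite, mul_zero]
  simp [Fin.sum_univ_succ, Fin.lt_def]
  ring

/-- If the connection form vanishes on radial vectors, then the coframe is parallel along radial
curves. -/
theorem frameRel_of_radial {e : OpenPartialHomeomorph M E7} {ρ : ℝ} {B : E7 → E7 →L[ℝ] E7}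
    {Θ : E7 → E7 →L[ℝ] E7 →L[ℝ] E7} (he : e ∈ IsManifold.maximalAtlas 𝓘(ℝ, E7) ∞ M)
    (hp : p ∈ e.source) (hq : q ∈ e.source) (h : IsLCCoframe (g.inChart e) (ball (e p) ρ) B Θ)
    (hVe : ball (e p) ρ ⊆ e.target) (hVU : ∀ x ∈ ball (e p) ρ, e.symm x ∈ U)
    (hΘ : ∀ z ∈ ball 0 ρ, ∀ t ∈ Icc (0 : ℝ) 1, Θ (e p + t • z) z = 0)
    (hqr : e q ∈ ball (e p) ρ) {φ : T7 p ≃ₗ[ℝ] E7} {ψ : T7 q ≃ₗ[ℝ] E7}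
    (hφ : ∀ v, frameAt e B p v = φ v) (hψ : ∀ v, frameAt e B q v = ψ v) : g.FrameRel U φ ψ := by
  have hz : e q - e p ∈ ball (0 : E7) ρ := by
    rwa [mem_ball_zero_iff, ← mem_ball_iff_norm]
  have hseg : ∀ t ∈ Icc (0 : ℝ) 1, e p + t • (e q - e p) ∈ ball (e p) ρ := by
    intro t ht
    rw [mem_ball_iff_norm, add_sub_cancel_left, norm_smul, Real.norm_of_nonneg ht.1]
    exact (mul_le_of_le_one_left (norm_nonneg _) ht.2).trans_lt (mem_ball_zero_iff.1 hz)
  have hd1 : ∀ t : ℝ, deriv (fun t : ℝ ↦ e p + t • (e q - e p)) t = e q - e p := fun t ↦ by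
    have := ((hasDerivAt_id t).smul_const (e q - e p)).const_add (e p)
    simpa using this.deriv
  have hd2 : ∀ t : ℝ, deriv (fun t : ℝ ↦ e p + (1 - t) • (e q - e p)) t = -(e q - e p) := fun t ↦ by
    have := (((hasDerivAt_id t).const_sub 1).smul_const (e q - e p)).const_add (e p)
    simpa using this.deriv
  refine ⟨isTransport_of_frame he h hVe hVU
      (c := fun t ↦ e p + t • (e q - e p)) (by fun_prop) hseg (fun t ht ↦ ?_) ?_ ?_ fun v ↦ ?_,
    isTransport_of_frame he h hVe hVU
      (c := fun t ↦ e p + (1 - t) • (e q - e p)) (by fun_prop)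
      (fun t ht ↦ hseg (1 - t) ⟨by linarith [ht.2], by linarith [ht.1]⟩) (fun t ht ↦ ?_) ?_ ?_
      fun v ↦ ?_⟩
  · rw [hd1]; exact hΘ _ hz t ht
  · simp [e.left_inv hp]
  · simp [e.left_inv hq]
  · simp [hψ, hφ]
  · rw [hd2, map_neg, hΘ _ hz (1 - t) ⟨by linarith [ht.2], by linarith [ht.1]⟩, neg_zero]
  · simp [e.left_inv hq]
  · simp [e.left_inv hp]
  · simp [hψ, hφ]

/-- Around every point there is a coframe which is parallel along radial curves. -/
theorem exists_radial_frames (g : Metric43 M) {e : OpenPartialHomeomorph M E7}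
    (he : e ∈ IsManifold.maximalAtlas 𝓘(ℝ, E7) ∞ M) (hU : IsOpen U) (hpU : p ∈ U)
    (hp : p ∈ e.source) {φ : T7 p ≃ₗ[ℝ] E7} (hφ : g.IsIsoFrame φ) :
    ∃ r > 0, ball (e p) r ⊆ e.target ∩ e.symm ⁻¹' U ∧ ∃ B Θ,
      IsLCCoframe (g.inChart e) (ball (e p) r) B Θ ∧ (∀ v, frameAt e B p v = φ v) ∧ Θ (e p) = 0 ∧
      ∀ q ∈ e.source, e q ∈ ball (e p) r → ∀ ψ : T7 q ≃ₗ[ℝ] E7, (∀ v, ψ v = frameAt e B q v) →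
        g.FrameRel U φ ψ := by
  have hVo : IsOpen (e.target ∩ e.symm ⁻¹' U) :=
    e.symm.continuousOn.isOpen_inter_preimage e.open_target hU
  have hd := mdifferentiable_of_mem_maximalAtlas he
  have hpV : e p ∈ e.target ∩ e.symm ⁻¹' U :=
    ⟨e.map_source hp, by rw [mem_preimage, e.left_inv hp]; exact hpU⟩
  let A : T7 p ≃ₗ[ℝ] E7 :=
    LinearEquiv.ofBijective (frameAt e (fun _ ↦ ContinuousLinearMap.id ℝ E7) p)
      (hd.mfderiv_bijective hp)
  have hA : ∀ v, A v = chartVec e p v := fun _ ↦ rfl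
  obtain ⟨b₀, hb₀A⟩ : ∃ b₀ : E7 →L[ℝ] E7, ∀ v, b₀ (chartVec e p v) = φ v :=
    ⟨LinearMap.toContinuousLinearMap ((A.symm.trans φ : E7 ≃ₗ[ℝ] E7) : E7 →ₗ[ℝ] E7), fun v ↦ by
      change φ (A.symm (A v)) = _
      rw [LinearEquiv.symm_apply_apply]⟩
  have hsymm : ∀ x ∈ e.target ∩ e.symm ⁻¹' U, ∀ v w, g.inChartL e x v w = g.inChartL e x w v :=
    fun x _ v w ↦ inChart_symm g x v w
  have hb₀ : ∀ v w, g.inChartL e (e p) v w = form43 (b₀ v) (b₀ w) := by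
    intro v w
    obtain ⟨v, rfl⟩ := A.surjective v
    obtain ⟨w, rfl⟩ := A.surjective w
    rw [Metric43.inChartL_apply, hA, hA, ← inner_eq_inChart g he hp, hφ, hb₀A, hb₀A]
  have hnd : ∀ x ∈ e.target ∩ e.symm ⁻¹' U, ∀ v, g.inChartL e x v = 0 → v = 0 := by
    intro x hx v hv
    have h1 : mfderiv 𝓘(ℝ, E7) 𝓘(ℝ, E7) e.symm x v = 0 := by
      refine g.inner_nondegenerate _ fun w ↦ ?_
      rw [inner_eq_inChart g he (e.map_target hx.1), chartVec_mfderiv_symm he hx.1,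
        e.right_inv hx.1, ← Metric43.inChartL_apply, hv, zero_apply]
    have h2 := chartVec_mfderiv_symm he hx.1 v
    rw [h1] at h2
    rw [← h2]
    exact map_zero (frameAt e (fun _ ↦ ContinuousLinearMap.id ℝ E7) (e.symm x))
  obtain ⟨r, hr, hrV, B, Θ, h, hB, hΘ0, hΘ⟩ := exists_radial_coframe hVo
    ((contDiffOn_inChartL g he).mono inter_subset_left) hsymm hnd hpV
    hb₀
  have hBp : ∀ v, frameAt e B p v = φ v := fun v ↦ by rw [frameAt_apply, hB, hb₀A]
  replace h : IsLCCoframe (g.inChart e) (ball (e p) r) B Θ := h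
  exact ⟨r, hr, hrV, B, Θ, h, hBp, hΘ0, fun q hq hqr ψ hψ ↦ frameRel_of_radial he hp hq h
    (fun x hx ↦ (hrV hx).1) (fun x hx ↦ (hrV hx).2) hΘ hqr hBp fun v ↦ (hψ v).symm⟩

/-- On a connected manifold, every point is reached from a given frame by parallel transport. -/
theorem exists_frameRel [PreconnectedSpace M] (g : Metric43 M) {φ : T7 p ≃ₗ[ℝ] E7}
    (hφ : g.IsIsoFrame φ) (q : M) :
    ∃ ψ : T7 q ≃ₗ[ℝ] E7, g.IsIsoFrame ψ ∧ g.FrameRel univ φ ψ := by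
  -- Radial coframes connect every point to its neighbours; this makes `W` both open and closed.
  let W : Set M := {q | ∃ ψ : T7 q ≃ₗ[ℝ] E7, g.IsIsoFrame ψ ∧ g.FrameRel univ φ ψ}
  have hloc : ∀ q : M, ∀ ψ : T7 q ≃ₗ[ℝ] E7, g.IsIsoFrame ψ → ∀ᶠ q' in 𝓝 q,
      ∃ ψ' : T7 q' ≃ₗ[ℝ] E7, g.IsIsoFrame ψ' ∧ g.FrameRel univ ψ ψ' := by
    intro q ψ hψ
    have he := IsManifold.chart_mem_maximalAtlas (I := 𝓘(ℝ, E7)) (n := ∞) q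
    have hq := mem_chart_source E7 q
    obtain ⟨r, hr, -, B, Θ, h, -, -, H⟩ := exists_radial_frames g he isOpen_univ (mem_univ q) hq hψ
    filter_upwards [(chartAt E7 q).open_source.mem_nhds hq,
      ((chartAt E7 q).continuousAt hq).eventually (ball_mem_nhds _ hr)] with q' hq' hq'r
    exact ⟨frameEquiv he h hq' hq'r, fun v w ↦ inner_eq_form43 he h hq' hq'r v w,
      H q' hq' hq'r _ fun v ↦ rfl⟩
  have hopen : IsOpen W := by
    refine isOpen_iff_mem_nhds.2 fun q ⟨ψ, hψ, hrel⟩ ↦ ?_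
    filter_upwards [hloc q ψ hψ] with q' ⟨ψ', hψ', hrel'⟩
    exact ⟨ψ', hψ', hrel.trans hrel'⟩
  have hclosed : IsClosed W := by
    refine ⟨isOpen_iff_mem_nhds.2 fun q hq ↦ ?_⟩
    obtain ⟨ψ, hψ⟩ := g.exists_isIsoFrame q
    filter_upwards [hloc q ψ hψ] with q' ⟨ψ', hψ', hrel'⟩ ⟨χ, hχ, hrel⟩
    -- At `q'` the transported frame `ψ'` and the frame `χ` coming from `p` differ by a constant
    -- isometry. Composing `ψ` with it gives a frame at `q` related to `φ`, which contradicts the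
    -- choice of `q`.
    refine hq ⟨ψ.trans (ψ'.symm.trans χ), hψ.trans fun a b ↦ ?_, hrel.trans ?_⟩
    · obtain ⟨a, rfl⟩ := ψ'.surjective a
      obtain ⟨b, rfl⟩ := ψ'.surjective b
      simp only [LinearEquiv.trans_apply, LinearEquiv.symm_apply_apply]
      rw [← hχ, ← hψ']
    · have := (hrel'.trans_right (ψ'.symm.trans χ)).symm
      rwa [← LinearEquiv.trans_assoc ψ', LinearEquiv.self_trans_symm, LinearEquiv.refl_trans] at this
  have hW : W = univ := IsClopen.eq_univ ⟨hclosed, hopen⟩ ⟨p, φ, hφ, .refl (mem_univ p)⟩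
  have : q ∈ W := hW ▸ mem_univ q
  exact this

end FrameRel

/-! ### The holonomy algebra with respect to a frame -/

section FrameHol

set_option linter.unusedSectionVars false

variable {M : Type*} [TopologicalSpace M] [ChartedSpace E7 M] [IsManifold 𝓘(ℝ, E7) ∞ M]
  {g : Metric43 M} {U : Set M} {p q r : M}

theorem Metric43.IsTransport.mono {U' : Set M} (hU : U' ⊆ U) {A : T7 p →ₗ[ℝ] T7 q}
    (hA : g.IsTransport U' p q A) : g.IsTransport U p q A := by
  induction hA with
  | refl h => exact .refl (hU h)
  | append γ A C _ hγ hγU hpar ih => exact .append γ A C ih hγ (fun t ht ↦ hU (hγU t ht)) hpar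

/-- The curve `c` of automorphisms of `ℝ⁷` consists of holonomies with respect to `φ` and has
velocity `A` at the identity. -/
structure Metric43.IsHolCurve (g : Metric43 M) (U : Set M) (φ : T7 p ≃ₗ[ℝ] E7)
    (c : ℝ → E7 ≃L[ℝ] E7) (A : E7 →L[ℝ] E7) : Prop where
  frameRel : ∀ t, g.FrameRel U φ (φ.trans (c t).toLinearEquiv)
  zero : c 0 = ContinuousLinearEquiv.refl ℝ E7
  contDiff : ContDiff ℝ 1 (fun t ↦ (c t : E7 →L[ℝ] E7))
  hasDerivAt : HasDerivAt (fun t ↦ (c t : E7 →L[ℝ] E7)) A 0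

namespace Metric43.IsHolCurve

variable {φ : T7 p ≃ₗ[ℝ] E7} {c c' : ℝ → E7 ≃L[ℝ] E7} {A A' : E7 →L[ℝ] E7}

/-- Velocities at the identity add under pointwise products. Together with `smul` this makes
`frameHol` a linear subspace. -/
theorem mul (h : g.IsHolCurve U φ c A) (h' : g.IsHolCurve U φ c' A') :
    g.IsHolCurve U φ (fun t ↦ (c' t).trans (c t)) (A + A') where
  frameRel t := (h.frameRel t).mul (h'.frameRel t)
  zero := by rw [h.zero, h'.zero]; rfl
  contDiff := h.contDiff.clm_comp h'.contDiff
  hasDerivAt := by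
    refine (h.hasDerivAt.clm_comp h'.hasDerivAt).congr_deriv ?_
    simp only [h.zero, h'.zero, ContinuousLinearEquiv.coe_refl]
    exact ContinuousLinearMap.ext fun v ↦ by simp

theorem smul (h : g.IsHolCurve U φ c A) (s : ℝ) :
    g.IsHolCurve U φ (fun t ↦ c (s * t)) (s • A) where
  frameRel t := h.frameRel _
  zero := by rw [mul_zero, h.zero]
  contDiff := h.contDiff.comp (contDiff_const.mul contDiff_id)
  hasDerivAt := by
    have h1 : HasDerivAt (fun t : ℝ ↦ s * t) s 0 := by
      simpa using (hasDerivAt_id (0 : ℝ)).const_mul s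
    have h2 : HasDerivAt (fun t ↦ (c t : E7 →L[ℝ] E7)) A (s * 0) := by
      rw [mul_zero]; exact h.hasDerivAt
    exact h2.scomp (0 : ℝ) h1

theorem conj (h : g.IsHolCurve U φ c A) {S : E7 ≃L[ℝ] E7}
    (hS : g.FrameRel U φ (φ.trans S.toLinearEquiv)) :
    g.IsHolCurve U φ (fun t ↦ (S.symm.trans (c t)).trans S)
      ((S : E7 →L[ℝ] E7) ∘L A ∘L (S.symm : E7 →L[ℝ] E7)) where
  frameRel t := hS.mul ((h.frameRel t).mul hS.inv)
  zero := by
    rw [h.zero]; ext v; simp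
  contDiff := (contDiff_const (c := (S : E7 →L[ℝ] E7))).clm_comp
    (h.contDiff.clm_comp (contDiff_const (c := (S.symm : E7 →L[ℝ] E7))))
  hasDerivAt := by
    refine ((hasDerivAt_const (0 : ℝ) (S : E7 →L[ℝ] E7)).clm_comp
      (h.hasDerivAt.clm_comp (hasDerivAt_const (0 : ℝ) (S.symm : E7 →L[ℝ] E7)))).congr_deriv ?_
    exact ContinuousLinearMap.ext fun v ↦ by simp

end Metric43.IsHolCurve

/-- The holonomy algebra with respect to the frame `φ`. -/
noncomputable def Metric43.frameHol (g : Metric43 M) (hp : p ∈ U) (φ : T7 p ≃ₗ[ℝ] E7) :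
    Submodule ℝ (E7 →L[ℝ] E7) where
  carrier := {A | ∃ c, g.IsHolCurve U φ c A}
  add_mem' := fun ⟨_, h⟩ ⟨_, h'⟩ ↦ ⟨_, h.mul h'⟩
  zero_mem' := ⟨fun _ ↦ ContinuousLinearEquiv.refl ℝ E7, fun _ ↦ .refl hp, rfl, contDiff_const,
    hasDerivAt_const _ _⟩
  smul_mem' := fun s _ ⟨_, h⟩ ↦ ⟨_, h.smul s⟩

variable {φ : T7 p ≃ₗ[ℝ] E7} {hp : p ∈ U}

theorem hasDerivAt_mem_submodule {F : Type*} [NormedAddCommGroup F] [NormedSpace ℝ F]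
    [FiniteDimensional ℝ F] {N : Submodule ℝ F} {f : ℝ → F} {f' : F} {t : ℝ}
    (hf : HasDerivAt f f' t) (hN : ∀ᶠ s in 𝓝 t, f s ∈ N) : f' ∈ N := by
  refine N.closed_of_finiteDimensional.mem_of_tendsto hf.tendsto_slope
    (Eventually.filter_mono nhdsWithin_le_nhds (hN.mono fun s hs ↦ ?_))
  exact N.smul_mem _ (N.sub_mem hs hN.self_of_nhds)

theorem Metric43.FrameRel.mono {U' : Set M} {ψ : T7 q ≃ₗ[ℝ] E7} (hU : U' ⊆ U)
    (h : g.FrameRel U' φ ψ) : g.FrameRel U φ ψ := ⟨h.1.mono hU, h.2.mono hU⟩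

/-- The curve `c t ∘ A' ∘ (c t)⁻¹` stays in `frameHol`, which is closed as a subspace of a
finite-dimensional space. Its velocity at `0` is the commutator. -/
theorem Metric43.bracket_mem_frameHol {A A' : E7 →L[ℝ] E7} (hA : A ∈ g.frameHol hp φ)
    (hA' : A' ∈ g.frameHol hp φ) : A ∘L A' - A' ∘L A ∈ g.frameHol hp φ := by
  obtain ⟨c, h⟩ := hA
  obtain ⟨c', h'⟩ := hA'
  have hinv : HasDerivAt (fun t ↦ ((c t).symm : E7 →L[ℝ] E7)) (-A) 0 := by
    have h1 : HasFDerivAt ContinuousLinearMap.inverse _ ((c 0 : E7 →L[ℝ] E7)) :=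
      ((contDiffAt_map_inverse (n := 1) (c 0)).differentiableAt (by simp)).hasFDerivAt
    have h2 := h1.comp_hasDerivAt (0 : ℝ) h.hasDerivAt
    have h3 : HasDerivAt (fun t ↦ ((c t).symm : E7 →L[ℝ] E7)) _ 0 :=
      h2.congr_of_eventuallyEq (Eventually.of_forall fun t ↦
        (ContinuousLinearMap.inverse_equiv (c t)).symm)
    have h4 := h.hasDerivAt.clm_comp h3
    have h5 : HasDerivAt (fun t ↦ (c t : E7 →L[ℝ] E7) ∘L ((c t).symm : E7 →L[ℝ] E7)) 0 0 :=
      (hasDerivAt_const (0 : ℝ) (ContinuousLinearMap.id ℝ E7)).congr_of_eventuallyEq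
        (Eventually.of_forall fun t ↦ by simp)
    have h6 := h4.unique h5
    simp only [h.zero, ContinuousLinearEquiv.coe_refl, ContinuousLinearEquiv.refl_symm,
      ContinuousLinearMap.comp_id, ContinuousLinearMap.id_comp] at h6
    refine h3.congr_deriv ?_
    simp only [h.zero, ContinuousLinearEquiv.coe_refl]
    exact eq_neg_of_add_eq_zero_right h6
  refine hasDerivAt_mem_submodule
    (f := fun t ↦ (c t : E7 →L[ℝ] E7) ∘L A' ∘L ((c t).symm : E7 →L[ℝ] E7)) (t := 0) ?_
    (Eventually.of_forall fun t ↦ ⟨_, h'.conj (h.frameRel t)⟩)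
  refine (h.hasDerivAt.clm_comp ((hasDerivAt_const (0 : ℝ) A').clm_comp hinv)).congr_deriv ?_
  simp only [h.zero]
  exact ContinuousLinearMap.ext fun v ↦ by simp [sub_eq_add_neg]

/-- The elements of `frameHol` belong to the holonomy algebra. -/
theorem Metric43.conj_mem_holAlgebra {A : E7 →L[ℝ] E7} (hA : A ∈ g.frameHol hp φ) :
    (φ.symm : E7 →ₗ[ℝ] T7 p) ∘ₗ (A : E7 →ₗ[ℝ] E7) ∘ₗ (φ : T7 p →ₗ[ℝ] E7) ∈ g.holAlgebra U p := by
  obtain ⟨c, h⟩ := hA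
  have key : ∀ v : E7, ContDiff ℝ 1 (fun t ↦ T7.toE7 (φ.symm (c t v))) ∧
      HasDerivAt (fun t ↦ T7.toE7 (φ.symm (c t v))) (T7.toE7 (φ.symm (A v))) 0 := by
    intro v
    let L : E7 →ₗ[ℝ] E7 := (φ.symm : E7 →ₗ[ℝ] T7 p)
    have h1 : ContDiff ℝ 1 (fun t ↦ (c t : E7 →L[ℝ] E7) v) := h.contDiff.clm_apply contDiff_const
    have h2 : HasDerivAt (fun t ↦ (c t : E7 →L[ℝ] E7) v) (A v) 0 := by
      simpa using h.hasDerivAt.clm_apply (hasDerivAt_const (0 : ℝ) v)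
    exact ⟨(LinearMap.toContinuousLinearMap L).contDiff.comp h1,
      (LinearMap.toContinuousLinearMap L).hasFDerivAt.comp_hasDerivAt (0 : ℝ) h2⟩
  refine ⟨fun t ↦ (φ.symm : E7 →ₗ[ℝ] T7 p) ∘ₗ ((c t : E7 →L[ℝ] E7) : E7 →ₗ[ℝ] E7) ∘ₗ
    (φ : T7 p →ₗ[ℝ] E7), fun t ↦ (h.frameRel t).2, ?_, fun v ↦ key (φ v)⟩
  ext v
  simp [h.zero]

/-- The curves in `holAlgebra` are defined for all real times, whereas radial coframes live on small
balls. A sine keeps the curve inside the ball without changing its initial velocity. -/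
theorem exists_bounded_reparametrization {ε : ℝ} (hε : 0 < ε) :
    ∃ s : ℝ → ℝ, ContDiff ℝ 1 s ∧ s 0 = 0 ∧ HasDerivAt s 1 0 ∧ ∀ t, |s t| ≤ ε := by
  refine ⟨fun t ↦ ε * Real.sin (t / ε), by fun_prop, by simp, ?_, fun t ↦ ?_⟩
  · have h1 : HasDerivAt (fun t : ℝ ↦ t / ε) (1 / ε) 0 := (hasDerivAt_id (0 : ℝ)).div_const ε
    have h2 := (h1.sin).const_mul ε
    refine h2.congr_deriv ?_
    simp [hε.ne']
  · rw [abs_mul, abs_of_pos hε]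
    exact mul_le_of_le_one_right hε.le (Real.abs_sin_le_one _)

/-- The values of the connection form of a radially parallel coframe belong to the holonomy
algebra. -/
theorem exists_radial_frames_frameHol (g : Metric43 M) {e : OpenPartialHomeomorph M E7}
    (he : e ∈ IsManifold.maximalAtlas 𝓘(ℝ, E7) ∞ M) (hU : IsOpen U) (hpU : p ∈ U)
    (hp : p ∈ e.source) {φ : T7 p ≃ₗ[ℝ] E7} (hφ : g.IsIsoFrame φ) :
    ∃ r > 0, ball (e p) r ⊆ e.target ∩ e.symm ⁻¹' U ∧ ∃ B Θ,
      IsLCCoframe (g.inChart e) (ball (e p) r) B Θ ∧ (∀ v, frameAt e B p v = φ v) ∧ Θ (e p) = 0 ∧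
      ∀ x ∈ ball (e p) r, ∀ w, Θ x w ∈ g.frameHol hpU φ := by
  obtain ⟨r, hr, hrV, B, Θ, h, hB, hΘ0, H⟩ := exists_radial_frames g he hU hpU hp hφ
  refine ⟨r, hr, hrV, B, Θ, h, hB, hΘ0, fun x hx w ↦ ?_⟩
  have hxt : x ∈ e.target := (hrV hx).1
  have hq : e.symm x ∈ e.source := e.map_target hxt
  have heq : e (e.symm x) = x := e.right_inv hxt
  have hqr : e (e.symm x) ∈ ball (e p) r := by rwa [heq]
  have hU'o : IsOpen (U ∩ (e.source ∩ e ⁻¹' ball (e p) r)) :=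
    hU.inter (e.continuousOn.isOpen_inter_preimage e.open_source isOpen_ball)
  -- A second radial coframe `B'`, centred at `x`, agrees there with `B` and has `Θ' x = 0`. Hence
  -- the transition `B' y ∘ (B y)⁻¹` is the identity at `y = x` and has derivative `Θ x`.
  obtain ⟨ρ, hρ, hρV, B', Θ', h', hB', hΘ'0, H'⟩ := exists_radial_frames g he hU'o
    (p := e.symm x) ⟨(hrV hx).2, hq, hqr⟩ hq (φ := frameEquiv he h hq hqr)
    (fun v w ↦ inner_eq_form43 he h hq hqr v w)
  rw [heq] at hρV h' hΘ'0 H'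
  have hsub : ball x ρ ⊆ ball (e p) r := fun y hy ↦ by
    have := (hρV hy).2.2.2
    rwa [mem_preimage, e.right_inv (hρV hy).1] at this
  obtain ⟨hSs, hSB, hSf, hSd⟩ := (h.mono isOpen_ball hsub).transition h'
  have hx' : x ∈ ball x ρ := mem_ball_self hρ
  have hSx : B' x ∘L (B x).inverse = ContinuousLinearMap.id ℝ E7 := by
    refine ContinuousLinearMap.ext fun a ↦ ?_
    obtain ⟨w, rfl⟩ : ∃ w, B x w = a := ⟨_, h.apply_inverse hx a⟩
    rw [hSB x hx']
    have := hB' (mfderiv 𝓘(ℝ, E7) 𝓘(ℝ, E7) e.symm x w)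
    rwa [frameEquiv_apply, frameAt_mfderiv_symm he hxt, frameAt_mfderiv_symm he hxt] at this
  have hSinv : ∀ y ∈ ball x ρ, ∃ S : E7 ≃L[ℝ] E7, (S : E7 →L[ℝ] E7) = B' y ∘L (B y).inverse :=
    fun y hy ↦ (h'.invertible y hy).comp (h.invertible y (hsub hy)).inverse
  -- The transition is the holonomy, read in `φ`, of a triangle: one side is parallel for `B'` and
  -- joins `x` to `y`, the other two are radial for `B` and join them to `p`.
  have hrel : ∀ y ∈ ball x ρ, ∀ S : E7 ≃L[ℝ] E7, (S : E7 →L[ℝ] E7) = B' y ∘L (B y).inverse →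
      g.FrameRel U φ (φ.trans S.toLinearEquiv) := by
    intro y hy S hS
    have hyt : y ∈ e.target := (hρV hy).1
    have hys : e.symm y ∈ e.source := e.map_target hyt
    have hey : e (e.symm y) = y := e.right_inv hyt
    have hyr : e (e.symm y) ∈ ball (e p) r := by rw [hey]; exact hsub hy
    have hyρ : e (e.symm y) ∈ ball x ρ := by rwa [hey]
    have r1 := H _ hq hqr (frameEquiv he h hq hqr) fun _ ↦ rfl
    have r2 := H _ hys hyr (frameEquiv he h hys hyr) fun _ ↦ rfl
    have r3 := (H' _ hys hyρ ((frameEquiv he h hys hyr).trans S.toLinearEquiv) fun v ↦ by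
      have : (S : E7 →L[ℝ] E7) (B y (chartVec e (e.symm y) v)) = B' y (chartVec e (e.symm y) v) := by
        rw [hS, hSB y hy]
      rw [LinearEquiv.trans_apply, frameEquiv_apply, frameAt_apply, frameAt_apply, hey]
      exact this).mono inter_subset_left
    exact (r1.trans r3).trans (r2.symm.trans_right _)
  obtain ⟨s, hs, hs0, hs1, hsε⟩ := exists_bounded_reparametrization
    (ε := ρ / (2 * (‖w‖ + 1))) (by positivity)
  have hmem : ∀ t, x + s t • w ∈ ball x ρ := by
    intro t
    rw [mem_ball_iff_norm, add_sub_cancel_left, norm_smul, Real.norm_eq_abs]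
    calc |s t| * ‖w‖ ≤ ρ / (2 * (‖w‖ + 1)) * (‖w‖ + 1) := by
          gcongr
          · exact hsε t
          · linarith
      _ = ρ / 2 := by field_simp
      _ < ρ := by linarith
  choose! S hS using hSinv
  have hcd : ContDiff ℝ 1 (fun t ↦ x + s t • w) := by fun_prop
  refine ⟨fun t ↦ S (x + s t • w), fun t ↦ hrel _ (hmem t) _ (hS _ (hmem t)), ?_, ?_, ?_⟩
  · refine ContinuousLinearEquiv.coe_injective ?_
    rw [hs0, zero_smul, add_zero, hS x hx', hSx]; rfl
  · have h1 : ContDiff ℝ 1 ((fun y ↦ B' y ∘L (B y).inverse) ∘ fun t ↦ x + s t • w) :=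
      contDiff_iff_contDiffAt.2 fun t ↦ ContDiffAt.comp t
        ((hSs.contDiffAt (isOpen_ball.mem_nhds (hmem t))).of_le (by simp))
        hcd.contDiffAt
    have h2 : (fun t ↦ (S (x + s t • w) : E7 →L[ℝ] E7))
        = (fun y ↦ B' y ∘L (B y).inverse) ∘ fun t ↦ x + s t • w := funext fun t ↦ hS _ (hmem t)
    rw [h2]; exact h1
  · have h1 : HasDerivAt (fun t ↦ x + s t • w) w 0 := by
      simpa using (hs1.smul_const w).const_add x
    have h2 : HasFDerivAt (fun y ↦ B' y ∘L (B y).inverse) _ (x + s 0 • w) :=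
      ((hSs.contDiffAt (isOpen_ball.mem_nhds (hmem 0))).differentiableAt (by simp)).hasFDerivAt
    refine ((h2.comp_hasDerivAt (0 : ℝ) h1).congr_of_eventuallyEq
      (Eventually.of_forall fun t ↦ hS _ (hmem t))).congr_deriv ?_
    rw [hs0, zero_smul, add_zero]
    refine ContinuousLinearMap.ext fun a ↦ ?_
    rw [hSd x hx', hSx, hΘ'0]
    simp

end FrameHol

/-! ### Existence of normal coordinates -/

section Necessity

set_option linter.unusedSectionVars false

variable {M : Type*} [TopologicalSpace M] [ChartedSpace E7 M] [IsManifold 𝓘(ℝ, E7) ∞ M]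
  {g : Metric43 M} {U : Set M} {p q : M}

theorem trans_mem_maximalAtlas {e₀ : OpenPartialHomeomorph M E7}
    (he₀ : e₀ ∈ IsManifold.maximalAtlas 𝓘(ℝ, E7) ∞ M) {e : OpenPartialHomeomorph E7 E7}
    (he : ContDiffOn ℝ ∞ e e.source) (he' : ContDiffOn ℝ ∞ e.symm e.target) :
    e₀ ≫ₕ e ∈ IsManifold.maximalAtlas 𝓘(ℝ, E7) ∞ M := by
  have heG : e ∈ contDiffGroupoid ∞ 𝓘(ℝ, E7) := by
    rw [contDiffGroupoid, mem_groupoid_of_pregroupoid]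
    simpa [contDiffPregroupoid] using ⟨he, he'⟩
  intro e₁ he₁
  obtain ⟨h1, h2⟩ := he₀ e₁ he₁
  constructor
  · rw [OpenPartialHomeomorph.trans_symm_eq_symm_trans_symm, OpenPartialHomeomorph.trans_assoc]
    exact (contDiffGroupoid ∞ 𝓘(ℝ, E7)).trans ((contDiffGroupoid ∞ 𝓘(ℝ, E7)).symm heG) h1
  · rw [← OpenPartialHomeomorph.trans_assoc]
    exact (contDiffGroupoid ∞ 𝓘(ℝ, E7)).trans h2 heG

theorem toMatrix_conj_mulVec (b : Module.Basis (Fin 7) ℝ (T7 p)) (A : T7 p →ₗ[ℝ] T7 p) (a : E7) :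
    (LinearMap.toMatrix b b A).mulVec a = b.equivFun (A (b.equivFun.symm a)) := by
  have h := LinearMap.toMatrix_mulVec_repr b b A (b.equivFun.symm a)
  rwa [← Module.Basis.equivFun_apply, ← Module.Basis.equivFun_apply,
    LinearEquiv.apply_symm_apply] at h

/-- The radial coframe extending the given basis has a connection form with values in the holonomy
algebra, hence in `hIII1a`. This places the metric within reach of `IsIII1aCoframe.exists_normal`.
-/
theorem exists_isNormalIn_of_holIsIII1a (hU : IsOpen U) (hp : p ∈ U) (hH : g.HolIsIII1a U p) :
    ∃ e : OpenPartialHomeomorph M E7, p ∈ e.source ∧ g.IsNormalIn e := by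
  obtain ⟨b, hb, -, hbA⟩ := hH
  have he₀ := IsManifold.chart_mem_maximalAtlas (I := 𝓘(ℝ, E7)) (n := ∞) p
  set e₀ := chartAt E7 p
  have hps : p ∈ e₀.source := mem_chart_source E7 p
  obtain ⟨r, hr, hrV, B, Θ, h, -, -, hΘ⟩ := exists_radial_frames_frameHol g he₀ hU hp hps
    (Metric43.isIsoFrame_of_basis hb)
  have hIII : IsIII1aCoframe (g.inChart e₀) (ball (e₀ p) r) B Θ := by
    refine { h with isIII1a := fun x hx w ↦ ?_ }
    have h1 := hbA _ (Metric43.conj_mem_holAlgebra (hΘ x hx w))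
    rw [mem_hIII1a_iff] at h1
    convert h1 using 1
    funext a
    rw [toMatrix_conj_mulVec]
    simp only [LinearMap.comp_apply, LinearEquiv.coe_coe, LinearEquiv.apply_symm_apply,
      ContinuousLinearMap.coe_coe]
  obtain ⟨e', hpe', hsub, hs, hs', D, hD, hG⟩ := hIII.exists_normal (mem_ball_self hr)
  have he := trans_mem_maximalAtlas he₀ hs hs'
  have htar : (e₀ ≫ₕ e').target ⊆ e'.target := fun x hx ↦ hx.1
  have ht₀ : ∀ x ∈ e'.target, e'.symm x ∈ e₀.target := fun x hx ↦
    (hrV (hsub (e'.map_target hx))).1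
  have htar' : (e₀ ≫ₕ e').target = e'.target := htar.antisymm fun x hx ↦ ⟨hx, ht₀ x hx⟩
  refine ⟨e₀ ≫ₕ e', ⟨hps, hpe'⟩, he, D, by rwa [htar'], fun x hx v w ↦ ?_⟩
  have hx' : x ∈ e'.target := htar hx
  have hk : ∀ y ∈ e'.target, e₀ ((e₀ ≫ₕ e').symm y) = e'.symm y := fun y hy ↦
    e₀.right_inv (ht₀ y hy)
  have hfd : fderiv ℝ (fun y ↦ e₀ ((e₀ ≫ₕ e').symm y)) x = fderiv ℝ e'.symm x :=
    Filter.EventuallyEq.fderiv_eq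
      (by filter_upwards [e'.open_target.mem_nhds hx'] with y hy using hk y hy)
  rw [inChart_transition g he he₀ ⟨hx, e₀.map_target (ht₀ x hx')⟩, hfd, hk x hx', hG x hx']

/-! ### Transfer of the holonomy along frames related by parallel transport -/

theorem Metric43.conj_mem_holGroup {φ : T7 p ≃ₗ[ℝ] E7} {ψ : T7 q ≃ₗ[ℝ] E7}
    (hrel : g.FrameRel U φ ψ) {A : T7 q →ₗ[ℝ] T7 q} (hA : A ∈ g.holGroup U q) :
    ((ψ.trans φ.symm : T7 q ≃ₗ[ℝ] T7 p) : T7 q →ₗ[ℝ] T7 p) ∘ₗ A ∘ₗ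
      ((φ.trans ψ.symm : T7 p ≃ₗ[ℝ] T7 q) : T7 p →ₗ[ℝ] T7 q) ∈ g.holGroup U p :=
  (hrel.1.comp hA).comp hrel.2

theorem Metric43.conj_mem_holAlgebra_of_frameRel {φ : T7 p ≃ₗ[ℝ] E7} {ψ : T7 q ≃ₗ[ℝ] E7}
    (hrel : g.FrameRel U φ ψ) {A : T7 q →ₗ[ℝ] T7 q} (hA : A ∈ g.holAlgebra U q) :
    ((ψ.trans φ.symm : T7 q ≃ₗ[ℝ] T7 p) : T7 q →ₗ[ℝ] T7 p) ∘ₗ A ∘ₗ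
      ((φ.trans ψ.symm : T7 p ≃ₗ[ℝ] T7 q) : T7 p →ₗ[ℝ] T7 q) ∈ g.holAlgebra U p := by
  obtain ⟨c, hc, hc0, hcd⟩ := hA
  refine ⟨_, fun t ↦ Metric43.conj_mem_holGroup hrel (hc t), ?_, fun v ↦ ?_⟩
  · ext v
    simp [hc0]
  · let L : E7 →ₗ[ℝ] E7 := ((ψ.trans φ.symm : T7 q ≃ₗ[ℝ] T7 p) : T7 q →ₗ[ℝ] T7 p)
    obtain ⟨h1, h2⟩ := hcd ((φ.trans ψ.symm : T7 p ≃ₗ[ℝ] T7 q) v)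
    exact ⟨(LinearMap.toContinuousLinearMap L).contDiff.comp h1,
      (LinearMap.toContinuousLinearMap L).hasFDerivAt.comp_hasDerivAt (0 : ℝ) h2⟩

theorem toMatrix_conj_eq {b : Module.Basis (Fin 7) ℝ (T7 p)} {ψ : T7 q ≃ₗ[ℝ] E7}
    (A : T7 q →ₗ[ℝ] T7 q) :
    LinearMap.toMatrix b b (((ψ.trans b.equivFun.symm : T7 q ≃ₗ[ℝ] T7 p) : T7 q →ₗ[ℝ] T7 p) ∘ₗ A ∘ₗ
      ((b.equivFun.trans ψ.symm : T7 p ≃ₗ[ℝ] T7 q) : T7 p →ₗ[ℝ] T7 q))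
    = LinearMap.toMatrix (Module.Basis.ofEquivFun ψ) (Module.Basis.ofEquivFun ψ) A := by
  refine Matrix.ext_of_mulVec_single fun i ↦ ?_
  rw [toMatrix_conj_mulVec, toMatrix_conj_mulVec]
  simp only [LinearMap.comp_apply, LinearEquiv.coe_coe, LinearEquiv.apply_symm_apply,
    LinearEquiv.trans_apply, Module.Basis.equivFun_ofEquivFun]

/-- Parallel transport from `p` to `q` conjugates the holonomies at `q` into those at `p`. In the
transported frame their matrices are the same. -/
theorem Metric43.HolIsIII1a.transfer [PreconnectedSpace M] (h : g.HolIsIII1a univ p) (q : M) :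
    g.HolIsIII1a univ q := by
  obtain ⟨b, hb, hG, hA⟩ := h
  obtain ⟨ψ, hψ, hrel⟩ := exists_frameRel g (Metric43.isIsoFrame_of_basis hb) q
  refine ⟨Module.Basis.ofEquivFun ψ, Metric43.isAdapted_of_isIsoFrame hψ, fun A hAq ↦ ?_,
    fun A hAq ↦ ?_⟩
  · rw [← toMatrix_conj_eq (b := b)]
    exact hG _ (Metric43.conj_mem_holGroup hrel hAq)
  · rw [← toMatrix_conj_eq (b := b)]
    exact hA _ (Metric43.conj_mem_holAlgebra_of_frameRel hrel hAq)

theorem Metric43.HolIsFullIII1a.transfer [PreconnectedSpace M] (h : g.HolIsFullIII1a univ p)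
    (q : M) : g.HolIsFullIII1a univ q := by
  obtain ⟨b, hb, hG, hA⟩ := h
  obtain ⟨ψ, hψ, hrel⟩ := exists_frameRel g (Metric43.isIsoFrame_of_basis hb) q
  refine ⟨Module.Basis.ofEquivFun ψ, Metric43.isAdapted_of_isIsoFrame hψ, fun A hAq ↦ ?_,
    Subset.antisymm ?_ ?_⟩
  · rw [← toMatrix_conj_eq (b := b)]
    exact hG _ (Metric43.conj_mem_holGroup hrel hAq)
  · rintro _ ⟨A, hAq, rfl⟩
    rw [← toMatrix_conj_eq (b := b), ← hA]
    exact ⟨_, Metric43.conj_mem_holAlgebra_of_frameRel hrel hAq, rfl⟩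
  · rw [← hA]
    rintro _ ⟨A, hAp, rfl⟩
    refine ⟨_, Metric43.conj_mem_holAlgebra_of_frameRel hrel.symm hAp, ?_⟩
    rw [← toMatrix_conj_eq (b := b)]
    congr 1
    ext v
    simp

end Necessity

/-! ### The holonomy of metrics with a coframe of Type III 1a -/

/-- The projection of `ℝ⁷` with kernel `nullPlane`. -/
noncomputable def nullPlaneProj : E7 →L[ℝ] E7 :=
  LinearMap.toContinuousLinearMap
    { toFun w := ![w 0, 0, 0, w 3, w 4, w 5, w 6]
      map_add' a b := by ext i; revert i; refine forall_fin_seven ?_ ?_ ?_ ?_ ?_ ?_ ?_ <;> simp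
      map_smul' a b := by ext i; revert i; refine forall_fin_seven ?_ ?_ ?_ ?_ ?_ ?_ ?_ <;> simp }

theorem nullPlaneProj_apply (w : E7) : nullPlaneProj w = ![w 0, 0, 0, w 3, w 4, w 5, w 6] := rfl

theorem nullPlaneProj_eq_zero_iff {w : E7} : nullPlaneProj w = 0 ↔ w ∈ nullPlane := by
  rw [mem_nullPlane, nullPlaneProj_apply]
  constructor
  · intro h
    have := fun i ↦ congrFun h i
    exact ⟨this 0, this 3, this 4, this 5, this 6⟩
  · rintro ⟨h0, h3, h4, h5, h6⟩
    ext i; revert i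
    refine forall_fin_seven ?_ ?_ ?_ ?_ ?_ ?_ ?_ <;> simp [*]

/-- `T` descends to the quotient by the null plane. Hence the projection of a parallel field
satisfies a linear equation of its own. -/
theorem IsIII1a.nullPlaneProj_comp {T : E7 →L[ℝ] E7} (hT : IsIII1a T) (w : E7) :
    nullPlaneProj (T (nullPlaneProj w)) = nullPlaneProj (T w) := by
  have h1 : w - nullPlaneProj w ∈ nullPlane := by
    rw [mem_nullPlane, nullPlaneProj_apply]; simp
  have h2 := nullPlaneProj_eq_zero_iff.2 (hT.map_nullPlane h1)
  rw [map_sub, map_sub, sub_eq_zero] at h2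
  exact h2.symm

/-- Nondegeneracy of the 3-form forces a linear map that preserves it to be injective, which yields
the invertibility clause of `G2Star`. -/
theorem eq_zero_of_omegaG2_eq_zero {a : E7} (h : ∀ b c, omegaG2 a b c = 0) : a = 0 := by
  have h2 : √2 ≠ 0 := by positivity
  have k0 := h (Pi.single 5 1) (Pi.single 6 1)
  have k1 := h (Pi.single 2 1) (Pi.single 4 1)
  have k2 := h (Pi.single 1 1) (Pi.single 4 1)
  have k3 := h (Pi.single 0 1) (Pi.single 4 1)
  have k4 := h (Pi.single 1 1) (Pi.single 2 1)
  have k5 := h (Pi.single 0 1) (Pi.single 6 1)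
  have k6 := h (Pi.single 0 1) (Pi.single 5 1)
  simp [omegaG2_eq] at k0 k1 k2 k3 k4 k5 k6
  ext i; revert i
  exact forall_fin_seven k0 k1 k2 k3 k4 k5 k6

section Sufficiency

set_option linter.unusedSectionVars false

variable {M : Type*} [TopologicalSpace M] [ChartedSpace E7 M] [IsManifold 𝓘(ℝ, E7) ∞ M]
  {g : Metric43 M} {e : OpenPartialHomeomorph M E7} {B : E7 → E7 →L[ℝ] E7}
  {Θ : E7 → E7 →L[ℝ] E7 →L[ℝ] E7}

/-- The components of a parallel field satisfy `y' = -Θ(c') y`, so the derivative of the 3-form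
along three such fields is `-omegaDer` of an element of the algebra, which is zero. -/
theorem IsIII1aCoframe.omegaG2_parallel (h : IsIII1aCoframe (g.inChart e) e.target B Θ)
    (he : e ∈ IsManifold.maximalAtlas 𝓘(ℝ, E7) ∞ M) {γ : ℝ → M}
    (hγ : ∀ t ∈ Icc (0 : ℝ) 1, γ t ∈ e.source) {Y₁ Y₂ Y₃ : ∀ t, T7 (γ t)}
    (h₁ : g.IsParallelAlong γ Y₁) (h₂ : g.IsParallelAlong γ Y₂) (h₃ : g.IsParallelAlong γ Y₃) :
    omegaG2 (frameAt e B (γ 1) (Y₁ 1)) (frameAt e B (γ 1) (Y₂ 1)) (frameAt e B (γ 1) (Y₃ 1))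
      = omegaG2 (frameAt e B (γ 0) (Y₁ 0)) (frameAt e B (γ 0) (Y₂ 0)) (frameAt e B (γ 0) (Y₃ 0)) := by
  have hd : ∀ t ∈ Icc (0 : ℝ) 1, HasDerivWithinAt (fun t ↦ omegaG2 (frameAt e B (γ t) (Y₁ t))
      (frameAt e B (γ t) (Y₂ t)) (frameAt e B (γ t) (Y₃ t))) 0 (Icc 0 1) t := by
    intro t ht
    have htar := e.map_source (hγ t ht)
    obtain ⟨c₁, hc₁, k₁⟩ := h₁.frameAt_deriv he h.toIsLCCoframe ht (hγ t ht) htar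
    obtain ⟨c₂, hc₂, k₂⟩ := h₂.frameAt_deriv he h.toIsLCCoframe ht (hγ t ht) htar
    obtain ⟨c₃, hc₃, k₃⟩ := h₃.frameAt_deriv he h.toIsLCCoframe ht (hγ t ht) htar
    -- Each parallel field brings its own derivative of the same curve. Uniqueness of derivatives on
    -- the interval identifies the three.
    have hu := (uniqueDiffOn_Icc (zero_lt_one (α := ℝ))) t ht
    obtain rfl : c₂ = c₁ := hu.eq_deriv _ hc₂ hc₁
    obtain rfl : c₃ = c₂ := hu.eq_deriv _ hc₃ hc₁
    refine (k₁.omegaG2 k₂ k₃).congr_deriv ?_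
    have h0 := (h.isIII1a _ htar c₃).omegaDer_eq_zero (frameAt e B (γ t) (Y₁ t))
      (frameAt e B (γ t) (Y₂ t)) (frameAt e B (γ t) (Y₃ t))
    simp only [omegaDer, omegaG2_eq, Pi.neg_apply] at h0 ⊢
    linarith
  exact constant_of_derivWithin_zero (fun t ht ↦ (hd t ht).differentiableWithinAt)
    (fun t ht ↦ (hd t (Ico_subset_Icc_self ht)).derivWithin
      ((uniqueDiffOn_Icc zero_lt_one) t (Ico_subset_Icc_self ht))) 1 (by simp)

/-- The projection of the field off the null plane satisfies a linear equation with bounded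
coefficients and starts at zero, so Gronwall's inequality keeps it zero. -/
theorem IsIII1aCoframe.nullPlane_parallel (h : IsIII1aCoframe (g.inChart e) e.target B Θ)
    (he : e ∈ IsManifold.maximalAtlas 𝓘(ℝ, E7) ∞ M) {γ : ℝ → M}
    (hγs : ContMDiffOn 𝓘(ℝ, ℝ) 𝓘(ℝ, E7) ∞ γ (Icc 0 1))
    (hγ : ∀ t ∈ Icc (0 : ℝ) 1, γ t ∈ e.source) {Y : ∀ t, T7 (γ t)} (hY : g.IsParallelAlong γ Y)
    (h0 : frameAt e B (γ 0) (Y 0) ∈ nullPlane) : frameAt e B (γ 1) (Y 1) ∈ nullPlane := by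
  have hcs : ContDiffOn ℝ ∞ (fun t ↦ e (γ t)) (Icc 0 1) :=
    ((contMDiffOn_of_mem_maximalAtlas he).comp hγs hγ).contDiffOn
  have hu := uniqueDiffOn_Icc (zero_lt_one (α := ℝ))
  have hc' : ContinuousOn (derivWithin (fun t ↦ e (γ t)) (Icc 0 1)) (Icc 0 1) :=
    hcs.continuousOn_derivWithin hu (by simp)
  have hcont : ContinuousOn (fun t ↦ nullPlaneProj ∘L
      Θ (e (γ t)) (derivWithin (fun t ↦ e (γ t)) (Icc 0 1) t)) (Icc 0 1) :=
    continuousOn_const.clm_comp (ContinuousOn.clm_apply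
      (h.smooth_conn.continuousOn.comp hcs.continuousOn fun t ht ↦ e.map_source (hγ t ht)) hc')
  obtain ⟨K, hK⟩ := isCompact_Icc.exists_bound_of_continuousOn hcont
  have hd : ∀ t ∈ Icc (0 : ℝ) 1, HasDerivWithinAt (fun t ↦ nullPlaneProj (frameAt e B (γ t) (Y t)))
      (-(nullPlaneProj ∘L Θ (e (γ t)) (derivWithin (fun t ↦ e (γ t)) (Icc 0 1) t))
        (nullPlaneProj (frameAt e B (γ t) (Y t)))) (Icc 0 1) t := by
    intro t ht
    have htar := e.map_source (hγ t ht)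
    obtain ⟨c, hc, k⟩ := hY.frameAt_deriv he h.toIsLCCoframe ht (hγ t ht) htar
    rw [hc.derivWithin (hu t ht), ContinuousLinearMap.comp_apply,
      (h.isIII1a _ htar c).nullPlaneProj_comp, ← map_neg]
    exact nullPlaneProj.hasFDerivAt.comp_hasDerivWithinAt t k
  refine nullPlaneProj_eq_zero_iff.1 ?_
  refine eq_zero_of_abs_deriv_le_mul_abs_self_of_eq_zero_right (K := K)
    (f := fun t ↦ nullPlaneProj (frameAt e B (γ t) (Y t)))
    (fun t ht ↦ (hd t ht).continuousWithinAt)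
    (fun t ht ↦ (hd t (Ico_subset_Icc_self ht)).mono_of_mem_nhdsWithin
      (Icc_mem_nhdsGE_of_mem ht)) (nullPlaneProj_eq_zero_iff.2 h0) (fun t ht ↦ ?_) 1 (by simp)
  rw [norm_neg]
  exact (ContinuousLinearMap.le_opNorm _ _).trans
    (mul_le_mul_of_nonneg_right (hK t (Ico_subset_Icc_self ht)) (norm_nonneg _))

theorem IsIII1aCoframe.isTransport (h : IsIII1aCoframe (g.inChart e) e.target B Θ)
    (he : e ∈ IsManifold.maximalAtlas 𝓘(ℝ, E7) ∞ M) {p q : M} {A : T7 p →ₗ[ℝ] T7 q}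
    (hA : g.IsTransport e.source p q A) :
    (∀ u v w, omegaG2 (frameAt e B q (A u)) (frameAt e B q (A v)) (frameAt e B q (A w))
      = omegaG2 (frameAt e B p u) (frameAt e B p v) (frameAt e B p w)) ∧
    ∀ v, frameAt e B p v ∈ nullPlane → frameAt e B q (A v) ∈ nullPlane := by
  induction hA with
  | refl _ => exact ⟨fun _ _ _ ↦ rfl, fun _ ↦ id⟩
  | append γ A C _ hγs hγ hpar ih =>
    constructor
    · intro u v w
      rw [← ih.1]
      obtain ⟨Y₁, h₁, k₁, l₁⟩ := hpar (A u)
      obtain ⟨Y₂, h₂, k₂, l₂⟩ := hpar (A v)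
      obtain ⟨Y₃, h₃, k₃, l₃⟩ := hpar (A w)
      have := h.omegaG2_parallel he hγ h₁ h₂ h₃
      rwa [k₁, k₂, k₃, l₁, l₂, l₃] at this
    · intro v hv
      obtain ⟨Y, h₁, k₁, l₁⟩ := hpar (A v)
      have := h.nullPlane_parallel he hγs hγ h₁ (by rw [k₁]; exact ih.2 v hv)
      rwa [l₁] at this

/-- Holonomies preserve `omegaG2` and the null plane. Differentiating both invariances along a curve
through the identity gives exactly the hypotheses of `isIII1a_of_omegaDer`. -/
theorem IsIII1aCoframe.holIsIII1a (h : IsIII1aCoframe (g.inChart e) e.target B Θ)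
    (he : e ∈ IsManifold.maximalAtlas 𝓘(ℝ, E7) ∞ M) {p : M} (hp : p ∈ e.source)
    {φ : T7 p ≃ₗ[ℝ] E7} (hφ : ∀ v, φ v = frameAt e B p v) :
    g.IsAdapted p (Module.Basis.ofEquivFun φ) ∧
    (∀ A ∈ g.holGroup e.source p,
      LinearMap.toMatrix (Module.Basis.ofEquivFun φ) (Module.Basis.ofEquivFun φ) A ∈ G2Star) ∧
    (∀ A ∈ g.holAlgebra e.source p,
      LinearMap.toMatrix (Module.Basis.ofEquivFun φ) (Module.Basis.ofEquivFun φ) A ∈ hIII1a) := by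
  have hpV := e.map_source hp
  have hω : ∀ A ∈ g.holGroup e.source p, ∀ a b c, omegaG2 (φ (A (φ.symm a))) (φ (A (φ.symm b)))
      (φ (A (φ.symm c))) = omegaG2 a b c := by
    intro A hA a b c
    have := (h.isTransport he hA).1 (φ.symm a) (φ.symm b) (φ.symm c)
    simpa only [← hφ, LinearEquiv.apply_symm_apply] using this
  have hP : ∀ A ∈ g.holGroup e.source p, ∀ a ∈ nullPlane, φ (A (φ.symm a)) ∈ nullPlane := by
    intro A hA a ha
    have := (h.isTransport he hA).2 (φ.symm a)
    simp only [← hφ, LinearEquiv.apply_symm_apply] at this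
    exact this ha
  refine ⟨Metric43.isAdapted_of_isIsoFrame fun v w ↦ ?_, fun A hA ↦ ⟨?_, ?_⟩, fun A hA ↦ ?_⟩
  · rw [hφ, hφ, inner_eq_form43 he h.toIsLCCoframe hp hpV]
  · rw [← Matrix.mulVec_injective_iff_isUnit]
    refine (injective_iff_map_eq_zero (Matrix.mulVecLin (LinearMap.toMatrix
      (Module.Basis.ofEquivFun φ) (Module.Basis.ofEquivFun φ) A))).2 fun a ha ↦ ?_
    refine eq_zero_of_omegaG2_eq_zero fun b c ↦ ?_
    rw [Matrix.mulVecLin_apply, toMatrix_conj_mulVec, Module.Basis.equivFun_ofEquivFun] at ha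
    rw [← hω A hA, ha, omegaG2_eq]
    simp
  · intro a b c
    simp only [toMatrix_conj_mulVec, Module.Basis.equivFun_ofEquivFun]
    exact hω A hA a b c
  · obtain ⟨c, hc, hc0, hcd⟩ := hA
    have hd : ∀ a, HasDerivAt (fun t ↦ φ (c t (φ.symm a))) (φ (A (φ.symm a))) 0 := by
      intro a
      let L : E7 →ₗ[ℝ] E7 := (φ : T7 p →ₗ[ℝ] E7)
      exact (LinearMap.toContinuousLinearMap L).hasFDerivAt.comp_hasDerivAt (0 : ℝ)
        (hcd (φ.symm a)).2
    have hc0' : ∀ a, φ (c 0 (φ.symm a)) = a := fun a ↦ by simp [hc0]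
    rw [mem_hIII1a_iff]
    have hT : (LinearMap.toMatrix (Module.Basis.ofEquivFun φ) (Module.Basis.ofEquivFun φ) A).mulVec
        = ((φ : T7 p →ₗ[ℝ] E7) ∘ₗ A ∘ₗ (φ.symm : E7 →ₗ[ℝ] T7 p)) := by
      funext a
      rw [toMatrix_conj_mulVec, Module.Basis.equivFun_ofEquivFun]; rfl
    rw [hT]
    refine isIII1a_of_omegaDer (fun a b d ↦ ?_) fun w hw ↦ ?_
    · have h1 := ((hd a).hasDerivWithinAt (s := univ)).omegaG2 (hd b).hasDerivWithinAt
        (hd d).hasDerivWithinAt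
      rw [hasDerivWithinAt_univ] at h1
      have h2 := h1.unique ((hasDerivAt_const (0 : ℝ) (omegaG2 a b d)).congr_of_eventuallyEq
        (Eventually.of_forall fun t ↦ hω _ (hc t) a b d))
      simp only [hc0'] at h2
      exact h2
    · exact hasDerivAt_mem_submodule (hd w) (Eventually.of_forall fun t ↦ hP _ (hc t) w hw)

theorem Metric43.IsNormalIn.exists_coframe (h : g.IsNormalIn e) :
    ∃ B Θ, IsIII1aCoframe (g.inChart e) e.target B Θ := by
  obtain ⟨he, D, hD, hG⟩ := h
  have h := hD.isIII1aCoframe e.open_target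
  exact ⟨_, _, { h with metric := fun x hx v w ↦ by rw [hG x hx, h.metric x hx] }⟩

theorem Metric43.IsNormalIn.holIsIII1a (h : g.IsNormalIn e) {p : M} (hp : p ∈ e.source) :
    g.HolIsIII1a e.source p := by
  obtain ⟨B, Θ, hB⟩ := h.exists_coframe
  exact ⟨_, hB.holIsIII1a h.1 hp
    (φ := frameEquiv h.1 hB.toIsLCCoframe hp (e.map_source hp)) fun _ ↦ rfl⟩

theorem NormalData.IsAdmissible.mono {D : NormalData} {V W : Set E7} (h : D.IsAdmissible V)
    (hWV : W ⊆ V) : D.IsAdmissible W :=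
  { h with
    smooth_u := h.smooth_u.mono hWV
    smooth_s6 := h.smooth_s6.mono hWV
    smooth_t6 := h.smooth_t6.mono hWV
    smooth_t7 := h.smooth_t7.mono hWV
    smooth_F4 := h.smooth_F4.mono hWV
    smooth_F5 := h.smooth_F5.mono hWV
    smooth_F6 := h.smooth_F6.mono hWV
    smooth_F7 := h.smooth_F7.mono hWV
    eq1 := fun x hx ↦ h.eq1 x (hWV hx)
    eq2 := fun x hx ↦ h.eq2 x (hWV hx)
    eq3 := fun x hx ↦ h.eq3 x (hWV hx)
    eq4 := fun x hx ↦ h.eq4 x (hWV hx) }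

/-- The neighbourhood is the preimage of a coordinate ball, which is contractible; the normal form
persists under restriction of the chart. -/
theorem Metric43.IsNormalIn.exists_isSimplyConnected (h : g.IsNormalIn e) {p : M}
    (hp : p ∈ e.source) :
    ∃ U : Set M, IsOpen U ∧ IsSimplyConnected U ∧ p ∈ U ∧ g.HolIsIII1a U p := by
  obtain ⟨he, D, hD, hG⟩ := h
  obtain ⟨r, hr, hrt⟩ := Metric.isOpen_iff.1 e.open_target _ (e.map_source hp)
  have hWo : IsOpen (e.source ∩ e ⁻¹' ball (e p) r) :=
    e.continuousOn.isOpen_inter_preimage e.open_source isOpen_ball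
  set e' := e.restr (e.source ∩ e ⁻¹' ball (e p) r) with he'
  have hsrc : e'.source = e.source ∩ e ⁻¹' ball (e p) r := by
    rw [he', e.restr_source, hWo.interior_eq, ← inter_assoc, inter_self]
  have htar : e'.target = ball (e p) r := by
    rw [← e'.image_source_eq_target, hsrc]
    refine Subset.antisymm (fun x ⟨q, hq, hqx⟩ ↦ hqx ▸ hq.2) fun x hx ↦ ?_
    exact ⟨e.symm x, ⟨e.map_target (hrt hx), by rwa [mem_preimage, e.right_inv (hrt hx)]⟩,
      e.right_inv (hrt hx)⟩
  have hN : g.IsNormalIn e' := by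
    refine ⟨restr_mem_maximalAtlas _ he hWo, D, hD.mono (htar ▸ hrt), fun x hx v w ↦ ?_⟩
    exact hG x (hrt (htar ▸ hx)) v w
  have hp' : p ∈ e'.source := by rw [hsrc]; exact ⟨hp, mem_ball_self hr⟩
  refine ⟨e'.source, e'.open_source, ?_, hp', hN.holIsIII1a hp'⟩
  have : ContractibleSpace e'.target := by
    rw [htar]
    exact (convex_ball (e p) r).contractibleSpace (nonempty_ball.2 hr)
  have : ContractibleSpace e'.source := e'.toHomeomorphSourceTarget.contractibleSpace
  exact SimplyConnectedSpace.ofContractible _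

end Sufficiency

/-! ### Curvature -/

section Curvature

set_option linter.unusedSectionVars false
set_option maxSynthPendingDepth 3

variable {M : Type*} [TopologicalSpace M] [ChartedSpace E7 M] [IsManifold 𝓘(ℝ, E7) ∞ M]
  {g : Metric43 M} {e : OpenPartialHomeomorph M E7} {V : Set E7} {B : E7 → E7 →L[ℝ] E7}
  {Θ : E7 → E7 →L[ℝ] E7 →L[ℝ] E7}

/-- The curvature of a connection form. -/
noncomputable def curvature (Θ : E7 → E7 →L[ℝ] E7 →L[ℝ] E7) (x v w : E7) : E7 →L[ℝ] E7 :=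
  fderiv ℝ Θ x v w - fderiv ℝ Θ x w v + (Θ x v ∘L Θ x w - Θ x w ∘L Θ x v)

/-- The curvature operators belong to the holonomy algebra. -/
theorem IsLCCoframe.curvature_mem_frameHol (h : IsLCCoframe (g.inChart e) V B Θ)
    (he : e ∈ IsManifold.maximalAtlas 𝓘(ℝ, E7) ∞ M) {p : M} (hp : p ∈ e.source) (hpV : e p ∈ V)
    {U : Set M} (hU : IsOpen U) (hpU : p ∈ U) {φ : T7 p ≃ₗ[ℝ] E7}
    (hφ : ∀ v, φ v = frameAt e B p v) (v w : E7) :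
    curvature Θ (e p) v w ∈ g.frameHol hpU φ := by
  -- A radial coframe at `p` has a connection form with values in the closed subspace `frameHol`, so
  -- the first derivatives of that form lie there as well. Since the form vanishes at the centre,
  -- these derivatives give the curvature.
  obtain ⟨r, hr, hrV, B', Θ', h', hB', hΘ'0, hhol⟩ := exists_radial_frames_frameHol g he hU hpU hp
    (φ := φ) (fun v w ↦ by rw [hφ, hφ, inner_eq_form43 he h hp hpV])
  set x := e p with hx
  have hWo : IsOpen (V ∩ ball x r) := h.isOpen.inter isOpen_ball
  have hxW : x ∈ V ∩ ball x r := ⟨hpV, mem_ball_self hr⟩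
  obtain ⟨hSs, hSB, -, hSd⟩ :=
    (h.mono hWo inter_subset_left).transition (h'.mono hWo inter_subset_right)
  have hSx : B' x ∘L (B x).inverse = ContinuousLinearMap.id ℝ E7 := by
    refine ContinuousLinearMap.ext fun a ↦ ?_
    obtain ⟨w, rfl⟩ : ∃ w, B x w = a := ⟨_, h.apply_inverse hpV a⟩
    rw [hSB x hxW]
    have hxt := e.map_source hp
    have h1 := hB' (φ.symm (B x w))
    rw [LinearEquiv.apply_symm_apply] at h1
    have h2 := hφ (φ.symm (B x w))
    rw [LinearEquiv.apply_symm_apply] at h2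
    rw [frameAt_apply] at h1 h2
    have h3 := congrArg (B x).inverse h2
    rw [h.inverse_apply hpV, h.inverse_apply hpV] at h3
    rw [← h3] at h1
    exact h1
  set S : E7 → E7 →L[ℝ] E7 := fun y ↦ B' y ∘L (B y).inverse with hSdef
  have hd1 : HasFDerivAt Θ (fderiv ℝ Θ x) x :=
    ((h.smooth_conn.contDiffAt (h.isOpen.mem_nhds hpV)).differentiableAt (by simp)).hasFDerivAt
  have hd2 : HasFDerivAt Θ' (fderiv ℝ Θ' x) x :=
    ((h'.smooth_conn.contDiffAt (isOpen_ball.mem_nhds hxW.2)).differentiableAt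
      (by simp)).hasFDerivAt
  have hd3 : HasFDerivAt S (fderiv ℝ S x) x :=
    ((hSs.contDiffAt (hWo.mem_nhds hxW)).differentiableAt (by simp)).hasFDerivAt
  have hmem : ∀ v w, fderiv ℝ Θ' x v w ∈ g.frameHol hpU φ := by
    intro v w
    have hl : HasDerivAt (fun t : ℝ ↦ x + t • v) v 0 := by
      simpa using ((hasDerivAt_id (0 : ℝ)).smul_const v).const_add x
    have hx0 : x + (0 : ℝ) • v = x := by simp
    have h1 : HasDerivAt (fun t : ℝ ↦ Θ' (x + t • v)) (fderiv ℝ Θ' x v) 0 :=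
      HasFDerivAt.comp_hasDerivAt (0 : ℝ) (by rw [hx0]; exact hd2) hl
    have h2 : HasDerivAt (fun t : ℝ ↦ Θ' (x + t • v) w) (fderiv ℝ Θ' x v w) 0 := by
      simpa using h1.clm_apply (hasDerivAt_const (0 : ℝ) w)
    refine hasDerivAt_mem_submodule h2 ?_
    have : ∀ᶠ t : ℝ in 𝓝 0, x + t • v ∈ ball x r :=
      hl.continuousAt.preimage_mem_nhds (by rw [hx0]; exact ball_mem_nhds x hr)
    filter_upwards [this] with t ht using hhol _ ht w
  -- the second derivative of the change of coframe
  have hdd : ∀ v w a, fderiv ℝ (fderiv ℝ S) x v w a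
      = Θ x v (Θ x w a) + fderiv ℝ Θ x v w a - fderiv ℝ Θ' x v w a := by
    intro v w a
    have hSdd : HasFDerivAt (fderiv ℝ S) (fderiv ℝ (fderiv ℝ S) x) x :=
      (((hSs.fderiv_of_isOpen hWo (m := ∞) (by simp)).contDiffAt
        (hWo.mem_nhds hxW)).differentiableAt (by simp)).hasFDerivAt
    have h1 := (hSdd.clm_apply (hasFDerivAt_const w x)).clm_apply (hasFDerivAt_const a x)
    have h2 := (hd3.clm_apply ((hd1.clm_apply (hasFDerivAt_const w x)).clm_apply
      (hasFDerivAt_const a x))).sub ((hd2.clm_apply (hasFDerivAt_const w x)).clm_apply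
        (hd3.clm_apply (hasFDerivAt_const a x)))
    have h3 := h1.congr_of_eventuallyEq
      (f₁ := fun y ↦ S y (Θ y w a) - Θ' y w (S y a)) (by
        filter_upwards [hWo.mem_nhds hxW] with y hy using (hSd y hy w a).symm)
    have h4 := DFunLike.congr_fun (h3.unique h2) v
    have h5 : fderiv ℝ S x v (Θ x w a) = Θ x v (Θ x w a) := by
      rw [hSd x hxW, hΘ'0]; simp only [hSx]; simp
    simp only [add_apply, sub_apply, ContinuousLinearMap.comp_apply,
      ContinuousLinearMap.flip_apply, zero_apply, map_zero, zero_add, hΘ'0] at h4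
    rw [h4, h5]
    simp only [S, hSx]
    simp only [ContinuousLinearMap.id_apply]
    abel
  have hsymm : IsSymmSndFDerivAt ℝ S x :=
    (hSs.contDiffAt (hWo.mem_nhds hxW)).isSymmSndFDerivAt (by simpa using ENat.LEInfty.out)
  -- The second derivative of the transition `S` is symmetric. Antisymmetrising its formula `hdd` at
  -- `x`, where `S` is the identity, equates the two curvatures.
  have key : curvature Θ x v w = fderiv ℝ Θ' x v w - fderiv ℝ Θ' x w v := by
    refine ContinuousLinearMap.ext fun a ↦ ?_
    have h1 := DFunLike.congr_fun (hsymm.eq v w) a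
    rw [hdd, hdd, ← sub_eq_zero] at h1
    simp only [curvature, add_apply, sub_apply, ContinuousLinearMap.comp_apply]
    rw [← sub_eq_zero]
    refine Eq.trans ?_ h1
    abel
  rw [key]
  exact Submodule.sub_mem _ (hmem v w) (hmem w v)

end Curvature

/-! ### The metric of an admissible system on `ℝ⁷` -/

/-- The scalar product `D.metric x` on the tangent space. -/
noncomputable def NormalData.innerL (D : NormalData) (x : E7) : T7 x →L[ℝ] T7 x →L[ℝ] ℝ :=
  (form43L.bilinearComp (D.coframeL x) (D.coframeL x) : E7 →L[ℝ] E7 →L[ℝ] ℝ)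

theorem NormalData.innerL_signature (D : NormalData) (x : E7) :
    ∃ b : Module.Basis (Fin 7) ℝ (T7 x), ∀ i j,
      D.innerL x (b i) (b j) = if i = j then (if i < 4 then -1 else 1) else 0 := by
  obtain ⟨K, hK⟩ := exists_diagonalizing
  obtain ⟨S, hS⟩ := NormalData.coframeL_isInvertible (D := D) x
  let b : Module.Basis (Fin 7) ℝ E7 := Module.Basis.ofEquivFun (S.toLinearEquiv.trans K.symm)
  have hb : ∀ i, D.coframeL x (b i) = K (Pi.single i 1) := fun i ↦ by
    simp only [b, Module.Basis.coe_ofEquivFun, ← hS]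
    simp
  refine ⟨b, fun i j ↦ ?_⟩
  change form43 (D.coframeL x (b i)) (D.coframeL x (b j)) = _
  rw [hb, hb, hK]
  revert i j
  refine forall_fin_seven ?_ ?_ ?_ ?_ ?_ ?_ ?_ <;>
    refine forall_fin_seven ?_ ?_ ?_ ?_ ?_ ?_ ?_ <;> simp [Fin.lt_def]

/-- The metric on `ℝ⁷` defined by globally admissible functions. -/
noncomputable def NormalData.IsAdmissible.metric43 {D : NormalData} (h : D.IsAdmissible univ) :
    Metric43 E7 where
  inner := D.innerL
  symm x v w := form43_comm _ _
  signature := D.innerL_signature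
  contMDiff := by
    intro x
    rw [contMDiffAt_section]
    have h1 : ContMDiffAt 𝓘(ℝ, E7) 𝓘(ℝ, E7 →L[ℝ] E7 →L[ℝ] ℝ) ∞
      (fun x ↦ form43L.bilinearComp (D.coframeL x) (D.coframeL x)) x := by
      have hc := h.contDiffOn_coframeL isOpen_univ
      have h2 : ContDiffOn ℝ ∞ (fun x ↦ form43L.bilinearComp (D.coframeL x) (D.coframeL x)) univ := by
        refine contDiffOn_clm_apply.2 fun v ↦ contDiffOn_clm_apply.2 fun w ↦ ?_
        exact (form43L.contDiff.comp_contDiffOn (hc.clm_apply contDiffOn_const)).clm_apply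
          (hc.clm_apply contDiffOn_const)
      exact (contDiffOn_univ.1 h2).contDiffAt.contMDiffAt
    -- Over the model space the trivialisations are the identity, so the section is its underlying
    -- function.
    convert! h1
    ext v w
    simp [hom_trivializationAt_apply, ContinuousLinearMap.inCoordinates, NormalData.innerL]
    rw [Trivialization.coe_linearMapAt_of_mem _ (by simp; exact mem_univ _)]
    simp [hom_trivializationAt_apply, ContinuousLinearMap.inCoordinates]
    rfl

theorem NormalData.IsAdmissible.inChart_refl {D : NormalData} (h : D.IsAdmissible univ)
    (x v w : E7) : h.metric43.inChart (OpenPartialHomeomorph.refl E7) x v w = D.metric x v w := by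
  have h1 : mfderiv 𝓘(ℝ, E7) 𝓘(ℝ, E7) (OpenPartialHomeomorph.refl E7).symm x
      = ContinuousLinearMap.id ℝ E7 := mfderiv_id
  simp only [Metric43.inChart]
  rw [h1]
  rfl

theorem refl_mem_maximalAtlas :
    OpenPartialHomeomorph.refl E7 ∈ IsManifold.maximalAtlas 𝓘(ℝ, E7) ∞ E7 :=
  IsManifold.chart_mem_maximalAtlas (I := 𝓘(ℝ, E7)) (n := ∞) (0 : E7)

theorem NormalData.IsAdmissible.coframe_metric43 {D : NormalData} (h : D.IsAdmissible univ) :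
    IsIII1aCoframe (h.metric43.inChart (OpenPartialHomeomorph.refl E7))
      (OpenPartialHomeomorph.refl E7).target D.coframeL D.conn :=
  { h.isIII1aCoframe isOpen_univ with metric := fun x _ v w ↦ h.inChart_refl x v w }

/-! ### The example: partial derivatives and admissibility -/

theorem pd_eq_of_hasDerivAt {f : E7 → ℝ} {x : E7} {i : Fin 7} {d : ℝ}
    (hf : DifferentiableAt ℝ f x) (h : HasDerivAt (fun t ↦ f (Function.update x i t)) d (x i)) :
    pd i f x = d := by
  have h1 : HasDerivAt (Function.update x i) (Pi.single i 1) (x i) := hasDerivAt_update x i (x i)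
  have h2 : HasFDerivAt f (fderiv ℝ f x) (Function.update x i (x i)) := by
    rw [Function.update_eq_self]; exact hf.hasFDerivAt
  exact (h2.comp_hasDerivAt (x i) h1).unique h

namespace NormalData

theorem one_add_exp_ne_zero (t : ℝ) : 1 + Real.exp t ≠ 0 := by positivity

theorem contDiff_one_add_exp : ContDiff ℝ ∞ (fun x : E7 ↦ 1 + Real.exp (x 4)) := by fun_prop

theorem example_contDiff_u : ContDiff ℝ ∞ example1a.u := by
  have h : ContDiff ℝ ∞ (fun x : E7 ↦ 4 * x 6 / (1 + Real.exp (x 4))) :=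
    ContDiff.div (by fun_prop) contDiff_one_add_exp fun x ↦ one_add_exp_ne_zero _
  have h' : ContDiff ℝ ∞ (fun x : E7 ↦ 4 / 3 * x 5) := by fun_prop
  exact h'.add h

theorem example_contDiff_s6 : ContDiff ℝ ∞ example1a.s6 := by
  unfold example1a; fun_prop

theorem example_contDiff_t6 : ContDiff ℝ ∞ example1a.t6 :=
  ContDiff.div (by fun_prop) contDiff_one_add_exp fun x ↦ one_add_exp_ne_zero _

theorem example_contDiff_t7 : ContDiff ℝ ∞ example1a.t7 :=
  ContDiff.div (by fun_prop) (contDiff_one_add_exp.pow 2)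
    fun x ↦ pow_ne_zero 2 (one_add_exp_ne_zero _)

theorem example_dep_u : DependsOn example1a.u {4, 5, 6} := fun x y h ↦ by
  simp [example1a, h 4, h 5, h 6]

theorem example_dep_s6 : DependsOn example1a.s6 {1, 2, 4, 5, 6} := fun x y h ↦ by
  simp [example1a, h 1, h 2, h 4]

theorem example_dep_t6 : DependsOn example1a.t6 {1, 2, 4, 5, 6} := fun x y h ↦ by
  simp [example1a, h 1, h 2, h 4]

theorem example_dep_t7 : DependsOn example1a.t7 {1, 2, 4, 5, 6} := fun x y h ↦ by
  simp [example1a, h 1, h 2, h 4]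

theorem example_s7 : example1a.s7 = example1a.t6 := by
  funext x; simp [s7, example1a]

theorem pd_example_u5 (x : E7) : pd 5 example1a.u x = 4 / 3 := by
  refine pd_eq_of_hasDerivAt (example_contDiff_u.differentiable (by simp) x) ?_
  have h := ((hasDerivAt_id (x 5)).const_mul (4 / 3)).add_const (4 * x 6 / (1 + Real.exp (x 4)))
  simpa [example1a] using h

theorem pd_example_u6 (x : E7) : pd 6 example1a.u x = 4 / (1 + Real.exp (x 4)) := by
  refine pd_eq_of_hasDerivAt (example_contDiff_u.differentiable (by simp) x) ?_
  have h := (((hasDerivAt_id (x 6)).const_mul 4).div_const (1 + Real.exp (x 4))).const_add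
    (4 / 3 * x 5)
  simpa [example1a] using h

theorem pd_example_s61 (x : E7) : pd 1 example1a.s6 x = 1 / 3 := by
  refine pd_eq_of_hasDerivAt (example_contDiff_s6.differentiable (by simp) x) ?_
  have h := ((hasDerivAt_id (x 1)).add_const (x 2 * (1 + Real.exp (x 4)))).const_mul (1 / 3)
  simpa [example1a] using h

theorem pd_example_s62 (x : E7) : pd 2 example1a.s6 x = (1 + Real.exp (x 4)) / 3 := by
  refine pd_eq_of_hasDerivAt (example_contDiff_s6.differentiable (by simp) x) ?_
  have h := (((hasDerivAt_id (x 2)).mul_const (1 + Real.exp (x 4))).const_add (x 1)).const_mul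
    (1 / 3)
  simpa [example1a, div_eq_inv_mul] using h

theorem pd_example_t61 (x : E7) : pd 1 example1a.t6 x = 1 / (1 + Real.exp (x 4)) := by
  refine pd_eq_of_hasDerivAt (example_contDiff_t6.differentiable (by simp) x) ?_
  have h := ((hasDerivAt_id (x 1)).add_const (x 2 * (1 + Real.exp (x 4)))).div_const
    (1 + Real.exp (x 4))
  simpa [example1a] using h

theorem pd_example_t62 (x : E7) : pd 2 example1a.t6 x = 1 := by
  refine pd_eq_of_hasDerivAt (example_contDiff_t6.differentiable (by simp) x) ?_
  have h := (((hasDerivAt_id (x 2)).mul_const (1 + Real.exp (x 4))).const_add (x 1)).div_const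
    (1 + Real.exp (x 4))
  simpa [example1a, one_add_exp_ne_zero] using h

theorem pd_example_t71 (x : E7) : pd 1 example1a.t7 x = 3 / (1 + Real.exp (x 4)) ^ 2 := by
  refine pd_eq_of_hasDerivAt (example_contDiff_t7.differentiable (by simp) x) ?_
  have h := (((hasDerivAt_id (x 1)).add_const (x 2 * (1 + Real.exp (x 4)))).const_mul 3).div_const
    ((1 + Real.exp (x 4)) ^ 2)
  simpa [example1a] using h

theorem pd_example_t72 (x : E7) : pd 2 example1a.t7 x = 3 / (1 + Real.exp (x 4)) := by
  refine pd_eq_of_hasDerivAt (example_contDiff_t7.differentiable (by simp) x) ?_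
  have h := ((((hasDerivAt_id (x 2)).mul_const (1 + Real.exp (x 4))).const_add (x 1)).const_mul
    3).div_const ((1 + Real.exp (x 4)) ^ 2)
  have e : 3 / (1 + Real.exp (x 4)) = 3 * (1 * (1 + Real.exp (x 4))) / (1 + Real.exp (x 4)) ^ 2 := by
    have := one_add_exp_ne_zero (x 4)
    field_simp
  rw [e]
  simpa [example1a] using h

theorem isAdmissible_example1a : example1a.IsAdmissible univ where
  smooth_u := example_contDiff_u.contDiffOn
  smooth_s6 := example_contDiff_s6.contDiffOn
  smooth_t6 := example_contDiff_t6.contDiffOn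
  smooth_t7 := example_contDiff_t7.contDiffOn
  smooth_F4 := contDiffOn_const
  smooth_F5 := contDiffOn_const
  smooth_F6 := by
    have h : ContDiff ℝ ∞ (fun x : E7 ↦ x 5 * x 6) := by fun_prop
    exact h.contDiffOn
  smooth_F7 := contDiffOn_const
  dep_u := example_dep_u
  dep_s6 := example_dep_s6
  dep_t6 := example_dep_t6
  dep_t7 := example_dep_t7
  dep_F4 := fun _ _ _ ↦ rfl
  dep_F5 := fun _ _ _ ↦ rfl
  dep_F6 := fun x y h ↦ by simp [example1a, h 5, h 6]
  dep_F7 := fun _ _ _ ↦ rfl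
  eq1 x _ := by rw [pd_example_u5, pd_example_s61, pd_example_t62]; norm_num
  eq2 x _ := by rw [pd_example_u6, pd_example_t72, pd_example_t61]; ring
  eq3 x _ := by
    have h5 : pd 5 example1a.t6 x = 0 := pd_eq_of_hasDerivAt
      (example_contDiff_t6.differentiable (by simp) x) (by simpa [example1a] using hasDerivAt_const _ _)
    have h6 : pd 6 example1a.s6 x = 0 := pd_eq_of_hasDerivAt
      (example_contDiff_s6.differentiable (by simp) x) (by simpa [example1a] using hasDerivAt_const _ _)
    rw [example_s7, h5, h6, pd_example_s62, pd_example_s61, pd_example_t62, pd_example_t61]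
    simp only [example1a]
    have := one_add_exp_ne_zero (x 4)
    field_simp
  eq4 x _ := by
    have h5 : pd 5 example1a.t7 x = 0 := pd_eq_of_hasDerivAt
      (example_contDiff_t7.differentiable (by simp) x) (by simpa [example1a] using hasDerivAt_const _ _)
    have h6 : pd 6 example1a.t6 x = 0 := pd_eq_of_hasDerivAt
      (example_contDiff_t6.differentiable (by simp) x) (by simpa [example1a] using hasDerivAt_const _ _)
    rw [example_s7, h5, h6, pd_example_t62, pd_example_t61, pd_example_t72, pd_example_t71]
    simp only [example1a]
    have := one_add_exp_ne_zero (x 4)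
    field_simp

/-- The bracket in the formula for `r₅`, for the example. -/
theorem bracket_example (x : E7) : example1a.bracket x
    = Real.exp (example1a.u x) * (x 5 + 4 * x 5 * x 6 / (1 + Real.exp (x 4))) := by
  have hF : Differentiable ℝ (fun x : E7 ↦ Real.exp (example1a.u x) * example1a.F6 x) := by
    have h1 := example_contDiff_u.differentiable (by simp)
    have h2 : Differentiable ℝ example1a.F6 := by unfold example1a; fun_prop
    exact h1.exp.mul h2
  have h6 : pd 6 (fun x : E7 ↦ Real.exp (example1a.u x) * example1a.F6 x) x
      = Real.exp (example1a.u x) * (x 5 + 4 * x 5 * x 6 / (1 + Real.exp (x 4))) := by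
    refine pd_eq_of_hasDerivAt (hF x) ?_
    have h1 := ((((hasDerivAt_id (x 6)).const_mul 4).div_const (1 + Real.exp (x 4))).const_add
      (4 / 3 * x 5)).exp.mul ((hasDerivAt_id (x 6)).const_mul (x 5))
    refine (h1.congr_of_eventuallyEq (Eventually.of_forall fun t ↦ ?_)).congr_deriv ?_
    · simp [example1a]
    · simp only [example1a, id]
      ring
  have h5 : pd 5 (fun x : E7 ↦ Real.exp (example1a.u x) * example1a.F7 x) x = 0 := by
    simp [pd, example1a]
  have h4 : pd 4 example1a.F4 x = 0 := by simp [pd, example1a]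
  rw [bracket, h6, h5, h4]
  ring

end NormalData

/-! ### The example: the holonomy algebra -/

/-- The isomorphism of `ℝ⁷` with the Lie algebra of Type III 1a. -/
noncomputable def hEnd : E7 →L[ℝ] E7 →L[ℝ] E7 :=
  hForm (ContinuousLinearMap.proj 0) (ContinuousLinearMap.proj 1) (ContinuousLinearMap.proj 2)
    (ContinuousLinearMap.proj 3) (ContinuousLinearMap.proj 4) (ContinuousLinearMap.proj 5)
    (ContinuousLinearMap.proj 6)

theorem hEnd_apply (c w : E7) :
    hEnd c w = hVec (c 0) (c 1) (c 2) (c 3) (c 4) (c 5) (c 6) w := rfl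

/-- The coordinates of an endomorphism of Type III 1a. -/
noncomputable def hCoord : (E7 →L[ℝ] E7) →L[ℝ] E7 :=
  LinearMap.toContinuousLinearMap
    { toFun T := ![T (Pi.single 1 1) 1, T (Pi.single 2 1) 1, T (Pi.single 1 1) 2,
        T (Pi.single 2 1) 2, T (Pi.single 6 1) 1, T (Pi.single 4 1) 1, T (Pi.single 4 1) 2]
      map_add' a c := by
        ext i; revert i; refine forall_fin_seven ?_ ?_ ?_ ?_ ?_ ?_ ?_ <;> simp
      map_smul' s a := by
        ext i; revert i; refine forall_fin_seven ?_ ?_ ?_ ?_ ?_ ?_ ?_ <;> simp }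

theorem hCoord_hEnd (c : E7) : hCoord (hEnd c) = c := by
  change ![hEnd c (Pi.single 1 1) 1, hEnd c (Pi.single 2 1) 1, hEnd c (Pi.single 1 1) 2,
    hEnd c (Pi.single 2 1) 2, hEnd c (Pi.single 6 1) 1, hEnd c (Pi.single 4 1) 1,
    hEnd c (Pi.single 4 1) 2] = c
  ext i; revert i
  refine forall_fin_seven ?_ ?_ ?_ ?_ ?_ ?_ ?_ <;> simp [hEnd_apply, hVec]

/-- The Lie bracket in the coordinates given by `hEnd`. -/
noncomputable def hLie (c d : E7) : E7 :=
  ![c 1 * d 2 - d 1 * c 2,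
    c 0 * d 1 + c 1 * d 3 - d 0 * c 1 - d 1 * c 3,
    c 2 * d 0 + c 3 * d 2 - d 2 * c 0 - d 3 * c 2,
    c 2 * d 1 - d 2 * c 1,
    (c 0 + c 3) * d 4 - (d 0 + d 3) * c 4,
    c 0 * d 5 + c 1 * d 6 - (d 0 + d 3) * c 5 - (d 0 * c 5 + d 1 * c 6 - (c 0 + c 3) * d 5),
    c 2 * d 5 + c 3 * d 6 - (d 0 + d 3) * c 6 - (d 2 * c 5 + d 3 * c 6 - (c 0 + c 3) * d 6)]

theorem hEnd_hLie (c d : E7) : hEnd c ∘L hEnd d - hEnd d ∘L hEnd c = hEnd (hLie c d) := by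
  refine ContinuousLinearMap.ext fun w ↦ ?_
  simp only [sub_apply, ContinuousLinearMap.comp_apply, hEnd_apply]
  ext i; revert i
  refine forall_fin_seven ?_ ?_ ?_ ?_ ?_ ?_ ?_ <;> simp [hVec, hLie] <;> ring

/-- A bracket-closed subspace that contains certain elements is everything. -/
theorem eq_top_of_hLie_mem {N : Submodule ℝ E7} (hN : ∀ c ∈ N, ∀ d ∈ N, hLie c d ∈ N)
    {X Y Z : E7} (hX : X ∈ N) (hY : Y ∈ N) (hZ : Z ∈ N)
    (hX0 : X 0 = 0) (hX1 : X 1 = 1 / 3) (hX2 : X 2 = -1 / 4) (hX3 : X 3 = 0) (hX4 : X 4 = -1 / 2)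
    (hY0 : Y 0 = -1 / 4) (hY1 : Y 1 = 0) (hY2 : Y 2 = -3 / 4) (hY3 : Y 3 = -3 / 4) (hY4 : Y 4 = 0)
    (hZ0 : Z = Pi.single 6 (-1)) (c : E7) : c ∈ N := by
  have h6 : ∀ s : ℝ, (![0, 0, 0, 0, 0, 0, s] : E7) ∈ N := by
    intro s
    convert N.smul_mem (-s) hZ using 1
    subst hZ0
    ext i; revert i
    refine forall_fin_seven ?_ ?_ ?_ ?_ ?_ ?_ ?_ <;> simp
  -- The bracket with `X` sends the last coordinate direction to `1 / 3` of the one before it; the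
  -- factor `3` compensates for `X 1 = 1 / 3`.
  have h5 : ∀ s : ℝ, (![0, 0, 0, 0, 0, s, 0] : E7) ∈ N := by
    intro s
    convert hN X hX _ (h6 (3 * s)) using 1
    ext i; revert i
    refine forall_fin_seven ?_ ?_ ?_ ?_ ?_ ?_ ?_ <;> simp [hLie, hX0, hX1, hX2, hX3, hX4]
  -- The whole `y`-part is now available, so that the computation continues modulo it.
  have hX' : (![0, 1 / 3, -1 / 4, 0, -1 / 2, 0, 0] : E7) ∈ N := by
    convert N.sub_mem (N.sub_mem hX (h6 (X 6))) (h5 (X 5)) using 1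
    ext i; revert i
    refine forall_fin_seven ?_ ?_ ?_ ?_ ?_ ?_ ?_ <;> simp only [Pi.sub_apply] <;>
      simp [hX0, hX1, hX2, hX3, hX4]
  have hY' : (![-1 / 4, 0, -3 / 4, -3 / 4, 0, 0, 0] : E7) ∈ N := by
    convert N.sub_mem (N.sub_mem hY (h6 (Y 6))) (h5 (Y 5)) using 1
    ext i; revert i
    refine forall_fin_seven ?_ ?_ ?_ ?_ ?_ ?_ ?_ <;> simp only [Pi.sub_apply] <;>
      simp [hY0, hY1, hY2, hY3, hY4]
  have hXY : (![-1 / 4, -1 / 6, -1 / 8, 1 / 4, -1 / 2, 0, 0] : E7) ∈ N := by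
    convert hN _ hX' _ hY' using 1
    ext i; revert i
    refine forall_fin_seven ?_ ?_ ?_ ?_ ?_ ?_ ?_ <;> simp [hLie] <;> norm_num
  have hXXY : (![-1 / 12, 1 / 6, 1 / 8, 1 / 12, 0, 0, 0] : E7) ∈ N := by
    convert hN _ hX' _ hXY using 1
    ext i; revert i
    refine forall_fin_seven ?_ ?_ ?_ ?_ ?_ ?_ ?_ <;> simp [hLie] <;> norm_num
  have hYXY : (![-1 / 8, -1 / 12, 7 / 16, 1 / 8, 1 / 2, 0, 0] : E7) ∈ N := by
    convert hN _ hY' _ hXY using 1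
    ext i; revert i
    refine forall_fin_seven ?_ ?_ ?_ ?_ ?_ ?_ ?_ <;> simp [hLie] <;> norm_num
  have hYYXY : (![-1 / 16, -1 / 24, -1 / 32, 1 / 16, -1 / 2, 0, 0] : E7) ∈ N := by
    convert hN _ hY' _ hYXY using 1
    ext i; revert i
    refine forall_fin_seven ?_ ?_ ?_ ?_ ?_ ?_ ?_ <;> simp [hLie] <;> norm_num
  -- The vectors of `hYYXY` and of `hXY`, the latter scaled by `1 / 4`, have equal `𝔤𝔩(2)`-parts.
  -- Their difference is `-3 / 8` in the `v`-direction.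
  have h4 : ∀ s : ℝ, (![0, 0, 0, 0, s, 0, 0] : E7) ∈ N := by
    intro s
    convert N.smul_mem (-(8 / 3) * s) (N.sub_mem hYYXY (N.smul_mem (1 / 4) hXY)) using 1
    ext i; revert i
    refine forall_fin_seven ?_ ?_ ?_ ?_ ?_ ?_ ?_ <;>
      simp only [Pi.smul_apply, Pi.sub_apply, smul_eq_mul, Matrix.cons_val] <;> ring
  have hA0 : (![1, 0, 0, -1, 0, 0, 0] : E7) ∈ N := by
    convert N.add_mem (N.smul_mem (-3) (N.add_mem hXY hXXY)) (h4 (-(3 / 2))) using 1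
    ext i; revert i
    refine forall_fin_seven ?_ ?_ ?_ ?_ ?_ ?_ ?_ <;> simp <;> norm_num
  have hP : (![0, 1 / 6, 1 / 8, 0, 0, 0, 0] : E7) ∈ N := by
    convert N.add_mem hXXY (N.smul_mem (1 / 12) hA0) using 1
    ext i; revert i
    refine forall_fin_seven ?_ ?_ ?_ ?_ ?_ ?_ ?_ <;> simp
    norm_num
  have hQ : (![0, 1 / 3, -1 / 4, 0, 0, 0, 0] : E7) ∈ N := by
    convert N.add_mem hX' (h4 (1 / 2)) using 1
    ext i; revert i
    refine forall_fin_seven ?_ ?_ ?_ ?_ ?_ ?_ ?_ <;> simp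
    norm_num
  have hA1 : (![0, 1, 0, 0, 0, 0, 0] : E7) ∈ N := by
    convert N.add_mem (N.smul_mem (3 / 2) hQ) (N.smul_mem 3 hP) using 1
    ext i; revert i
    refine forall_fin_seven ?_ ?_ ?_ ?_ ?_ ?_ ?_ <;> simp <;> norm_num
  have hA2 : (![0, 0, 1, 0, 0, 0, 0] : E7) ∈ N := by
    convert N.sub_mem (N.smul_mem 4 hP) (N.smul_mem 2 hQ) using 1
    ext i; revert i
    refine forall_fin_seven ?_ ?_ ?_ ?_ ?_ ?_ ?_ <;> simp <;> norm_num
  have hA3 : (![0, 0, 0, 1, 0, 0, 0] : E7) ∈ N := by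
    convert N.sub_mem (N.sub_mem (N.smul_mem (-1) hY') (N.smul_mem (1 / 4) hA0))
      (N.smul_mem (3 / 4) hA2) using 1
    ext i; revert i
    refine forall_fin_seven ?_ ?_ ?_ ?_ ?_ ?_ ?_ <;> simp <;> norm_num
  -- The coefficient `c 0 + c 3` of `hA3` makes up for the entry `-1` of `hA0`.
  convert N.add_mem (N.add_mem (N.add_mem (N.add_mem (N.add_mem (N.add_mem
    (N.smul_mem (c 0) hA0) (N.smul_mem (c 1) hA1)) (N.smul_mem (c 2) hA2))
    (N.smul_mem (c 0 + c 3) hA3)) (h4 (c 4))) (h5 (c 5))) (h6 (c 6)) using 1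
  ext i; revert i
  refine forall_fin_seven ?_ ?_ ?_ ?_ ?_ ?_ ?_ <;> simp

namespace NormalData

variable {D : NormalData}

/-- The coordinates of the connection form. -/
noncomputable def connVec (D : NormalData) (x v : E7) : E7 := hCoord (D.conn x v)

theorem conn_eq (x v : E7) : D.conn x v = hEnd ![oneForm 0 (pd 1 D.s6 x) (pd 1 D.s7 x) v,
    oneForm 0 (pd 2 D.s6 x) (pd 2 D.s7 x) v, oneForm 0 (pd 1 D.t6 x) (pd 1 D.t7 x) v,
    oneForm 0 (pd 2 D.t6 x) (pd 2 D.t7 x) v, oneForm (D.bracket x / 2) 0 0 v,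
    oneForm (pd 4 D.r6 x - pd 5 D.r5 x - pd 5 D.u x * D.r5 x)
      (Real.exp (-D.u x) * pd 4 D.s6 x)
      (Real.exp (-D.u x) * pd 4 D.s7 x + Real.exp (-D.u x) * D.bracket x / 2) v,
    oneForm (pd 4 D.r7 x - pd 6 D.r5 x - pd 6 D.u x * D.r5 x)
      (Real.exp (-D.u x) * pd 4 D.t6 x - Real.exp (-D.u x) * D.bracket x / 2)
      (Real.exp (-D.u x) * pd 4 D.t7 x) v] :=
  ContinuousLinearMap.ext fun _ ↦ rfl

theorem hEnd_connVec (x v : E7) : hEnd (D.connVec x v) = D.conn x v := by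
  rw [connVec, conn_eq, hCoord_hEnd]

theorem IsAdmissible.differentiableAt_connVec (h : D.IsAdmissible univ) (x w : E7) (k : Fin 7) :
    DifferentiableAt ℝ (fun y ↦ D.connVec y w k) x := by
  have hd : DifferentiableAt ℝ D.conn x :=
    ((h.contDiffOn_conn isOpen_univ).contDiffAt univ_mem).differentiableAt (by simp)
  exact differentiableAt_pi.1
    (hCoord.differentiableAt.comp x (hd.clm_apply (differentiableAt_const w))) k

set_option maxSynthPendingDepth 3 in
/-- The coordinates of the curvature. -/
theorem IsAdmissible.exists_curvature (h : D.IsAdmissible univ) (x : E7) (i j : Fin 7) :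
    ∃ c : E7, curvature D.conn x (Pi.single i 1) (Pi.single j 1) = hEnd c ∧
      ∀ k, c k = pd i (fun y ↦ D.connVec y (Pi.single j 1) k) x
        - pd j (fun y ↦ D.connVec y (Pi.single i 1) k) x
        + hLie (D.connVec x (Pi.single i 1)) (D.connVec x (Pi.single j 1)) k := by
  have hd : HasFDerivAt D.conn (fderiv ℝ D.conn x) x :=
    (((h.contDiffOn_conn isOpen_univ).contDiffAt univ_mem).differentiableAt (by simp)).hasFDerivAt
  have hd1 : ∀ w, HasFDerivAt (fun y ↦ D.conn y w) ((fderiv ℝ D.conn x).flip w) x := fun w ↦ by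
    simpa using hd.clm_apply (hasFDerivAt_const w x)
  have hd2 : ∀ w, HasFDerivAt (fun y ↦ D.connVec y w) (hCoord ∘L (fderiv ℝ D.conn x).flip w) x :=
    fun w ↦ hCoord.hasFDerivAt.comp x (hd1 w)
  have hd3 : ∀ v w, fderiv ℝ D.conn x v w = hEnd (hCoord (fderiv ℝ D.conn x v w)) := fun v w ↦ by
    have h1 := (hEnd.hasFDerivAt.comp x (hd2 w)).congr_of_eventuallyEq (f₁ := fun y ↦ D.conn y w)
      (Eventually.of_forall fun y ↦ (hEnd_connVec y w).symm)
    exact DFunLike.congr_fun ((hd1 w).unique h1) v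
  have hd4 : ∀ i w k, hCoord (fderiv ℝ D.conn x (Pi.single i 1) w) k
      = pd i (fun y ↦ D.connVec y w k) x := fun i w k ↦ by
    have := (hasFDerivAt_pi'.1 (hd2 w)) k
    rw [pd, this.fderiv]; rfl
  refine ⟨hCoord (fderiv ℝ D.conn x (Pi.single i 1) (Pi.single j 1))
    - hCoord (fderiv ℝ D.conn x (Pi.single j 1) (Pi.single i 1))
    + hLie (D.connVec x (Pi.single i 1)) (D.connVec x (Pi.single j 1)), ?_, fun k ↦ ?_⟩
  · rw [map_add, map_sub, ← hd3, ← hd3, ← hEnd_hLie, hEnd_connVec, hEnd_connVec]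
    rfl
  · rw [Pi.add_apply, Pi.sub_apply, hd4, hd4]

theorem example_connVec4 (x : E7) :
    example1a.connVec x (Pi.single 4 1) 0 = 0 ∧ example1a.connVec x (Pi.single 4 1) 1 = 0 ∧
    example1a.connVec x (Pi.single 4 1) 2 = 0 ∧ example1a.connVec x (Pi.single 4 1) 3 = 0 ∧
    example1a.connVec x (Pi.single 4 1) 4 = example1a.bracket x / 2 ∧
    example1a.connVec x (Pi.single 4 1) 5
      = pd 4 example1a.r6 x - pd 5 example1a.r5 x - 4 / 3 * example1a.r5 x ∧
    example1a.connVec x (Pi.single 4 1) 6 = pd 4 example1a.r7 x - pd 6 example1a.r5 x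
      - 4 / (1 + Real.exp (x 4)) * example1a.r5 x := by
  rw [connVec, conn_eq, hCoord_hEnd, pd_example_u5, pd_example_u6]
  simp [oneForm_apply]

theorem example_connVec5 (x : E7) :
    example1a.connVec x (Pi.single 5 1) 0 = 1 / 3 ∧
    example1a.connVec x (Pi.single 5 1) 1 = (1 + Real.exp (x 4)) / 3 ∧
    example1a.connVec x (Pi.single 5 1) 2 = 1 / (1 + Real.exp (x 4)) ∧
    example1a.connVec x (Pi.single 5 1) 3 = 1 ∧ example1a.connVec x (Pi.single 5 1) 4 = 0 := by
  rw [connVec, conn_eq, hCoord_hEnd, pd_example_s61, pd_example_s62, pd_example_t61,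
    pd_example_t62]
  simp [oneForm_apply]

theorem example_connVec6 (x : E7) :
    example1a.connVec x (Pi.single 6 1) 0 = 1 / (1 + Real.exp (x 4)) ∧
    example1a.connVec x (Pi.single 6 1) 1 = 1 ∧
    example1a.connVec x (Pi.single 6 1) 2 = 3 / (1 + Real.exp (x 4)) ^ 2 ∧
    example1a.connVec x (Pi.single 6 1) 3 = 3 / (1 + Real.exp (x 4)) ∧
    example1a.connVec x (Pi.single 6 1) 4 = 0 := by
  rw [connVec, conn_eq, hCoord_hEnd, example_s7, pd_example_t61, pd_example_t62, pd_example_t71,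
    pd_example_t72]
  simp [oneForm_apply]

theorem example_connVec0 (x : E7) : example1a.connVec x (Pi.single 0 1) = 0 := by
  rw [connVec, conn_eq, hCoord_hEnd]
  ext i; revert i
  refine forall_fin_seven ?_ ?_ ?_ ?_ ?_ ?_ ?_ <;> simp [oneForm_apply]

/-- Where `f` is not differentiable, `fderiv` is zero by convention, so no regularity is required.
-/
theorem pd_eq_zero_of_update {f : E7 → ℝ} {i : Fin 7} (h : ∀ x t, f (Function.update x i t) = f x)
    (x : E7) : pd i f x = 0 := by
  by_cases hf : DifferentiableAt ℝ f x
  · exact pd_eq_of_hasDerivAt hf (by simpa only [h] using hasDerivAt_const _ _)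
  · rw [pd, fderiv_zero_of_not_differentiableAt hf, zero_apply]

theorem pd_exp_coord (x : E7) {k : ℝ → ℝ} {d : ℝ} (hk : HasDerivAt k d (x 4)) :
    pd 4 (fun y ↦ k (y 4)) x = d := by
  have h1 : HasFDerivAt (fun y : E7 ↦ y 4)
      (ContinuousLinearMap.proj (R := ℝ) (φ := fun _ : Fin 7 ↦ ℝ) 4) x :=
    (ContinuousLinearMap.proj (R := ℝ) (φ := fun _ : Fin 7 ↦ ℝ) 4).hasFDerivAt
  have h2 := hk.comp_hasFDerivAt x h1
  change fderiv ℝ (k ∘ fun y : E7 ↦ y 4) x _ = d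
  rw [h2.fderiv]
  simp

end NormalData

/-! ### Curvature of the example at the origin. -/

namespace NormalData

theorem bracket_example_zero : example1a.bracket 0 = 0 := by
  rw [bracket_example]; simp

theorem differentiableAt_bracket_example :
    DifferentiableAt ℝ (fun x ↦ example1a.bracket x / 2) 0 := by
  have h : DifferentiableAt ℝ example1a.bracket 0 :=
    ((isAdmissible_example1a.smooth_bracket isOpen_univ).contDiffAt univ_mem).differentiableAt
      (by simp)
  simpa only [div_eq_mul_inv] using h.mul_const (2 : ℝ)⁻¹

theorem pd5_bracket_example : pd 5 (fun x ↦ example1a.bracket x / 2) 0 = 1 / 2 := by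
  refine pd_eq_of_hasDerivAt differentiableAt_bracket_example ?_
  have h := ((((hasDerivAt_id (0 : ℝ)).const_mul (4 / 3)).exp).mul (hasDerivAt_id (0 : ℝ))).div_const 2
  refine (h.congr_of_eventuallyEq (Eventually.of_forall fun t ↦ ?_)).congr_deriv ?_
  · rw [bracket_example]; simp [example1a]
  · simp

theorem pd6_bracket_example : pd 6 (fun x ↦ example1a.bracket x / 2) 0 = 0 := by
  refine pd_eq_of_hasDerivAt differentiableAt_bracket_example ?_
  refine (hasDerivAt_const _ (0 : ℝ)).congr_of_eventuallyEq (Eventually.of_forall fun t ↦ ?_)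
  simp [bracket_example]

theorem hasDerivAt_one_add_exp (t : ℝ) : HasDerivAt (fun t ↦ 1 + Real.exp t) (Real.exp t) t :=
  (Real.hasDerivAt_exp t).const_add 1

theorem hasDerivAt_const_div_one_add_exp (a t : ℝ) :
    HasDerivAt (fun t ↦ a / (1 + Real.exp t)) (-(a * Real.exp t) / (1 + Real.exp t) ^ 2) t := by
  refine ((hasDerivAt_const t a).div (hasDerivAt_one_add_exp t) (one_add_exp_ne_zero t)).congr_deriv
    ?_
  ring

/-- At the origin the bracket in `r5` vanishes, so the first five components of the commutator term
are zero and the derivatives of the connection form remain. The entry `-1 / 2` in the `v`-direction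
is due to `F6`. Components 5 and 6 are left open, since `eq_top_of_hLie_mem` removes them by means
of `example_curvature04`. -/
theorem example_curvature45 : ∃ X : E7,
    curvature example1a.conn 0 (Pi.single 4 1) (Pi.single 5 1) = hEnd X ∧
    X 0 = 0 ∧ X 1 = 1 / 3 ∧ X 2 = -1 / 4 ∧ X 3 = 0 ∧ X 4 = -1 / 2 := by
  obtain ⟨X, hX, hk⟩ := isAdmissible_example1a.exists_curvature 0 4 5
  have a0 := fun x ↦ (example_connVec4 x).1
  have a1 := fun x ↦ (example_connVec4 x).2.1
  have a2 := fun x ↦ (example_connVec4 x).2.2.1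
  have a3 := fun x ↦ (example_connVec4 x).2.2.2.1
  have a4 := fun x ↦ (example_connVec4 x).2.2.2.2.1
  have b0 := fun x ↦ (example_connVec5 x).1
  have b1 := fun x ↦ (example_connVec5 x).2.1
  have b2 := fun x ↦ (example_connVec5 x).2.2.1
  have b3 := fun x ↦ (example_connVec5 x).2.2.2.1
  have b4 := fun x ↦ (example_connVec5 x).2.2.2.2
  have d1 : pd 4 (fun x ↦ (1 + Real.exp (x 4)) / 3) 0 = 1 / 3 := by
    rw [pd_exp_coord 0 ((hasDerivAt_one_add_exp _).div_const 3)]; simp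
  have d2 : pd 4 (fun x ↦ 1 / (1 + Real.exp (x 4))) 0 = -1 / 4 := by
    rw [pd_exp_coord 0 (hasDerivAt_const_div_one_add_exp 1 _)]; norm_num
  refine ⟨X, hX, ?_, ?_, ?_, ?_, ?_⟩ <;> rw [hk] <;>
    simp only [a0, a1, a2, a3, a4, b0, b1, b2, b3, b4, hLie, d1, d2, pd5_bracket_example,
      bracket_example_zero, pd_const, Matrix.cons_val] <;> norm_num

/-- Again only derivatives survive in the first five components. The `v`-part is zero because the
bracket in `r5` vanishes along the last coordinate axis. -/
theorem example_curvature46 : ∃ Y : E7,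
    curvature example1a.conn 0 (Pi.single 4 1) (Pi.single 6 1) = hEnd Y ∧
    Y 0 = -1 / 4 ∧ Y 1 = 0 ∧ Y 2 = -3 / 4 ∧ Y 3 = -3 / 4 ∧ Y 4 = 0 := by
  obtain ⟨Y, hY, hk⟩ := isAdmissible_example1a.exists_curvature 0 4 6
  have a0 := fun x ↦ (example_connVec4 x).1
  have a1 := fun x ↦ (example_connVec4 x).2.1
  have a2 := fun x ↦ (example_connVec4 x).2.2.1
  have a3 := fun x ↦ (example_connVec4 x).2.2.2.1
  have a4 := fun x ↦ (example_connVec4 x).2.2.2.2.1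
  have b0 := fun x ↦ (example_connVec6 x).1
  have b1 := fun x ↦ (example_connVec6 x).2.1
  have b2 := fun x ↦ (example_connVec6 x).2.2.1
  have b3 := fun x ↦ (example_connVec6 x).2.2.2.1
  have b4 := fun x ↦ (example_connVec6 x).2.2.2.2
  have d0 : pd 4 (fun x ↦ 1 / (1 + Real.exp (x 4))) 0 = -1 / 4 := by
    rw [pd_exp_coord 0 (hasDerivAt_const_div_one_add_exp 1 _)]; norm_num
  have d2 : pd 4 (fun x ↦ 3 / (1 + Real.exp (x 4)) ^ 2) 0 = -3 / 4 := by
    rw [pd_exp_coord 0 ((hasDerivAt_const _ (3 : ℝ)).fun_div ((hasDerivAt_one_add_exp _).fun_pow 2)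
      (pow_ne_zero 2 (one_add_exp_ne_zero _)))]
    norm_num
  have d3 : pd 4 (fun x ↦ 3 / (1 + Real.exp (x 4))) 0 = -3 / 4 := by
    rw [pd_exp_coord 0 (hasDerivAt_const_div_one_add_exp 3 _)]; norm_num
  refine ⟨Y, hY, ?_, ?_, ?_, ?_, ?_⟩ <;> rw [hk] <;>
    simp only [a0, a1, a2, a3, a4, b0, b1, b2, b3, b4, hLie, d0, d2, d3, pd6_bracket_example,
      bracket_example_zero, pd_const, Matrix.cons_val] <;> norm_num

/-- The connection form vanishes on the first coordinate vector. On the fifth it depends on the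
first coordinate only through the term `x₁ u_{x₇}` of `r7`, and `u_{x₇} = 4 / (1 + e^{x₅})` has
`x₅`-derivative `-1` at the origin. -/
theorem example_curvature04 :
    curvature example1a.conn 0 (Pi.single 0 1) (Pi.single 4 1) = hEnd (Pi.single 6 (-1)) := by
  obtain ⟨Z, hZ, hk⟩ := isAdmissible_example1a.exists_curvature 0 0 4
  rw [hZ]
  congr 1
  have hbr : ∀ x t, example1a.bracket (Function.update x 0 t) = example1a.bracket x := by
    intro x t; rw [bracket_example, bracket_example]; simp [example1a]
  have hr5 : ∀ x t, example1a.r5 (Function.update x 0 t) = example1a.r5 x := by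
    intro x t
    have h : ∀ x, example1a.r5 x = x 3 / √2 * example1a.bracket x + example1a.F5 x := fun x ↦ rfl
    rw [h, h, hbr]
    simp [example1a]
  have hdep : DependsOn example1a.r5 {3, 4, 5, 6} := by
    intro x y hxy
    have h : ∀ x, example1a.r5 x = x 3 / √2 * example1a.bracket x + example1a.F5 x := fun x ↦ rfl
    rw [h, h, bracket_example, bracket_example]
    simp [example1a, hxy 3, hxy 4, hxy 5, hxy 6]
  have hpr5 : ∀ i x t, pd i example1a.r5 (Function.update x 0 t) = pd i example1a.r5 x := by
    intro i x t
    refine hdep.pd i fun j hj ↦ ?_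
    have : j ≠ 0 := by rintro rfl; simp at hj
    rw [Function.update_of_ne this]
  have hr6 : ∀ x, pd 4 example1a.r6 x = 0 := by
    refine pd_eq_zero_of_update fun x t ↦ ?_
    simp only [r6, pd_example_u5]
    simp [example1a]
  have hr7 : ∀ x, pd 4 example1a.r7 x = x 0 * (-(4 * Real.exp (x 4)) / (1 + Real.exp (x 4)) ^ 2) := by
    intro x
    refine pd_eq_of_hasDerivAt (((isAdmissible_example1a.smooth_r7 isOpen_univ).contDiffAt
      univ_mem).differentiableAt (by simp)) ?_
    refine ((hasDerivAt_const_div_one_add_exp 4 (x 4)).const_mul (x 0)).congr_of_eventuallyEq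
      (Eventually.of_forall fun t ↦ ?_)
    simp only [r7, pd_example_u6]
    simp [example1a]
  have a0 := fun x ↦ (example_connVec4 x).1
  have a1 := fun x ↦ (example_connVec4 x).2.1
  have a2 := fun x ↦ (example_connVec4 x).2.2.1
  have a3 := fun x ↦ (example_connVec4 x).2.2.2.1
  have a4 := fun x ↦ (example_connVec4 x).2.2.2.2.1
  have a5 := fun x ↦ (example_connVec4 x).2.2.2.2.2.1
  have a6 := fun x ↦ (example_connVec4 x).2.2.2.2.2.2
  have h4 : pd 0 (fun y ↦ example1a.connVec y (Pi.single 4 1) 4) 0 = 0 :=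
    pd_eq_zero_of_update (fun x t ↦ by simp only [a4, hbr]) 0
  have h5 : pd 0 (fun y ↦ example1a.connVec y (Pi.single 4 1) 5) 0 = 0 :=
    pd_eq_zero_of_update (fun x t ↦ by simp only [a5, hr5, hpr5, hr6]) 0
  have h6 : pd 0 (fun y ↦ example1a.connVec y (Pi.single 4 1) 6) 0 = -1 := by
    refine pd_eq_of_hasDerivAt (isAdmissible_example1a.differentiableAt_connVec 0 _ 6) ?_
    have h := (((hasDerivAt_id (0 : ℝ)).const_mul (-1)).sub_const (pd 6 example1a.r5 0)).sub_const
      (4 / (1 + Real.exp 0) * example1a.r5 0)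
    refine (h.congr_of_eventuallyEq (Eventually.of_forall fun t ↦ ?_)).congr_deriv (by simp)
    simp only [a6, hr5, hpr5, hr7]
    simp
    ring
  ext i
  rw [hk]
  simp only [example_connVec0, hLie]
  revert i
  refine forall_fin_seven ?_ ?_ ?_ ?_ ?_ ?_ ?_ <;> simp [a0, a1, a2, a3, h4, h5, h6]

/-- The holonomy algebra of the example is the full algebra. -/
theorem holIsFullIII1a_example_zero :
    isAdmissible_example1a.metric43.HolIsFullIII1a univ (0 : E7) := by
  have h := isAdmissible_example1a.coframe_metric43
  have he := refl_mem_maximalAtlas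
  have hp : (0 : E7) ∈ (OpenPartialHomeomorph.refl E7).source := mem_univ _
  have hpV : (OpenPartialHomeomorph.refl E7) 0 ∈ (OpenPartialHomeomorph.refl E7).target :=
    mem_univ _
  let φ := frameEquiv he h.toIsLCCoframe hp hpV
  obtain ⟨hb, hG, hA⟩ := h.holIsIII1a he hp (φ := φ) fun _ ↦ rfl
  refine ⟨_, hb, hG, Subset.antisymm ?_ ?_⟩
  · rintro _ ⟨A, hAm, rfl⟩
    exact hA A hAm
  · intro T hT
    have hR : ∀ v w, curvature example1a.conn 0 v w
        ∈ isAdmissible_example1a.metric43.frameHol (mem_univ (0 : E7)) φ := fun v w ↦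
      h.toIsLCCoframe.curvature_mem_frameHol he hp hpV isOpen_univ (mem_univ (0 : E7))
        (fun _ ↦ rfl) v w
    obtain ⟨X, hX, x0, x1, x2, x3, x4⟩ := example_curvature45
    obtain ⟨Y, hY, y0, y1, y2, y3, y4⟩ := example_curvature46
    have hN : ∀ c, hEnd c ∈ isAdmissible_example1a.metric43.frameHol (mem_univ (0 : E7)) φ := by
      refine eq_top_of_hLie_mem (N := (isAdmissible_example1a.metric43.frameHol
        (mem_univ (0 : E7)) φ).comap (hEnd : E7 →ₗ[ℝ] E7 →L[ℝ] E7)) (fun c hc d hd ↦ ?_)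
        (X := X) (Y := Y) (Z := Pi.single 6 (-1)) ?_ ?_ ?_ x0 x1 x2 x3 x4 y0 y1 y2 y3 y4 rfl
      · have := Metric43.bracket_mem_frameHol (hp := mem_univ (0 : E7)) hc hd
        rw [Submodule.mem_comap, ContinuousLinearMap.coe_coe, ← hEnd_hLie]
        exact this
      · rw [Submodule.mem_comap, ContinuousLinearMap.coe_coe, ← hX]; exact hR _ _
      · rw [Submodule.mem_comap, ContinuousLinearMap.coe_coe, ← hY]; exact hR _ _
      · rw [Submodule.mem_comap, ContinuousLinearMap.coe_coe, ← example_curvature04]; exact hR _ _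
    obtain ⟨a₁, a₂, a₃, a₄, v, z₁, z₂, hT⟩ := mem_hIII1a_iff.1 hT
    refine ⟨_, Metric43.conj_mem_holAlgebra (hN ![a₁, a₂, a₃, a₄, v, z₁, z₂]), ?_⟩
    refine Matrix.ext_of_mulVec_single fun i ↦ ?_
    rw [toMatrix_conj_mulVec, hT]
    simp only [Module.Basis.equivFun_ofEquivFun, LinearMap.comp_apply, LinearEquiv.coe_coe,
      LinearEquiv.apply_symm_apply, ContinuousLinearMap.coe_coe]
    rfl

end NormalData

theorem mainTheorem2 :
    (∀ (M : Type*) [TopologicalSpace M] [T2Space M] [ChartedSpace E7 M]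
      [IsManifold 𝓘(ℝ, E7) ∞ M] (g : Metric43 M),
      -- the equivalence, near a point
      (∀ p : M, (∃ U : Set M, IsOpen U ∧ IsSimplyConnected U ∧ p ∈ U ∧ g.HolIsIII1a U p) ↔
        ∃ e : OpenPartialHomeomorph M E7, p ∈ e.source ∧ g.IsNormalIn e) ∧
      -- necessity, for the holonomy of a whole simply connected manifold
      (SimplyConnectedSpace M → ∀ p : M, g.HolIsIII1a univ p →
        ∀ q : M, ∃ e : OpenPartialHomeomorph M E7, q ∈ e.source ∧ g.IsNormalIn e) ∧
      -- sufficiency, for the holonomy of the whole coordinate domain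
      (∀ e : OpenPartialHomeomorph M E7, g.IsNormalIn e →
        ∀ p ∈ e.source, g.HolIsIII1a e.source p)) ∧
    -- the example attains the full algebra
    (NormalData.example1a.IsAdmissible univ ∧
      ∃ g : Metric43 E7,
        (∀ x v w : E7, g.inner x v w = NormalData.example1a.metric x v w) ∧
        ∀ p : E7, g.HolIsFullIII1a univ p) := by
  refine ⟨fun M _ _ _ _ g ↦ ⟨fun p ↦ ⟨?_, ?_⟩, fun hM p hp q ↦ ?_, fun e he p hp ↦
    he.holIsIII1a hp⟩, NormalData.isAdmissible_example1a,
    NormalData.isAdmissible_example1a.metric43, fun x v w ↦ rfl, fun p ↦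
    NormalData.holIsFullIII1a_example_zero.transfer p⟩
  · rintro ⟨U, hU, -, hpU, hH⟩
    exact exists_isNormalIn_of_holIsIII1a hU hpU hH
  · rintro ⟨e, hp, he⟩
    exact he.exists_isSimplyConnected hp
  · exact exists_isNormalIn_of_holIsIII1a isOpen_univ (mem_univ q) (hp.transfer q)
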